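/- **Conventions.** $M^{\dagger}$, $M^T$, $\overline M$ denote adjoint, transpose, entrywise conjugate; $\|\cdot\|$ is the Euclidean operator norm; $e_i^k$ is the $i$-th unit vector of $\mathbb C^k$; $U_k=[0,\ I_k]$ and $U^1_k=[I_k,\ 0]$ are $k\times(k+1)$ matrices. The upper Cholesky factor of a positive definite $M$ is the upper triangular $B$ with positive diagonal and $M=BB^\dagger$. Matrices with an empty index set are allowed and are zero. A polynomial $p(z,w)=\sum_{i\le n,\,j\le m}k_{i,j}z^iw^j$ has degree $(n,m)$ if $k_{n,m}\neq0$; its reverse is $\overleftarrow p(z,w)=z^nw^m\overline{p(1/\bar z,1/\bar w)}$; the reverse $\overleftarrow\Phi$ of a vector of polynomials is taken entrywise (at level $(n,m)$ with respect to $(n,m)$) and is regarded as a row. A polynomial is stable if it has no zero with $|z|\le1$, $|w|\le1$. On $\mathbb T^2$, $P^\dagger$ is the pointwise adjoint of a vector $P$ of polynomials. **The construction.** Let $u_{i,j}\in\mathbb C$ $(i,j\in\mathbb Z)$ satisfy $u_{-i,-j}=\overline{u_{i,j}}$. One builds recursively, at each level $(n,m)$, $n,m\ge0$: vectors of polynomials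 $\Phi_{n,m}$ (of length $m+1$) and $\tilde\Phi_{n,m}$ (of length $n+1$), and matrices $\mathcal K_{n,m},\mathcal K^1_{n,m}$ ($m\times n$), $\Gamma_{n,m},\Gamma^1_{n,m}$ ($m\times(m+1)$), $I_{n,m},I^1_{n,m}$ ($(m+1)\times(n+1)$), and, of size $(m+1)\times(m+1)$, $\hat E_{n,m},A_{n,m}$ (for $n\ge1$), together with the tilde versions of these, for which the roles of $z,w$ and of the two indices are interchanged and $\tilde{\mathcal K}=\mathcal K^\dagger$, $\tilde{\mathcal K}^1=(\mathcal K^1)^T$, $\tilde I=I^\dagger$, $\tilde I^1=(I^1)^T$. A formula marked $(\sim)$ is the formula referred to after this interchange. $\Phi^m_{n,n}$ is the $(m+1)\times(m+1)$ coefficient of $z^n$ when $\Phi_{n,m}$ is written as $(\Phi^m_{n,n}z^n+\cdots)[w^m,\dots,1]^T$; $\tilde\Phi^n_{m,m}$ is the coefficient of $w^m$ when $\tilde\Phi_{n,m}$ is written as $(\tilde\Phi^n_{m,m}w^m+\cdots)[z^n,\dots,1]^T$. *Level $(0,0)$:* $\Phi_{0,0}=\tilde\Phi_{0,0}=u_{0,0}^{-1/2}$,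 $I_{0,0}=I^1_{0,0}=1$. *For $n\ge1$, at every level:* $$(1)\quad A_{n,m}\Phi_{n,m}=z\Phi_{n-1,m}-\hat E_{n,m}\overleftarrow\Phi_{n-1,m}^T,$$ $$(2)\quad I^1_{n,m}=-\overline{A}_{n,m}^{-1}\hat E_{n,m}^\dagger A_{n,m}I_{n,m}+A_{n,m}^TI^1_{n-1,m}\tilde\Gamma_{n,m}.$$ *Level $(n,0)$, $n\ge1$:* $\hat E_{n,0}=u_{n,0}$, $A_{n,0}=\sqrt{1-|\hat E_{n,0}|^2}$, $I_{n,0}=(e^{n+1}_1)^T$, $\tilde\Gamma_{n,0}=U_n$, $\Phi_{n,0}$ and $I^1_{n,0}$ by (1), (2), $\tilde\Phi_{n,0}=I_{n,0}^\dagger\Phi_{n,0}+\tilde\Gamma_{n,0}^\dagger\tilde\Phi_{n-1,0}$, and $\tilde\Gamma^1_{n,0}=XU_n+\sqrt{1-(XX^\dagger)_{1,1}}\;e_1^n(e_1^{n+1})^T$ with $X=I_{n-1,0}^\dagger\hat E_{n,0}I^1_{n-1,0}+\tilde\Gamma_{n-1,0}^\dagger\tilde\Gamma^1_{n-1,0}$.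 *Level $(0,m)$, $m\ge1$:* the same with the roles interchanged; in particular $\tilde{\hat E}_{0,m}=u_{0,m}$. *Level $(n,m)$, $n,m\ge1$:* - $\mathcal K_{1,1}=\overline{u_{1,-1}}$; for $(n,m)\ne(1,1)$, $$\mathcal K_{n,m}=\Phi^{m-1}_{n,n}\bigl(u_{-n,m}e^m_m(e^n_n)^T+(U^1_{m-1})^TH_{n,m-1}+e^m_m(e^m_m)^T\tilde H_{n-1,m}U^1_{n-1}\bigr)(\tilde\Phi^{n-1}_{m,m})^\dagger,$$ where $H_{n,m-1}=(\Phi^{m-2}_{n,n})^{-1}(\mathcal K_{n,m-1}-\mathcal K^1_{n,m-1}\tilde{\hat E}{}^\dagger_{n-1,m})((\tilde\Phi^{n-1}_{m-1,m-1})^\dagger)^{-1}$ with $\Phi^{m-2}_{n,n}=\Gamma^1_{n,m-1}\Phi^{m-1}_{n,n}(U^1_{m-1})^T$ and $\tilde\Phi^{n-1}_{m-1,m-1}=\tilde A_{n-1,m}\tilde\Phi^{n-1}_{m,m}$, and $\tilde H_{n-1,m}=(\Phi^{m-1}_{n-1,n-1})^{-1}(\mathcal K_{n-1,m}-\hat E_{n,m-1}\overline{\mathcal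 K^1_{n-1,m}})((\tilde\Phi^{n-2}_{m,m})^\dagger)^{-1}$, with $\Phi^{m-1}_{n-1,n-1}=A_{n,m-1}\Phi^{m-1}_{n,n}$ and $\tilde\Phi^{n-2}_{m,m}=\tilde\Gamma^1_{n-1,m}\tilde\Phi^{n-1}_{m,m}(U^1_{n-1})^T$. - $\Gamma_{n,m}=BU_m$ and $\tilde\Gamma_{n,m}=\tilde BU_n$, where $B,\tilde B$ are the upper Cholesky factors of $I-\mathcal K_{n,m}\mathcal K_{n,m}^\dagger$, $I-\mathcal K_{n,m}^\dagger\mathcal K_{n,m}$. - $\mathcal K^1_{n,m}$ has $(1,1)$ entry $\overline{u_{n,m}}$; its rows $2,\dots,m$ form the matrix $(\Gamma_{n,m-1}U_{m-1}^T)^{-1}(\mathcal K^1_{n,m-1}-\mathcal K_{n,m-1}\tilde{\hat E}{}^T_{n-1,m})(\tilde A_{n-1,m}^{-1})^T$, and its first row, without the first entry, is the first row of $A_{n,m-1}^{-1}(\mathcal K^1_{n-1,m}-\hat E_{n,m-1}\overline{\mathcal K_{n-1,m}})(U_{n-1}\tilde\Gamma_{n-1,m}^T)^{-1}$. - With $\hat\Gamma_{n-1,m}$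 the first row of $\Gamma^1_{n-1,m}$ stacked on $\Gamma_{n-1,m}$, $\hat E_{n,m}$ is given by $$\hat\Gamma_{n-1,m}\hat E_{n,m}=U_m^T\bigl(A_{n,m-1}\mathcal K_{n,m}(I^1_{n-1,m})^\dagger+\hat E_{n,m-1}\overline{\Gamma^1_{n-1,m}}\bigr)+e^{m+1}_1(e^m_1)^T\bigl(A_{n,m-1}\mathcal K^1_{n,m}I_{n-1,m}^T+\hat E_{n,m-1}\overline{\Gamma_{n-1,m}}\bigr),$$ $\tilde{\hat E}_{n,m}$ by $(\sim)$ of this; $A_{n,m}$, $\tilde A_{n,m}$ are the upper Cholesky factors of $I-\hat E_{n,m}\hat E_{n,m}^\dagger$, $I-\tilde{\hat E}_{n,m}\tilde{\hat E}{}_{n,m}^\dagger$; $\Phi_{n,m}$ is given by (1) and $\tilde\Phi_{n,m}$ by $(\sim)$ of (1). - $H^3_{n,m}=(H^2+\mathcal K^1_{n,m}H^1)(H^2+\mathcal K^1_{n,m}H^1)^\dagger+\mathcal K^1_{n,m}(\mathcal K^1_{n,m})^\dagger$, where, with $V=(I^1_{n,m-1})^T(U_m\Gamma_{n,m}^\dagger)^{-1}$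 and $\tilde{\hat\Gamma}=\tilde{\hat\Gamma}_{n,m-1}$ the first row of $\tilde\Gamma^1_{n,m-1}$ stacked on $\tilde\Gamma_{n,m-1}$, $$H^2=I_{n,m-1}\bigl((I^1_{n,m-1})^\dagger\overline{\mathcal K_{n,m}}\tilde A_{n-1,m}^T+(\tilde\Gamma^1_{n,m-1})^\dagger\tilde{\hat E}_{n-1,m}\bigr)U_n(\tilde{\hat\Gamma}{}^T)^{-1}V,$$ $$H^1=\tilde A_{n-1,m}^Te^n_1(e^{n+1}_1)^T(\tilde{\hat\Gamma}{}^T)^{-1}V+\overline{\tilde A_{n-1,m}}^{-1}\tilde{\hat E}{}_{n-1,m}^\dagger\tilde A_{n-1,m}\mathcal K_{n,m}^\dagger(U_m\Gamma_{n,m}^\dagger)^{-1}.$$ - $\Gamma^1_{n,m}=YU_m+\sqrt{1-(e_1^m)^TH^3_{n,m}e_1^m}\;e_1^m(e_1^{m+1})^T$ with $Y=\bigl(I_{n,m-1}\tilde{\hat E}_{n,m}(I^1_{n,m-1})^T+\Gamma_{n,m-1}^\dagger\Gamma^1_{n,m-1}+\mathcal K^1_{n,m}\overline{\tilde A_{n-1,m}}^{-1}\tilde{\hat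 E}{}_{n-1,m}^\dagger\tilde A_{n-1,m}\mathcal K_{n,m}^\dagger\bigr)(U_m\Gamma_{n,m}^\dagger)^{-1}$, and $\tilde\Gamma^1_{n,m}$ by $(\sim)$ of this; the first row and column of $I_{n,m}$ are zero except for the entry $1$ at $(1,1)$ and its other columns form $-\Gamma_{n,m}^\dagger\mathcal K_{n,m}(U_n\tilde\Gamma_{n,m}^\dagger)^{-1}$; $I^1_{n,m}$ is given by (2). **The positivity condition $(P_{i,j})$** is: $u_{0,0}>0$ if $i=j=0$; $|\hat E_{i,0}|<1$ if $i>0=j$; $|\tilde{\hat E}_{0,j}|<1$ if $i=0<j$; $\|\mathcal K_{i,j}\|<1$ and $(e^j_1)^TH^3_{i,j}e^j_1<1$ if $i,j>0$. The construction can be carried out up to level $(i,j)$, so that $\mathcal K_{i,j}$, $\hat E_{i,j}$, $\tilde{\hat E}_{i,j}$ are defined, when $(P_{i',j'})$ holds for all $(i',j')\ne(i,j)$ with $0\le i'\le i$, $0\le j'\le j$. **Theorem.** Let $n,m\ge0$ and let $u_{i,j}$, $i,j\in\mathbb Z$, $u_{-i,-j}=\overline{u_{i,j}}$, be such that $(P_{i,j})$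 holds for $0\le i\le n$, $0\le j\le m$ and - (a) for all $j\ge m$: $\mathcal K_{n,j}$ is defined, $\mathcal K_{n,j}=0$, $\tilde{\hat E}_{n-1,j+1}=0$ (no condition if $n=0$) and $u_{n,j+1}=0$; - (b) for all $i>n$: $\mathcal K_{i,m}$ is defined, $\mathcal K_{i,m}=0$, $\hat E_{i,m-1}=0$ (no condition if $m=0$) and $u_{i,m}=0$; - (c) $u_{i,j}=u_{-i,j}=0$ for all $i>n$, $j>m$. Then $(P_{i,j})$ holds for all $i,j\ge0$, so that the construction can be carried out at all levels, and there is exactly one positive linear functional $\mathcal L$ on $C(\mathbb T^2)$ with $$\mathcal L(\Phi_{i,M}\Phi_{j,M}^\dagger)=\delta_{i,j}I_{M+1},\qquad \mathcal L(\tilde\Phi_{N,i}\tilde\Phi_{N,j}^\dagger)=\delta_{i,j}I_{N+1}\qquad\text{for all } N,M,i,j\ge0 .$$ Moreover, there is a polynomial $p_{n,m}$ of degree $(n,m)$ with $\overleftarrow p_{n,m}$ stable such that for all $f\in C(\mathbb T^2)$ $$\mathcal L(f)=\Bigl(\frac1{2\pi}\Bigr)^2\int_{-\pi}^{\pi}\int_{-\pi}^{\pi}\frac{f(e^{i\theta},e^{i\phi})}{|p_{n,m}(e^{i\theta},e^{i\phi})|^2}\,d\phi\,d\theta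 .$$ -/

import Mathlib

open scoped Matrix

noncomputable section

namespace Bicircle

/-! ### Matrices -/

/-- The `k × (k+1)` matrix `[0, I_k]`. -/
def U (k : ℕ) : Matrix (Fin k) (Fin (k + 1)) ℂ :=
  Matrix.of fun i j => if j = i.succ then 1 else 0

/-- The `k × (k+1)` matrix `[I_k, 0]`. -/
def U₁ (k : ℕ) : Matrix (Fin k) (Fin (k + 1)) ℂ :=
  Matrix.of fun i j => if j = i.castSucc then 1 else 0

/-- The `(k+1) × (l+1)` matrix `e₁ e₁ᵀ` whose only non-zero entry is a `1` in the corner `(1,1)`. -/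
def corner (k l : ℕ) : Matrix (Fin (k + 1)) (Fin (l + 1)) ℂ := Matrix.single 0 0 1

/-- The `(k+1) × (k+1)` matrix whose only non-zero entry is a `1` in the last diagonal place. -/
def lastCorner (k : ℕ) : Matrix (Fin (k + 1)) (Fin (k + 1)) ℂ :=
  Matrix.single (Fin.last k) (Fin.last k) 1

/-- `B` is an upper Cholesky factor of `M`: it is upper triangular with positive diagonal
entries and `M = B B†`. -/
def IsUpperCholesky {k : ℕ} (M B : Matrix (Fin k) (Fin k) ℂ) : Prop :=
  (∀ i j, j < i → B i j = 0) ∧ (∀ i, 0 < (B i i).re ∧ (B i i).im = 0) ∧ M = B * Bᴴ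

open Classical in
/-- The upper Cholesky factor (which is unique) of a positive definite matrix.
It is `0` when there is none. -/
def upperCholesky {k : ℕ} (M : Matrix (Fin k) (Fin k) ℂ) : Matrix (Fin k) (Fin k) ℂ :=
  if h : ∃ B, IsUpperCholesky M B then h.choose else 0

/-- The operator norm of a matrix with respect to the Euclidean norms. -/
def opNorm {k l : ℕ} (M : Matrix (Fin k) (Fin l) ℂ) : ℝ :=
  ‖LinearMap.toContinuousLinearMap (Matrix.toEuclideanLin M)‖

/-! ### Polynomials in two variables -/

/-- Polynomials in `z` (variable `0`) and `w` (variable `1`). -/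
abbrev Poly := MvPolynomial (Fin 2) ℂ

/-- The coefficient of `z^i w^j`. -/
def coef (p : Poly) (i j : ℕ) : ℂ :=
  MvPolynomial.coeff (Finsupp.single 0 i + Finsupp.single 1 j) p

/-- The reverse polynomial `z^n w^m conj(p(1/conj z, 1/conj w))` of a polynomial `p` whose
degrees in `z` and `w` are at most `n` and `m`. -/
def reverse (n m : ℕ) (p : Poly) : Poly :=
  ∑ i ∈ Finset.range (n + 1), ∑ j ∈ Finset.range (m + 1),
    MvPolynomial.C (star (coef p i j)) *
      (MvPolynomial.X 0 ^ (n - i) * MvPolynomial.X 1 ^ (m - j))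

/-- `p = ∑_{i ≤ n} ∑_{j ≤ m} k_{i,j} z^i w^j` with `k_{n,m} ≠ 0`. -/
def HasDegree (p : Poly) (n m : ℕ) : Prop :=
  p.degreeOf 0 ≤ n ∧ p.degreeOf 1 ≤ m ∧ coef p n m ≠ 0

/-- `p` has no zero in the closed bidisk. -/
def Stable (p : Poly) : Prop :=
  ∀ z w : ℂ, ‖z‖ ≤ 1 → ‖w‖ ≤ 1 → MvPolynomial.eval ![z, w] p ≠ 0

/-- Interchange of `z` and `w`. -/
def swapPoly (p : Poly) : Poly := MvPolynomial.rename (Equiv.swap (0 : Fin 2) 1) p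

/-- The product of a matrix of scalars and a vector of polynomials. -/
def act {k l : ℕ} (M : Matrix (Fin k) (Fin l) ℂ) (v : Fin l → Poly) : Fin k → Poly :=
  fun a => ∑ b, MvPolynomial.C (M a b) * v b

/-! ### The coefficients attached to a level -/

/-- The polynomials and recurrence coefficients at level `(n, m)`. A name ending in `T` is the
counterpart with a tilde, for the reverse lexicographical ordering. The vector `Phi` lists
`φ^m, …, φ^0` and `PhiT` lists `φ̃^n, …, φ̃^0`; `G` stands for `Γ`, `E` for `Ê`, `ET` for the
counterpart of `Ê`. The counterparts of `K`, `K1`, `J`, `J1` (with `J`, `J1` for `I`, `I¹`) are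
`Kᴴ`, `K1ᵀ`, `Jᴴ`, `J1ᵀ`. -/
structure Level (n m : ℕ) where
  Phi : Fin (m + 1) → Poly
  PhiT : Fin (n + 1) → Poly
  K : Matrix (Fin m) (Fin n) ℂ
  K1 : Matrix (Fin m) (Fin n) ℂ
  G : Matrix (Fin m) (Fin (m + 1)) ℂ
  G1 : Matrix (Fin m) (Fin (m + 1)) ℂ
  GT : Matrix (Fin n) (Fin (n + 1)) ℂ
  G1T : Matrix (Fin n) (Fin (n + 1)) ℂ
  E : Matrix (Fin (m + 1)) (Fin (m + 1)) ℂ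
  A : Matrix (Fin (m + 1)) (Fin (m + 1)) ℂ
  ET : Matrix (Fin (n + 1)) (Fin (n + 1)) ℂ
  AT : Matrix (Fin (n + 1)) (Fin (n + 1)) ℂ
  J : Matrix (Fin (m + 1)) (Fin (n + 1)) ℂ
  J1 : Matrix (Fin (m + 1)) (Fin (n + 1)) ℂ

/-- Interchange of the roles of `z` and `w`, hence of the two orderings. A formula for a
quantity without a tilde, applied to swapped levels, is the corresponding tilde formula. -/
def Level.swap {n m : ℕ} (l : Level n m) : Level m n where
  Phi := fun a => swapPoly (l.PhiT a)
  PhiT := fun a => swapPoly (l.Phi a)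
  K := l.Kᴴ
  K1 := l.K1ᵀ
  G := l.GT
  G1 := l.G1T
  GT := l.G
  G1T := l.G1
  E := l.ET
  A := l.AT
  ET := l.E
  AT := l.A
  J := l.Jᴴ
  J1 := l.J1ᵀ

/-- The leading matrix `Φ^m_{n,n}`: the coefficient of `z^n` when
`Φ_{n,m} = (Φ^m_{n,n} z^n + ⋯) [w^m, …, 1]ᵀ`. -/
def Level.lead {n m : ℕ} (l : Level n m) : Matrix (Fin (m + 1)) (Fin (m + 1)) ℂ :=
  Matrix.of fun a b => coef (l.Phi a) n (m - b)

/-- The leading matrix `Φ̃^n_{m,m}`: the coefficient of `w^m` when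
`Φ̃_{n,m} = (Φ̃^n_{m,m} w^m + ⋯) [z^n, …, 1]ᵀ`. -/
def Level.leadT {n m : ℕ} (l : Level n m) : Matrix (Fin (n + 1)) (Fin (n + 1)) ℂ :=
  Matrix.of fun a b => coef (l.PhiT a) (n - b) m

/-- `Φ_{n+1,m}` from `A_{n+1,m} Φ_{n+1,m} = z Φ_{n,m} - Ê_{n+1,m} (reverse Φ_{n,m})ᵀ`. -/
def nextPhi {n m : ℕ} (A E : Matrix (Fin (m + 1)) (Fin (m + 1)) ℂ) (l : Level n m) :
    Fin (m + 1) → Poly :=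
  act A⁻¹ (fun a => MvPolynomial.X 0 * l.Phi a - act E (fun b => reverse n m (l.Phi b)) a)

/-- `I¹_{n+1,m}` from `A_{n+1,m}`, `Ê_{n+1,m}`, `I_{n+1,m}`, `Γ̃_{n+1,m}` and `I¹_{n,m}`. -/
def nextJ1 {n m : ℕ} (A E : Matrix (Fin (m + 1)) (Fin (m + 1)) ℂ)
    (J : Matrix (Fin (m + 1)) (Fin (n + 2)) ℂ) (GT : Matrix (Fin (n + 1)) (Fin (n + 2)) ℂ)
    (l : Level n m) : Matrix (Fin (m + 1)) (Fin (n + 2)) ℂ :=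
  -((A.map star)⁻¹ * Eᴴ * A * J) + Aᵀ * l.J1 * GT

/-! ### Levels `(0, 0)` and `(n, 0)` -/

/-- Level `(0, 0)`. Only `Phi`, `PhiT`, `J`, `J1` are meaningful (the matrices with an empty
index set are trivial, and `E`, `A`, `ET`, `AT` are never used). -/
def baseLevel (c : ℂ) : Level 0 0 where
  Phi := fun _ => MvPolynomial.C ((1 / Real.sqrt c.re : ℝ) : ℂ)
  PhiT := fun _ => MvPolynomial.C ((1 / Real.sqrt c.re : ℝ) : ℂ)
  K := 0
  K1 := 0
  G := 0
  G1 := 0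
  GT := 0
  G1T := 0
  E := 0
  A := 1
  ET := 0
  AT := 1
  J := 1
  J1 := 1

/-- `Γ̃¹_{n+1,0} [0, I]ᵀ`. -/
def edgeRows {n : ℕ} (E : Matrix (Fin 1) (Fin 1) ℂ) (l : Level n 0) :
    Matrix (Fin (n + 1)) (Fin (n + 1)) ℂ :=
  l.Jᴴ * E * l.J1 + l.GTᴴ * l.G1T

/-- Level `(n+1, 0)` from level `(n, 0)` and the parameter `c = u_{n+1,0}`. The fields `ET`, `AT`
have no meaning at such a level and are never used. -/
def edgeStep {n : ℕ} (c : ℂ) (l : Level n 0) : Level (n + 1) 0 :=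
  let E : Matrix (Fin 1) (Fin 1) ℂ := Matrix.of fun _ _ => c
  let A : Matrix (Fin 1) (Fin 1) ℂ := Matrix.of fun _ _ => ((Real.sqrt (1 - ‖c‖ ^ 2) : ℝ) : ℂ)
  let J : Matrix (Fin 1) (Fin (n + 2)) ℂ := corner 0 (n + 1)
  let X := edgeRows E l
  let Phi := nextPhi A E l
  { Phi := Phi
    PhiT := fun a => act Jᴴ Phi a + act (U (n + 1))ᴴ l.PhiT a
    K := 0
    K1 := 0
    G := 0
    G1 := 0
    GT := U (n + 1)
    G1T := X * U (n + 1) +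
      Matrix.single 0 0 ((Real.sqrt (1 - ((X * Xᴴ) 0 0).re) : ℝ) : ℂ)
    E := E
    A := A
    ET := 0
    AT := 1
    J := J
    J1 := nextJ1 A E J (U (n + 1)) l }

/-! ### Level `(n+1, m+1)`

In this part `l` is level `(n, m+1)` and `d` is level `(n+1, m)`. -/

/-- `H_{n+1,m}`, that is
`(Φ^{m-1}_{n+1,n+1})⁻¹ (K_{n+1,m} - K¹_{n+1,m} (Ễ_{n,m+1})†) ((Φ̃^n_{m,m})†)⁻¹`, where
`Φ^{m-1}_{n+1,n+1} = Γ¹_{n+1,m} Φ^m_{n+1,n+1} [I, 0]ᵀ` and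
`Φ̃^n_{m,m} = Ã_{n,m+1} Φ̃^n_{m+1,m+1}`. -/
def matH {n m : ℕ} (l : Level n (m + 1)) (d : Level (n + 1) m) :
    Matrix (Fin m) (Fin (n + 1)) ℂ :=
  (d.G1 * d.lead * (U₁ m)ᵀ)⁻¹ * (d.K - d.K1 * l.ETᴴ) * ((l.AT * l.leadT)ᴴ)⁻¹

/-- `K_{n+1,m+1}`. At level `(1,1)` it is the scalar `conj u_{1,-1}`. -/
def matK {n m : ℕ} (u : ℤ → ℤ → ℂ) (l : Level n (m + 1)) (d : Level (n + 1) m) :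
    Matrix (Fin (m + 1)) (Fin (n + 1)) ℂ :=
  if n = 0 ∧ m = 0 then Matrix.of fun _ _ => star (u 1 (-1))
  else
    d.lead *
      (Matrix.single (Fin.last m) (Fin.last n) (u (-(n + 1)) (m + 1)) + (U₁ m)ᵀ * matH l d +
        lastCorner m * (matH d.swap l.swap)ᴴ * U₁ n) *
      l.leadTᴴ

/-- All rows of `K¹_{n+1,m+1}` but the first. -/
def rowsK1 {n m : ℕ} (l : Level n (m + 1)) (d : Level (n + 1) m) :
    Matrix (Fin m) (Fin (n + 1)) ℂ :=
  (d.G * (U m)ᵀ)⁻¹ * (d.K1 - d.K * l.ETᵀ) * (l.AT⁻¹)ᵀ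

/-- `K¹_{n+1,m+1}`: its `(1,1)` entry is `conj u_{n+1,m+1}`, its other rows are given by
`rowsK1`, and its other columns (used here for the first row) by the tilde version of `rowsK1`. -/
def matK1 {n m : ℕ} (u : ℤ → ℤ → ℂ) (l : Level n (m + 1)) (d : Level (n + 1) m) :
    Matrix (Fin (m + 1)) (Fin (n + 1)) ℂ :=
  Matrix.single 0 0 (star (u (n + 1) (m + 1))) + (U m)ᵀ * rowsK1 l d +
    corner m m * (rowsK1 d.swap l.swap)ᵀ * U n

/-- The first row of `G1` stacked on `G`. -/
def stack {k : ℕ} (G1 G : Matrix (Fin (k + 1)) (Fin (k + 2)) ℂ) :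
    Matrix (Fin (k + 2)) (Fin (k + 2)) ℂ :=
  Matrix.of (Fin.cons (G1 0) G)

/-- `Ê_{n+1,m+1}`, given `K = K_{n+1,m+1}` and `K1 = K¹_{n+1,m+1}`. -/
def matE {n m : ℕ} (K K1 : Matrix (Fin (m + 1)) (Fin (n + 1)) ℂ)
    (l : Level n (m + 1)) (d : Level (n + 1) m) : Matrix (Fin (m + 2)) (Fin (m + 2)) ℂ :=
  (stack l.G1 l.G)⁻¹ *
    ((U (m + 1))ᵀ * (d.A * K * l.J1ᴴ + d.E * l.G1.map star) +
      corner (m + 1) m * (d.A * K1 * l.Jᵀ + d.E * l.G.map star))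

/-- `H²_{n+1,m+1}`, given `K = K_{n+1,m+1}` and `G = Γ_{n+1,m+1}`. -/
def matH2 {n m : ℕ} (K : Matrix (Fin (m + 1)) (Fin (n + 1)) ℂ)
    (G : Matrix (Fin (m + 1)) (Fin (m + 2)) ℂ)
    (l : Level n (m + 1)) (d : Level (n + 1) m) : Matrix (Fin (m + 1)) (Fin (m + 1)) ℂ :=
  d.J * (d.J1ᴴ * K.map star * l.ATᵀ + d.G1Tᴴ * l.ET) * U (n + 1) *
    ((stack d.G1T d.GT)ᵀ)⁻¹ * d.J1ᵀ * (U (m + 1) * Gᴴ)⁻¹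

/-- `H¹_{n+1,m+1}`, given `K = K_{n+1,m+1}` and `G = Γ_{n+1,m+1}`. -/
def matH1 {n m : ℕ} (K : Matrix (Fin (m + 1)) (Fin (n + 1)) ℂ)
    (G : Matrix (Fin (m + 1)) (Fin (m + 2)) ℂ)
    (l : Level n (m + 1)) (d : Level (n + 1) m) : Matrix (Fin (n + 1)) (Fin (m + 1)) ℂ :=
  l.ATᵀ * corner n (n + 1) * ((stack d.G1T d.GT)ᵀ)⁻¹ * d.J1ᵀ * (U (m + 1) * Gᴴ)⁻¹ +
    (l.AT.map star)⁻¹ * l.ETᴴ * l.AT * Kᴴ * (U (m + 1) * Gᴴ)⁻¹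

/-- `H³_{n+1,m+1}`. -/
def matH3 {n m : ℕ} (K K1 : Matrix (Fin (m + 1)) (Fin (n + 1)) ℂ)
    (G : Matrix (Fin (m + 1)) (Fin (m + 2)) ℂ)
    (l : Level n (m + 1)) (d : Level (n + 1) m) : Matrix (Fin (m + 1)) (Fin (m + 1)) ℂ :=
  (matH2 K G l d + K1 * matH1 K G l d) * (matH2 K G l d + K1 * matH1 K G l d)ᴴ + K1 * K1ᴴ

/-- `Γ¹_{n+1,m+1}`, given `K`, `K¹`, `Γ` and `Ễ` at level `(n+1,m+1)`: all columns but the first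
are given by an explicit formula, and the first column has the single non-zero entry
`√(1 - e₁ᵀ H³ e₁)` on top. -/
def matG1 {n m : ℕ} (K K1 : Matrix (Fin (m + 1)) (Fin (n + 1)) ℂ)
    (G : Matrix (Fin (m + 1)) (Fin (m + 2)) ℂ) (ET : Matrix (Fin (n + 2)) (Fin (n + 2)) ℂ)
    (l : Level n (m + 1)) (d : Level (n + 1) m) : Matrix (Fin (m + 1)) (Fin (m + 2)) ℂ :=
  (d.J * ET * d.J1ᵀ + d.Gᴴ * d.G1 + K1 * (l.AT.map star)⁻¹ * l.ETᴴ * l.AT * Kᴴ) *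
      (U (m + 1) * Gᴴ)⁻¹ * U (m + 1) +
    Matrix.single 0 0 ((Real.sqrt (1 - (matH3 K K1 G l d 0 0).re) : ℝ) : ℂ)

/-- Level `(n+1, m+1)` from the levels `(n, m+1)` and `(n+1, m)` and the two parameters
`u_{n+1,m+1}` and `u_{-(n+1),m+1}`. -/
def innerStep {n m : ℕ} (u : ℤ → ℤ → ℂ) (l : Level n (m + 1)) (d : Level (n + 1) m) :
    Level (n + 1) (m + 1) :=
  let K := matK u l d
  let K1 := matK1 u l d
  let G := upperCholesky (1 - K * Kᴴ) * U (m + 1)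
  let GT := upperCholesky (1 - Kᴴ * K) * U (n + 1)
  let E := matE K K1 l d
  let ET := matE Kᴴ K1ᵀ d.swap l.swap
  let A := upperCholesky (1 - E * Eᴴ)
  let AT := upperCholesky (1 - ET * ETᴴ)
  let J := corner (m + 1) (n + 1) - Gᴴ * K * (U (n + 1) * GTᴴ)⁻¹ * U (n + 1)
  { Phi := nextPhi A E l
    PhiT := fun a => swapPoly (nextPhi AT ET d.swap a)
    K := K
    K1 := K1
    G := G
    G1 := matG1 K K1 G ET l d
    GT := GT
    G1T := matG1 Kᴴ K1ᵀ GT E d.swap l.swap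
    E := E
    A := A
    ET := ET
    AT := AT
    J := J
    J1 := nextJ1 A E J GT l }

/-! ### The construction from the parameters -/

/-- The polynomials and recurrence coefficients built from the parameters `u`. -/
def level (u : ℤ → ℤ → ℂ) : (n m : ℕ) → Level n m
  | 0, 0 => baseLevel (u 0 0)
  | n + 1, 0 => edgeStep (u (n + 1) 0) (level u n 0)
  | 0, m + 1 => (edgeStep (u 0 (m + 1)) (level u 0 m).swap).swap
  | n + 1, m + 1 => innerStep u (level u n (m + 1)) (level u (n + 1) m)
termination_by n m => n + m

/-- The positivity condition on the parameters at level `(i, j)`. -/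
def Positivity (u : ℤ → ℤ → ℂ) : ℕ → ℕ → Prop
  | 0, 0 => 0 < (u 0 0).re
  | i + 1, 0 => ‖(level u (i + 1) 0).E 0 0‖ < 1
  | 0, j + 1 => ‖(level u 0 (j + 1)).ET 0 0‖ < 1
  | i + 1, j + 1 =>
      opNorm (level u (i + 1) (j + 1)).K < 1 ∧
      (matH3 (level u (i + 1) (j + 1)).K (level u (i + 1) (j + 1)).K1
        (level u (i + 1) (j + 1)).G (level u i (j + 1)) (level u (i + 1) j) 0 0).re < 1

/-- The construction can be carried out up to level `(i, j)`, so that the coefficients `K`, `Ê`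
and `Ễ` at level `(i, j)` are genuinely defined: the positivity condition holds at all
preceding levels. -/
def Reached (u : ℤ → ℤ → ℂ) (i j : ℕ) : Prop :=
  ∀ i' j' : ℕ, i' ≤ i → j' ≤ j → (i', j') ≠ (i, j) → Positivity u i' j'

/-! ### The functional -/

/-- A polynomial as a continuous function on the bicircle. -/
def onTorus : Poly →ₐ[ℂ] C(Circle × Circle, ℂ) :=
  MvPolynomial.aeval
    ![⟨fun x => (x.1 : ℂ), by fun_prop⟩, ⟨fun x => (x.2 : ℂ), by fun_prop⟩]

/-- `ℒ` is a positive linear functional determined by the parameters `u`: the polynomials built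
from `u` satisfy `ℒ(Φ_{i,M} Φ_{j,M}†) = δ_{i,j} I_{M+1}` and
`ℒ(Φ̃_{N,i} Φ̃_{N,j}†) = δ_{i,j} I_{N+1}` for all `N`, `M`, `i`, `j`. -/
def IsFunctionalOf (u : ℤ → ℤ → ℂ) (ℒ : C(Circle × Circle, ℂ) →ₗ[ℂ] ℂ) : Prop :=
  (∀ f : C(Circle × Circle, ℂ), (∀ x, 0 ≤ (f x).re ∧ (f x).im = 0) →
    0 ≤ (ℒ f).re ∧ (ℒ f).im = 0) ∧
  (∀ (M i j : ℕ) (a b : Fin (M + 1)),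
    ℒ (onTorus ((level u i M).Phi a) * star (onTorus ((level u j M).Phi b))) =
      if i = j ∧ a = b then 1 else 0) ∧
  (∀ (N i j : ℕ) (a b : Fin (N + 1)),
    ℒ (onTorus ((level u N i).PhiT a) * star (onTorus ((level u N j).PhiT b))) =
      if i = j ∧ a = b then 1 else 0)

end Bicircle

end

/-! The parameters u are coordinates for the moments of a Hermitian form on Laurent polynomials in
z, w. At an inner level (N, M) only the moments at (N, M) and (N, -M) are new up to Hermitian
symmetry (at an edge level only one is). Each enters its parameter linearly, with a nonzero
coefficient, once the smaller moments are known. So `moment` solves recursively for a form c with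
the parameters u.

The link between construction and form is `step`. Suppose all lower levels consist of orthonormal
polynomials of c together with their Gram matrices (`Good`), and c is positive definite there
(`PD`). Then the positivity condition at (N, M) is equivalent to positive definiteness of c up to
degree (N, M), and in that case level (N, M) is good too. This holds because each formula of the
construction is an identity between Gram matrices: one vector is expanded along another, and the
remainder is orthogonal for degree reasons. Tilde statements are the plain ones after interchange of
z and w.

Hypotheses (a), (b) give positivity only on the two strips N ≤ n and M ≤ m. Let p be the first entry
of Φ_{n,m}, which is also that of Φ̃_{n,m}. Three facts carry the proof.

Orthogonality (`Strip.shift_Ph`, `Strip.orthogonal`): the vanishing coefficients force w^k p to be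
the top polynomial at level (n, m+k). Hence p is orthogonal to z^a w^b for 0 ≤ a ≤ n and every
integer b, unless a = n and b ≥ m.

Stability (`evL_rev_ne_zero`): K_{n,m} = 0 makes Φ_{n,m-1} and Φ̃_{n-1,m} orthogonal. At a zero of
the reverse of p in the closed bidisk, the functional of evaluation then has two expressions for its
kernel. Comparing them gives a Christoffel-Darboux identity, a sum of nonnegative terms equal to 0.
Analysing equality shows that the kernel is 0, although it must reproduce the value 1 of the
constant 1.

Uniqueness (`StripOrth.unique`): by stability the weight 1/|p|² makes sense, and by the mean value
property its form satisfies the same orthogonality relations. On the strip |a| ≤ n the difference of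
the two families of moments consists of bounded sequences in b. The relations with p and with its
reverse show that these are annihilated by the resultant in z, a polynomial in w without zeros on
|w| = 1. Such a recurrence has no bounded solution except 0. So the weight has the moments c on both
strips.

Hence the weight has the parameters u on the strips. Elsewhere its top polynomials are monomial
multiples of p and its parameters vanish, as (c) demands (`BernsteinSzego.paramEq`). The weight is
positive definite everywhere, so `step`, read backwards, yields positivity and orthonormality at all
levels. Finally, orthonormality fixes a functional on the products of a polynomial and a conjugate
polynomial. These span a dense subspace by Stone-Weierstrass, and positive functionals are bounded,
whence uniqueness. -/

noncomputable section

namespace Bicircle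

/-! ### Laurent polynomials in two variables and sesquilinear forms given by moments -/

/-- Laurent polynomials in `z` and `w`, given by their coefficients. -/
abbrev Laurent := (ℤ × ℤ) →₀ ℂ

/-- The sesquilinear form with moments `c`. -/
def ip (c : ℤ × ℤ → ℂ) (f g : Laurent) : ℂ :=
  f.sum fun x a => g.sum fun y b => a * star b * c (x - y)

/-- The moments are those of a Hermitian form. -/
def Herm (c : ℤ × ℤ → ℂ) : Prop := ∀ x, c (-x) = star (c x)

section ip
variable (c : ℤ × ℤ → ℂ)

@[simp] lemma ip_zero_left (g : Laurent) : ip c 0 g = 0 := by simp [ip]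
@[simp] lemma ip_zero_right (f : Laurent) : ip c f 0 = 0 := by simp [ip]

lemma ip_add_left (f f' g : Laurent) : ip c (f + f') g = ip c f g + ip c f' g := by
  unfold ip
  rw [Finsupp.sum_add_index']
  · simp
  · intro x a b; simp only [add_mul]; rw [Finsupp.sum_add]

lemma ip_add_right (f g g' : Laurent) : ip c f (g + g') = ip c f g + ip c f g' := by
  unfold ip
  rw [← Finsupp.sum_add]
  refine Finsupp.sum_congr fun x _ => ?_
  rw [Finsupp.sum_add_index']
  · simp
  · intro y a b; simp only [star_add]; ring

lemma ip_smul_left (r : ℂ) (f g : Laurent) : ip c (r • f) g = r * ip c f g := by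
  unfold ip
  rw [Finsupp.sum_smul_index' (by simp), Finsupp.mul_sum]
  refine Finsupp.sum_congr fun x _ => ?_
  rw [Finsupp.mul_sum]
  refine Finsupp.sum_congr fun y _ => ?_
  simp only [smul_eq_mul]; ring

lemma ip_smul_right (r : ℂ) (f g : Laurent) : ip c f (r • g) = star r * ip c f g := by
  unfold ip
  rw [Finsupp.mul_sum]
  refine Finsupp.sum_congr fun x _ => ?_
  rw [Finsupp.sum_smul_index' (by simp), Finsupp.mul_sum]
  refine Finsupp.sum_congr fun y _ => ?_
  simp only [smul_eq_mul, star_mul']; ring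

@[simp] lemma ip_neg_left (f g : Laurent) : ip c (-f) g = -ip c f g := by
  have := ip_smul_left c (-1) f g; simpa using this

@[simp] lemma ip_neg_right (f g : Laurent) : ip c f (-g) = -ip c f g := by
  have := ip_smul_right c (-1) f g; simpa using this

lemma ip_sub_left (f f' g : Laurent) : ip c (f - f') g = ip c f g - ip c f' g := by
  rw [sub_eq_add_neg, ip_add_left, ip_neg_left, sub_eq_add_neg]

lemma ip_sub_right (f g g' : Laurent) : ip c f (g - g') = ip c f g - ip c f g' := by
  rw [sub_eq_add_neg, ip_add_right, ip_neg_right, sub_eq_add_neg]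

lemma ip_sum_left {ι : Type*} (s : Finset ι) (f : ι → Laurent) (g : Laurent) :
    ip c (∑ i ∈ s, f i) g = ∑ i ∈ s, ip c (f i) g :=
  map_sum (AddMonoidHom.mk' (fun f => ip c f g) fun f f' => ip_add_left c f f' g) f s

lemma ip_sum_right {ι : Type*} (s : Finset ι) (f : Laurent) (g : ι → Laurent) :
    ip c f (∑ i ∈ s, g i) = ∑ i ∈ s, ip c f (g i) :=
  map_sum (AddMonoidHom.mk' (fun g => ip c f g) fun g g' => ip_add_right c f g g') g s

@[simp] lemma ip_single (x y : ℤ × ℤ) (a b : ℂ) :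
    ip c (Finsupp.single x a) (Finsupp.single y b) = a * star b * c (x - y) := by
  simp [ip]

variable {c}

lemma ip_star (hc : Herm c) (f g : Laurent) : star (ip c f g) = ip c g f := by
  induction f using Finsupp.induction_linear with
  | zero => simp
  | add f f' h h' => rw [ip_add_left, star_add, h, h', ip_add_right]
  | single x a =>
    induction g using Finsupp.induction_linear with
    | zero => simp
    | add g g' h h' => rw [ip_add_left, ip_add_right, star_add, h, h']
    | single y b =>
      rw [ip_single, ip_single, star_mul', star_mul', star_star, ← hc, neg_sub]
      ring

lemma ip_self_im (hc : Herm c) (f : Laurent) : (ip c f f).im = 0 := by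
  have := congrArg Complex.im (ip_star hc f f)
  simp at this; linarith

lemma ip_self_eq_re (hc : Herm c) (f : Laurent) : ip c f f = ((ip c f f).re : ℂ) :=
  Complex.ext (by simp) (by simp [ip_self_im hc])

lemma ip_eq_zero_comm (hc : Herm c) {f g : Laurent} (h : ip c f g = 0) : ip c g f = 0 := by
  rw [← ip_star hc, h, star_zero]

end ip

/-! ### Shift, reversal and interchange of the variables -/

/-- Multiplication by `z^a w^b`, with `v = (a, b)`. -/
def shift (v : ℤ × ℤ) : Laurent ≃ₗ[ℂ] Laurent := Finsupp.domLCongr (Equiv.addRight v)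

@[simp] lemma shift_apply (v x : ℤ × ℤ) (f : Laurent) : shift v f x = f (x - v) := by
  simp [shift, sub_eq_add_neg]

@[simp] lemma shift_single (v x : ℤ × ℤ) (a : ℂ) :
    shift v (Finsupp.single x a) = Finsupp.single (x + v) a := by
  simp [shift]

/-- The reverse `z^a w^b conj(f(1/conj z, 1/conj w))`, with `v = (a, b)`. -/
def rev (v : ℤ × ℤ) (f : Laurent) : Laurent :=
  (f.mapRange star (star_zero ℂ)).equivMapDomain (Equiv.subLeft v)

@[simp] lemma rev_apply (v x : ℤ × ℤ) (f : Laurent) : rev v f x = star (f (v - x)) := by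
  simp [rev, Finsupp.equivMapDomain_apply, Equiv.subLeft, sub_eq_add_neg, add_comm]

lemma rev_add (v : ℤ × ℤ) (f g : Laurent) : rev v (f + g) = rev v f + rev v g := by
  ext x; simp

lemma rev_sub (v : ℤ × ℤ) (f g : Laurent) : rev v (f - g) = rev v f - rev v g := by
  ext x; simp

@[simp] lemma rev_zero (v : ℤ × ℤ) : rev v 0 = 0 := by
  ext x; simp

lemma rev_smul (v : ℤ × ℤ) (r : ℂ) (f : Laurent) : rev v (r • f) = star r • rev v f := by
  ext x; simp

lemma rev_sum (v : ℤ × ℤ) {ι : Type*} (s : Finset ι) (f : ι → Laurent) :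
    rev v (∑ i ∈ s, f i) = ∑ i ∈ s, rev v (f i) :=
  map_sum (AddMonoidHom.mk' (rev v) (rev_add v)) f s

@[simp] lemma rev_single (v x : ℤ × ℤ) (a : ℂ) :
    rev v (Finsupp.single x a) = Finsupp.single (v - x) (star a) := by
  ext y
  simp only [rev_apply, Finsupp.single_apply]
  by_cases h : x = v - y
  · rw [if_pos h, if_pos (by rw [h]; abel)]
  · rw [if_neg h, if_neg (fun h' => h (by rw [← h']; abel)), star_zero]

lemma rev_rev (v v' : ℤ × ℤ) (f : Laurent) : rev v (rev v' f) = shift (v - v') f := by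
  ext x; simp [sub_sub_eq_add_sub]; congr 1; abel

lemma shift_shift (v v' : ℤ × ℤ) (f : Laurent) : shift v (shift v' f) = shift (v + v') f := by
  ext x; simp [sub_sub]

@[simp] lemma shift_zero (f : Laurent) : shift 0 f = f := by ext x; simp

lemma rev_shift (v v' : ℤ × ℤ) (f : Laurent) : rev v (shift v' f) = rev (v - v') f := by
  ext x; simp; congr 2; abel

lemma shift_rev (v v' : ℤ × ℤ) (f : Laurent) : shift v (rev v' f) = rev (v + v') f := by
  ext x; simp; congr 2; abel

/-- Interchange of `z` and `w`. -/
def swapL : Laurent ≃ₗ[ℂ] Laurent := Finsupp.domLCongr (Equiv.prodComm ℤ ℤ)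

@[simp] lemma swapL_apply (x : ℤ × ℤ) (f : Laurent) : swapL f x = f x.swap := by
  simp [swapL]

@[simp] lemma swapL_single (x : ℤ × ℤ) (a : ℂ) :
    swapL (Finsupp.single x a) = Finsupp.single x.swap a := by
  simp [swapL]

@[simp] lemma swapL_swapL (f : Laurent) : swapL (swapL f) = f := by ext x; simp

lemma swapL_shift (v : ℤ × ℤ) (f : Laurent) : swapL (shift v f) = shift v.swap (swapL f) := by
  ext x; simp

lemma swapL_rev (v : ℤ × ℤ) (f : Laurent) : swapL (rev v f) = rev v.swap (swapL f) := by
  ext x; simp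

/-- Moments after interchange of `z` and `w`. -/
def swapM (c : ℤ × ℤ → ℂ) : ℤ × ℤ → ℂ := fun x => c x.swap

@[simp] lemma swapM_swapM (c : ℤ × ℤ → ℂ) : swapM (swapM c) = c := by
  funext x; simp [swapM]

lemma Herm.swap {c : ℤ × ℤ → ℂ} (hc : Herm c) : Herm (swapM c) := fun x => hc x.swap

section ip
variable (c : ℤ × ℤ → ℂ)

lemma ip_shift (v : ℤ × ℤ) (f g : Laurent) : ip c (shift v f) (shift v g) = ip c f g := by
  induction f using Finsupp.induction_linear with
  | zero => simp
  | add f f' h h' => rw [map_add, ip_add_left, h, h', ip_add_left]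
  | single x a =>
    induction g using Finsupp.induction_linear with
    | zero => simp
    | add g g' h h' => rw [map_add, ip_add_right, h, h', ip_add_right]
    | single y b => simp

lemma ip_rev (v : ℤ × ℤ) (f g : Laurent) : ip c (rev v f) (rev v g) = ip c g f := by
  induction f using Finsupp.induction_linear with
  | zero => simp
  | add f f' h h' => rw [rev_add, ip_add_left, h, h', ip_add_right]
  | single x a =>
    induction g using Finsupp.induction_linear with
    | zero => simp
    | add g g' h h' => rw [rev_add, ip_add_right, h, h', ip_add_left]
    | single y b =>
      rw [rev_single, rev_single, ip_single, ip_single, star_star, sub_sub_sub_cancel_left]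
      ring

@[simp] lemma ip_swapL (f g : Laurent) : ip (swapM c) (swapL f) (swapL g) = ip c f g := by
  induction f using Finsupp.induction_linear with
  | zero => simp
  | add f f' h h' => rw [map_add, ip_add_left, h, h', ip_add_left]
  | single x a =>
    induction g using Finsupp.induction_linear with
    | zero => simp
    | add g g' h h' => rw [map_add, ip_add_right, h, h', ip_add_right]
    | single y b => simp [swapM]

end ip

/-! ### Boxes of exponents -/

/-- Laurent polynomials with exponents between `lo` and `hi`. -/
def box (lo hi : ℤ × ℤ) : Submodule ℂ Laurent := Finsupp.supported ℂ ℂ (Set.Icc lo hi)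

lemma mem_box {lo hi : ℤ × ℤ} {f : Laurent} :
    f ∈ box lo hi ↔ ∀ x, ¬(lo.1 ≤ x.1 ∧ x.1 ≤ hi.1 ∧ lo.2 ≤ x.2 ∧ x.2 ≤ hi.2) → f x = 0 := by
  rw [box, Finsupp.mem_supported']
  refine forall_congr' fun x => ?_
  have : x ∈ Set.Icc lo hi ↔ (lo.1 ≤ x.1 ∧ x.1 ≤ hi.1 ∧ lo.2 ≤ x.2 ∧ x.2 ≤ hi.2) := by
    simp only [Set.mem_Icc, Prod.le_def]; tauto
  rw [this]

lemma single_mem_box {lo hi x : ℤ × ℤ} {a : ℂ}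
    (h : lo.1 ≤ x.1 ∧ x.1 ≤ hi.1 ∧ lo.2 ≤ x.2 ∧ x.2 ≤ hi.2) : Finsupp.single x a ∈ box lo hi := by
  rw [mem_box]
  intro y hy
  rw [Finsupp.single_apply, if_neg]
  rintro rfl; exact hy h

lemma box_mono {lo hi lo' hi' : ℤ × ℤ} (h1 : lo'.1 ≤ lo.1) (h2 : lo'.2 ≤ lo.2)
    (h3 : hi.1 ≤ hi'.1) (h4 : hi.2 ≤ hi'.2) {f : Laurent} (hf : f ∈ box lo hi) :
    f ∈ box lo' hi' := by
  rw [mem_box] at *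
  intro x hx
  exact hf x fun h => hx (by omega)

lemma shift_mem_box {lo hi : ℤ × ℤ} (v : ℤ × ℤ) {f : Laurent} (hf : f ∈ box lo hi) :
    shift v f ∈ box (lo + v) (hi + v) := by
  rw [mem_box] at *
  intro x hx
  rw [shift_apply]
  exact hf _ fun h => hx (by simp at h ⊢; omega)

lemma rev_mem_box {lo hi : ℤ × ℤ} (v : ℤ × ℤ) {f : Laurent} (hf : f ∈ box lo hi) :
    rev v f ∈ box (v - hi) (v - lo) := by
  rw [mem_box] at *
  intro x hx
  rw [rev_apply, hf _ fun h => hx (by simp at h ⊢; omega), star_zero]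

lemma swapL_mem_box {lo hi : ℤ × ℤ} {f : Laurent} :
    swapL f ∈ box lo hi ↔ f ∈ box lo.swap hi.swap := by
  rw [mem_box, mem_box]
  constructor
  · intro h x hx
    have := h x.swap (fun h => hx (by simp at h ⊢; tauto))
    simpa using this
  · intro h x hx
    rw [swapL_apply]
    exact h _ fun h => hx (by simp at h ⊢; tauto)

lemma box_eq_bot_of_lt {lo hi : ℤ × ℤ} (h : hi.1 < lo.1 ∨ hi.2 < lo.2) {f : Laurent}
    (hf : f ∈ box lo hi) : f = 0 := by
  ext x
  exact mem_box.1 hf x (by omega)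

/-- Induction over a box of exponents: a linear condition holds on a box as soon as it holds for
the monomials. -/
lemma box_induction {lo hi : ℤ × ℤ} {f : Laurent} (hf : f ∈ box lo hi) (S : Submodule ℂ Laurent)
    (h : ∀ x : ℤ × ℤ, lo.1 ≤ x.1 → x.1 ≤ hi.1 → lo.2 ≤ x.2 → x.2 ≤ hi.2 →
      Finsupp.single x 1 ∈ S) : f ∈ S := by
  rw [← Finsupp.sum_single f]
  refine Submodule.sum_mem _ fun x hx => ?_
  by_cases hb : lo.1 ≤ x.1 ∧ x.1 ≤ hi.1 ∧ lo.2 ≤ x.2 ∧ x.2 ≤ hi.2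
  · have := S.smul_mem (f x) (h x hb.1 hb.2.1 hb.2.2.1 hb.2.2.2)
    simpa using this
  · simp [mem_box.1 hf x hb]

/-! ### Vectors of Laurent polynomials -/

/-- The product of a matrix of scalars and a vector of Laurent polynomials. -/
def actL {k l : ℕ} (M : Matrix (Fin k) (Fin l) ℂ) (F : Fin l → Laurent) : Fin k → Laurent :=
  fun a => ∑ b, M a b • F b

infixr:73 " ⊳ " => actL

/-- The Gram matrix of two vectors of Laurent polynomials. -/
def gram (c : ℤ × ℤ → ℂ) {k l : ℕ} (F : Fin k → Laurent) (G : Fin l → Laurent) :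
    Matrix (Fin k) (Fin l) ℂ :=
  Matrix.of fun a b => ip c (F a) (G b)

/-- The vector `F` is orthogonal to the subspace `S`. -/
def Perp (c : ℤ × ℤ → ℂ) {k : ℕ} (F : Fin k → Laurent) (S : Submodule ℂ Laurent) : Prop :=
  ∀ a, ∀ g ∈ S, ip c (F a) g = 0

/-- Multiplication by a monomial, for a vector. -/
def shiftV (v : ℤ × ℤ) {k : ℕ} (F : Fin k → Laurent) : Fin k → Laurent := fun a => shift v (F a)

/-- Reversal of a vector. -/
def revV (v : ℤ × ℤ) {k : ℕ} (F : Fin k → Laurent) : Fin k → Laurent := fun a => rev v (F a)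

/-- Interchange of the variables for a vector. -/
def swapV {k : ℕ} (F : Fin k → Laurent) : Fin k → Laurent := fun a => swapL (F a)

section vectors
variable {k l r : ℕ}

lemma actL_actL (M : Matrix (Fin k) (Fin l) ℂ) (N : Matrix (Fin l) (Fin r) ℂ)
    (F : Fin r → Laurent) : M ⊳ (N ⊳ F) = (M * N) ⊳ F := by
  funext a
  simp only [actL, Finset.smul_sum, smul_smul, Matrix.mul_apply, Finset.sum_smul]
  rw [Finset.sum_comm]

lemma actL_add (M : Matrix (Fin k) (Fin l) ℂ) (F G : Fin l → Laurent) :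
    M ⊳ (F + G) = M ⊳ F + M ⊳ G := by
  funext a; simp [actL, Finset.sum_add_distrib]

lemma actL_sub (M : Matrix (Fin k) (Fin l) ℂ) (F G : Fin l → Laurent) :
    M ⊳ (F - G) = M ⊳ F - M ⊳ G := by
  funext a; simp [actL, smul_sub, Finset.sum_sub_distrib]

lemma sub_actL (M N : Matrix (Fin k) (Fin l) ℂ) (F : Fin l → Laurent) :
    (M - N) ⊳ F = M ⊳ F - N ⊳ F := by
  funext a; simp [actL, sub_smul, Finset.sum_sub_distrib]

@[simp] lemma one_actL (F : Fin l → Laurent) : (1 : Matrix (Fin l) (Fin l) ℂ) ⊳ F = F := by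
  funext a; simp [actL, Matrix.one_apply, ite_smul]

lemma actL_mem {M : Matrix (Fin k) (Fin l) ℂ} {F : Fin l → Laurent} {S : Submodule ℂ Laurent}
    (h : ∀ a, F a ∈ S) (a : Fin k) : (M ⊳ F) a ∈ S :=
  S.sum_mem fun b _ => S.smul_mem _ (h b)

lemma actL_apply (M : Matrix (Fin k) (Fin l) ℂ) (F : Fin l → Laurent) (a : Fin k) (x : ℤ × ℤ) :
    (M ⊳ F) a x = ∑ b, M a b * F b x := by
  simp [actL, Finsupp.finsetSum_apply]

lemma shiftV_actL (v : ℤ × ℤ) (M : Matrix (Fin k) (Fin l) ℂ) (F : Fin l → Laurent) :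
    shiftV v (M ⊳ F) = M ⊳ shiftV v F := by
  funext a; simp [shiftV, actL]

lemma shiftV_sub (v : ℤ × ℤ) (F G : Fin l → Laurent) :
    shiftV v (F - G) = shiftV v F - shiftV v G := by
  funext a; simp [shiftV]

lemma shiftV_add (v : ℤ × ℤ) (F G : Fin l → Laurent) :
    shiftV v (F + G) = shiftV v F + shiftV v G := by
  funext a; simp [shiftV]

lemma revV_actL (v : ℤ × ℤ) (M : Matrix (Fin k) (Fin l) ℂ) (F : Fin l → Laurent) :
    revV v (M ⊳ F) = (M.map star) ⊳ revV v F := by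
  funext a; simp [revV, actL, rev_sum, rev_smul]

lemma revV_sub (v : ℤ × ℤ) (F G : Fin l → Laurent) :
    revV v (F - G) = revV v F - revV v G := by
  funext a; simp [revV, rev_sub]

lemma revV_revV (v v' : ℤ × ℤ) (F : Fin l → Laurent) :
    revV v (revV v' F) = shiftV (v - v') F := by
  funext a; simp [revV, shiftV, rev_rev]

lemma shiftV_shiftV (v v' : ℤ × ℤ) (F : Fin l → Laurent) :
    shiftV v (shiftV v' F) = shiftV (v + v') F := by
  funext a; simp [shiftV, shift_shift]

lemma revV_shiftV (v v' : ℤ × ℤ) (F : Fin l → Laurent) :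
    revV v (shiftV v' F) = revV (v - v') F := by
  funext a; simp [revV, shiftV, rev_shift]

lemma shiftV_revV (v v' : ℤ × ℤ) (F : Fin l → Laurent) :
    shiftV v (revV v' F) = revV (v + v') F := by
  funext a; simp [revV, shiftV, shift_rev]

lemma swapV_actL (M : Matrix (Fin k) (Fin l) ℂ) (F : Fin l → Laurent) :
    swapV (M ⊳ F) = M ⊳ swapV F := by
  funext a; simp [swapV, actL]

lemma swapV_sub (F G : Fin l → Laurent) : swapV (F - G) = swapV F - swapV G := by
  funext a; simp [swapV]

lemma swapV_shiftV (v : ℤ × ℤ) (F : Fin l → Laurent) :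
    swapV (shiftV v F) = shiftV v.swap (swapV F) := by
  funext a; simp [swapV, shiftV, swapL_shift]

lemma swapV_revV (v : ℤ × ℤ) (F : Fin l → Laurent) :
    swapV (revV v F) = revV v.swap (swapV F) := by
  funext a; simp [swapV, revV, swapL_rev]

@[simp] lemma swapV_swapV (F : Fin l → Laurent) : swapV (swapV F) = F := by
  funext a; simp [swapV]

variable (c : ℤ × ℤ → ℂ)

lemma gram_actL_left (M : Matrix (Fin k) (Fin l) ℂ) (F : Fin l → Laurent) (G : Fin r → Laurent) :
    gram c (M ⊳ F) G = M * gram c F G := by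
  ext a b; simp [gram, actL, ip_sum_left, ip_smul_left, Matrix.mul_apply]

lemma gram_actL_right (M : Matrix (Fin k) (Fin l) ℂ) (F : Fin r → Laurent) (G : Fin l → Laurent) :
    gram c F (M ⊳ G) = gram c F G * Mᴴ := by
  ext a b
  simp only [gram, actL, ip_sum_right, ip_smul_right, Matrix.mul_apply, Matrix.of_apply,
    Matrix.conjTranspose_apply]
  exact Finset.sum_congr rfl fun _ _ => mul_comm _ _

lemma gram_add_left (F F' : Fin k → Laurent) (G : Fin l → Laurent) :
    gram c (F + F') G = gram c F G + gram c F' G := by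
  ext a b; simp [gram, ip_add_left]

lemma gram_sub_left (F F' : Fin k → Laurent) (G : Fin l → Laurent) :
    gram c (F - F') G = gram c F G - gram c F' G := by
  ext a b; simp [gram, ip_sub_left]

lemma gram_add_right (F : Fin k → Laurent) (G G' : Fin l → Laurent) :
    gram c F (G + G') = gram c F G + gram c F G' := by
  ext a b; simp [gram, ip_add_right]

lemma gram_sub_right (F : Fin k → Laurent) (G G' : Fin l → Laurent) :
    gram c F (G - G') = gram c F G - gram c F G' := by
  ext a b; simp [gram, ip_sub_right]

lemma gram_shiftV (v : ℤ × ℤ) (F : Fin k → Laurent) (G : Fin l → Laurent) :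
    gram c (shiftV v F) (shiftV v G) = gram c F G := by
  ext a b; simp [gram, shiftV, ip_shift]

lemma gram_swapV (F : Fin k → Laurent) (G : Fin l → Laurent) :
    gram (swapM c) (swapV F) (swapV G) = gram c F G := by
  ext a b; simp [gram, swapV]

lemma gram_revV (v : ℤ × ℤ) (F : Fin k → Laurent) (G : Fin l → Laurent) :
    gram c (revV v F) (revV v G) = (gram c G F)ᵀ := by
  ext a b; simp [gram, revV, ip_rev]

variable {c}

lemma gram_conjTranspose (hc : Herm c) (F : Fin k → Laurent) (G : Fin l → Laurent) :
    (gram c F G)ᴴ = gram c G F := by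
  ext a b; simp only [gram, Matrix.conjTranspose_apply, Matrix.of_apply, ip_star hc]

lemma gram_eq_zero {F : Fin k → Laurent} {G : Fin l → Laurent} {S : Submodule ℂ Laurent}
    (h : Perp c F S) (hG : ∀ b, G b ∈ S) : gram c F G = 0 := by
  ext a b; exact h a _ (hG b)

lemma gram_eq_zero' (hc : Herm c) {F : Fin k → Laurent} {G : Fin l → Laurent}
    {S : Submodule ℂ Laurent} (h : Perp c F S) (hG : ∀ b, G b ∈ S) : gram c G F = 0 := by
  rw [← gram_conjTranspose hc, gram_eq_zero h hG, Matrix.conjTranspose_zero]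

lemma Perp.mono {F : Fin k → Laurent} {S T : Submodule ℂ Laurent} (h : Perp c F S)
    (hT : ∀ g ∈ T, g ∈ S) : Perp c F T := fun a g hg => h a g (hT g hg)

lemma Perp.sub {F G : Fin k → Laurent} {S : Submodule ℂ Laurent} (h : Perp c F S)
    (h' : Perp c G S) : Perp c (F - G) S := fun a g hg => by
  rw [Pi.sub_apply, ip_sub_left, h a g hg, h' a g hg, sub_zero]

lemma Perp.actL {F : Fin l → Laurent} {S : Submodule ℂ Laurent} (h : Perp c F S)
    (M : Matrix (Fin k) (Fin l) ℂ) : Perp c (M ⊳ F) S := fun a g hg => by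
  simp only [Bicircle.actL, ip_sum_left, ip_smul_left]
  exact Finset.sum_eq_zero fun b _ => by rw [h b g hg, mul_zero]

lemma Perp.shiftV {F : Fin k → Laurent} {lo hi : ℤ × ℤ} (h : Perp c F (box lo hi)) (v : ℤ × ℤ) :
    Perp c (shiftV v F) (box (lo + v) (hi + v)) := fun a g hg => by
  have h1 := h a (shift (-v) g) (by have := shift_mem_box (-v) hg; simpa using this)
  rw [← ip_shift c v, shift_shift] at h1
  simpa [Bicircle.shiftV] using h1

lemma Perp.revV (hc : Herm c) {F : Fin k → Laurent} {lo hi : ℤ × ℤ} (h : Perp c F (box lo hi))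
    (v : ℤ × ℤ) : Perp c (revV v F) (box (v - hi) (v - lo)) := fun a g hg => by
  have h1 := h a (rev v g) (by have := rev_mem_box v hg; simpa using this)
  rw [← ip_rev c v, rev_rev] at h1
  exact ip_eq_zero_comm hc (by simpa [Bicircle.revV] using h1)

lemma Perp.swapV {F : Fin k → Laurent} {lo hi : ℤ × ℤ} (h : Perp c F (box lo hi)) :
    Perp (swapM c) (swapV F) (box lo.swap hi.swap) := fun a g hg => by
  have h1 := h a (swapL g) (swapL_mem_box.2 hg)
  rw [← ip_swapL c] at h1
  simpa [Bicircle.swapV] using h1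

/-- A vector orthogonal to one subspace and to a complementary family is orthogonal to all. -/
lemma Perp.of_decomp {F : Fin k → Laurent} {G : Fin l → Laurent} {S T : Submodule ℂ Laurent}
    (h : Perp c F S) (hG : gram c F G = 0)
    (hT : ∀ g ∈ T, ∃ x : Fin l → ℂ, g - ∑ b, x b • G b ∈ S) : Perp c F T := fun a g hg => by
  obtain ⟨x, hx⟩ := hT g hg
  have h1 := h a _ hx
  have h2 : ∀ b, ip c (F a) (G b) = 0 := fun b => congrFun (congrFun hG a) b
  simpa [ip_sub_right, ip_sum_right, ip_smul_right, h2] using h1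

end vectors

/-! ### Upper triangular matrices with positive diagonal -/

/-- A positive real number, as a complex number. -/
def IsPos (z : ℂ) : Prop := 0 < z.re ∧ z.im = 0

lemma IsPos.ne_zero {z : ℂ} (h : IsPos z) : z ≠ 0 := by
  rintro rfl; simpa using h.1

lemma isPos_ofReal {r : ℝ} (h : 0 < r) : IsPos (r : ℂ) := ⟨by simpa using h, by simp⟩

lemma IsPos.eq_ofReal {z : ℂ} (h : IsPos z) : z = (z.re : ℂ) := Complex.ext (by simp) (by simp [h.2])

lemma IsPos.star_eq {z : ℂ} (h : IsPos z) : star z = z := by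
  rw [h.eq_ofReal]; simp

lemma IsPos.mul {z w : ℂ} (hz : IsPos z) (hw : IsPos w) : IsPos (z * w) := by
  rw [hz.eq_ofReal, hw.eq_ofReal, ← Complex.ofReal_mul]
  exact isPos_ofReal (mul_pos hz.1 hw.1)

lemma IsPos.inv {z : ℂ} (hz : IsPos z) : IsPos z⁻¹ := by
  rw [hz.eq_ofReal, ← Complex.ofReal_inv]
  exact isPos_ofReal (inv_pos.2 hz.1)

lemma IsPos.eq_of_mul_star {z w : ℂ} (hz : IsPos z) (hw : IsPos w)
    (h : z * star z = w * star w) : z = w := by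
  rw [hz.star_eq, hw.star_eq, hz.eq_ofReal, hw.eq_ofReal] at h
  rw [hz.eq_ofReal, hw.eq_ofReal]
  have h' : z.re * z.re = w.re * w.re := by exact_mod_cast h
  have := hz.1; have := hw.1
  rw [(mul_self_inj (by positivity) (by positivity)).1 h']

/-- Upper triangular with positive diagonal. -/
def UTP {k : ℕ} (B : Matrix (Fin k) (Fin k) ℂ) : Prop :=
  (∀ i j, j < i → B i j = 0) ∧ ∀ i, IsPos (B i i)

lemma isUpperCholesky_iff {k : ℕ} {M B : Matrix (Fin k) (Fin k) ℂ} :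
    IsUpperCholesky M B ↔ UTP B ∧ M = B * Bᴴ := by
  unfold IsUpperCholesky UTP IsPos; tauto

namespace UTP
variable {k : ℕ} {B C : Matrix (Fin k) (Fin k) ℂ}

lemma blockTriangular (h : UTP B) : B.BlockTriangular id := fun i j hij => h.1 i j hij

lemma isUnit_det (h : UTP B) : IsUnit B.det := by
  rw [Matrix.det_of_isUpperTriangular h.blockTriangular, isUnit_iff_ne_zero]
  exact Finset.prod_ne_zero_iff.2 fun i _ => (h.2 i).ne_zero

lemma mul_inv (h : UTP B) : B * B⁻¹ = 1 := Matrix.mul_nonsing_inv _ h.isUnit_det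

lemma inv_mul (h : UTP B) : B⁻¹ * B = 1 := Matrix.nonsing_inv_mul _ h.isUnit_det

lemma mul_diag (h : UTP B) (h' : ∀ i j, j < i → C i j = 0) (i : Fin k) :
    (B * C) i i = B i i * C i i := by
  rw [Matrix.mul_apply, Finset.sum_eq_single i]
  · intro j _ hj
    rcases lt_or_gt_of_ne hj with hj | hj
    · rw [h.1 i j hj, zero_mul]
    · rw [h' j i hj, mul_zero]
  · simp

lemma mul (h : UTP B) (h' : UTP C) : UTP (B * C) := by
  refine ⟨fun i j hij => (h.blockTriangular.mul h'.blockTriangular) hij, fun i => ?_⟩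
  rw [h.mul_diag h'.1]
  exact (h.2 i).mul (h'.2 i)

lemma inv (h : UTP B) : UTP B⁻¹ := by
  have : Invertible B := Matrix.invertibleOfIsUnitDet _ h.isUnit_det
  have h1 : ∀ i j, j < i → B⁻¹ i j = 0 := fun i j hij =>
    (Matrix.blockTriangular_inv_of_blockTriangular h.blockTriangular) hij
  refine ⟨h1, fun i => ?_⟩
  have h2 := h.mul_diag h1 i
  rw [h.mul_inv, Matrix.one_apply_eq] at h2
  rw [eq_inv_of_mul_eq_one_right h2.symm]
  exact (h.2 i).inv

/-- The inverse, which is upper triangular, equals Bᴴ, which is lower triangular; so B is diagonal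
with positive entries of modulus one. -/
lemma eq_one_of_mul_conjTranspose (h : UTP B) (h1 : B * Bᴴ = 1) : B = 1 := by
  have h2 : B⁻¹ = Bᴴ := Matrix.inv_eq_right_inv h1
  have h3 : ∀ i j, i < j → B i j = 0 := fun i j hij => by
    have := h.inv.1 j i hij
    rw [h2, Matrix.conjTranspose_apply] at this
    simpa using this
  ext i j
  rcases lt_trichotomy i j with hij | rfl | hij
  · rw [h3 i j hij, Matrix.one_apply_ne hij.ne]
  · rw [Matrix.one_apply_eq]
    refine (h.2 i).eq_of_mul_star (by simpa using isPos_ofReal one_pos) ?_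
    have h4 := h.mul_diag h.inv.1 i
    rw [h2, h1, Matrix.one_apply_eq, Matrix.conjTranspose_apply] at h4
    rw [← h4]; simp
  · rw [h.1 i j hij, Matrix.one_apply_ne hij.ne']

/-- Uniqueness of the Cholesky factor. -/
lemma eq_of_mul_conjTranspose (h : UTP B) (h' : UTP C) (h1 : B * Bᴴ = C * Cᴴ) : B = C := by
  have h2 : C⁻¹ * B = 1 := by
    refine (h'.inv.mul h).eq_one_of_mul_conjTranspose ?_
    rw [Matrix.conjTranspose_mul, Matrix.mul_assoc, ← Matrix.mul_assoc B, h1, Matrix.mul_assoc C,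
      ← Matrix.conjTranspose_mul, h'.inv_mul, Matrix.conjTranspose_one, Matrix.mul_one, h'.inv_mul]
  have h3 := congrArg (C * ·) h2
  simpa [← Matrix.mul_assoc, h'.mul_inv] using h3

end UTP

lemma UTP.isUnit_det_conjTranspose {k : ℕ} {B : Matrix (Fin k) (Fin k) ℂ} (h : UTP B) :
    IsUnit Bᴴ.det := by
  rw [Matrix.det_conjTranspose]; exact h.isUnit_det.star

lemma UTP.map_star {k : ℕ} {B : Matrix (Fin k) (Fin k) ℂ} (h : UTP B) : UTP (B.map star) := by
  refine ⟨fun i j hij => by simp [h.1 i j hij], fun i => ?_⟩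
  rw [Matrix.map_apply, (h.2 i).star_eq]; exact h.2 i

open scoped ComplexOrder in
/-- Existence of the upper Cholesky factor. -/
lemma exists_utp {k : ℕ} {M : Matrix (Fin k) (Fin k) ℂ} (hM : M.PosDef) :
    ∃ B : Matrix (Fin k) (Fin k) ℂ, UTP B ∧ M = B * Bᴴ := by
  induction k with
  | zero => exact ⟨0, ⟨fun i => i.elim0, fun i => i.elim0⟩, by ext i; exact i.elim0⟩
  | succ k ih =>
    obtain ⟨B', hB', hBM⟩ := ih (M := M.submatrix Fin.succ Fin.succ)
      (hM.submatrix (Fin.succ_injective k))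
    -- The factor is built from the lower right block B'. Its first row is (√s, v), where v B'ᴴ is
    -- the rest of the first row of M and s is the Schur complement.
    set v : Fin k → ℂ := fun j => ∑ i, M 0 i.succ * (B'ᴴ)⁻¹ i j with hv
    have hvB : ∀ j : Fin k, ∑ i, v i * star (B' j i) = M 0 j.succ := by
      intro j
      have h1 : (Matrix.of fun (_ : Fin 1) i => M 0 (Fin.succ i)) * (B'ᴴ)⁻¹ * B'ᴴ =
          Matrix.of fun (_ : Fin 1) i => M 0 (Fin.succ i) := by
        rw [Matrix.mul_assoc, Matrix.nonsing_inv_mul _ hB'.isUnit_det_conjTranspose,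
          Matrix.mul_one]
      have h2 := congrFun (congrFun h1 0) j
      rw [Matrix.mul_apply] at h2
      simpa [Matrix.mul_apply, hv] using h2
    have hH : ∀ i j, star (M i j) = M j i := fun i j => by
      have := congrFun (congrFun hM.isHermitian j) i
      simpa using this
    set s : ℂ := M 0 0 - ∑ i, v i * star (v i) with hs
    have hpos : IsPos s := by
      -- With B'ᴴ y = v†, the quadratic form of M takes the value s at (1, -y); this is why s is
      -- positive.
      set y : Fin k → ℂ := fun i => ∑ j, star ((B'⁻¹) j i) * star (v j) with hy
      have hyB : ∀ i, ∑ j, star (B' j i) * y j = star (v i) := by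
        intro i
        have h1 : (B'ᴴ * (B'⁻¹)ᴴ) * (Matrix.of fun j (_ : Fin 1) => star (v j)) =
            Matrix.of fun j (_ : Fin 1) => star (v j) := by
          rw [← Matrix.conjTranspose_mul, hB'.inv_mul, Matrix.conjTranspose_one, Matrix.one_mul]
        have h2 := congrFun (congrFun h1 i) 0
        rw [Matrix.mul_assoc, Matrix.mul_apply] at h2
        simpa [Matrix.mul_apply, hy] using h2
      have h1 : ∀ i, ∑ j, M (Fin.succ i) (Fin.succ j) * y j = ∑ l, B' i l * star (v l) := by
        intro i
        have : ∀ j, M (Fin.succ i) (Fin.succ j) = ∑ l, B' i l * star (B' j l) := by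
          intro j
          have := congrFun (congrFun hBM i) j
          simpa [Matrix.mul_apply] using this
        simp_rw [this, Finset.sum_mul]
        rw [Finset.sum_comm]
        refine Finset.sum_congr rfl fun l _ => ?_
        rw [← hyB l, Finset.mul_sum]
        exact Finset.sum_congr rfl fun j _ => by ring
      have h2 : ∑ j, M 0 (Fin.succ j) * y j = ∑ l, v l * star (v l) := by
        simp_rw [← hvB, Finset.sum_mul]
        rw [Finset.sum_comm]
        refine Finset.sum_congr rfl fun l _ => ?_
        rw [← hyB l, Finset.mul_sum]
        exact Finset.sum_congr rfl fun j _ => by ring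
      have h3 : ∀ i : Fin k, M i.succ 0 = ∑ l, B' i l * star (v l) := by
        intro i
        rw [← hH, ← hvB i, star_sum]
        exact Finset.sum_congr rfl fun j _ => by simp [mul_comm]
      have h4 := hM.dotProduct_mulVec_pos (x := Fin.cons 1 (fun i => - y i))
        (fun h => one_ne_zero (congrFun h 0))
      have h5 : star (Fin.cons 1 (fun i => - y i) : Fin (k + 1) → ℂ) ⬝ᵥ
          M.mulVec (Fin.cons 1 (fun i => - y i)) = s := by
        simp only [dotProduct, Matrix.mulVec, Fin.sum_univ_succ, Pi.star_apply, Fin.cons_zero,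
          Fin.cons_succ, star_one, one_mul, mul_one, mul_neg, Finset.sum_neg_distrib, h1, h2, h3]
        simp [hs]; ring
      rw [h5, Complex.lt_def] at h4
      exact ⟨by simpa using h4.1, by simpa using h4.2.symm⟩
    refine ⟨Matrix.of (Fin.cons (Fin.cons ((Real.sqrt s.re : ℝ) : ℂ) v)
      fun i => Fin.cons 0 (B' i)), ⟨?_, ?_⟩, ?_⟩
    · intro i j
      refine Fin.cases ?_ (fun i => ?_) i
      · intro h; exact absurd h (Fin.not_lt_zero j)
      · refine Fin.cases ?_ (fun j => ?_) j
        · intro; simp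
        · intro h; simpa using hB'.1 i j (by simpa using h)
    · intro i
      refine Fin.cases ?_ (fun i => ?_) i
      · simpa using isPos_ofReal (Real.sqrt_pos.2 hpos.1)
      · simpa using hB'.2 i
    · ext i j
      rw [Matrix.mul_apply, Fin.sum_univ_succ]
      refine Fin.cases ?_ (fun i => ?_) i
      · refine Fin.cases ?_ (fun j => ?_) j
        · simp only [Matrix.of_apply, Fin.cons_zero, Fin.cons_succ, Matrix.conjTranspose_apply]
          have : ((Real.sqrt s.re : ℝ) : ℂ) * star ((Real.sqrt s.re : ℝ) : ℂ) = s := by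
            rw [(isPos_ofReal (Real.sqrt_pos.2 hpos.1)).star_eq, ← Complex.ofReal_mul,
              Real.mul_self_sqrt hpos.1.le, ← hpos.eq_ofReal]
          rw [this, hs]; ring
        · simp [← hvB j]
      · refine Fin.cases ?_ (fun j => ?_) j
        · rw [← hH, ← hvB i, star_sum]
          simp [mul_comm]
        · have := congrFun (congrFun hBM i) j
          simpa [Matrix.mul_apply] using this

lemma isUpperCholesky_upperCholesky {k : ℕ} {M : Matrix (Fin k) (Fin k) ℂ}
    (h : ∃ B : Matrix (Fin k) (Fin k) ℂ, UTP B ∧ M = B * Bᴴ) : UTP (upperCholesky M) ∧ M = upperCholesky M * (upperCholesky M)ᴴ := by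
  have h' : ∃ B, IsUpperCholesky M B := by simpa only [isUpperCholesky_iff] using h
  rw [upperCholesky, dif_pos h', ← isUpperCholesky_iff]
  exact h'.choose_spec

lemma upperCholesky_eq {k : ℕ} {M B : Matrix (Fin k) (Fin k) ℂ} (h : UTP B) (h' : M = B * Bᴴ) :
    upperCholesky M = B := by
  have := isUpperCholesky_upperCholesky ⟨B, h, h'⟩
  exact this.1.eq_of_mul_conjTranspose h (by rw [← this.2, h'])

/-! ### The matrices `[0, I]` and `[I, 0]` -/

section U
variable {k l : ℕ}

@[simp] lemma U_mul_apply (M : Matrix (Fin (k + 1)) (Fin l) ℂ) (i : Fin k) (j : Fin l) :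
    (U k * M) i j = M i.succ j := by simp [U, Matrix.mul_apply]

@[simp] lemma mul_U_transpose_apply (M : Matrix (Fin l) (Fin (k + 1)) ℂ) (i : Fin l) (j : Fin k) :
    (M * (U k)ᵀ) i j = M i j.succ := by simp [U, Matrix.mul_apply]

@[simp] lemma mul_U₁_transpose_apply (M : Matrix (Fin l) (Fin (k + 1)) ℂ) (i : Fin l)
    (j : Fin k) : (M * (U₁ k)ᵀ) i j = M i j.castSucc := by simp [U₁, Matrix.mul_apply]

@[simp] lemma mul_U_apply_zero (M : Matrix (Fin l) (Fin k) ℂ) (i : Fin l) :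
    (M * U k) i 0 = 0 := by
  simp [U, Matrix.mul_apply, (Fin.succ_ne_zero _).symm]

@[simp] lemma mul_U_apply_succ (M : Matrix (Fin l) (Fin k) ℂ) (i : Fin l) (j : Fin k) :
    (M * U k) i j.succ = M i j := by simp [U, Matrix.mul_apply]

@[simp] lemma U_transpose_mul_apply_zero (M : Matrix (Fin k) (Fin l) ℂ) (j : Fin l) :
    ((U k)ᵀ * M) 0 j = 0 := by
  simp [U, Matrix.mul_apply, (Fin.succ_ne_zero _).symm]

@[simp] lemma U_transpose_mul_apply_succ (M : Matrix (Fin k) (Fin l) ℂ) (i : Fin k) (j : Fin l) :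
    ((U k)ᵀ * M) i.succ j = M i j := by simp [U, Matrix.mul_apply]

@[simp] lemma mul_U₁_apply_last (M : Matrix (Fin l) (Fin k) ℂ) (i : Fin l) :
    (M * U₁ k) i (Fin.last k) = 0 := by
  simp [U₁, Matrix.mul_apply, (Fin.castSucc_ne_last _).symm]

@[simp] lemma mul_U₁_apply_castSucc (M : Matrix (Fin l) (Fin k) ℂ) (i : Fin l) (j : Fin k) :
    (M * U₁ k) i j.castSucc = M i j := by simp [U₁, Matrix.mul_apply]

@[simp] lemma U₁_transpose_mul_apply_last (M : Matrix (Fin k) (Fin l) ℂ) (j : Fin l) :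
    ((U₁ k)ᵀ * M) (Fin.last k) j = 0 := by
  simp [U₁, Matrix.mul_apply, (Fin.castSucc_ne_last _).symm]

@[simp] lemma U₁_transpose_mul_apply_castSucc (M : Matrix (Fin k) (Fin l) ℂ) (i : Fin k)
    (j : Fin l) : ((U₁ k)ᵀ * M) i.castSucc j = M i j := by simp [U₁, Matrix.mul_apply]

@[simp] lemma U_mul_U_transpose : U k * (U k)ᵀ = 1 := by
  ext i j; rw [U_mul_apply]; simp [U, Matrix.one_apply]

lemma U_conjTranspose : (U k)ᴴ = (U k)ᵀ := by
  ext i j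
  simp only [U, Matrix.conjTranspose_apply, Matrix.transpose_apply, Matrix.of_apply]
  split_ifs <;> simp

lemma eq_mul_U {M : Matrix (Fin l) (Fin (k + 1)) ℂ} (h : ∀ i, M i 0 = 0) :
    M = (M * (U k)ᵀ) * U k := by
  ext i j
  refine Fin.cases ?_ (fun j => ?_) j
  · rw [mul_U_apply_zero, h]
  · rw [mul_U_apply_succ, mul_U_transpose_apply]

lemma UTP.submatrix_succ {B : Matrix (Fin (k + 1)) (Fin (k + 1)) ℂ} (h : UTP B) :
    UTP (U k * B * (U k)ᵀ) := by
  refine ⟨fun i j hij => ?_, fun i => ?_⟩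
  · rw [mul_U_transpose_apply, U_mul_apply]; exact h.1 _ _ (by simpa using hij)
  · rw [mul_U_transpose_apply, U_mul_apply]; exact h.2 _

end U

/-! ### Matrices of norm less than one -/

-- x†(1 - MM†)x = ‖x‖² - ‖M†x‖², and M, M† have equal norms. A strict inequality at each vector
-- becomes a strict bound on the norm because the unit sphere is compact.
open scoped ComplexOrder in
lemma opNorm_lt_one_iff {k l : ℕ} (M : Matrix (Fin k) (Fin l) ℂ) :
    opNorm M < 1 ↔ (1 - M * Mᴴ).PosDef := by
  have hadj : opNorm M = opNorm Mᴴ := by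
    unfold opNorm
    rw [Matrix.toEuclideanLin_conjTranspose_eq_adjoint]
    have : LinearMap.toContinuousLinearMap (LinearMap.adjoint (Matrix.toEuclideanLin M)) =
        ContinuousLinearMap.adjoint (LinearMap.toContinuousLinearMap (Matrix.toEuclideanLin M)) := rfl
    rw [this, LinearIsometryEquiv.norm_map]
  have hherm : (1 - M * Mᴴ).IsHermitian := by
    unfold Matrix.IsHermitian; simp
  have hq : ∀ x : EuclideanSpace ℂ (Fin k), star x.ofLp ⬝ᵥ (1 - M * Mᴴ).mulVec x.ofLp =
      ((‖x‖ ^ 2 - ‖Matrix.toEuclideanLin Mᴴ x‖ ^ 2 : ℝ) : ℂ) := by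
    intro x
    have h1 : ∀ (j : ℕ) (y : EuclideanSpace ℂ (Fin j)), star y.ofLp ⬝ᵥ y.ofLp = ((‖y‖ ^ 2 : ℝ) : ℂ) := by
      intro j y
      rw [EuclideanSpace.norm_sq_eq]
      simp only [dotProduct, Pi.star_apply]
      push_cast
      exact Finset.sum_congr rfl fun i _ => by
        rw [← Complex.mul_conj']; exact mul_comm _ _
    rw [Matrix.sub_mulVec, dotProduct_sub, Matrix.one_mulVec, h1]
    push_cast
    congr 1
    rw [← Matrix.mulVec_mulVec, Matrix.dotProduct_mulVec]
    have := h1 _ (Matrix.toEuclideanLin Mᴴ x)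
    rw [Complex.ofReal_pow] at this
    rw [← this]
    congr 1
    simp [Matrix.star_mulVec]
  constructor
  · intro h
    refine Matrix.PosDef.of_dotProduct_mulVec_pos hherm fun x hx => ?_
    have h1 := hq (WithLp.toLp 2 x)
    simp only at h1
    rw [h1, Complex.zero_lt_real]
    have h2 : ‖Matrix.toEuclideanLin Mᴴ (WithLp.toLp 2 x)‖ ≤ opNorm Mᴴ * ‖WithLp.toLp 2 x‖ :=
      (LinearMap.toContinuousLinearMap (Matrix.toEuclideanLin Mᴴ)).le_opNorm _
    rw [hadj] at h
    have h3 : 0 < ‖WithLp.toLp 2 x‖ := norm_pos_iff.2 (by simpa using hx)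
    have h4 : ‖Matrix.toEuclideanLin Mᴴ (WithLp.toLp 2 x)‖ < ‖WithLp.toLp 2 x‖ := by nlinarith
    have := norm_nonneg (Matrix.toEuclideanLin Mᴴ (WithLp.toLp 2 x))
    nlinarith
  · intro h
    rw [hadj]
    have hlt : ∀ x : EuclideanSpace ℂ (Fin k), x ≠ 0 → ‖Matrix.toEuclideanLin Mᴴ x‖ < ‖x‖ := by
      intro x hx
      have h1 := h.dotProduct_mulVec_pos (x := x.ofLp) (by simpa using hx)
      rw [hq, Complex.zero_lt_real] at h1
      have := norm_nonneg x
      by_contra! h2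
      nlinarith [norm_nonneg (Matrix.toEuclideanLin Mᴴ x)]
    rcases (Metric.sphere (0 : EuclideanSpace ℂ (Fin k)) 1).eq_empty_or_nonempty with he | hne
    · have h0 : ∀ x : EuclideanSpace ℂ (Fin k), x = 0 := by
        intro x
        by_contra hx
        have : (‖x‖⁻¹ : ℂ) • x ∈ Metric.sphere (0 : EuclideanSpace ℂ (Fin k)) 1 := by
          simp [norm_smul, norm_ne_zero_iff.2 hx]
        rw [he] at this; exact this
      have : opNorm Mᴴ ≤ 0 := ContinuousLinearMap.opNorm_le_bound _ le_rfl fun x => by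
        rw [h0 x]; simp
      linarith
    · obtain ⟨x₀, hx₀, hmax⟩ := (isCompact_sphere (0 : EuclideanSpace ℂ (Fin k)) 1).exists_isMaxOn hne
        ((LinearMap.toContinuousLinearMap (Matrix.toEuclideanLin Mᴴ)).continuous.norm.continuousOn)
      have hx1 : ‖x₀‖ = 1 := by simpa using hx₀
      have h1 : ‖Matrix.toEuclideanLin Mᴴ x₀‖ < 1 := by
        rw [← hx1]; exact hlt _ (by rintro rfl; simp at hx1)
      refine lt_of_le_of_lt (ContinuousLinearMap.opNorm_le_bound _ (norm_nonneg _) fun x => ?_) h1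
      by_cases hx : x = 0
      · simp [hx]
      have h2 : (‖x‖⁻¹ : ℂ) • x ∈ Metric.sphere (0 : EuclideanSpace ℂ (Fin k)) 1 := by
        simp [norm_smul, norm_ne_zero_iff.2 hx]
      have h3 := hmax h2
      simp only [Set.mem_ofPred_eq, map_smul, norm_smul, norm_inv, Complex.norm_real, norm_norm] at h3
      rw [inv_mul_le_iff₀ (norm_pos_iff.2 hx), mul_comm] at h3
      exact h3

/-! ### Orthonormal vectors attached to a level -/

/-- The coefficients at `z^n w^m, z^n w^(m-1), …` of a vector. -/
def coefZ (n m : ℤ) {k : ℕ} (F : Fin k → Laurent) : Matrix (Fin k) (Fin k) ℂ :=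
  Matrix.of fun a b => F a (n, m - (b : ℕ))

/-- The vector `F` is the orthonormal vector at level `(n, m)` for the lexicographical ordering. -/
structure IsOrth (c : ℤ × ℤ → ℂ) (n m : ℤ) {k : ℕ} (F : Fin k → Laurent) : Prop where
  card : (k : ℤ) = m + 1
  mem : ∀ a, F a ∈ box 0 (n, m)
  utp : UTP (coefZ n m F)
  gram : gram c F F = 1
  perp : Perp c F (box 0 (n - 1, m))

/-- The vector `F` is the orthonormal vector at level `(n, m)` for the reverse lexicographical
ordering. -/
def IsOrthT (c : ℤ × ℤ → ℂ) (n m : ℤ) {k : ℕ} (F : Fin k → Laurent) : Prop :=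
  IsOrth (swapM c) m n (swapV F)

/-- The form is positive definite on the polynomials of degree at most `(n, m)`. -/
def PD (c : ℤ × ℤ → ℂ) (n m : ℤ) : Prop :=
  ∀ f ∈ box 0 (n, m), f ≠ 0 → 0 < (ip c f f).re

lemma PD.mono {c : ℤ × ℤ → ℂ} {n m n' m' : ℤ} (h : PD c n m) (hn : n' ≤ n) (hm : m' ≤ m) :
    PD c n' m' := fun f hf => h f (box_mono le_rfl le_rfl hn hm hf)

lemma PD.swap {c : ℤ × ℤ → ℂ} {n m : ℤ} (h : PD c n m) : PD (swapM c) m n := by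
  intro f hf h0
  have := h (swapL f) (swapL_mem_box.2 hf) (by simpa using h0)
  rwa [← ip_swapL, swapL_swapL] at this

lemma PD.eq_zero {c : ℤ × ℤ → ℂ} {n m : ℤ} (h : PD c n m) {f : Laurent} (hf : f ∈ box 0 (n, m))
    (h0 : ip c f f = 0) : f = 0 := by
  by_contra hne
  have := h f hf hne
  rw [h0] at this; simp at this

section IsOrth
variable {c : ℤ × ℤ → ℂ} {n m : ℤ} {k l : ℕ} {F : Fin k → Laurent}

lemma coefZ_actL (M : Matrix (Fin k) (Fin k) ℂ) (F : Fin k → Laurent) :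
    coefZ n m (M ⊳ F) = M * coefZ n m F := by
  ext a b; simp [coefZ, actL_apply, Matrix.mul_apply]

/-- Since k = m + 1, the exponents tested are all those of z-degree n in the box. -/
lemma mem_box_of_coef {f : Laurent} (hf : f ∈ box 0 (n, m)) (hk : (k : ℤ) = m + 1)
    (h : ∀ b : Fin k, f (n, m - (b : ℕ)) = 0) : f ∈ box 0 (n - 1, m) := by
  rw [mem_box] at *
  rintro ⟨i, j⟩ hx
  by_cases hb : (0 : ℤ) ≤ i ∧ i ≤ n ∧ 0 ≤ j ∧ j ≤ m
  · have hi : i = n := by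
      simp only [Prod.fst_zero, Prod.snd_zero] at hx; omega
    subst hi
    have hlt : (m - j).toNat < k := by omega
    have := h ⟨(m - j).toNat, hlt⟩
    simp only at this
    rwa [show m - ((m - j).toNat : ℤ) = j by omega] at this
  · exact hf _ (by simpa using hb)

/-- Orthogonal decomposition with respect to the orthonormal vector at a level. -/
lemma IsOrth.decomp (hF : IsOrth c n m F) (hc : Herm c) {f : Laurent} (hf : f ∈ box 0 (n, m)) :
    f - ∑ b, ip c f (F b) • F b ∈ box 0 (n - 1, m) := by
  -- These coefficients cancel all terms of z-degree n of f; orthogonality of F to lower degree then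
  -- identifies them with the products of f with F.
  set x : Fin k → ℂ := fun b => ∑ a : Fin k, f (n, m - (a : ℕ)) * (coefZ n m F)⁻¹ a b with hx
  have hxF : ∀ b : Fin k, ∑ a, x a * F a (n, m - (b : ℕ)) = f (n, m - (b : ℕ)) := by
    intro b
    have h1 : (Matrix.of fun (_ : Fin 1) (a : Fin k) => f (n, m - (a : ℕ))) * (coefZ n m F)⁻¹ *
        coefZ n m F = Matrix.of fun (_ : Fin 1) (a : Fin k) => f (n, m - (a : ℕ)) := by
      rw [Matrix.mul_assoc, hF.utp.inv_mul, Matrix.mul_one]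
    have h2 := congrFun (congrFun h1 0) b
    rw [Matrix.mul_apply] at h2
    simpa [Matrix.mul_apply, hx, coefZ] using h2
  have hg : f - ∑ b, x b • F b ∈ box 0 (n - 1, m) := by
    refine mem_box_of_coef (Submodule.sub_mem _ hf (Submodule.sum_mem _ fun b _ =>
      Submodule.smul_mem _ _ (hF.mem b))) hF.card fun b => ?_
    simp [hxF b]
  have hip : ∀ a, ip c f (F a) = x a := by
    intro a
    have h1 := ip_eq_zero_comm hc (hF.perp a _ hg)
    rw [ip_sub_left, ip_sum_left, sub_eq_zero] at h1
    rw [h1]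
    have h2 : ∀ b, ip c (x b • F b) (F a) = if b = a then x b else 0 := by
      intro b
      have := congrFun (congrFun hF.gram b) a
      simp only [Bicircle.gram, Matrix.of_apply, Matrix.one_apply] at this
      rw [ip_smul_left, this]; simp
    simp [h2]
  simpa only [hip] using hg

lemma IsOrth.decompV (hF : IsOrth c n m F) (hc : Herm c) {G : Fin l → Laurent}
    (hG : ∀ a, G a ∈ box 0 (n, m)) (a : Fin l) :
    (G - Bicircle.gram c G F ⊳ F) a ∈ box 0 (n - 1, m) := hF.decomp hc (hG a)

lemma IsOrth.perp_of_gram (hF : IsOrth c n m F) (hc : Herm c) {G : Fin l → Laurent}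
    (hG : Perp c G (box 0 (n - 1, m))) (h : Bicircle.gram c G F = 0) :
    Perp c G (box 0 (n, m)) :=
  hG.of_decomp h fun _ hg => ⟨_, hF.decomp hc hg⟩

/-- A Pythagoras argument: positivity is inherited along an orthonormal vector. -/
lemma IsOrth.pd (hF : IsOrth c n m F) (hc : Herm c) (h : PD c (n - 1) m) : PD c n m := by
  intro f hf hne
  set x : Fin k → ℂ := fun b => ip c f (F b) with hx
  set g := f - ∑ b, x b • F b with hg
  have hgm : g ∈ box 0 (n - 1, m) := hF.decomp hc hf
  have hfg : f = g + ∑ b, x b • F b := by rw [hg]; abel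
  have h1 : ∀ b, ip c g (F b) = 0 := fun b => ip_eq_zero_comm hc (hF.perp b _ hgm)
  have h2 : ip c f f = ip c g g + ∑ b, x b * star (x b) := by
    have hff : ip c f f = ip c g f + ∑ b, x b * ip c (F b) f := by
      conv_lhs => rw [hfg, ip_add_left, ip_sum_left]
      rw [← hfg]; simp [ip_smul_left]
    have hgf : ip c g f = ip c g g := by
      conv_lhs => rw [hfg, ip_add_right, ip_sum_right]
      simp [ip_smul_right, h1]
    rw [hff, hgf]
    congr 1
    exact Finset.sum_congr rfl fun b _ => by rw [hx, ip_star hc]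
  have h3 : (∑ b, x b * star (x b)).re = ∑ b, Complex.normSq (x b) := by
    rw [Complex.re_sum]
    exact Finset.sum_congr rfl fun b _ => by
      simp [Complex.mul_re, Complex.normSq_apply]
  rw [h2, Complex.add_re, h3]
  by_cases hg0 : g = 0
  · have : ∃ b, x b ≠ 0 := by
      by_contra! hall
      apply hne; rw [hfg, hg0]; simp [hall]
    obtain ⟨b, hb⟩ := this
    rw [hg0]
    simpa using Finset.sum_pos' (fun b _ => Complex.normSq_nonneg (x b))
      ⟨b, Finset.mem_univ b, Complex.normSq_pos.2 hb⟩
  · have := h g hgm hg0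
    have h4 : 0 ≤ ∑ b, Complex.normSq (x b) := Finset.sum_nonneg fun b _ => Complex.normSq_nonneg _
    linarith

lemma IsOrthT.mem (hF : IsOrthT c n m F) (a : Fin k) : F a ∈ box 0 (n, m) :=
  swapL_mem_box.1 (IsOrth.mem hF a)

lemma IsOrthT.gram (hF : IsOrthT c n m F) : Bicircle.gram c F F = 1 := by
  rw [← gram_swapV]; exact IsOrth.gram hF

lemma IsOrthT.perp (hF : IsOrthT c n m F) : Perp c F (box 0 (n, m - 1)) := by
  have := (IsOrth.perp hF).swapV
  rw [swapM_swapM, swapV_swapV] at this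
  exact this

lemma IsOrthT.decomp (hF : IsOrthT c n m F) (hc : Herm c) {f : Laurent} (hf : f ∈ box 0 (n, m)) :
    f - ∑ b, ip c f (F b) • F b ∈ box 0 (n, m - 1) := by
  have h := IsOrth.decomp hF hc.swap (f := swapL f) (swapL_mem_box.2 (by simpa using hf))
  simp only [swapV, ip_swapL] at h
  rw [← swapL_swapL (f - _)]
  rw [swapL_mem_box]
  simpa using h

lemma IsOrthT.decompV (hF : IsOrthT c n m F) (hc : Herm c) {G : Fin l → Laurent}
    (hG : ∀ a, G a ∈ box 0 (n, m)) (a : Fin l) :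
    (G - Bicircle.gram c G F ⊳ F) a ∈ box 0 (n, m - 1) := hF.decomp hc (hG a)

lemma IsOrthT.perp_of_gram (hF : IsOrthT c n m F) (hc : Herm c) {G : Fin l → Laurent}
    (hG : Perp c G (box 0 (n, m - 1))) (h : Bicircle.gram c G F = 0) :
    Perp c G (box 0 (n, m)) :=
  hG.of_decomp h fun _ hg => ⟨_, hF.decomp hc hg⟩

/-- The normalized polynomial of degree exactly `(n, m)` orthogonal to all others. -/
structure IsTop (c : ℤ × ℤ → ℂ) (n m : ℤ) (f : Laurent) : Prop where
  mem : f ∈ box 0 (n, m)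
  pos : IsPos (f (n, m))
  norm : ip c f f = 1
  perp : ∀ g ∈ box 0 (n, m), g (n, m) = 0 → ip c f g = 0

/-- The combination g(n,m) f - f(n,m) g has no term z^n w^m, so it is orthogonal to f and g, hence
to itself, and vanishes. The norms and positive leading coefficients fix the factor. This is the
bridge between the two orderings, whose orthonormal vectors share their first entry. -/
lemma IsTop.eq {f g : Laurent} (hpd : PD c n m) (hf : IsTop c n m f)
    (hg : IsTop c n m g) : f = g := by
  set h := g (n, m) • f - f (n, m) • g with hh
  have hm : h ∈ box 0 (n, m) :=
    Submodule.sub_mem _ (Submodule.smul_mem _ _ hf.mem) (Submodule.smul_mem _ _ hg.mem)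
  have h0 : h (n, m) = 0 := by simp [hh, mul_comm]
  have h1 : ip c h h = 0 := by
    have e1 := hf.perp h hm h0
    have e2 := hg.perp h hm h0
    conv_lhs => rw [hh]
    rw [ip_sub_left, ip_smul_left, ip_smul_left, ← hh, e1, e2]; simp
  have h2 : g (n, m) • f = f (n, m) • g := sub_eq_zero.1 (hpd.eq_zero hm h1)
  have h3 := congrArg (fun x => ip c x x) h2
  simp only [ip_smul_left, ip_smul_right, hf.norm, hg.norm, mul_one] at h3
  have h4 := hg.pos.eq_of_mul_star hf.pos (by rw [mul_comm, h3, mul_comm])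
  rw [h4] at h2
  exact smul_right_injective _ hf.pos.ne_zero h2

lemma IsTop.swap {f : Laurent} (h : IsTop c n m f) : IsTop (swapM c) m n (swapL f) where
  mem := swapL_mem_box.2 h.mem
  pos := by simpa using h.pos
  norm := by simpa using h.norm
  perp := fun g hg h0 => by
    have := h.perp (swapL g) (swapL_mem_box.2 hg) (by simpa using h0)
    rwa [← ip_swapL, swapL_swapL] at this

/-- By triangularity only `F 0` contains z^n w^m, so a polynomial without this monomial has no
component along `F 0`. -/
lemma IsOrth.isTop {F : Fin (k + 1) → Laurent} (hF : IsOrth c n m F) (hc : Herm c) :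
    IsTop c n m (F 0) where
  mem := hF.mem 0
  pos := by simpa [coefZ] using hF.utp.2 0
  norm := by simpa [Bicircle.gram] using congrFun (congrFun hF.gram 0) 0
  perp := fun g hg h0 => by
    have h1 := hF.decomp hc hg
    set x : Fin (k + 1) → ℂ := fun b => ip c g (F b) with hx
    have h2 : (g - ∑ b, x b • F b) (n, m) = 0 := mem_box.1 h1 _ (by simp)
    have h3 : x 0 * F 0 (n, m) = 0 := by
      rw [Finsupp.sub_apply, h0, zero_sub, neg_eq_zero, Finsupp.finsetSum_apply,
        Finset.sum_eq_single 0] at h2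
      · simpa using h2
      · intro b _ hb
        have := hF.utp.1 b 0 (Fin.pos_of_ne_zero hb)
        simp only [coefZ, Matrix.of_apply, Fin.val_zero, Nat.cast_zero, sub_zero] at this
        simp [this]
      · simp
    have h4 : F 0 (n, m) ≠ 0 := by simpa [coefZ] using (hF.utp.2 0).ne_zero
    have h5 : x 0 = 0 := (mul_eq_zero.1 h3).resolve_right h4
    exact ip_eq_zero_comm hc h5

lemma IsOrthT.isTop {F : Fin (k + 1) → Laurent} (hF : IsOrthT c n m F) (hc : Herm c) :
    IsTop c n m (F 0) := by
  have := (IsOrth.isTop hF hc.swap).swap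
  simpa [swapV] using this

end IsOrth

/-! ### Polynomials as Laurent polynomials -/

/-- The coefficients of a polynomial. -/
def emb : Poly →ₗ[ℂ] Laurent :=
  (MvPolynomial.basisMonomials (Fin 2) ℂ).constr ℂ fun d => Finsupp.single ((d 0 : ℤ), (d 1 : ℤ)) 1

@[simp] lemma emb_monomial (d : Fin 2 →₀ ℕ) (a : ℂ) :
    emb (MvPolynomial.monomial d a) = Finsupp.single ((d 0 : ℤ), (d 1 : ℤ)) a := by
  have h1 : MvPolynomial.monomial d a = a • MvPolynomial.basisMonomials (Fin 2) ℂ d := by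
    rw [MvPolynomial.coe_basisMonomials, MvPolynomial.smul_monomial]; simp
  rw [h1, map_smul, emb, Module.Basis.constr_basis]; simp

lemma exponent_ext {d e : Fin 2 →₀ ℕ} (h0 : d 0 = e 0) (h1 : d 1 = e 1) : d = e := by
  ext i; fin_cases i <;> simpa

lemma emb_apply_nat (p : Poly) (i j : ℕ) : emb p ((i : ℤ), (j : ℤ)) = coef p i j := by
  induction p using MvPolynomial.induction_on' with
  | monomial d a =>
    rw [emb_monomial, coef, MvPolynomial.coeff_monomial, Finsupp.single_apply]
    refine if_congr ⟨fun h => ?_, fun h => ?_⟩ rfl rfl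
    · simp only [Prod.mk.injEq, Nat.cast_inj] at h
      exact exponent_ext (by simp [h.1]) (by simp [h.2])
    · rw [h]; simp
  | add p q hp hq => simp [hp, hq, coef] 

lemma emb_apply_of_neg (p : Poly) {x : ℤ × ℤ} (hx : x.1 < 0 ∨ x.2 < 0) : emb p x = 0 := by
  induction p using MvPolynomial.induction_on' with
  | monomial d a =>
    rw [emb_monomial, Finsupp.single_apply, if_neg]
    rintro rfl
    simp at hx; omega
  | add p q hp hq => simp [hp, hq]

lemma emb_injective : Function.Injective emb := by
  intro p q h
  ext d
  have := DFunLike.congr_fun h ((d 0 : ℤ), (d 1 : ℤ))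
  rw [emb_apply_nat, emb_apply_nat, coef, coef] at this
  rwa [show Finsupp.single 0 (d 0) + Finsupp.single 1 (d 1) = d from
    exponent_ext (by simp) (by simp)] at this

lemma emb_C_mul (a : ℂ) (p : Poly) : emb (MvPolynomial.C a * p) = a • emb p := by
  rw [MvPolynomial.C_mul', map_smul]

lemma emb_X_mul (p : Poly) : emb (MvPolynomial.X 0 * p) = shift (1, 0) (emb p) := by
  induction p using MvPolynomial.induction_on' with
  | monomial d a =>
    rw [MvPolynomial.X, MvPolynomial.monomial_mul, emb_monomial, emb_monomial, shift_single]
    simp [add_comm]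
  | add p q hp hq => rw [mul_add, map_add, hp, hq, map_add, map_add]

lemma emb_swapPoly (p : Poly) : emb (swapPoly p) = swapL (emb p) := by
  induction p using MvPolynomial.induction_on' with
  | monomial d a =>
    rw [swapPoly, MvPolynomial.rename_monomial, emb_monomial, emb_monomial, swapL_single]
    congr 2
    · rw [← Finsupp.equivMapDomain_eq_mapDomain, Finsupp.equivMapDomain_apply]; simp
    · rw [← Finsupp.equivMapDomain_eq_mapDomain, Finsupp.equivMapDomain_apply]; simp
  | add p q hp hq => 
    unfold swapPoly at *
    rw [map_add, map_add, hp, hq, map_add, map_add]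

lemma swapPoly_swapPoly (p : Poly) : swapPoly (swapPoly p) = p :=
  emb_injective (by rw [emb_swapPoly, emb_swapPoly, swapL_swapL])

/-- The degree bound is essential: `reverse` keeps only the coefficients inside the box. -/
lemma emb_reverse (n m : ℕ) {p : Poly} (hp : emb p ∈ box 0 (n, m)) :
    emb (reverse n m p) = rev (n, m) (emb p) := by
  have h1 : ∀ i j : ℕ, MvPolynomial.C (star (coef p i j)) *
      (MvPolynomial.X 0 ^ (n - i) * MvPolynomial.X 1 ^ (m - j)) =
      (MvPolynomial.monomial (Finsupp.single 0 (n - i) + Finsupp.single 1 (m - j))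
        (star (coef p i j)) : Poly) := by
    intro i j
    rw [MvPolynomial.X_pow_eq_monomial, MvPolynomial.X_pow_eq_monomial, MvPolynomial.monomial_mul,
      MvPolynomial.C_mul_monomial]; simp
  have h2 : emb (reverse n m p) = ∑ i ∈ Finset.range (n + 1), ∑ j ∈ Finset.range (m + 1),
      rev (n, m) (Finsupp.single ((i : ℤ), (j : ℤ)) (coef p i j)) := by
    rw [reverse, map_sum]
    refine Finset.sum_congr rfl fun i hi => ?_
    rw [map_sum]
    refine Finset.sum_congr rfl fun j hj => ?_
    rw [h1, emb_monomial, rev_single]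
    rw [Finset.mem_range] at hi hj
    congr 2
    · simp; omega
    · simp; omega
  rw [h2]
  simp_rw [← rev_sum]
  congr 1
  ext ⟨a, b⟩
  simp only [Finsupp.finsetSum_apply, Finsupp.single_apply, Prod.mk.injEq]
  by_cases hx : (0 : ℤ) ≤ a ∧ a ≤ n ∧ 0 ≤ b ∧ b ≤ m
  · obtain ⟨a, rfl⟩ := Int.eq_ofNat_of_zero_le hx.1
    obtain ⟨b, rfl⟩ := Int.eq_ofNat_of_zero_le hx.2.2.1
    rw [Finset.sum_eq_single a, Finset.sum_eq_single b]
    · simp [emb_apply_nat]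
    · intro j _ hj; simp [hj]
    · intro hb; simp at hb; omega
    · intro i _ hi; simp [hi]
    · intro ha; simp at ha; omega
  · rw [mem_box.1 hp _ (by simpa using hx)]
    refine Finset.sum_eq_zero fun i hi => Finset.sum_eq_zero fun j hj => ?_
    rw [Finset.mem_range] at hi hj
    rw [if_neg]; omega

/-! ### Families of levels -/

section family
variable (lev : ∀ n m : ℕ, Level n m)

/-- The vector `Φ_{n,m}`. -/
def Ph (n m : ℕ) : Fin (m + 1) → Laurent := fun a => emb ((lev n m).Phi a)

/-- The vector `Φ̃_{n,m}`. -/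
def PT (n m : ℕ) : Fin (n + 1) → Laurent := fun a => emb ((lev n m).PhiT a)

/-- The vector `Φ_{n,m-1}`, which is empty for `m = 0`. -/
def PhD (n : ℕ) : (m : ℕ) → Fin m → Laurent
  | 0 => Fin.elim0
  | m + 1 => Ph lev n m

/-- The vector `Φ̃_{n-1,m}`, which is empty for `n = 0`. -/
def PTD : (n m : ℕ) → Fin n → Laurent
  | 0, _ => Fin.elim0
  | n + 1, m => PT lev n m

/-- The family after interchange of the roles of `z` and `w`. -/
def swapFam : ∀ n m : ℕ, Level n m := fun n m => (lev m n).swap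

lemma Level.swap_swap {n m : ℕ} (l : Level n m) : l.swap.swap = l := by
  cases l; simp [Level.swap, swapPoly_swapPoly]

@[simp] lemma swapFam_swapFam : swapFam (swapFam lev) = lev := by
  funext n m; simp [swapFam, Level.swap_swap]

lemma Ph_swapFam (n m : ℕ) : Ph (swapFam lev) n m = swapV (PT lev m n) := by
  funext a; simp [Ph, PT, swapV, swapFam, Level.swap, emb_swapPoly]

lemma PT_swapFam (n m : ℕ) : PT (swapFam lev) n m = swapV (Ph lev m n) := by
  funext a; simp [Ph, PT, swapV, swapFam, Level.swap, emb_swapPoly]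

lemma PhD_swapFam (n m : ℕ) : PhD (swapFam lev) n m = swapV (PTD lev m n) := by
  cases m with
  | zero => funext a; exact a.elim0
  | succ m => exact Ph_swapFam lev n m

lemma PTD_swapFam (n m : ℕ) : PTD (swapFam lev) n m = swapV (PhD lev m n) := by
  cases n with
  | zero => funext a; exact a.elim0
  | succ m => exact PT_swapFam lev _ _

/-- Level `(n, m)` of the family consists of the orthonormal polynomials and the recurrence
coefficients of the form with moments `c`. -/
structure Good (c : ℤ × ℤ → ℂ) (n m : ℕ) : Prop where
  orth : IsOrth c n m (Ph lev n m)
  orthT : IsOrthT c n m (PT lev n m)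
  K : (lev n m).K = gram c (PhD lev n m) (PTD lev n m)
  K1 : (lev n m).K1 = gram c (shiftV (0, 1) (PhD lev n m)) (revV ((n : ℤ) - 1, m) (PTD lev n m))
  G : (lev n m).G = gram c (PhD lev n m) (Ph lev n m)
  G1 : (lev n m).G1 = gram c (shiftV (0, 1) (PhD lev n m)) (Ph lev n m)
  GT : (lev n m).GT = gram c (PTD lev n m) (PT lev n m)
  G1T : (lev n m).G1T = gram c (shiftV (1, 0) (PTD lev n m)) (PT lev n m)
  J : (lev n m).J = gram c (Ph lev n m) (PT lev n m)
  J1 : (lev n m).J1 = gram c (revV (n, m) (Ph lev n m)) (PT lev n m)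
  -- At n = 0 the fields `E` and `A` hold meaningless default values, so they are constrained only
  -- when n is a successor.
  E : ∀ k, n = k + 1 →
    (lev n m).E = gram c (shiftV (1, 0) (Ph lev k m)) (revV (k, m) (Ph lev k m))
  A : ∀ k, n = k + 1 → UTP (lev n m).A ∧
    (lev n m).A ⊳ Ph lev n m = shiftV (1, 0) (Ph lev k m) - (lev n m).E ⊳ revV (k, m) (Ph lev k m)
  ET : ∀ k, m = k + 1 →
    (lev n m).ET = gram c (shiftV (0, 1) (PT lev n k)) (revV (n, k) (PT lev n k))
  AT : ∀ k, m = k + 1 → UTP (lev n m).AT ∧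
    (lev n m).AT ⊳ PT lev n m = shiftV (0, 1) (PT lev n k) - (lev n m).ET ⊳ revV (n, k) (PT lev n k)

variable {lev} {c : ℤ × ℤ → ℂ}

/-- `gram (z P) (rev F)` and `gram (w F) (rev P)` are transposes of each other. -/
lemma gram_shift_rev {k l : ℕ} (n m : ℤ) (F : Fin k → Laurent) (P : Fin l → Laurent) :
    gram c (shiftV (1, 0) P) (revV (n, m - 1) F) =
      (gram c (shiftV (0, 1) F) (revV (n - 1, m) P))ᵀ := by
  rw [← gram_revV c (n, m), revV_revV, revV_shiftV]
  have h1 : ((n, m) - (n - 1, m) : ℤ × ℤ) = (1, 0) := by ext <;> simp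
  have h2 : ((n, m) - (0, 1) : ℤ × ℤ) = (n, m - 1) := by ext <;> simp
  rw [h1, h2]

/-- Each field becomes its tilde counterpart. Every tilde statement below is obtained from the plain
one applied to `swapFam lev` and `swapM c`. -/
lemma Good.swap (hc : Herm c) {n m : ℕ} (h : Good lev c n m) :
    Good (swapFam lev) (swapM c) m n where
  orth := by rw [Ph_swapFam]; exact h.orthT
  orthT := by
    rw [PT_swapFam, IsOrthT, swapM_swapM, swapV_swapV]; exact h.orth
  K := by
    rw [PhD_swapFam, PTD_swapFam, gram_swapV, ← gram_conjTranspose hc, ← h.K]; rfl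
  K1 := by
    rw [PhD_swapFam, PTD_swapFam]
    have := gram_swapV c (shiftV (1, 0) (PTD lev n m)) (revV ((n : ℤ), (m : ℤ) - 1) (PhD lev n m))
    rw [swapV_shiftV, swapV_revV] at this
    refine Eq.trans ?_ this.symm
    rw [gram_shift_rev, ← h.K1]; rfl
  G := by rw [PhD_swapFam, Ph_swapFam, gram_swapV, ← h.GT]; rfl
  G1 := by
    rw [PhD_swapFam, Ph_swapFam]
    have := gram_swapV c (shiftV (1, 0) (PTD lev n m)) (PT lev n m)
    rw [swapV_shiftV] at this
    refine Eq.trans ?_ this.symm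
    rw [← h.G1T]; rfl
  GT := by rw [PTD_swapFam, PT_swapFam, gram_swapV, ← h.G]; rfl
  G1T := by
    rw [PTD_swapFam, PT_swapFam]
    have := gram_swapV c (shiftV (0, 1) (PhD lev n m)) (Ph lev n m)
    rw [swapV_shiftV] at this
    refine Eq.trans ?_ this.symm
    rw [← h.G1]; rfl
  J := by
    rw [Ph_swapFam, PT_swapFam, gram_swapV, ← gram_conjTranspose hc, ← h.J]; rfl
  J1 := by
    rw [Ph_swapFam, PT_swapFam]
    have := gram_swapV c (revV (n, m) (PT lev n m)) (Ph lev n m)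
    rw [swapV_revV] at this
    refine Eq.trans ?_ this.symm
    have h2 : (lev n m).J1ᵀ = (gram c (revV (n, m) (Ph lev n m)) (PT lev n m))ᵀ := by rw [h.J1]
    rw [← gram_revV c ((n : ℤ), (m : ℤ)), revV_revV] at h2
    have e' : shiftV (((n : ℤ), (m : ℤ)) - ((n : ℤ), (m : ℤ))) (Ph lev n m) = Ph lev n m := by
      funext a; simp [shiftV]
    rw [e'] at h2
    exact h2
  E := by
    intro k hk
    rw [Ph_swapFam]
    have := gram_swapV c (shiftV (0, 1) (PT lev n k)) (revV (n, k) (PT lev n k))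
    rw [swapV_shiftV, swapV_revV] at this
    refine Eq.trans ?_ this.symm
    rw [← h.ET k hk]; rfl
  A := by
    intro k hk
    refine ⟨(h.AT k hk).1, ?_⟩
    have := congrArg swapV (h.AT k hk).2
    rw [swapV_sub, swapV_actL, swapV_actL, swapV_shiftV, swapV_revV, ← Ph_swapFam,
      ← Ph_swapFam] at this
    exact this
  ET := by
    intro k hk
    rw [PT_swapFam]
    have := gram_swapV c (shiftV (1, 0) (Ph lev k m)) (revV (k, m) (Ph lev k m))
    rw [swapV_shiftV, swapV_revV] at this
    refine Eq.trans ?_ this.symm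
    rw [← h.E k hk]; rfl
  AT := by
    intro k hk
    refine ⟨(h.A k hk).1, ?_⟩
    have := congrArg swapV (h.A k hk).2
    rw [swapV_sub, swapV_actL, swapV_actL, swapV_shiftV, swapV_revV, ← PT_swapFam,
      ← PT_swapFam] at this
    exact this

/-- The vector `Φ_{n,m-1}` is orthonormal at its level. -/
lemma isOrth_PhD {n m : ℕ} (h : ∀ k, m = k + 1 → Good lev c n k) :
    IsOrth c n ((m : ℤ) - 1) (PhD lev n m) := by
  cases m with
  | zero =>
    exact ⟨by simp, fun a => a.elim0, ⟨fun a => a.elim0, fun a => a.elim0⟩,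
      by ext a; exact a.elim0, fun a => a.elim0⟩
  | succ m =>
    have := (h m rfl).orth
    simpa [PhD] using this

lemma isOrthT_PTD {n m : ℕ} (h : ∀ k, n = k + 1 → Good lev c k m) :
    IsOrthT c ((n : ℤ) - 1) m (PTD lev n m) := by
  cases n with
  | zero =>
    exact ⟨by simp, fun a => a.elim0, ⟨fun a => a.elim0, fun a => a.elim0⟩,
      by ext a; exact a.elim0, fun a => a.elim0⟩
  | succ n =>
    have := (h n rfl).orthT
    simpa [PTD] using this

end family

/-! ### Consequences of a recurrence with reflection matrix `E` -/

lemma map_star_eq {k l : ℕ} (M : Matrix (Fin k) (Fin l) ℂ) : M.map star = Mᴴᵀ := rfl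

lemma conjTranspose_map_star {k l : ℕ} (M : Matrix (Fin k) (Fin l) ℂ) : (M.map star)ᴴ = Mᵀ := by
  ext a b; simp

/-- The vectors `F`, `F'` satisfy `A F' = v F - E (reverse F)ᵀ`, where `v` stands for the
multiplication by a monomial. -/
structure Recur (c : ℤ × ℤ → ℂ) (v x : ℤ × ℤ) {k : ℕ} (A E : Matrix (Fin k) (Fin k) ℂ)
    (F F' : Fin k → Laurent) : Prop where
  utp : UTP A
  hE : E = gram c (shiftV v F) (revV x F)
  rec_eq : A ⊳ F' = shiftV v F - E ⊳ revV x F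
  gram_old : gram c F F = 1
  gram_new : gram c F' F' = 1

namespace Recur
variable {c : ℤ × ℤ → ℂ} {v x : ℤ × ℤ} {k : ℕ} {A E : Matrix (Fin k) (Fin k) ℂ}
  {F F' : Fin k → Laurent}

/-- Reversal at x + v exchanges the shifted and the reversed vector and transposes Gram matrices.
Hence reflection matrices are symmetric. -/
lemma transpose_gram (F : Fin k → Laurent) :
    (gram c (shiftV v F) (revV x F))ᵀ = gram c (shiftV v F) (revV x F) := by
  rw [← gram_revV c (x + v), revV_revV, revV_shiftV, add_sub_cancel_left, add_sub_cancel_right]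

lemma transpose (h : Recur c v x A E F F') : Eᵀ = E := by rw [h.hE, transpose_gram]

lemma map_star (h : Recur c v x A E F F') : E.map star = Eᴴ := by
  conv_lhs => rw [← h.transpose]
  ext a b; simp

lemma shift_eq (h : Recur c v x A E F F') : shiftV v F = A ⊳ F' + E ⊳ revV x F := by
  rw [h.rec_eq]; abel

lemma gram_residual (hc : Herm c) (hE : E = gram c (shiftV v F) (revV x F))
    (hF : gram c F F = 1) :
    gram c (shiftV v F - E ⊳ revV x F) (shiftV v F - E ⊳ revV x F) = 1 - E * Eᴴ := by
  rw [gram_sub_left, gram_sub_right, gram_sub_right, gram_actL_left, gram_actL_left,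
    gram_actL_right, gram_actL_right, gram_shiftV, gram_revV, hF,
    ← gram_conjTranspose hc (shiftV v F) (revV x F), ← hE]
  simp

lemma mul_conjTranspose (h : Recur c v x A E F F') (hc : Herm c) : A * Aᴴ = 1 - E * Eᴴ := by
  rw [← gram_residual hc h.hE h.gram_old, ← h.rec_eq, gram_actL_left, gram_actL_right, h.gram_new,
    Matrix.one_mul]

lemma rev_old (h : Recur c v x A E F F') :
    revV x F = (E.map star) ⊳ shiftV v F + (A.map star) ⊳ revV (x + v) F' := by
  have h1 := congrArg (revV (x + v)) h.rec_eq
  rw [revV_sub, revV_actL, revV_actL, revV_revV, revV_shiftV, add_sub_cancel_left,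
    add_sub_cancel_right] at h1
  rw [h1]; abel

/-- Reverse the recurrence and eliminate the shifted old vector. The coefficient 1 - E†E that
appears equals Ā Aᵀ because E is symmetric. This is the origin of the formula for I¹. -/
lemma rev_new (h : Recur c v x A E F F') (hc : Herm c) :
    revV (x + v) F' = Aᵀ ⊳ revV x F - ((A.map star)⁻¹ * Eᴴ * A) ⊳ F' := by
  have h1 : (A.map star) ⊳ revV (x + v) F' =
      (A.map star * Aᵀ) ⊳ revV x F - (Eᴴ * A) ⊳ F' := by
    have h2 : A.map star * Aᵀ = 1 - Eᴴ * E := by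
      have := congrArg Matrix.transpose (h.mul_conjTranspose hc)
      rw [Matrix.transpose_mul, Matrix.transpose_sub, Matrix.transpose_mul, h.transpose,
        Matrix.transpose_one] at this
      rw [map_star_eq, this, ← map_star_eq, h.map_star]
    have h3 := h.rev_old
    rw [h.map_star, h.shift_eq, actL_add, actL_actL, actL_actL] at h3
    rw [h2, sub_actL, one_actL, eq_sub_iff_add_eq, eq_sub_iff_add_eq]
    conv_rhs => rw [h3]
    abel
  have h4 := congrArg ((A.map star)⁻¹ ⊳ ·) h1
  simp only [actL_sub, actL_actL, ← Matrix.mul_assoc, h.utp.map_star.inv_mul, one_actL,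
    Matrix.one_mul] at h4
  exact h4

end Recur

lemma stack_succ {k : ℕ} (G1 G : Matrix (Fin (k + 1)) (Fin (k + 2)) ℂ) (i : Fin (k + 1))
    (j : Fin (k + 2)) : stack G1 G i.succ j = G i j := rfl

/-! ### The matrices `Γ`, `Γ¹` of two consecutive levels -/

section consecutive
variable {c : ℤ × ℤ → ℂ} {n m : ℤ} {k : ℕ} {F : Fin k → Laurent} {F' : Fin (k + 1) → Laurent}

lemma coefZ_of_sub_mem {k l : ℕ} {F : Fin k → Laurent} {F' : Fin l → Laurent}
    {M : Matrix (Fin k) (Fin l) ℂ} (h : ∀ a, (F - M ⊳ F') a ∈ box 0 (n - 1, m)) (a : Fin k)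
    (j : ℤ) : F a (n, j) = ∑ b, M a b * F' b (n, j) := by
  have := mem_box.1 (h a) (n, j) (by simp)
  rwa [Pi.sub_apply, Finsupp.sub_apply, actL_apply, sub_eq_zero] at this

/-- The left side collects the z^n coefficients of F, since F minus its expansion along F' has
smaller z-degree. The right side is the same data, displaced by one column because F has no term in
w^m. -/
lemma gram_consecutive_mul (hc : Herm c) (hF : IsOrth c n (m - 1) F) (hF' : IsOrth c n m F') :
    gram c F F' * coefZ n m F' = coefZ n (m - 1) F * U k := by
  ext a b
  have h1 := coefZ_of_sub_mem (hF'.decompV hc (G := F)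
    (fun a => box_mono (by simp) (by simp) (by simp) (by simp) (hF.mem a))) a (m - (b : ℕ))
  have h2 : (gram c F F' * coefZ n m F') a b = F a (n, m - (b : ℕ)) := by
    rw [h1]; rfl
  rw [h2]
  refine Fin.cases ?_ (fun b => ?_) b
  · rw [mul_U_apply_zero]
    exact mem_box.1 (hF.mem a) _ (by simp)
  · rw [mul_U_apply_succ]
    simp only [coefZ, Matrix.of_apply, Fin.val_succ]
    congr 2; push_cast; ring

/-- `Γ` is `[0, B]` with `B` upper triangular with positive diagonal. -/
lemma gram_consecutive (hc : Herm c) (hF : IsOrth c n (m - 1) F) (hF' : IsOrth c n m F') :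
    ∃ B : Matrix (Fin k) (Fin k) ℂ, UTP B ∧ gram c F F' = B * U k := by
  have h1 := gram_consecutive_mul hc hF hF'
  have h2 : gram c F F' = coefZ n (m - 1) F * (U k * (coefZ n m F')⁻¹) := by
    rw [← Matrix.mul_assoc, ← h1, Matrix.mul_assoc, hF'.utp.mul_inv, Matrix.mul_one]
  refine ⟨coefZ n (m - 1) F * (U k * (coefZ n m F')⁻¹ * (U k)ᵀ),
    hF.utp.mul hF'.utp.inv.submatrix_succ, ?_⟩
  rw [h2, Matrix.mul_assoc (coefZ n (m - 1) F), ← eq_mul_U]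
  intro i
  rw [U_mul_apply]
  exact hF'.utp.inv.1 _ _ (Fin.succ_pos i)

lemma gram_shift_consecutive_mul (hc : Herm c) (hF : IsOrth c n (m - 1) F)
    (hF' : IsOrth c n m F') :
    gram c (shiftV (0, 1) F) F' * coefZ n m F' =
      Matrix.of fun a (b : Fin (k + 1)) => F a (n, m - 1 - (b : ℕ)) := by
  ext a b
  have h1 := coefZ_of_sub_mem (hF'.decompV hc (G := shiftV (0, 1) F)
    (fun a => box_mono (by simp) (by simp) (by simp) (by simp)
      (shift_mem_box (0, 1) (hF.mem a)))) a (m - (b : ℕ))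
  have h2 : (gram c (shiftV (0, 1) F) F' * coefZ n m F') a b =
      shiftV (0, 1) F a (n, m - (b : ℕ)) := by
    rw [h1]; rfl
  rw [h2]
  simp only [shiftV, shift_apply, Matrix.of_apply]
  congr 1; ext <;> simp; ring

lemma gram_shift_consecutive_mul_U₁ (hc : Herm c) (hF : IsOrth c n (m - 1) F)
    (hF' : IsOrth c n m F') :
    gram c (shiftV (0, 1) F) F' * coefZ n m F' * (U₁ k)ᵀ = coefZ n (m - 1) F := by
  rw [gram_shift_consecutive_mul hc hF hF']
  ext a b
  rw [mul_U₁_transpose_apply]; rfl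

lemma gram_shift_consecutive_apply (hc : Herm c) (hF : IsOrth c n (m - 1) F)
    (hF' : IsOrth c n m F') (a : Fin k) :
    gram c (shiftV (0, 1) F) F' a 0 = F a (n, m - 1) * (coefZ n m F')⁻¹ 0 0 := by
  have h1 := gram_shift_consecutive_mul hc hF hF'
  have h2 := congrArg (· * (coefZ n m F')⁻¹) h1
  simp only [Matrix.mul_assoc, hF'.utp.mul_inv, Matrix.mul_one] at h2
  rw [h2, Matrix.mul_apply, Finset.sum_eq_single 0]
  · simp
  · intro b _ hb
    rw [hF'.utp.inv.1 b 0 (Fin.pos_of_ne_zero hb), mul_zero]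
  · simp

lemma gram_shift_consecutive_ne {F : Fin (k + 1) → Laurent} {F' : Fin (k + 2) → Laurent}
    (hc : Herm c) (hF : IsOrth c n (m - 1) F) (hF' : IsOrth c n m F') (a : Fin k) :
    gram c (shiftV (0, 1) F) F' a.succ 0 = 0 := by
  rw [gram_shift_consecutive_apply hc hF hF']
  have := hF.utp.1 a.succ 0 (Fin.succ_pos a)
  simp only [coefZ, Matrix.of_apply, Fin.val_zero, Nat.cast_zero, sub_zero] at this
  rw [this, zero_mul]

lemma gram_shift_consecutive_pos {F : Fin (k + 1) → Laurent} {F' : Fin (k + 2) → Laurent}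
    (hc : Herm c) (hF : IsOrth c n (m - 1) F) (hF' : IsOrth c n m F') :
    IsPos (gram c (shiftV (0, 1) F) F' 0 0) := by
  rw [gram_shift_consecutive_apply hc hF hF']
  refine IsPos.mul ?_ (hF'.utp.inv.2 0)
  simpa [coefZ] using hF.utp.2 0

/-- Below the first row stands [0, B] with B triangular, and the corner entry of Γ¹ is positive. The
inverses of stacked matrices in the formulas for Ê and H², H¹ are therefore genuine. -/
lemma utp_stack {F : Fin (k + 1) → Laurent} {F' : Fin (k + 2) → Laurent}
    (hc : Herm c) (hF : IsOrth c n (m - 1) F) (hF' : IsOrth c n m F') :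
    UTP (stack (gram c (shiftV (0, 1) F) F') (gram c F F')) := by
  obtain ⟨B, hB, hG⟩ := gram_consecutive hc hF hF'
  constructor
  · intro i j
    refine Fin.cases ?_ (fun i => ?_) i
    · intro h; exact absurd h (Fin.not_lt_zero j)
    · rw [stack_succ, hG]
      refine Fin.cases ?_ (fun j => ?_) j
      · intro; exact mul_U_apply_zero B i
      · intro h; exact (mul_U_apply_succ B i j).trans (hB.1 _ _ (by simpa using h))
  · intro i
    refine Fin.cases ?_ (fun i => ?_) i
    · exact gram_shift_consecutive_pos hc hF hF'
    · rw [stack_succ, hG, mul_U_apply_succ]; exact hB.2 i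

end consecutive

lemma stack_mul {k l : ℕ} (G1 G : Matrix (Fin (k + 1)) (Fin (k + 2)) ℂ)
    (X : Matrix (Fin (k + 2)) (Fin l) ℂ) :
    stack G1 G * X = (U (k + 1))ᵀ * (G * X) + corner (k + 1) k * (G1 * X) := by
  ext i j
  have hc : ∀ (i : Fin (k + 2)) (Y : Matrix (Fin (k + 1)) (Fin l) ℂ),
      (corner (k + 1) k * Y) i j = if i = 0 then Y 0 j else 0 := by
    intro i Y
    simp [corner, Matrix.mul_apply, Matrix.single_apply, ite_and, eq_comm]
  rw [Matrix.add_apply, hc]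
  refine Fin.cases ?_ (fun i => ?_) i
  · rw [U_transpose_mul_apply_zero, if_pos rfl, zero_add]; rfl
  · rw [U_transpose_mul_apply_succ, if_neg (Fin.succ_ne_zero i), add_zero]; rfl

/-! ### The leading matrices -/

section lead
variable (lev : ∀ n m : ℕ, Level n m)

lemma lead_eq (n m : ℕ) : (lev n m).lead = coefZ n m (Ph lev n m) := by
  ext a b
  simp only [Level.lead, coefZ, Matrix.of_apply, Ph]
  rw [← emb_apply_nat, Nat.cast_sub (by omega)]

lemma Level.swap_leadT {n m : ℕ} (l : Level n m) : l.swap.leadT = l.lead := by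
  ext a b
  simp only [Level.lead, Level.leadT, Matrix.of_apply, Level.swap]
  rw [← emb_apply_nat, ← emb_apply_nat, emb_swapPoly, swapL_apply]; rfl

lemma leadT_eq (n m : ℕ) : (lev n m).leadT = coefZ m n (swapV (PT lev n m)) := by
  rw [← Level.swap_swap (lev n m), Level.swap_leadT, ← Ph_swapFam, ← lead_eq]; rfl

end lead

/-! ### Levels strictly below (n+1, m+1) -/

section step
variable {lev : ∀ n m : ℕ, Level n m} {c : ℤ × ℤ → ℂ} {n m : ℕ}

/-- All levels below `(n, m)` are good. -/
def LowerGood (lev : ∀ n m : ℕ, Level n m) (c : ℤ × ℤ → ℂ) (n m : ℕ) : Prop :=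
  ∀ i j, i ≤ n → j ≤ m → (i, j) ≠ (n, m) → Good lev c i j

lemma LowerGood.swap (hc : Herm c) (h : LowerGood lev c n m) :
    LowerGood (swapFam lev) (swapM c) m n := fun i j hi hj hij =>
  (h j i hj hi (by rintro ⟨⟩; exact hij rfl)).swap hc

lemma Good.recZ (h : Good lev c (n + 1) m) (h' : Good lev c n m) :
    Recur c (1, 0) (n, m) (lev (n + 1) m).A (lev (n + 1) m).E (Ph lev n m) (Ph lev (n + 1) m) :=
  ⟨(h.A n rfl).1, h.E n rfl, (h.A n rfl).2, h'.orth.gram, h.orth.gram⟩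

lemma Good.recW (h : Good lev c n (m + 1)) (h' : Good lev c n m) :
    Recur c (0, 1) (n, m) (lev n (m + 1)).AT (lev n (m + 1)).ET (PT lev n m) (PT lev n (m + 1)) :=
  ⟨(h.AT m rfl).1, h.ET m rfl, (h.AT m rfl).2, h'.orthT.gram, h.orthT.gram⟩

lemma LowerGood.left (h : LowerGood lev c (n + 1) (m + 1)) : Good lev c n (m + 1) :=
  h _ _ (by omega) le_rfl (by simp)

lemma LowerGood.down (h : LowerGood lev c (n + 1) (m + 1)) : Good lev c (n + 1) m :=
  h _ _ le_rfl (by omega) (by simp)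

lemma LowerGood.diag (h : LowerGood lev c (n + 1) (m + 1)) : Good lev c n m :=
  h _ _ (by omega) (by omega) (by simp)

lemma LowerGood.orth_PhD (h : LowerGood lev c (n + 1) (m + 1)) :
    IsOrth c ((n : ℤ) + 1) ((m : ℤ) - 1) (PhD lev (n + 1) m) := by
  have := isOrth_PhD (n := n + 1) (m := m) (lev := lev) (c := c)
    (fun k hk => h _ _ le_rfl (by omega) (by simp; omega))
  simpa using this

lemma LowerGood.orth_left (h : LowerGood lev c (n + 1) (m + 1)) :
    IsOrth c n ((m : ℤ) + 1) (Ph lev n (m + 1)) := by simpa using h.left.orth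

lemma LowerGood.orthT_left (h : LowerGood lev c (n + 1) (m + 1)) :
    IsOrthT c n ((m : ℤ) + 1) (PT lev n (m + 1)) := by simpa using h.left.orthT

lemma LowerGood.orth_down (h : LowerGood lev c (n + 1) (m + 1)) :
    IsOrth c ((n : ℤ) + 1) m (Ph lev (n + 1) m) := by simpa using h.down.orth

lemma LowerGood.orthT_down (h : LowerGood lev c (n + 1) (m + 1)) :
    IsOrthT c ((n : ℤ) + 1) m (PT lev (n + 1) m) := by simpa using h.down.orthT

lemma LowerGood.perp_down (h : LowerGood lev c (n + 1) (m + 1)) :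
    Perp c (Ph lev (n + 1) m) (box 0 (n, m)) := by simpa using h.orth_down.perp

lemma LowerGood.perpT_left (h : LowerGood lev c (n + 1) (m + 1)) :
    Perp c (PT lev n (m + 1)) (box 0 (n, m)) := by simpa using h.orthT_left.perp

/-- The Gram matrix that `K_{n+1,m+1}` is meant to be. -/
def gramK (lev : ∀ n m : ℕ, Level n m) (c : ℤ × ℤ → ℂ) (n m : ℕ) :
    Matrix (Fin (m + 1)) (Fin (n + 1)) ℂ :=
  gram c (Ph lev (n + 1) m) (PT lev n (m + 1))

/-- The Gram matrix that `K¹_{n+1,m+1}` is meant to be. -/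
def gramK1 (lev : ∀ n m : ℕ, Level n m) (c : ℤ × ℤ → ℂ) (n m : ℕ) :
    Matrix (Fin (m + 1)) (Fin (n + 1)) ℂ :=
  gram c (shiftV (0, 1) (Ph lev (n + 1) m)) (revV (n, (m : ℤ) + 1) (PT lev n (m + 1)))

lemma gramK_swap (hc : Herm c) : gramK (swapFam lev) (swapM c) m n = (gramK lev c n m)ᴴ := by
  rw [gramK, gramK, Ph_swapFam, PT_swapFam, gram_swapV, gram_conjTranspose hc]

lemma gramK1_swap : gramK1 (swapFam lev) (swapM c) m n = (gramK1 lev c n m)ᵀ := by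
  rw [gramK1, gramK1, Ph_swapFam, PT_swapFam]
  have := gram_swapV c (shiftV (1, 0) (PT lev n (m + 1)))
    (revV ((n : ℤ) + 1, (m : ℤ)) (Ph lev (n + 1) m))
  rw [swapV_shiftV, swapV_revV] at this
  refine Eq.trans this ?_
  have h2 := gram_shift_rev (c := c) ((n : ℤ) + 1) ((m : ℤ) + 1) (Ph lev (n + 1) m)
    (PT lev n (m + 1))
  simpa using h2

/-! ### The matrix `K` -/

/-- These products are known from lower levels. The vectors wΦ_{n+1,m-1} and D applied to the
monomials have the same z^{n+1} coefficients, so they differ by a polynomial of degree (n, m), to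
which Φ̃_{n,m+1} is orthogonal. The recurrence for Φ̃_{n,m+1} turns the product with wΦ_{n+1,m-1}
into K and K¹ of level (n+1, m). -/
lemma gram_matH (hc : Herm c) (h : LowerGood lev c (n + 1) (m + 1)) :
    gram c (fun b : Fin m => Finsupp.single ((n : ℤ) + 1, (m : ℤ) - (b : ℕ)) 1)
      (PT lev n (m + 1)) =
    matH (lev n (m + 1)) (lev (n + 1) m) * (lev n (m + 1)).leadTᴴ := by
  set X := gram c (fun b : Fin m => Finsupp.single ((n : ℤ) + 1, (m : ℤ) - (b : ℕ)) 1)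
      (PT lev n (m + 1)) with hX
  have hD := h.orth_PhD
  set D := coefZ ((n : ℤ) + 1) ((m : ℤ) - 1) (PhD lev (n + 1) m) with hDdef
  have hlead : (lev (n + 1) m).G1 * (lev (n + 1) m).lead * (U₁ m)ᵀ = D := by
    rw [h.down.G1, lead_eq]
    have := gram_shift_consecutive_mul_U₁ hc hD h.orth_down
    simpa using this
  have hrec := h.left.recW h.diag
  have hgram : gram c (shiftV (0, 1) (PhD lev (n + 1) m)) (PT lev n (m + 1)) = D * X := by
    have : D * X = gram c (D ⊳ fun b : Fin m => Finsupp.single ((n : ℤ) + 1, (m : ℤ) - (b : ℕ)) 1)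
        (PT lev n (m + 1)) := by rw [gram_actL_left]
    rw [this, ← sub_eq_zero, ← gram_sub_left]
    refine gram_eq_zero' hc h.perpT_left fun a => ?_
    have h1 : (shiftV (0, 1) (PhD lev (n + 1) m) - D ⊳ fun b : Fin m =>
        Finsupp.single ((n : ℤ) + 1, (m : ℤ) - (b : ℕ)) (1 : ℂ)) a ∈ box 0 ((n : ℤ) + 1, m) := by
      refine Submodule.sub_mem _ (box_mono (by simp) (by simp) (by simp) (by simp)
        (shift_mem_box (0, 1) (hD.mem a))) (actL_mem (fun b => single_mem_box ?_) a)
      simp; omega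
    have h2 : (shiftV (0, 1) (PhD lev (n + 1) m) - D ⊳ fun b : Fin m =>
        Finsupp.single ((n : ℤ) + 1, (m : ℤ) - (b : ℕ)) (1 : ℂ)) a ∈ box (0, 1) ((n : ℤ) + 1, m) := by
      refine Submodule.sub_mem _ (box_mono (by simp) (by simp) (by simp) (by simp)
        (shift_mem_box (0, 1) (hD.mem a))) (actL_mem (fun b => single_mem_box ?_) a)
      simp; omega
    -- The last coefficient, at w^0, vanishes because both terms have exponents of w at least 1
    -- (`h2`).
    have h3 := mem_box_of_coef (k := m + 1) h1 (by simp) (fun b => by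
      rw [Pi.sub_apply, Finsupp.sub_apply, actL_apply]
      refine Fin.lastCases ?_ (fun b => ?_) b
      · have := mem_box.1 h2 ((n : ℤ) + 1, (m : ℤ) - ((Fin.last m : Fin (m + 1)) : ℕ)) (by simp)
        rwa [Pi.sub_apply, Finsupp.sub_apply, actL_apply] at this
      · rw [Finset.sum_eq_single b]
        · simp [shiftV, hDdef, coefZ]
          rw [sub_eq_zero]; congr 2; ring
        · intro b' _ hb'
          rw [Finsupp.single_apply, if_neg, mul_zero]
          simp only [Prod.mk.injEq, true_and, Fin.val_castSucc]
          intro h; apply hb'; ext; omega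
        · simp)
    simpa using h3
  have hmain : D * X * (lev n (m + 1)).ATᴴ =
      (lev (n + 1) m).K - (lev (n + 1) m).K1 * (lev n (m + 1)).ETᴴ := by
    rw [← hgram, ← gram_actL_right, hrec.rec_eq, gram_sub_right, gram_actL_right, gram_shiftV,
      h.down.K, h.down.K1]
    simp [PTD]
  have hA : IsUnit ((lev n (m + 1)).ATᴴ).det := hrec.utp.isUnit_det_conjTranspose
  have hL : UTP (lev n (m + 1)).leadT := by
    rw [leadT_eq]; exact IsOrth.utp h.left.orthT
  rw [matH, hlead, ← hmain, Matrix.conjTranspose_mul, Matrix.mul_inv_rev]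
  have e2 : ((lev n (m + 1)).ATᴴ)⁻¹ * (((lev n (m + 1)).leadTᴴ)⁻¹ * (lev n (m + 1)).leadTᴴ) =
      ((lev n (m + 1)).ATᴴ)⁻¹ := by
    rw [Matrix.nonsing_inv_mul _ hL.isUnit_det_conjTranspose, Matrix.mul_one]
  calc X = D⁻¹ * D * X * ((lev n (m + 1)).ATᴴ * ((lev n (m + 1)).ATᴴ)⁻¹) := by
        rw [hD.utp.inv_mul, Matrix.mul_nonsing_inv _ hA, Matrix.one_mul, Matrix.mul_one]
    _ = _ := by conv_lhs => rw [← e2]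
                simp only [Matrix.mul_assoc]

end step

section step
variable {lev : ∀ n m : ℕ, Level n m} {c : ℤ × ℤ → ℂ} {n m : ℕ}

lemma LowerGood.utp_lead (h : LowerGood lev c (n + 1) (m + 1)) : UTP (lev (n + 1) m).lead := by
  rw [lead_eq]; exact h.down.orth.utp

lemma LowerGood.utp_leadT (h : LowerGood lev c (n + 1) (m + 1)) : UTP (lev n (m + 1)).leadT := by
  rw [leadT_eq]; exact IsOrth.utp h.left.orthT

/-- `K_{n+1,m+1}` relative to the leading matrices. -/
def relK (lev : ∀ n m : ℕ, Level n m) (c : ℤ × ℤ → ℂ) (n m : ℕ) :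
    Matrix (Fin (m + 1)) (Fin (n + 1)) ℂ :=
  (lev (n + 1) m).lead⁻¹ * gramK lev c n m * ((lev n (m + 1)).leadTᴴ)⁻¹

lemma relK_swap (hc : Herm c) : relK (swapFam lev) (swapM c) m n = (relK lev c n m)ᴴ := by
  have e1 : (swapFam lev (m + 1) n).lead = (lev n (m + 1)).leadT := by
    rw [← Level.swap_leadT]; rw [swapFam, Level.swap_swap]
  have e2 : (swapFam lev m (n + 1)).leadT = (lev (n + 1) m).lead := Level.swap_leadT _
  rw [relK, gramK_swap hc, e1, e2, relK]
  simp only [Matrix.conjTranspose_mul, Matrix.conjTranspose_nonsing_inv,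
    Matrix.conjTranspose_conjTranspose, Matrix.mul_assoc]

/-- Φ_{n+1,m} and its leading matrix applied to the monomials z^{n+1}w^{m-b} differ by a polynomial
of degree (n, m), orthogonal to Φ̃_{n,m+1}. -/
lemma relK_eq (hc : Herm c) (h : LowerGood lev c (n + 1) (m + 1)) :
    relK lev c n m = gram c (fun b : Fin (m + 1) =>
      Finsupp.single ((n : ℤ) + 1, (m : ℤ) - (b : ℕ)) 1) (PT lev n (m + 1)) *
        ((lev n (m + 1)).leadTᴴ)⁻¹ := by
  set e : Fin (m + 1) → Laurent := fun b => Finsupp.single ((n : ℤ) + 1, (m : ℤ) - (b : ℕ)) 1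
  have h1 : gramK lev c n m = (lev (n + 1) m).lead * gram c e (PT lev n (m + 1)) := by
    rw [gramK, ← gram_actL_left, ← sub_eq_zero, ← gram_sub_left]
    refine gram_eq_zero' hc h.perpT_left fun a => ?_
    have h1 : (Ph lev (n + 1) m - (lev (n + 1) m).lead ⊳ e) a ∈ box 0 ((n : ℤ) + 1, m) :=
      Submodule.sub_mem _ (h.orth_down.mem a) (actL_mem (fun b => single_mem_box (by simp; omega)) a)
    have h3 := mem_box_of_coef (k := m + 1) h1 (by simp) (fun b => by
      rw [Pi.sub_apply, Finsupp.sub_apply, actL_apply, Finset.sum_eq_single b]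
      · rw [lead_eq]; simp [coefZ, e]
      · intro b' _ hb'
        simp only [e]
        rw [Finsupp.single_apply, if_neg, mul_zero]
        simp only [Prod.mk.injEq, true_and]
        intro h; apply hb'; ext; omega
      · simp)
    simpa using h3
  rw [relK, h1, ← Matrix.mul_assoc, h.utp_lead.inv_mul, Matrix.one_mul]

lemma relK_castSucc (hc : Herm c) (h : LowerGood lev c (n + 1) (m + 1)) (i : Fin m)
    (j : Fin (n + 1)) :
    relK lev c n m i.castSucc j = matH (lev n (m + 1)) (lev (n + 1) m) i j := by
  have h1 := gram_matH hc h
  have h2 := congrArg (· * ((lev n (m + 1)).leadTᴴ)⁻¹) h1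
  simp only [Matrix.mul_assoc] at h2
  rw [Matrix.mul_nonsing_inv _ h.utp_leadT.isUnit_det_conjTranspose, Matrix.mul_one] at h2
  rw [relK_eq hc h, ← h2]
  rfl

lemma mul_relK (h : LowerGood lev c (n + 1) (m + 1)) :
    (lev (n + 1) m).lead * relK lev c n m * (lev n (m + 1)).leadTᴴ = gramK lev c n m := by
  rw [relK]
  calc _ = ((lev (n + 1) m).lead * (lev (n + 1) m).lead⁻¹) * gramK lev c n m *
        (((lev n (m + 1)).leadTᴴ)⁻¹ * (lev n (m + 1)).leadTᴴ) := by simp only [Matrix.mul_assoc]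
    _ = _ := by
        rw [h.utp_lead.mul_inv, Matrix.nonsing_inv_mul _ h.utp_leadT.isUnit_det_conjTranspose,
          Matrix.one_mul, Matrix.mul_one]

/-- After removal of the leading matrices, all rows but the last are given by `matH`, and by
interchange all columns but the last. The one remaining entry, in the last corner, is the free
parameter. -/
lemma matK_eq (hc : Herm c) (h : LowerGood lev c (n + 1) (m + 1)) (u : ℤ → ℤ → ℂ)
    (hnm : ¬ (n = 0 ∧ m = 0))
    (hu : relK lev c n m (Fin.last m) (Fin.last n) = u (-(n + 1)) (m + 1)) :
    matK u (lev n (m + 1)) (lev (n + 1) m) = gramK lev c n m := by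
  rw [matK, if_neg hnm, ← mul_relK h]
  congr 2
  have hl : ∀ (i : Fin (m + 1)) (j : Fin (n + 1)) (Y : Matrix (Fin (m + 1)) (Fin (n + 1)) ℂ),
      (lastCorner m * Y) i j = if i = Fin.last m then Y (Fin.last m) j else 0 := by
    intro i j Y
    simp [lastCorner, Matrix.mul_apply, Matrix.single_apply, ite_and, eq_comm]
  ext i j
  rw [Matrix.add_apply, Matrix.add_apply, Matrix.mul_assoc, hl]
  refine Fin.lastCases ?_ (fun i => ?_) i
  · rw [U₁_transpose_mul_apply_last, if_pos rfl, add_zero]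
    refine Fin.lastCases ?_ (fun j => ?_) j
    · rw [mul_U₁_apply_last, hu]; simp
    · rw [mul_U₁_apply_castSucc]
      have := relK_castSucc hc.swap (h.swap hc) j (Fin.last m)
      rw [relK_swap hc] at this
      rw [Matrix.conjTranspose_apply] at this ⊢
      rw [Matrix.single_apply, if_neg (by simp [(Fin.castSucc_ne_last j).symm]), zero_add]
      have h3 := congrArg star this
      rw [star_star] at h3
      exact h3.symm
  · rw [U₁_transpose_mul_apply_castSucc, if_neg (Fin.castSucc_ne_last i), add_zero,
      relK_castSucc hc h, Matrix.single_apply, if_neg (by simp [(Fin.castSucc_ne_last i).symm]),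
      zero_add]

/-! ### The matrix `K¹` -/

lemma LowerGood.perp_shift_down (h : LowerGood lev c (n + 1) (m + 1)) :
    Perp c (shiftV (0, 1) (Ph lev (n + 1) m)) (box (0, 1) (n, (m : ℤ) + 1)) := by
  simpa using h.perp_down.shiftV (0, 1)

lemma LowerGood.perp_rev_left (hc : Herm c) (h : LowerGood lev c (n + 1) (m + 1)) :
    Perp c (revV (n, (m : ℤ) + 1) (PT lev n (m + 1))) (box (0, 1) (n, (m : ℤ) + 1)) := by
  have := h.perpT_left.revV hc (n, (m : ℤ) + 1)
  simpa using this

lemma LowerGood.G_eq (h : LowerGood lev c (n + 1) (m + 1)) :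
    (lev (n + 1) m).G = gram c (PhD lev (n + 1) m) (Ph lev (n + 1) m) := h.down.G

lemma LowerGood.exists_G (hc : Herm c) (h : LowerGood lev c (n + 1) (m + 1)) :
    ∃ B : Matrix (Fin m) (Fin m) ℂ, UTP B ∧ (lev (n + 1) m).G = B * U m := by
  rw [h.G_eq]
  exact gram_consecutive hc h.orth_PhD h.orth_down

lemma LowerGood.sub_mem_down (hc : Herm c) (h : LowerGood lev c (n + 1) (m + 1)) (a : Fin m) :
    (PhD lev (n + 1) m - (lev (n + 1) m).G ⊳ Ph lev (n + 1) m) a ∈ box 0 (n, m) := by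
  have := h.orth_down.decompV hc (G := PhD lev (n + 1) m) (fun a =>
    box_mono (by simp) (by simp) (by simp) (by simp) (h.orth_PhD.mem a)) a
  rw [← h.G_eq] at this
  simpa using this

/-- Γ discards the first row. Modulo polynomials orthogonal to the reverse of Φ̃_{n,m+1} it replaces
Φ_{n+1,m} by Φ_{n+1,m-1}, and the reversed recurrence expresses what is left by K and K¹ of level
(n+1, m). -/
lemma U_mul_gramK1 (hc : Herm c) (h : LowerGood lev c (n + 1) (m + 1)) :
    U m * gramK1 lev c n m = rowsK1 (lev n (m + 1)) (lev (n + 1) m) := by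
  obtain ⟨B, hB, hG⟩ := h.exists_G hc
  have hrec := h.left.recW h.diag
  set Y := gram c (shiftV (0, 1) (PhD lev (n + 1) m)) (revV (n, (m : ℤ) + 1) (PT lev n (m + 1)))
  have h1 : (lev (n + 1) m).G * gramK1 lev c n m = Y := by
    rw [gramK1, ← gram_actL_left, ← shiftV_actL, eq_comm, ← sub_eq_zero, ← gram_sub_left,
      ← shiftV_sub]
    refine gram_eq_zero' hc (h.perp_rev_left hc) fun a => ?_
    have := shift_mem_box (0, 1) (h.sub_mem_down hc a)
    exact box_mono (by simp) (by simp) (by simp) (by simp) this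
  have h2 : (lev (n + 1) m).K1 - (lev (n + 1) m).K * (lev n (m + 1)).ETᵀ =
      Y * (lev n (m + 1)).ATᵀ := by
    have e1 : (lev (n + 1) m).K1 =
        gram c (shiftV (0, 1) (PhD lev (n + 1) m)) (revV (n, m) (PT lev n m)) := by
      rw [h.down.K1]; simp [PTD]
    have e2 : (lev (n + 1) m).K = gram c (PhD lev (n + 1) m) (PT lev n m) := h.down.K
    rw [e1, hrec.rev_old, gram_add_right, gram_actL_right, gram_actL_right, gram_shiftV, ← e2,
      conjTranspose_map_star, conjTranspose_map_star, add_sub_cancel_left]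
    simp [Y]
  have hA : IsUnit ((lev n (m + 1)).ATᵀ).det := by
    rw [Matrix.det_transpose]; exact hrec.utp.isUnit_det
  rw [rowsK1, h2, Matrix.transpose_nonsing_inv, Matrix.mul_assoc, Matrix.mul_assoc Y,
    Matrix.mul_nonsing_inv _ hA, Matrix.mul_one, ← h1, hG, Matrix.mul_assoc B, U_mul_U_transpose,
    Matrix.mul_one, Matrix.mul_assoc B, ← Matrix.mul_assoc B⁻¹, hB.inv_mul, Matrix.one_mul]

lemma matK1_eq (hc : Herm c) (h : LowerGood lev c (n + 1) (m + 1)) (u : ℤ → ℤ → ℂ)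
    (hu : gramK1 lev c n m 0 0 = star (u (n + 1) (m + 1))) :
    matK1 u (lev n (m + 1)) (lev (n + 1) m) = gramK1 lev c n m := by
  have hl : ∀ (i : Fin (m + 1)) (j : Fin (n + 1)) (Y : Matrix (Fin (m + 1)) (Fin (n + 1)) ℂ),
      (corner m m * Y) i j = if i = 0 then Y 0 j else 0 := by
    intro i j Y
    simp [corner, Matrix.mul_apply, Matrix.single_apply, ite_and, eq_comm]
  ext i j
  rw [matK1, Matrix.add_apply, Matrix.add_apply, Matrix.mul_assoc (corner m m), hl]
  refine Fin.cases ?_ (fun i => ?_) i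
  · rw [U_transpose_mul_apply_zero, if_pos rfl, add_zero]
    refine Fin.cases ?_ (fun j => ?_) j
    · rw [mul_U_apply_zero, hu]; simp
    · rw [mul_U_apply_succ, Matrix.single_apply, if_neg (by simp [(Fin.succ_ne_zero j).symm]),
        zero_add]
      have := U_mul_gramK1 hc.swap (h.swap hc)
      rw [gramK1_swap] at this
      have h2 := congrFun (congrFun this j) 0
      rw [U_mul_apply] at h2
      exact h2.symm
  · rw [U_transpose_mul_apply_succ, if_neg (Fin.succ_ne_zero i), add_zero, Matrix.single_apply,
      if_neg (by simp [(Fin.succ_ne_zero i).symm]), zero_add, ← U_mul_gramK1 hc h, U_mul_apply]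

/-! ### The matrix `Ê` -/

lemma LowerGood.rev_left_sub_mem (hc : Herm c) (h : LowerGood lev c (n + 1) (m + 1))
    (a : Fin (m + 2)) :
    (revV (n, (m : ℤ) + 1) (Ph lev n (m + 1)) - (lev n (m + 1)).J1 ⊳ PT lev n (m + 1)) a ∈
      box 0 (n, m) := by
  have := h.orthT_left.decompV hc (G := revV (n, (m : ℤ) + 1) (Ph lev n (m + 1))) (fun a => by
    have := rev_mem_box (n, (m : ℤ) + 1) (h.orth_left.mem a)
    simpa [revV] using this) a
  have e : (lev n (m + 1)).J1 =
      gram c (revV (n, (m : ℤ) + 1) (Ph lev n (m + 1))) (PT lev n (m + 1)) := by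
    rw [h.left.J1]; simp
  rw [← e] at this
  simpa using this

lemma LowerGood.left_sub_mem (hc : Herm c) (h : LowerGood lev c (n + 1) (m + 1))
    (a : Fin (m + 2)) :
    (Ph lev n (m + 1) - (lev n (m + 1)).J ⊳ PT lev n (m + 1)) a ∈ box 0 (n, m) := by
  have := h.orthT_left.decompV hc h.orth_left.mem a
  rw [← h.left.J] at this
  simpa using this

/-- The reflection matrix `Ê_{n+1,m+1}` is given by `matE`. -/
lemma gram_eq_matE (hc : Herm c) (h : LowerGood lev c (n + 1) (m + 1)) :
    gram c (shiftV (1, 0) (Ph lev n (m + 1))) (revV (n, (m : ℤ) + 1) (Ph lev n (m + 1))) =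
      matE (gramK lev c n m) (gramK1 lev c n m) (lev n (m + 1)) (lev (n + 1) m) := by
  set X := gram c (shiftV (1, 0) (Ph lev n (m + 1))) (revV (n, (m : ℤ) + 1) (Ph lev n (m + 1)))
  have hrec := h.down.recZ h.diag
  have hperp : Perp c (revV (n, (m : ℤ) + 1) (Ph lev n (m + 1))) (box (1, 0) (n, (m : ℤ) + 1)) := by
    have := h.orth_left.perp.revV hc (n, (m : ℤ) + 1)
    simpa using this
  have hG : (lev n (m + 1)).G = gram c (Ph lev n m) (Ph lev n (m + 1)) := h.left.G
  have hG1 : (lev n (m + 1)).G1 = gram c (shiftV (0, 1) (Ph lev n m)) (Ph lev n (m + 1)) := h.left.G1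
  have horth : IsOrth c n (((m : ℤ) + 1) - 1) (Ph lev n m) := by simpa using h.diag.orth
  have hU : UTP (stack (lev n (m + 1)).G1 (lev n (m + 1)).G) := by
    rw [hG, hG1]
    exact utp_stack hc horth h.orth_left
  -- A vector that agrees with M Φ_{n,m+1} up to smaller z-degree has the same product with the
  -- reverse: the remainder, times z, lies in the range of exponents to which the reverse is
  -- orthogonal.
  have key : ∀ {k : ℕ} (M : Matrix (Fin k) (Fin (m + 2)) ℂ) (F : Fin k → Laurent),
      (∀ a, (F - M ⊳ Ph lev n (m + 1)) a ∈ box 0 ((n : ℤ) - 1, (m : ℤ) + 1)) →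
      M * X = gram c (shiftV (1, 0) F) (revV (n, (m : ℤ) + 1) (Ph lev n (m + 1))) := by
    intro k M F hF
    rw [← gram_actL_left, ← shiftV_actL, eq_comm, ← sub_eq_zero, ← gram_sub_left, ← shiftV_sub]
    refine gram_eq_zero' hc hperp fun a => ?_
    have := shift_mem_box (1, 0) (hF a)
    simpa [shiftV] using this
  -- Here zΦ_{n,m} = AΦ_{n+1,m} + E·rev Φ_{n,m}. The first part meets the reverse of Φ_{n,m+1} only
  -- through its components I¹ along Φ̃_{n,m+1}. In the second part rev Φ_{n,m} is the reverse of
  -- wΦ_{n,m} one level up, which produces Γ¹.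
  have r2 : (lev n (m + 1)).G * X =
      (lev (n + 1) m).A * gramK lev c n m * (lev n (m + 1)).J1ᴴ +
        (lev (n + 1) m).E * (lev n (m + 1)).G1.map star := by
    rw [key (lev n (m + 1)).G (Ph lev n m) (fun a => by
      have := h.orth_left.decompV hc (G := Ph lev n m) (fun a =>
        box_mono (by simp) (by simp) (by simp) (by simp) (h.diag.orth.mem a)) a
      rwa [← hG] at this), hrec.shift_eq, gram_add_left, gram_actL_left, gram_actL_left,
      Matrix.mul_assoc]
    congr 2
    · rw [gramK, ← gram_actL_right, ← sub_eq_zero, ← gram_sub_right]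
      exact gram_eq_zero h.perp_down (h.rev_left_sub_mem hc)
    · have e : revV ((n : ℤ), (m : ℤ)) (Ph lev n m) =
          revV (n, (m : ℤ) + 1) (shiftV (0, 1) (Ph lev n m)) := by
        rw [revV_shiftV]; simp
      rw [e, gram_revV, hG1, ← gram_conjTranspose hc (shiftV (0, 1) (Ph lev n m)), map_star_eq]
  -- The same computation for wΦ_{n,m}; the extra factor w exchanges the roles of K and K¹, of I and
  -- I¹, and of Γ and Γ¹.
  have r1 : (lev n (m + 1)).G1 * X =
      (lev (n + 1) m).A * gramK1 lev c n m * (lev n (m + 1)).Jᵀ +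
        (lev (n + 1) m).E * (lev n (m + 1)).G.map star := by
    rw [key (lev n (m + 1)).G1 (shiftV (0, 1) (Ph lev n m)) (fun a => by
      have := h.orth_left.decompV hc (G := shiftV (0, 1) (Ph lev n m)) (fun a =>
        box_mono (by simp) (by simp) (by simp) (by simp)
          (shift_mem_box (0, 1) (h.diag.orth.mem a))) a
      rwa [← hG1] at this), shiftV_shiftV, add_comm ((1 : ℤ), (0 : ℤ)), ← shiftV_shiftV,
      hrec.shift_eq, shiftV_add, shiftV_actL, shiftV_actL, gram_add_left, gram_actL_left,
      gram_actL_left, Matrix.mul_assoc]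
    congr 2
    · rw [gramK1, ← conjTranspose_map_star, ← gram_actL_right, ← revV_actL, ← sub_eq_zero,
        ← gram_sub_right, ← revV_sub]
      refine gram_eq_zero h.perp_shift_down fun a => ?_
      have := rev_mem_box (n, (m : ℤ) + 1) (h.left_sub_mem hc a)
      simpa [revV] using this
    · have e : shiftV (0, 1) (revV ((n : ℤ), (m : ℤ)) (Ph lev n m)) =
          revV (n, (m : ℤ) + 1) (Ph lev n m) := by
        rw [shiftV_revV]; simp [add_comm]
      rw [e, gram_revV, hG, ← gram_conjTranspose hc (Ph lev n m), map_star_eq]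
  rw [matE, ← r1, ← r2, ← stack_mul, ← Matrix.mul_assoc, hU.inv_mul, Matrix.one_mul]

lemma gram_eq_matET (hc : Herm c) (h : LowerGood lev c (n + 1) (m + 1)) :
    gram c (shiftV (0, 1) (PT lev (n + 1) m)) (revV ((n : ℤ) + 1, m) (PT lev (n + 1) m)) =
      matE (gramK lev c n m)ᴴ (gramK1 lev c n m)ᵀ (lev (n + 1) m).swap (lev n (m + 1)).swap := by
  have := gram_eq_matE hc.swap (h.swap hc)
  rw [gramK_swap hc, gramK1_swap, Ph_swapFam] at this
  refine Eq.trans ?_ this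
  have h2 := gram_swapV c (shiftV (0, 1) (PT lev (n + 1) m))
    (revV ((n : ℤ) + 1, (m : ℤ)) (PT lev (n + 1) m))
  rw [swapV_shiftV, swapV_revV] at h2
  exact h2.symm

end step

namespace Recur
variable {c : ℤ × ℤ → ℂ} {v x : ℤ × ℤ} {k : ℕ} {A E : Matrix (Fin k) (Fin k) ℂ}
  {F F' : Fin k → Laurent}

lemma gram_new_rev (h : Recur c v x A E F F') : gram c F' (revV x F) = 0 := by
  have h1 : A * gram c F' (revV x F) = 0 := by
    rw [← gram_actL_left, h.rec_eq, gram_sub_left, gram_actL_left, gram_revV, h.gram_old, ← h.hE]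
    simp
  have h2 := congrArg (A⁻¹ * ·) h1
  simpa [← Matrix.mul_assoc, h.utp.inv_mul] using h2

/-- Up to sign this is the Gram matrix of rev F' and F', which reversal at x + v maps to its own
transpose. -/
lemma transpose_reflection (h : Recur c v x A E F F') (hc : Herm c) :
    ((A.map star)⁻¹ * Eᴴ * A)ᵀ = (A.map star)⁻¹ * Eᴴ * A := by
  have h1 : gram c (revV (x + v) F') F' = -((A.map star)⁻¹ * Eᴴ * A) := by
    rw [h.rev_new hc, gram_sub_left, gram_actL_left, gram_actL_left, h.gram_new,
      ← gram_conjTranspose hc F', h.gram_new_rev]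
    simp
  have h2 : (gram c (revV (x + v) F') F')ᵀ = gram c (revV (x + v) F') F' := by
    rw [← gram_revV c (x + v), revV_revV]
    congr 1
    funext a; simp [shiftV]
  rw [h1, Matrix.transpose_neg, neg_inj] at h2
  exact h2

lemma new_eq (h : Recur c v x A E F F') (hc : Herm c) :
    F' = Aᴴ ⊳ shiftV v F - ((A.map star)⁻¹ * Eᴴ * A).map star ⊳ revV (x + v) F' := by
  have h1 := congrArg (revV (x + v)) (h.rev_new hc)
  rw [revV_sub, revV_actL, revV_actL, revV_revV, revV_revV, sub_self, add_sub_cancel_left] at h1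
  have e : shiftV 0 F' = F' := by funext a; simp [shiftV]
  rw [e] at h1
  exact h1

end Recur

/-! ### The residual of Φ_{n+1,m} and the first row of H² + K¹H¹ -/

section step
variable {lev : ∀ n m : ℕ, Level n m} {c : ℤ × ℤ → ℂ} {n m : ℕ}

/-- The residual of `Φ_{n+1,m}` on the polynomials of degree at most `(n, m+1)`. -/
def resid (lev : ∀ n m : ℕ, Level n m) (c : ℤ × ℤ → ℂ) (n m : ℕ) : Fin (m + 1) → Laurent :=
  Ph lev (n + 1) m - gramK lev c n m ⊳ PT lev n (m + 1)

lemma LowerGood.perp_resid (hc : Herm c) (h : LowerGood lev c (n + 1) (m + 1)) :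
    Perp c (resid lev c n m) (box 0 (n, (m : ℤ) + 1)) := by
  refine h.orthT_left.perp_of_gram hc ?_ ?_
  · simpa [resid] using h.perp_down.sub (h.perpT_left.actL (gramK lev c n m))
  · rw [resid, gram_sub_left, gram_actL_left, h.orthT_left.gram, Matrix.mul_one, gramK, sub_self]

lemma LowerGood.gram_resid (hc : Herm c) (h : LowerGood lev c (n + 1) (m + 1)) :
    gram c (resid lev c n m) (resid lev c n m) = 1 - gramK lev c n m * (gramK lev c n m)ᴴ := by
  have e : gram c (resid lev c n m) (resid lev c n m) =
      gram c (Ph lev (n + 1) m - gramK lev c n m ⊳ PT lev n (m + 1)) (resid lev c n m) := rfl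
  rw [e, gram_sub_left, gram_actL_left, gram_eq_zero' hc (h.perp_resid hc) h.orthT_left.mem,
    resid, gram_sub_right, gram_actL_right, h.orth_down.gram, ← gramK]
  simp

lemma LowerGood.resid_mem (h : LowerGood lev c (n + 1) (m + 1)) (a : Fin (m + 1)) :
    resid lev c n m a ∈ box 0 ((n : ℤ) + 1, (m : ℤ) + 1) :=
  Submodule.sub_mem _ (box_mono (by simp) (by simp) (by simp) (by simp) (h.orth_down.mem a))
    (actL_mem (fun b => box_mono (by simp) (by simp) (by simp) (by simp) (h.orthT_left.mem b)) a)

/-- The Gram matrix of `w Φ_{n+1,m}` with the residual. -/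
lemma LowerGood.gram_shift_resid (hc : Herm c) (h : LowerGood lev c (n + 1) (m + 1)) :
    gram c (shiftV (0, 1) (Ph lev (n + 1) m)) (resid lev c n m) =
      (lev (n + 1) m).J * gram c (shiftV (0, 1) (PT lev (n + 1) m))
          (revV ((n : ℤ) + 1, m) (PT lev (n + 1) m)) * (lev (n + 1) m).J1ᵀ +
        (lev (n + 1) m).Gᴴ * (lev (n + 1) m).G1 +
        gramK1 lev c n m * ((lev n (m + 1)).AT.map star)⁻¹ * (lev n (m + 1)).ETᴴ *
          (lev n (m + 1)).AT * (gramK lev c n m)ᴴ := by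
  have hrec := h.left.recW h.diag
  have hJ : (lev (n + 1) m).J = gram c (Ph lev (n + 1) m) (PT lev (n + 1) m) := h.down.J
  have hG : (lev (n + 1) m).Gᴴ = gram c (Ph lev (n + 1) m) (PhD lev (n + 1) m) := by
    rw [h.G_eq, gram_conjTranspose hc]
  -- the part along `Φ_{n+1,m}`
  have h1 : gram c (shiftV (0, 1) (Ph lev (n + 1) m)) (Ph lev (n + 1) m) =
      (lev (n + 1) m).J * gram c (shiftV (0, 1) (PT lev (n + 1) m))
          (revV ((n : ℤ) + 1, m) (PT lev (n + 1) m)) * (lev (n + 1) m).J1ᵀ +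
        (lev (n + 1) m).Gᴴ * (lev (n + 1) m).G1 := by
    -- Φ_{n+1,m} is expanded along Φ̃_{n+1,m} and then along Φ_{n+1,m-1}. The remainder has degree
    -- (n, m-1), so w times it is orthogonal to Φ_{n+1,m}.
    set r := Ph lev (n + 1) m - (lev (n + 1) m).J ⊳ PT lev (n + 1) m with hr
    have hrm : ∀ a, r a ∈ box 0 ((n : ℤ) + 1, (m : ℤ) - 1) := by
      have := h.orthT_down.decompV hc (G := Ph lev (n + 1) m) h.orth_down.mem
      rwa [← hJ] at this
    have hrG : gram c r (PhD lev (n + 1) m) = (lev (n + 1) m).Gᴴ := by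
      rw [hr, gram_sub_left, gram_actL_left,
        gram_eq_zero h.orthT_down.perp h.orth_PhD.mem, hG]
      simp
    have hs : ∀ a, (r - (lev (n + 1) m).Gᴴ ⊳ PhD lev (n + 1) m) a ∈ box 0 (n, (m : ℤ) - 1) := by
      have := h.orth_PhD.decompV hc hrm
      rw [hrG] at this
      simpa using this
    have e0 : gram c (shiftV (0, 1) (r - (lev (n + 1) m).Gᴴ ⊳ PhD lev (n + 1) m))
        (Ph lev (n + 1) m) = 0 := by
      refine gram_eq_zero' hc h.perp_down fun a => ?_
      have := shift_mem_box (0, 1) (hs a)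
      exact box_mono (by simp) (by simp) (by simp) (by simp) this
    have e1 : gram c (shiftV (0, 1) (PT lev (n + 1) m)) (Ph lev (n + 1) m) =
        gram c (shiftV (0, 1) (PT lev (n + 1) m))
          (revV ((n : ℤ) + 1, m) (PT lev (n + 1) m)) * (lev (n + 1) m).J1ᵀ := by
      -- wΦ̃_{n+1,m} is orthogonal to w-degrees 1 to m. Removing from rev Φ_{n+1,m} its part along
      -- Φ̃_{n+1,m} and reversing back leaves exactly such degrees.
      have hp : Perp c (shiftV (0, 1) (PT lev (n + 1) m)) (box (0, 1) ((n : ℤ) + 1, m)) := by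
        have := h.orthT_down.perp.shiftV (0, 1)
        simpa using this
      rw [← conjTranspose_map_star, ← gram_actL_right, ← sub_eq_zero, ← gram_sub_right]
      refine gram_eq_zero hp fun a => ?_
      have h2 := h.orthT_down.decompV hc (G := revV ((n : ℤ) + 1, m) (Ph lev (n + 1) m))
        (fun a => by
          have := rev_mem_box ((n : ℤ) + 1, (m : ℤ)) (h.orth_down.mem a)
          simpa [revV] using this) a
      have hJ1 : (lev (n + 1) m).J1 =
          gram c (revV ((n : ℤ) + 1, m) (Ph lev (n + 1) m)) (PT lev (n + 1) m) := by
        rw [h.down.J1]; simp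
      rw [← hJ1] at h2
      have h3 := rev_mem_box ((n : ℤ) + 1, (m : ℤ)) h2
      have h4 : revV ((n : ℤ) + 1, (m : ℤ)) (revV ((n : ℤ) + 1, m) (Ph lev (n + 1) m) -
          (lev (n + 1) m).J1 ⊳ PT lev (n + 1) m) a ∈ box (0, 1) ((n : ℤ) + 1, m) := by
        simpa [revV] using h3
      rw [revV_sub, revV_actL, revV_revV, sub_self] at h4
      have e : shiftV 0 (Ph lev (n + 1) m) = Ph lev (n + 1) m := by funext a; simp [shiftV]
      rwa [e] at h4
    have e2 : shiftV (0, 1) (Ph lev (n + 1) m) =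
        shiftV (0, 1) (r - (lev (n + 1) m).Gᴴ ⊳ PhD lev (n + 1) m) +
          ((lev (n + 1) m).J ⊳ shiftV (0, 1) (PT lev (n + 1) m) +
            (lev (n + 1) m).Gᴴ ⊳ shiftV (0, 1) (PhD lev (n + 1) m)) := by
      rw [hr, shiftV_sub, shiftV_sub, shiftV_actL, shiftV_actL]; abel
    rw [e2, gram_add_left, gram_add_left, e0, gram_actL_left, gram_actL_left, e1, zero_add,
      ← Matrix.mul_assoc, h.down.G1]
  -- Φ̃_{n,m+1} is a multiple of wΦ̃_{n,m} minus a multiple of its own reverse. The first part is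
  -- orthogonal to wΦ_{n+1,m}, the second gives K¹.
  have h2 : gram c (shiftV (0, 1) (Ph lev (n + 1) m)) (PT lev n (m + 1)) =
      -(gramK1 lev c n m * (((lev n (m + 1)).AT.map star)⁻¹ * (lev n (m + 1)).ETᴴ *
          (lev n (m + 1)).AT)) := by
    have e1 := hrec.new_eq hc
    have e2 : gram c (shiftV (0, 1) (Ph lev (n + 1) m)) (shiftV (0, 1) (PT lev n m)) = 0 := by
      refine gram_eq_zero h.perp_shift_down fun a => ?_
      have := shift_mem_box (0, 1) (h.diag.orthT.mem a)
      simpa [shiftV] using this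
    conv_lhs => rw [e1]
    rw [gram_sub_right, gram_actL_right, e2, gram_actL_right, conjTranspose_map_star,
      hrec.transpose_reflection hc, gramK1]
    simp
  rw [resid, gram_sub_right, gram_actL_right, h1, h2]
  simp only [Matrix.neg_mul, sub_neg_eq_add, Matrix.mul_assoc]

section J
variable {i j : ℕ}

lemma Good.Ph_zero (hc : Herm c) (h : Good lev c i j) (hpd : PD c i j) :
    Ph lev i j 0 = PT lev i j 0 :=
  IsTop.eq hpd (h.orth.isTop hc) (h.orthT.isTop hc)

lemma gram_zero_left {k l : ℕ} {F : Fin (k + 1) → Laurent} {G : Fin (l + 1) → Laurent}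
    (h0 : F 0 = G 0) (hG : gram c G G = 1) (b : Fin (l + 1)) :
    gram c F G 0 b = if b = 0 then 1 else 0 := by
  have := congrFun (congrFun hG 0) b
  simp only [gram, Matrix.of_apply] at this ⊢
  rw [h0, this, Matrix.one_apply]
  simp [eq_comm]

lemma gram_zero_right {k l : ℕ} {F : Fin (k + 1) → Laurent} {G : Fin (l + 1) → Laurent}
    (h0 : F 0 = G 0) (hF : gram c F F = 1) (a : Fin (k + 1)) :
    gram c F G a 0 = if a = 0 then 1 else 0 := by
  have := congrFun (congrFun hF a) 0
  simp only [gram, Matrix.of_apply] at this ⊢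
  rw [← h0, this, Matrix.one_apply]

end J

/-- The first row of the product with `H² + K¹ H¹`. -/
lemma LowerGood.matH2_add (hc : Herm c) (h : LowerGood lev c (n + 1) (m + 1))
    (hpd : PD c ((n : ℤ) + 1) m) (G : Matrix (Fin (m + 1)) (Fin (m + 2)) ℂ) (b : Fin (m + 1)) :
    (matH2 (gramK lev c n m) G (lev n (m + 1)) (lev (n + 1) m) +
      gramK1 lev c n m * matH1 (gramK lev c n m) G (lev n (m + 1)) (lev (n + 1) m)) 0 b =
    (gram c (shiftV (0, 1) (Ph lev (n + 1) m)) (resid lev c n m) * (U (m + 1) * Gᴴ)⁻¹) 0 b := by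
  set l := lev n (m + 1) with hl
  set d := lev (n + 1) m with hd
  set K := gramK lev c n m
  set K1 := gramK1 lev c n m
  have hrecl := h.left.recW h.diag
  set E := gram c (shiftV (0, 1) (PT lev (n + 1) m))
    (revV ((n : ℤ) + 1, m) (PT lev (n + 1) m)) with hE
  have hEt : Eᵀ = E := Recur.transpose_gram _
  have h0 : Ph lev (n + 1) m 0 = PT lev (n + 1) m 0 :=
    h.down.Ph_zero hc (by simpa using hpd)
  -- Both orderings have the same first polynomial, so the first row and the first column of I are
  -- unit vectors.
  have hJr : ∀ j, d.J 0 j = if j = 0 then 1 else 0 := by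
    intro j; rw [hd, h.down.J]; exact gram_zero_left h0 h.orthT_down.gram j
  have hJc : ∀ i, d.J i 0 = if i = 0 then 1 else 0 := by
    intro j; rw [hd, h.down.J]; exact gram_zero_right h0 h.orth_down.gram j
  have hS : UTP (stack d.G1T d.GT) := by
    have hT : IsOrth (swapM c) (m : ℤ) (((n : ℤ) + 1) - 1) (swapV (PT lev n m)) := by
      have := h.diag.orthT; simpa [IsOrthT] using this
    have := utp_stack hc.swap hT h.orthT_down
    rw [gram_swapV] at this
    have e := gram_swapV c (shiftV (1, 0) (PT lev n m)) (PT lev (n + 1) m)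
    rw [swapV_shiftV] at e
    have e' : gram (swapM c) (shiftV (0, 1) (swapV (PT lev n m))) (swapV (PT lev (n + 1) m)) =
      gram c (shiftV (1, 0) (PT lev n m)) (PT lev (n + 1) m) := e
    rw [e'] at this
    rw [hd, h.down.G1T, h.down.GT]
    exact this
  have hGT : ∀ i, d.GT i 0 = 0 := by
    intro i
    have := hS.1 i.succ 0 (Fin.succ_pos i)
    rwa [stack_succ] at this
  have hG0 : ∀ i, d.G i 0 = 0 := by
    intro i
    obtain ⟨B, -, hB⟩ := h.exists_G hc
    rw [hd, hB]; simp
  have hSE : stack d.G1T d.GT * E =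
      (U (n + 1))ᵀ * (l.AT * Kᴴ * (d.J1ᵀ)ᴴ + l.ET * d.G1T.map star) +
      corner (n + 1) n * (l.AT * K1ᵀ * (d.Jᴴ)ᵀ + l.ET * d.GT.map star) := by
    have := gram_eq_matET hc h
    rw [← hE] at this
    rw [this, matE]
    exact (Matrix.mul_nonsing_inv_cancel_left _ _ hS.isUnit_det)
  have hSt : IsUnit (stack d.G1T d.GT)ᵀ.det := by
    rw [Matrix.det_transpose]; exact hS.isUnit_det
  have hcT : (corner (n + 1) n)ᵀ = corner n (n + 1) := by
    ext i j; simp [corner, Matrix.single_apply, and_comm]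
  -- Since the reflection matrix is symmetric, the transposed formula may be used; it separates a
  -- term free of K¹ from one containing it. In the first row these become H² and the first part of
  -- K¹H¹. All other contributions are killed by the zero first columns of Γ and Γ̃.
  have hES : E = ((d.J1ᴴ * K.map star * l.ATᵀ + d.G1Tᴴ * l.ET) * U (n + 1) +
      (d.Jᴴ * K1 * l.ATᵀ + d.GTᴴ * l.ET) * corner n (n + 1)) * (stack d.G1T d.GT)ᵀ⁻¹ := by
    have h1 := congrArg Matrix.transpose hSE
    simp only [Matrix.transpose_mul, Matrix.transpose_add, Matrix.transpose_transpose, hEt, hcT] at h1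
    have e1 : ((d.J1ᵀ)ᴴ)ᵀ = d.J1ᴴ := by ext; simp
    have e2 : (Kᴴ)ᵀ = K.map star := rfl
    have e3 : (d.G1T.map star)ᵀ = d.G1Tᴴ := rfl
    have e4 : (d.GT.map star)ᵀ = d.GTᴴ := rfl
    have hET : l.ETᵀ = l.ET := hrecl.transpose
    rw [e1, e2, e3, e4, hET] at h1
    simp only [Matrix.mul_assoc] at h1 ⊢
    rw [← h1, Matrix.mul_nonsing_inv_cancel_right _ _ hSt]
  have hrow : ∀ (X : Matrix (Fin (n + 2)) (Fin (m + 1)) ℂ) (b : Fin (m + 1)),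
      (d.J * X) 0 b = X 0 b := by
    intro X b; simp [Matrix.mul_apply, hJr]
  rw [h.gram_shift_resid hc, ← hl, ← hd, ← hE]
  conv_rhs => rw [hES]
  rw [matH2, matH1]
  set V := (U (m + 1) * Gᴴ)⁻¹
  set W := (stack d.G1T d.GT)ᵀ⁻¹
  set Q := d.J1ᴴ * K.map star * l.ATᵀ + d.G1Tᴴ * l.ET
  have k1 : (d.Gᴴ * d.G1 * V) 0 b = 0 := by
    rw [Matrix.mul_assoc, Matrix.mul_apply]
    simp [hG0]
  have k2 : (d.J * ((d.Jᴴ * K1 * l.ATᵀ + d.GTᴴ * l.ET) * corner n (n + 1) * W) * d.J1ᵀ * V) 0 b =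
      (K1 * (l.ATᵀ * corner n (n + 1) * W * d.J1ᵀ * V)) 0 b := by
    have e1 : ∀ (X : Matrix (Fin (n + 1)) (Fin (m + 1)) ℂ), (d.GTᴴ * X) 0 b = 0 := by
      intro X; simp [Matrix.mul_apply, hGT]
    have e2 : ∀ (X : Matrix (Fin (m + 1)) (Fin (m + 1)) ℂ), (d.Jᴴ * X) 0 b = X 0 b := by
      intro X
      simp [Matrix.mul_apply, hJc, apply_ite]
    simp only [Matrix.mul_assoc]
    rw [hrow]
    simp only [Matrix.add_mul, Matrix.mul_assoc]
    rw [Matrix.add_apply, e1, e2, add_zero]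
  have k3 : (d.J * ((Q * U (n + 1) + (d.Jᴴ * K1 * l.ATᵀ + d.GTᴴ * l.ET) * corner n (n + 1)) * W) *
      d.J1ᵀ + d.Gᴴ * d.G1 + K1 * (l.AT.map star)⁻¹ * l.ETᴴ * l.AT * Kᴴ) * V =
      d.J * Q * U (n + 1) * W * d.J1ᵀ * V +
      d.J * ((d.Jᴴ * K1 * l.ATᵀ + d.GTᴴ * l.ET) * corner n (n + 1) * W) * d.J1ᵀ * V +
      d.Gᴴ * d.G1 * V + K1 * ((l.AT.map star)⁻¹ * l.ETᴴ * l.AT * Kᴴ * V) := by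
    simp only [Matrix.add_mul, Matrix.mul_add, Matrix.mul_assoc]
  rw [k3]
  simp only [Matrix.add_apply, Matrix.mul_add, k1, k2, add_zero, add_assoc]

lemma LowerGood.matH3_zero (hc : Herm c) (h : LowerGood lev c (n + 1) (m + 1))
    (hpd : PD c ((n : ℤ) + 1) m) (G : Matrix (Fin (m + 1)) (Fin (m + 2)) ℂ)
    {Y : Matrix (Fin (m + 1)) (Fin (m + 1)) ℂ}
    (hY : Y = gram c (shiftV (0, 1) (Ph lev (n + 1) m)) (resid lev c n m) * (U (m + 1) * Gᴴ)⁻¹) :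
    matH3 (gramK lev c n m) (gramK1 lev c n m) G (lev n (m + 1)) (lev (n + 1) m) 0 0 =
      (Y * Yᴴ + gramK1 lev c n m * (gramK1 lev c n m)ᴴ) 0 0 := by
  have h1 := h.matH2_add hc hpd G
  rw [← hY] at h1
  rw [matH3, Matrix.add_apply, Matrix.add_apply]
  congr 1
  rw [Matrix.mul_apply, Matrix.mul_apply]
  exact Finset.sum_congr rfl fun b _ => by
    rw [Matrix.conjTranspose_apply, Matrix.conjTranspose_apply, h1]

end step

section step
variable {lev : ∀ n m : ℕ, Level n m} {c : ℤ × ℤ → ℂ} {n m : ℕ} {F' : Fin (m + 2) → Laurent}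
  {T' : Fin (n + 2) → Laurent}

/-! ### The matrices `Γ` and `Γ¹` -/

/-- Both sides are orthogonal to degree (n, m+1) and have the same component along F', so their
difference lies in that box, is orthogonal to itself, and vanishes. -/
lemma LowerGood.resid_eq (hc : Herm c) (h : LowerGood lev c (n + 1) (m + 1))
    (hpd : PD c n ((m : ℤ) + 1)) (hF' : IsOrth c ((n : ℤ) + 1) ((m : ℤ) + 1) F') :
    resid lev c n m = gram c (Ph lev (n + 1) m) F' ⊳ F' := by
  have hp : Perp c F' (box 0 (n, (m : ℤ) + 1)) := by simpa using hF'.perp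
  have h1 : gram c (resid lev c n m) F' = gram c (Ph lev (n + 1) m) F' := by
    rw [resid, gram_sub_left, gram_actL_left, gram_eq_zero' hc hp h.orthT_left.mem]
    simp
  have h2 : ∀ a, (resid lev c n m - gram c (Ph lev (n + 1) m) F' ⊳ F') a ∈
      box 0 (n, (m : ℤ) + 1) := by
    have := hF'.decompV hc (fun a => h.resid_mem (c := c) a)
    rw [h1] at this
    simpa using this
  have h3 : Perp c (resid lev c n m - gram c (Ph lev (n + 1) m) F' ⊳ F')
      (box 0 (n, (m : ℤ) + 1)) := (h.perp_resid hc).sub (hp.actL _)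
  rw [← sub_eq_zero]
  funext a
  exact hpd.eq_zero (h2 a) (h3 a _ (h2 a))

/-- The residual has Gram matrix 1 - KK† and equals ΓF', so ΓΓ† = 1 - KK†; the triangular shape is
that of consecutive levels. -/
lemma LowerGood.exists_cholesky (hc : Herm c) (h : LowerGood lev c (n + 1) (m + 1))
    (hpd : PD c n ((m : ℤ) + 1)) (hF' : IsOrth c ((n : ℤ) + 1) ((m : ℤ) + 1) F') :
    ∃ B : Matrix (Fin (m + 1)) (Fin (m + 1)) ℂ, UTP B ∧
      1 - gramK lev c n m * (gramK lev c n m)ᴴ = B * Bᴴ ∧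
      gram c (Ph lev (n + 1) m) F' = B * U (m + 1) := by
  have hF : IsOrth c ((n : ℤ) + 1) (((m : ℤ) + 1) - 1) (Ph lev (n + 1) m) := by
    simpa using h.orth_down
  obtain ⟨B, hB, hG⟩ := gram_consecutive hc hF hF'
  refine ⟨B, hB, ?_, hG⟩
  rw [← h.gram_resid hc, h.resid_eq hc hpd hF', gram_actL_left, gram_actL_right, hF'.gram,
    Matrix.one_mul, hG, Matrix.conjTranspose_mul, U_conjTranspose, Matrix.mul_assoc,
    ← Matrix.mul_assoc (U (m + 1)), U_mul_U_transpose, Matrix.one_mul]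

lemma LowerGood.gram_eq_cholesky (hc : Herm c) (h : LowerGood lev c (n + 1) (m + 1))
    (hpd : PD c n ((m : ℤ) + 1)) (hF' : IsOrth c ((n : ℤ) + 1) ((m : ℤ) + 1) F') :
    gram c (Ph lev (n + 1) m) F' =
      upperCholesky (1 - gramK lev c n m * (gramK lev c n m)ᴴ) * U (m + 1) := by
  obtain ⟨B, hB, h1, h2⟩ := h.exists_cholesky hc hpd hF'
  rw [h2, upperCholesky_eq hB h1]

/-- wΦ_{n+1,m} is a combination of F' and the reverse of Φ̃_{n,m+1}: the remainder s lies in the box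
of w-degrees 1 to m+1 and z-degree at most n, and is orthogonal to that box. The identity is
Pythagoras for these two orthogonal parts. -/
lemma LowerGood.gram_shift_new (hc : Herm c) (h : LowerGood lev c (n + 1) (m + 1))
    (hF' : IsOrth c ((n : ℤ) + 1) ((m : ℤ) + 1) F') :
    gram c (shiftV (0, 1) (Ph lev (n + 1) m)) F' *
        (gram c (shiftV (0, 1) (Ph lev (n + 1) m)) F')ᴴ +
      gramK1 lev c n m * (gramK1 lev c n m)ᴴ = 1 := by
  set P := shiftV (0, 1) (Ph lev (n + 1) m) with hP
  set R := revV (n, (m : ℤ) + 1) (PT lev n (m + 1)) with hR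
  set G1 := gram c P F' with hG1
  have hp : Perp c F' (box 0 (n, (m : ℤ) + 1)) := by simpa using hF'.perp
  have hRm : ∀ a, R a ∈ box 0 (n, (m : ℤ) + 1) := fun a => by
    have := rev_mem_box (n, (m : ℤ) + 1) (h.orthT_left.mem a)
    simpa [hR, revV] using this
  have hPm : ∀ a, P a ∈ box 0 ((n : ℤ) + 1, (m : ℤ) + 1) := fun a =>
    box_mono (by simp) (by simp) (by simp) (by simp) (shift_mem_box (0, 1) (h.orth_down.mem a))
  have hRR : gram c R R = 1 := by
    rw [hR, gram_revV, h.orthT_left.gram, Matrix.transpose_one]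
  have hFR : gram c F' R = 0 := gram_eq_zero hp hRm
  have hK : gram c P R = gramK1 lev c n m := rfl
  set s := P - G1 ⊳ F' - gramK1 lev c n m ⊳ R with hs
  have hsp : Perp c s (box (0, 1) (n, (m : ℤ) + 1)) := by
    refine (h.perp_shift_down.sub (Perp.actL ?_ _)).sub ((h.perp_rev_left hc).actL _)
    exact hp.mono fun g hg => box_mono (by simp) (by simp) (by simp) (by simp) hg
  have hsm : ∀ a, s a ∈ box (0, 1) (n, (m : ℤ) + 1) := by
    intro a
    have h1 : ∀ a, (P - G1 ⊳ F') a ∈ box 0 (n, (m : ℤ) + 1) := by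
      have := hF'.decompV hc hPm
      simpa using this
    have h2 : ∀ a, revV (n, (m : ℤ) + 1) (P - G1 ⊳ F') a ∈ box 0 (n, (m : ℤ) + 1) := fun a => by
      have := rev_mem_box (n, (m : ℤ) + 1) (h1 a)
      simpa [revV] using this
    have h3 := h.orthT_left.decompV hc h2 a
    have h4 : gram c (revV (n, (m : ℤ) + 1) (P - G1 ⊳ F')) (PT lev n (m + 1)) =
        (gramK1 lev c n m).map star := by
      have e : PT lev n (m + 1) = revV (n, (m : ℤ) + 1) R := by
        rw [hR, revV_revV, sub_self]; funext a; simp [shiftV]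
      rw [e, gram_revV, gram_sub_right, gram_actL_right, ← gram_conjTranspose hc P R, hK,
        ← gram_conjTranspose hc F' R, hFR]
      simp
      rfl
    rw [h4] at h3
    have h5 := rev_mem_box (n, (m : ℤ) + 1) h3
    have h6 : revV (n, (m : ℤ) + 1) (revV (n, (m : ℤ) + 1) (P - G1 ⊳ F') -
        (gramK1 lev c n m).map star ⊳ PT lev n (m + 1)) a ∈ box (0, 1) (n, (m : ℤ) + 1) := by
      simpa [revV] using h5
    rw [revV_sub, revV_actL, revV_revV, sub_self] at h6
    have e : ∀ X : Fin (m + 1) → Laurent, shiftV 0 X = X := fun X => by funext a; simp [shiftV]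
    have e2 : ((gramK1 lev c n m).map star).map star = gramK1 lev c n m := by ext; simp
    rw [e, e2] at h6
    exact h6
  have h0 : gram c s s = 0 := gram_eq_zero hsp hsm
  have hPP : gram c P P = 1 := by rw [hP, gram_shiftV, h.orth_down.gram]
  have hRF : gram c R F' = 0 := by rw [← gram_conjTranspose hc, hFR, Matrix.conjTranspose_zero]
  have hFP : gram c F' P = G1ᴴ := by rw [← gram_conjTranspose hc P F']
  have hRP : gram c R P = (gramK1 lev c n m)ᴴ := by rw [← hK, gram_conjTranspose hc]
  rw [hs] at h0
  simp only [gram_sub_left, gram_sub_right, gram_actL_left, gram_actL_right, hPP, hRF, hFR, hK,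
    hFP, hRP, hRR, hF'.gram, ← hG1, Matrix.zero_mul, Matrix.mul_zero,
    Matrix.mul_one, sub_zero, sub_self] at h0
  rw [sub_eq_zero] at h0
  rw [← sub_eq_zero, ← neg_eq_zero]
  rw [← h0]; abel

lemma isPos_eq_sqrt {z : ℂ} (hz : IsPos z) {r : ℝ} (h : z * star z = r) :
    z = ((Real.sqrt r : ℝ) : ℂ) := by
  rw [hz.star_eq, hz.eq_ofReal] at h
  have h' : z.re * z.re = r := by exact_mod_cast h
  rw [hz.eq_ofReal, ← h', Real.sqrt_mul_self hz.1.le]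

/-- All columns but the first follow from the product with the residual, divided by the Cholesky
factor. The first column vanishes below its corner. By Pythagoras in the first row, the square of
the positive corner entry is 1 minus the (1,1) entry of H³, which is thus below 1. -/
lemma LowerGood.gram_eq_matG1 (hc : Herm c) (h : LowerGood lev c (n + 1) (m + 1))
    (hpd : PD c n ((m : ℤ) + 1)) (hpd' : PD c ((n : ℤ) + 1) m)
    (hF' : IsOrth c ((n : ℤ) + 1) ((m : ℤ) + 1) F') :
    gram c (shiftV (0, 1) (Ph lev (n + 1) m)) F' =
      matG1 (gramK lev c n m) (gramK1 lev c n m) (gram c (Ph lev (n + 1) m) F')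
        (gram c (shiftV (0, 1) (PT lev (n + 1) m)) (revV ((n : ℤ) + 1, m) (PT lev (n + 1) m)))
        (lev n (m + 1)) (lev (n + 1) m) ∧
    (matH3 (gramK lev c n m) (gramK1 lev c n m) (gram c (Ph lev (n + 1) m) F')
        (lev n (m + 1)) (lev (n + 1) m) 0 0).re < 1 := by
  obtain ⟨B, hB, -, hG⟩ := h.exists_cholesky hc hpd hF'
  set G := gram c (Ph lev (n + 1) m) F' with hGdef
  set G1 := gram c (shiftV (0, 1) (Ph lev (n + 1) m)) F' with hG1
  have hF : IsOrth c ((n : ℤ) + 1) (((m : ℤ) + 1) - 1) (Ph lev (n + 1) m) := by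
    simpa using h.orth_down
  have hUG : U (m + 1) * Gᴴ = Bᴴ := by
    rw [hG, Matrix.conjTranspose_mul, U_conjTranspose, ← Matrix.mul_assoc, U_mul_U_transpose,
      Matrix.one_mul]
  have hZ : gram c (shiftV (0, 1) (Ph lev (n + 1) m)) (resid lev c n m) = G1 * (U (m + 1))ᵀ * Bᴴ := by
    rw [h.resid_eq hc hpd hF', gram_actL_right, ← hGdef, ← hG1, hG, Matrix.conjTranspose_mul,
      U_conjTranspose, Matrix.mul_assoc]
  have hY : gram c (shiftV (0, 1) (Ph lev (n + 1) m)) (resid lev c n m) * (U (m + 1) * Gᴴ)⁻¹ =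
      G1 * (U (m + 1))ᵀ := by
    rw [hUG, hZ, Matrix.mul_nonsing_inv_cancel_right _ _ hB.isUnit_det_conjTranspose]
  have hH3 := h.matH3_zero hc hpd' G hY.symm
  have hsum := congrFun (congrFun (h.gram_shift_new hc hF') 0) 0
  rw [← hG1, Matrix.one_apply_eq] at hsum
  have hpos : IsPos (G1 0 0) := gram_shift_consecutive_pos hc hF hF'
  have h00 : G1 0 0 * star (G1 0 0) =
      1 - matH3 (gramK lev c n m) (gramK1 lev c n m) G (lev n (m + 1)) (lev (n + 1) m) 0 0 := by
    rw [hH3, ← hsum, Matrix.add_apply, Matrix.add_apply, Matrix.mul_apply, Fin.sum_univ_succ,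
      Matrix.mul_apply (M := G1 * (U (m + 1))ᵀ)]
    simp only [Matrix.conjTranspose_apply, mul_U_transpose_apply]
    ring
  have hre : G1 0 0 * star (G1 0 0) = ((1 - (matH3 (gramK lev c n m) (gramK1 lev c n m) G
      (lev n (m + 1)) (lev (n + 1) m) 0 0).re : ℝ) : ℂ) := by
    have e : G1 0 0 * star (G1 0 0) = ((G1 0 0 * star (G1 0 0)).re : ℂ) := by
      rw [hpos.star_eq]; exact (hpos.mul hpos).eq_ofReal
    rw [e, h00]; simp
  refine ⟨?_, ?_⟩
  · rw [matG1, ← h.gram_shift_resid hc, hY]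
    ext a b
    rw [Matrix.add_apply]
    refine Fin.cases ?_ (fun b => ?_) b
    · rw [mul_U_apply_zero, zero_add]
      refine Fin.cases ?_ (fun a => ?_) a
      · rw [Matrix.single_apply, if_pos ⟨rfl, rfl⟩]
        exact isPos_eq_sqrt hpos hre
      · rw [Matrix.single_apply, if_neg (by simp [(Fin.succ_ne_zero a).symm])]
        exact gram_shift_consecutive_ne hc hF hF' a
    · rw [mul_U_apply_succ, mul_U_transpose_apply, Matrix.single_apply,
        if_neg (by simp [(Fin.succ_ne_zero b).symm]), add_zero]
  · have h1 := congrArg Complex.re hre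
    rw [hpos.star_eq, Complex.ofReal_re] at h1
    have := (hpos.mul hpos).1
    linarith

/-! ### The matrices `I` and `I¹` -/

lemma IsOrthT.mem' (hT' : IsOrthT c ((n : ℤ) + 1) ((m : ℤ) + 1) T') :
    Perp c T' (box 0 ((n : ℤ) + 1, m)) := by simpa using hT'.perp

/-- The first column comes from the common first polynomial. For the others, Φ̃_{n,m+1} - Γ̃T' has
degree (n+1, m). Computing its product with F' directly, and again by expanding it along Φ_{n+1,m},
gives IΓ̃† = -Γ†K. -/
lemma LowerGood.gram_eq_matJ (hc : Herm c) (h : LowerGood lev c (n + 1) (m + 1))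
    (hpd : PD c n ((m : ℤ) + 1)) (hpd' : PD c ((n : ℤ) + 1) m)
    (hpdN : PD c ((n : ℤ) + 1) ((m : ℤ) + 1))
    (hF' : IsOrth c ((n : ℤ) + 1) ((m : ℤ) + 1) F')
    (hT' : IsOrthT c ((n : ℤ) + 1) ((m : ℤ) + 1) T') :
    gram c F' T' = corner (m + 1) (n + 1) - (gram c (Ph lev (n + 1) m) F')ᴴ * gramK lev c n m *
      (U (n + 1) * (gram c (PT lev n (m + 1)) T')ᴴ)⁻¹ * U (n + 1) := by
  set G := gram c (Ph lev (n + 1) m) F' with hG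
  set GT := gram c (PT lev n (m + 1)) T' with hGT
  have h0 : F' 0 = T' 0 := IsTop.eq hpdN (hF'.isTop hc) (hT'.isTop hc)
  have hp : Perp c F' (box 0 (n, (m : ℤ) + 1)) := by simpa using hF'.perp
  have hpT := hT'.mem'
  obtain ⟨C, hC, -, hCG⟩ := (h.swap hc).exists_cholesky hc.swap hpd'.swap (F' := swapV T') hT'
  rw [Ph_swapFam, gram_swapV, ← hGT] at hCG
  have hU : U (n + 1) * GTᴴ = Cᴴ := by
    rw [hCG, Matrix.conjTranspose_mul, U_conjTranspose, ← Matrix.mul_assoc, U_mul_U_transpose,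
      Matrix.one_mul]
  obtain ⟨B, -, -, hBG⟩ := h.exists_cholesky hc hpd hF'
  rw [← hG] at hBG
  have key : gram c F' T' * GTᴴ = -(Gᴴ * gramK lev c n m) := by
    set r := PT lev n (m + 1) - GT ⊳ T' with hr
    have hrm : ∀ a, r a ∈ box 0 ((n : ℤ) + 1, m) := by
      have := hT'.decompV hc (G := PT lev n (m + 1)) (fun a =>
        box_mono (by simp) (by simp) (by simp) (by simp) (h.orthT_left.mem a))
      simpa [hr, hGT] using this
    have h1 : gram c F' r = -(gram c F' T' * GTᴴ) := by
      rw [hr, gram_sub_right, gram_eq_zero hp h.orthT_left.mem, gram_actL_right, zero_sub]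
    have h2 : gram c (Ph lev (n + 1) m) r = gramK lev c n m := by
      rw [hr, gram_sub_right, gram_actL_right, gram_eq_zero' hc hpT h.orth_down.mem]
      simp [gramK]
    have h3 : gram c F' (r - gram c r (Ph lev (n + 1) m) ⊳ Ph lev (n + 1) m) = 0 := by
      refine gram_eq_zero hp fun a => ?_
      have := h.orth_down.decompV hc hrm a
      exact box_mono (by simp) (by simp) (by simp) (by simp) this
    rw [gram_sub_right, gram_actL_right, gram_conjTranspose hc, h2, sub_eq_zero, h1,
      ← gram_conjTranspose hc (Ph lev (n + 1) m)] at h3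
    rw [hG, ← h3, neg_neg]
  rw [hU]
  have key2 : gram c F' T' * (U (n + 1))ᵀ = -(Gᴴ * gramK lev c n m) * (Cᴴ)⁻¹ := by
    rw [← key, hCG, Matrix.conjTranspose_mul, U_conjTranspose, ← Matrix.mul_assoc,
      Matrix.mul_nonsing_inv_cancel_right _ _ hC.isUnit_det_conjTranspose]
  ext a b
  rw [Matrix.sub_apply]
  refine Fin.cases ?_ (fun b => ?_) b
  · rw [gram_zero_right h0 hF'.gram]
    simp [corner, Matrix.single_apply, eq_comm]
  · have := congrFun (congrFun key2 a) b
    rw [mul_U_transpose_apply] at this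
    rw [this]
    simp [corner, (Fin.succ_ne_zero b).symm]

lemma LowerGood.gram_eq_matJ1 (hc : Herm c) (h : LowerGood lev c (n + 1) (m + 1))
    {A E : Matrix (Fin (m + 2)) (Fin (m + 2)) ℂ}
    (hrec : Recur c (1, 0) (n, (m : ℤ) + 1) A E (Ph lev n (m + 1)) F')
    (hT' : IsOrthT c ((n : ℤ) + 1) ((m : ℤ) + 1) T') :
    gram c (revV ((n : ℤ) + 1, (m : ℤ) + 1) F') T' =
      nextJ1 A E (gram c F' T') (gram c (PT lev n (m + 1)) T') (lev n (m + 1)) := by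
  have h1 := hrec.rev_new hc
  have e : (((n : ℤ), (m : ℤ) + 1) + (1, 0) : ℤ × ℤ) = ((n : ℤ) + 1, (m : ℤ) + 1) := by simp
  rw [e] at h1
  have hpT := hT'.mem'
  have h2 : gram c (revV ((n : ℤ), (m : ℤ) + 1) (Ph lev n (m + 1))) T' =
      (lev n (m + 1)).J1 * gram c (PT lev n (m + 1)) T' := by
    rw [← gram_actL_left, ← sub_eq_zero, ← gram_sub_left]
    refine gram_eq_zero' hc hpT fun a => ?_
    exact box_mono (by simp) (by simp) (by simp) (by simp) (h.rev_left_sub_mem hc a)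
  rw [h1, gram_sub_left, gram_actL_left, gram_actL_left, h2, nextJ1]
  rw [← Matrix.mul_assoc]
  abel

end step

@[simp] lemma shiftV_zero {k : ℕ} (F : Fin k → Laurent) : shiftV 0 F = F := by
  funext a; simp [shiftV]

open scoped ComplexOrder in
lemma UTP.posDef {k : ℕ} {B : Matrix (Fin k) (Fin k) ℂ} (hB : UTP B) : (B * Bᴴ).PosDef := by
  have h1 : (1 : Matrix (Fin k) (Fin k) ℂ).PosDef := Matrix.PosDef.one
  have := h1.mul_mul_conjTranspose_same (B := B) (fun x y hxy => by
    have := congrArg (fun v => Matrix.vecMul v B⁻¹) hxy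
    simpa [Matrix.vecMul_vecMul, hB.mul_inv] using this)
  simpa using this

open scoped ComplexOrder in
lemma gram_posDef {c : ℤ × ℤ → ℂ} (hc : Herm c) {k : ℕ} {F : Fin k → Laurent}
    (h : ∀ x : Fin k → ℂ, x ≠ 0 → 0 < (ip c (∑ a, x a • F a) (∑ a, x a • F a)).re) :
    (gram c F F).PosDef := by
  refine Matrix.PosDef.of_dotProduct_mulVec_pos (gram_conjTranspose hc F F) fun x hx => ?_
  have h1 := h (star x) (by simpa using hx)
  have h2 : star x ⬝ᵥ (gram c F F).mulVec x =
      ip c (∑ a, star x a • F a) (∑ a, star x a • F a) := by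
    simp only [ip_sum_left, ip_sum_right, ip_smul_left, ip_smul_right, dotProduct, Matrix.mulVec,
      gram, Matrix.of_apply, Pi.star_apply, star_star]
    simp only [Finset.mul_sum]
    rw [Finset.sum_comm]
    exact Finset.sum_congr rfl fun a _ => Finset.sum_congr rfl fun b _ => by ring
  rw [h2, ip_self_eq_re hc, Complex.zero_lt_real]
  exact h1

/-! ### One step of the recurrence in z -/

section next
variable {c : ℤ × ℤ → ℂ} {n m : ℤ} {k : ℕ} {F : Fin k → Laurent}
  {A E : Matrix (Fin k) (Fin k) ℂ}

/-- The residual of `z Φ_{n,m}`. -/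
def zResid (n m : ℤ) (E : Matrix (Fin k) (Fin k) ℂ) (F : Fin k → Laurent) : Fin k → Laurent :=
  shiftV (1, 0) F - E ⊳ revV (n, m) F

lemma IsOrth.rev_mem (hF : IsOrth c n m F) (a : Fin k) : revV (n, m) F a ∈ box 0 (n, m) := by
  have := rev_mem_box (n, m) (hF.mem a)
  simpa [revV] using this

lemma IsOrth.zResid_mem (hF : IsOrth c n m F) (a : Fin k) :
    zResid n m E F a ∈ box 0 (n + 1, m) := by
  refine Submodule.sub_mem _ ?_ (actL_mem (fun b => ?_) a)
  · exact box_mono (by simp) (by simp) (by simp) (by simp) (shift_mem_box (1, 0) (hF.mem a))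
  · exact box_mono (by simp) (by simp) (by simp) (by simp) (hF.rev_mem b)

lemma IsOrth.coefZ_zResid (hF : IsOrth c n m F) :
    coefZ (n + 1) m (zResid n m E F) = coefZ n m F := by
  ext a b
  simp only [coefZ, zResid, Matrix.of_apply, Pi.sub_apply, Finsupp.sub_apply, actL_apply, shiftV,
    shift_apply]
  rw [Finset.sum_eq_zero, sub_zero]
  · congr 1; ext <;> simp
  · intro b _
    rw [mem_box.1 (hF.rev_mem b) _ (by simp), mul_zero]

/-- Both zF and rev F are orthogonal to z-degrees 1 to n. Subtracting E·rev F also removes the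
component along rev F, and after reversal at (n, m) this supplies the missing column z^0. -/
lemma IsOrth.perp_zResid (hF : IsOrth c n m F) (hc : Herm c)
    (hE : E = Bicircle.gram c (shiftV (1, 0) F) (revV (n, m) F)) :
    Perp c (zResid n m E F) (box 0 (n, m)) := by
  have h1 : Perp c (zResid n m E F) (box (1, 0) (n, m)) := by
    refine Perp.sub ?_ (Perp.actL ?_ _)
    · have := hF.perp.shiftV (1, 0); simpa using this
    · have := hF.perp.revV hc (n, m); simpa using this
  have h2 : Perp c (revV (n, m) (zResid n m E F)) (box 0 (n - 1, m)) := by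
    have := h1.revV hc (n, m); simpa using this
  have h3 : Bicircle.gram c (zResid n m E F) (revV (n, m) F) = 0 := by
    rw [zResid, gram_sub_left, gram_actL_left, gram_revV, hF.gram, ← hE]; simp
  have h4 : Bicircle.gram c (revV (n, m) (zResid n m E F)) F = 0 := by
    have e : F = revV (n, m) (revV (n, m) F) := by rw [revV_revV, sub_self, shiftV_zero]
    have e2 : Bicircle.gram c (revV (n, m) (zResid n m E F)) F =
        Bicircle.gram c (revV (n, m) (zResid n m E F)) (revV (n, m) (revV (n, m) F)) := by rw [← e]
    rw [e2, gram_revV, ← gram_conjTranspose hc, h3]; simp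
  have h5 := (hF.perp_of_gram hc h2 h4).revV hc (n, m)
  rw [revV_revV, sub_self, shiftV_zero] at h5
  simpa using h5

lemma IsOrth.gram_zResid (hF : IsOrth c n m F) (hc : Herm c)
    (hE : E = Bicircle.gram c (shiftV (1, 0) F) (revV (n, m) F)) :
    Bicircle.gram c (zResid n m E F) (zResid n m E F) = 1 - E * Eᴴ :=
  Recur.gram_residual hc hE hF.gram

lemma IsOrth.next (hF : IsOrth c n m F) (hc : Herm c)
    (hE : E = Bicircle.gram c (shiftV (1, 0) F) (revV (n, m) F)) (hA : UTP A)
    (hAE : 1 - E * Eᴴ = A * Aᴴ) : IsOrth c (n + 1) m (A⁻¹ ⊳ zResid n m E F) where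
  card := hF.card
  mem := actL_mem hF.zResid_mem
  utp := by rw [coefZ_actL, hF.coefZ_zResid]; exact hA.inv.mul hF.utp
  gram := by
    rw [gram_actL_left, gram_actL_right, hF.gram_zResid hc hE, hAE, Matrix.mul_assoc A,
      ← Matrix.conjTranspose_mul, hA.inv_mul, Matrix.conjTranspose_one, Matrix.mul_one, hA.inv_mul]
  perp := by
    have := (hF.perp_zResid hc hE).actL A⁻¹
    simpa using this

lemma IsOrth.recur (hF : IsOrth c n m F) (hc : Herm c)
    (hE : E = Bicircle.gram c (shiftV (1, 0) F) (revV (n, m) F)) (hA : UTP A)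
    (hAE : 1 - E * Eᴴ = A * Aᴴ) :
    Recur c (1, 0) (n, m) A E F (A⁻¹ ⊳ zResid n m E F) where
  utp := hA
  hE := hE
  rec_eq := by rw [actL_actL, hA.mul_inv, one_actL, zResid]
  gram_old := hF.gram
  gram_new := (hF.next hc hE hA hAE).gram

/-- 1 - EE† is the Gram matrix of the residual, whose leading coefficients are those of F. These are
invertible, so no nontrivial combination of the residual vanishes. -/
lemma IsOrth.exists_next (hF : IsOrth c n m F) (hc : Herm c)
    (hE : E = Bicircle.gram c (shiftV (1, 0) F) (revV (n, m) F)) (hpd : PD c (n + 1) m) :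
    ∃ A : Matrix (Fin k) (Fin k) ℂ, UTP A ∧ 1 - E * Eᴴ = A * Aᴴ := by
  rw [← hF.gram_zResid hc hE]
  refine exists_utp (gram_posDef hc fun x hx => ?_)
  refine hpd _ (Submodule.sum_mem _ fun a _ => Submodule.smul_mem _ _ (hF.zResid_mem a)) fun h0 => ?_
  apply hx
  have h1 : Matrix.vecMul x (coefZ n m F) = 0 := by
    funext b
    rw [← hF.coefZ_zResid (E := E)]
    have := DFunLike.congr_fun h0 (n + 1, m - (b : ℕ))
    simpa [Matrix.vecMul, dotProduct, coefZ, Finsupp.finsetSum_apply] using this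
  have h2 := congrArg (fun v => Matrix.vecMul v (coefZ n m F)⁻¹) h1
  simpa [Matrix.vecMul_vecMul, hF.utp.mul_inv] using h2

end next

lemma emb_nextPhi {c : ℤ × ℤ → ℂ} {n m : ℕ} (A E : Matrix (Fin (m + 1)) (Fin (m + 1)) ℂ)
    (l : Level n m) (hF : IsOrth c n m fun a => emb (l.Phi a)) (a : Fin (m + 1)) :
    emb (nextPhi A E l a) = (A⁻¹ ⊳ zResid n m E fun a => emb (l.Phi a)) a := by
  rw [nextPhi, act, map_sum, actL]
  refine Finset.sum_congr rfl fun b _ => ?_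
  rw [emb_C_mul, map_sub, emb_X_mul, act, map_sum]
  congr 1
  rw [zResid, Pi.sub_apply, shiftV, actL]
  congr 1
  exact Finset.sum_congr rfl fun b _ => by
    rw [emb_C_mul, emb_reverse n m (hF.mem b)]; rfl

/-! ### Positive definiteness at level (n+1, m+1) -/

section step
variable {lev : ∀ n m : ℕ, Level n m} {c : ℤ × ℤ → ℂ} {n m : ℕ}

/-- Reversal turns the missing row w^0 into the row w^{m+1}, which is controlled by the components
along Φ̃_{n,m+1}. -/
lemma LowerGood.perp_of_gram_rev (hc : Herm c) (h : LowerGood lev c (n + 1) (m + 1)) {k : ℕ}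
    {X : Fin k → Laurent} (hX : Perp c X (box (0, 1) (n, (m : ℤ) + 1)))
    (hg : gram c X (revV (n, (m : ℤ) + 1) (PT lev n (m + 1))) = 0) :
    Perp c X (box 0 (n, (m : ℤ) + 1)) := by
  have h2 : Perp c (revV (n, (m : ℤ) + 1) X) (box 0 (n, (m : ℤ) + 1 - 1)) := by
    have := hX.revV hc (n, (m : ℤ) + 1); simpa using this
  have h4 : gram c (revV (n, (m : ℤ) + 1) X) (PT lev n (m + 1)) = 0 := by
    have e : PT lev n (m + 1) =
        revV (n, (m : ℤ) + 1) (revV (n, (m : ℤ) + 1) (PT lev n (m + 1))) := by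
      rw [revV_revV, sub_self, shiftV_zero]
    rw [e, gram_revV, ← gram_conjTranspose hc, hg]; simp
  have h5 := (h.orthT_left.perp_of_gram hc h2 h4).revV hc (n, (m : ℤ) + 1)
  rw [revV_revV, sub_self, shiftV_zero] at h5
  simpa using h5

lemma LowerGood.resid_apply (h : LowerGood lev c (n + 1) (m + 1)) (a : Fin (m + 1)) (j : ℤ) :
    resid lev c n m a ((n : ℤ) + 1, j) = Ph lev (n + 1) m a ((n : ℤ) + 1, j) := by
  rw [resid, Pi.sub_apply, Finsupp.sub_apply, actL_apply, Finset.sum_eq_zero, sub_zero]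
  intro b _
  rw [mem_box.1 (h.orthT_left.mem b) _ (by simp), mul_zero]

/-- The new orthonormal vector is exhibited directly. Its entries but the first are the residual
divided by B. The first is ψ₀ normalized, where ψ is the part of wΦ_{n+1,m} orthogonal to the
reverse of Φ̃_{n,m+1} and to φ; its squared norm is 1 minus the (1,1) entry of H³. Positivity then
extends along this vector by `IsOrth.pd`. -/
lemma LowerGood.pd (hc : Herm c) (h : LowerGood lev c (n + 1) (m + 1))
    (hpd : PD c n ((m : ℤ) + 1)) (hpd' : PD c ((n : ℤ) + 1) m)
    {B : Matrix (Fin (m + 1)) (Fin (m + 1)) ℂ} (hB : UTP B)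
    (hBK : 1 - gramK lev c n m * (gramK lev c n m)ᴴ = B * Bᴴ)
    (h3 : (matH3 (gramK lev c n m) (gramK1 lev c n m) (B * U (m + 1)) (lev n (m + 1))
      (lev (n + 1) m) 0 0).re < 1) : PD c ((n : ℤ) + 1) ((m : ℤ) + 1) := by
  set P := shiftV (0, 1) (Ph lev (n + 1) m) with hP
  set R := revV (n, (m : ℤ) + 1) (PT lev n (m + 1)) with hR
  set K1 := gramK1 lev c n m with hK1
  set φ := B⁻¹ ⊳ resid lev c n m with hφ
  set Y := gram c P φ with hY
  set ψ := P - K1 ⊳ R - Y ⊳ φ with hψ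
  have hUG : U (m + 1) * (B * U (m + 1))ᴴ = Bᴴ := by
    rw [Matrix.conjTranspose_mul, U_conjTranspose, ← Matrix.mul_assoc, U_mul_U_transpose,
      Matrix.one_mul]
  have hYZ : Y = gram c P (resid lev c n m) * (U (m + 1) * (B * U (m + 1))ᴴ)⁻¹ := by
    rw [hY, hφ, gram_actL_right, hUG, Matrix.conjTranspose_nonsing_inv]
  have hH3 := h.matH3_zero hc hpd' (B * U (m + 1)) hYZ
  have hφφ : gram c φ φ = 1 := by
    rw [hφ, gram_actL_left, gram_actL_right, h.gram_resid hc, hBK, Matrix.mul_assoc B,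
      ← Matrix.conjTranspose_mul, hB.inv_mul, Matrix.conjTranspose_one, Matrix.mul_one, hB.inv_mul]
  have hφp : Perp c φ (box 0 (n, (m : ℤ) + 1)) := (h.perp_resid hc).actL _
  have hRm : ∀ a, R a ∈ box 0 (n, (m : ℤ) + 1) := fun a => by
    have := rev_mem_box (n, (m : ℤ) + 1) (h.orthT_left.mem a)
    simpa [hR, revV] using this
  have hPm : ∀ a, P a ∈ box 0 ((n : ℤ) + 1, (m : ℤ) + 1) := fun a =>
    box_mono (by simp) (by simp) (by simp) (by simp) (shift_mem_box (0, 1) (h.orth_down.mem a))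
  have hφm : ∀ a, φ a ∈ box 0 ((n : ℤ) + 1, (m : ℤ) + 1) := actL_mem h.resid_mem
  have hRR : gram c R R = 1 := by
    rw [hR, gram_revV, h.orthT_left.gram, Matrix.transpose_one]
  have hφR : gram c φ R = 0 := gram_eq_zero hφp hRm
  have hRφ : gram c R φ = 0 := by rw [← gram_conjTranspose hc, hφR, Matrix.conjTranspose_zero]
  have hPR : gram c P R = K1 := rfl
  have hRP : gram c R P = K1ᴴ := by rw [← hPR, gram_conjTranspose hc]
  have hφP : gram c φ P = Yᴴ := by rw [hY, gram_conjTranspose hc]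
  have hPP : gram c P P = 1 := by rw [hP, gram_shiftV, h.orth_down.gram]
  have hψφ : gram c ψ φ = 0 := by
    simp only [hψ, gram_sub_left, gram_actL_left, hRφ, hφφ, ← hY, Matrix.mul_zero, Matrix.mul_one,
      sub_zero, sub_self]
  have hψR : gram c ψ R = 0 := by
    simp only [hψ, gram_sub_left, gram_actL_left, hRR, hφR, hPR, Matrix.mul_zero, Matrix.mul_one,
      sub_self]
  have hψP : gram c ψ P = 1 - K1 * K1ᴴ - Y * Yᴴ := by
    simp only [hψ, gram_sub_left, gram_actL_left, hPP, hRP, hφP]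
  have hψψ : gram c ψ ψ = 1 - K1 * K1ᴴ - Y * Yᴴ := by
    have e : gram c ψ ψ = gram c ψ (P - K1 ⊳ R - Y ⊳ φ) := rfl
    rw [e, gram_sub_right, gram_sub_right, gram_actL_right, gram_actL_right, hψR, hψφ, hψP]
    simp
  have hψp : Perp c ψ (box 0 (n, (m : ℤ) + 1)) := by
    refine h.perp_of_gram_rev hc ((h.perp_shift_down.sub ((h.perp_rev_left hc).actL _)).sub
      ((hφp.mono fun g hg => ?_).actL _)) hψR
    exact box_mono (by simp) (by simp) (by simp) (by simp) hg
  have hψm : ∀ a, ψ a ∈ box 0 ((n : ℤ) + 1, (m : ℤ) + 1) := fun a =>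
    Submodule.sub_mem _ (Submodule.sub_mem _ (hPm a) (actL_mem (fun b =>
      box_mono (by simp) (by simp) (by simp) (by simp) (hRm b)) a)) (actL_mem hφm a)
  set t := (ip c (ψ 0) (ψ 0)).re with ht
  have ht1 : ip c (ψ 0) (ψ 0) = 1 - matH3 (gramK lev c n m) K1 (B * U (m + 1)) (lev n (m + 1))
      (lev (n + 1) m) 0 0 := by
    have := congrFun (congrFun hψψ 0) 0
    rw [gram, Matrix.of_apply] at this
    rw [this, hH3, Matrix.sub_apply, Matrix.sub_apply, Matrix.add_apply, Matrix.one_apply_eq]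
    ring
  have htpos : 0 < t := by
    rw [ht, ht1, Complex.sub_re, Complex.one_re]; linarith
  set r : ℂ := (((Real.sqrt t)⁻¹ : ℝ) : ℂ) with hr
  have hrpos : IsPos r := isPos_ofReal (inv_pos.2 (Real.sqrt_pos.2 htpos))
  have hrt : r * star r * ip c (ψ 0) (ψ 0) = 1 := by
    rw [hrpos.star_eq, ip_self_eq_re hc, ← ht, hr, ← Complex.ofReal_mul, ← Complex.ofReal_mul,
      ← mul_inv, Real.mul_self_sqrt htpos.le, inv_mul_cancel₀ htpos.ne', Complex.ofReal_one]
  have hφ0 : ∀ a, φ a ((n : ℤ) + 1, (m : ℤ) + 1) = 0 := by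
    intro a
    rw [hφ, actL_apply]
    refine Finset.sum_eq_zero fun b _ => ?_
    rw [h.resid_apply, mem_box.1 (h.orth_down.mem b) _ (by simp), mul_zero]
  set F' : Fin (m + 2) → Laurent := Fin.cons (r • ψ 0) φ with hF'
  have hF'0 : F' 0 = r • ψ 0 := rfl
  have hF's : ∀ a : Fin (m + 1), F' a.succ = φ a := fun a => rfl
  have horth : IsOrth c ((n : ℤ) + 1) ((m : ℤ) + 1) F' := by
    refine ⟨by push_cast; ring, ?_, ⟨?_, ?_⟩, ?_, ?_⟩
    · intro a
      refine Fin.cases ?_ (fun a => ?_) a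
      · exact Submodule.smul_mem _ _ (hψm 0)
      · exact hφm a
    · intro i j
      refine Fin.cases ?_ (fun i => ?_) i
      · intro h; exact absurd h (Fin.not_lt_zero j)
      · refine Fin.cases ?_ (fun j => ?_) j
        · intro _
          simp [coefZ, hF's, hφ0]
        · intro hij
          have hu := (hB.inv.mul h.orth_down.utp).1 i j (by simpa using hij)
          rw [← coefZ_actL] at hu
          simp only [coefZ, Matrix.of_apply, hF's, Fin.val_succ, hφ, actL_apply,
            h.resid_apply] at hu ⊢
          rw [← hu]
          refine Finset.sum_congr rfl fun b _ => ?_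
          congr 2; ext <;> simp; try ring
    · intro i
      refine Fin.cases ?_ (fun i => ?_) i
      · simp only [coefZ, Matrix.of_apply, hF'0, Finsupp.smul_apply, smul_eq_mul]
        refine hrpos.mul ?_
        have hu := h.orth_down.utp.2 0
        have e : ψ 0 ((n : ℤ) + 1, (m : ℤ) + 1) = Ph lev (n + 1) m 0 ((n : ℤ) + 1, (m : ℤ)) := by
          rw [hψ, Pi.sub_apply, Finsupp.sub_apply, Pi.sub_apply, Finsupp.sub_apply, actL_apply,
            actL_apply, Finset.sum_eq_zero, Finset.sum_eq_zero, sub_zero, sub_zero]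
          · simp [hP, shiftV]
          · intro b _
            rw [hφ0, mul_zero]
          · intro b _
            rw [mem_box.1 (hRm b) _ (by simp), mul_zero]
        simp only [coefZ, Matrix.of_apply] at hu
        simp only [Fin.val_zero, Nat.cast_zero, sub_zero] at hu ⊢
        rw [e]; exact hu
      · have hu := (hB.inv.mul h.orth_down.utp).2 i
        rw [← coefZ_actL] at hu
        simp only [coefZ, Matrix.of_apply, hF's, Fin.val_succ, hφ, actL_apply,
          h.resid_apply] at hu ⊢
        convert hu using 5
        push_cast; ring
    · have e1 : ∀ b, ip c (ψ 0) (φ b) = 0 := fun b => congrFun (congrFun hψφ 0) b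
      have e2 : ∀ a b, ip c (φ a) (φ b) = (1 : Matrix (Fin (m + 1)) (Fin (m + 1)) ℂ) a b :=
        fun a b => congrFun (congrFun hφφ a) b
      ext a b
      rw [gram, Matrix.of_apply]
      refine Fin.cases ?_ (fun a => ?_) a <;> refine Fin.cases ?_ (fun b => ?_) b
      · rw [hF'0, ip_smul_left, ip_smul_right, ← mul_assoc, hrt]; simp
      · rw [hF'0, hF's, ip_smul_left, e1]; simp [(Fin.succ_ne_zero b).symm]
      · rw [hF'0, hF's, ip_smul_right, ip_eq_zero_comm hc (e1 a)]; simp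
      · rw [hF's, hF's, e2]; simp [Matrix.one_apply]
    · intro a g hg
      rw [show ((n : ℤ) + 1 - 1, (m : ℤ) + 1) = ((n : ℤ), (m : ℤ) + 1) by simp] at hg
      revert a
      refine Fin.cases ?_ fun a => ?_
      · rw [hF'0, ip_smul_left, hψp 0 g hg, mul_zero]
      · exact hφp a g hg
  exact horth.pd hc (by simpa using hpd)

end step

section inner
variable {lev : ∀ n m : ℕ, Level n m} {c : ℤ × ℤ → ℂ} {n m : ℕ}

/-! ### Levels `(n+1, m+1)` -/

lemma LowerGood.next (hc : Herm c) (h : LowerGood lev c (n + 1) (m + 1))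
    (hpd : PD c ((n : ℤ) + 1) ((m : ℤ) + 1)) {A E : Matrix (Fin (m + 2)) (Fin (m + 2)) ℂ}
    (hE : E = matE (gramK lev c n m) (gramK1 lev c n m) (lev n (m + 1)) (lev (n + 1) m))
    (hA : A = upperCholesky (1 - E * Eᴴ)) :
    IsOrth c ((n : ℤ) + 1) ((m : ℤ) + 1) (fun a => emb (nextPhi A E (lev n (m + 1)) a)) ∧
    Recur c (1, 0) (n, (m : ℤ) + 1) A E (Ph lev n (m + 1))
      (fun a => emb (nextPhi A E (lev n (m + 1)) a)) := by
  have hE' : E = gram c (shiftV (1, 0) (Ph lev n (m + 1)))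
      (revV (n, (m : ℤ) + 1) (Ph lev n (m + 1))) := by rw [hE, gram_eq_matE hc h]
  obtain ⟨A', hA', h1⟩ := h.orth_left.exists_next hc hE' hpd
  have hAA : A = A' := by rw [hA, upperCholesky_eq hA' h1]
  subst hAA
  have e : (fun a => emb (nextPhi A E (lev n (m + 1)) a)) =
      A⁻¹ ⊳ zResid n ((m : ℤ) + 1) E (Ph lev n (m + 1)) := by
    funext a
    have := emb_nextPhi (c := c) A E (lev n (m + 1)) h.left.orth a
    simp only [Nat.cast_add, Nat.cast_one] at this
    exact this
  rw [e]
  exact ⟨h.orth_left.next hc hE' hA' h1, h.orth_left.recur hc hE' hA' h1⟩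

/-- Once K and K¹ are the right Gram matrices, every other entry of `innerStep` is one of the Gram
identities above, and the tilde entries follow by interchange. -/
lemma good_inner (hc : Herm c) (h : LowerGood lev c (n + 1) (m + 1))
    (hpd : PD c n ((m : ℤ) + 1)) (hpd' : PD c ((n : ℤ) + 1) m)
    (hpdN : PD c ((n : ℤ) + 1) ((m : ℤ) + 1)) (u : ℤ → ℤ → ℂ)
    (hlev : lev (n + 1) (m + 1) = innerStep u (lev n (m + 1)) (lev (n + 1) m))
    (hK : matK u (lev n (m + 1)) (lev (n + 1) m) = gramK lev c n m)
    (hK1 : matK1 u (lev n (m + 1)) (lev (n + 1) m) = gramK1 lev c n m) :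
    Good lev c (n + 1) (m + 1) := by
  have hs := h.swap hc
  have eE : (lev (n + 1) (m + 1)).E =
      matE (gramK lev c n m) (gramK1 lev c n m) (lev n (m + 1)) (lev (n + 1) m) := by
    rw [hlev, ← hK, ← hK1]; rfl
  have eET : (lev (n + 1) (m + 1)).ET = matE (gramK lev c n m)ᴴ (gramK1 lev c n m)ᵀ
      (lev (n + 1) m).swap (lev n (m + 1)).swap := by
    rw [hlev, ← hK, ← hK1]; rfl
  have eA : (lev (n + 1) (m + 1)).A = upperCholesky
      (1 - (lev (n + 1) (m + 1)).E * (lev (n + 1) (m + 1)).Eᴴ) := by rw [hlev]; rfl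
  have eAT : (lev (n + 1) (m + 1)).AT = upperCholesky
      (1 - (lev (n + 1) (m + 1)).ET * (lev (n + 1) (m + 1)).ETᴴ) := by rw [hlev]; rfl
  have ePh : Ph lev (n + 1) (m + 1) = fun a => emb (nextPhi (lev (n + 1) (m + 1)).A
      (lev (n + 1) (m + 1)).E (lev n (m + 1)) a) := by
    rw [hlev]; funext a; rw [Ph, hlev]; rfl
  have ePT : swapV (PT lev (n + 1) (m + 1)) = fun a => emb (nextPhi (lev (n + 1) (m + 1)).AT
      (lev (n + 1) (m + 1)).ET (swapFam lev m (n + 1)) a) := by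
    rw [hlev]; funext a; rw [swapV, PT, hlev]
    have : (innerStep u (lev n (m + 1)) (lev (n + 1) m)).PhiT a =
      swapPoly (nextPhi (innerStep u (lev n (m + 1)) (lev (n + 1) m)).AT
        (innerStep u (lev n (m + 1)) (lev (n + 1) m)).ET (swapFam lev m (n + 1)) a) := rfl
    rw [this, emb_swapPoly, swapL_swapL]
  obtain ⟨ho, hr⟩ := h.next hc hpdN eE eA
  rw [← ePh] at ho hr
  have hoT' : IsOrthT c ((n : ℤ) + 1) ((m : ℤ) + 1) (PT lev (n + 1) (m + 1)) ∧
      Recur c (0, 1) ((n : ℤ) + 1, m) (lev (n + 1) (m + 1)).AT (lev (n + 1) (m + 1)).ET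
        (PT lev (n + 1) m) (PT lev (n + 1) (m + 1)) := by
    have := hs.next hc.swap hpdN.swap (E := (lev (n + 1) (m + 1)).ET)
      (by rw [eET, gramK_swap hc, gramK1_swap]; rfl) eAT
    rw [← ePT] at this
    refine ⟨this.1, ?_⟩
    have h2 := this.2
    rw [Ph_swapFam] at h2
    refine ⟨h2.utp, ?_, ?_, ?_, ?_⟩
    · have h3 := h2.hE
      have e := gram_swapV c (shiftV (0, 1) (PT lev (n + 1) m))
        (revV ((n : ℤ) + 1, (m : ℤ)) (PT lev (n + 1) m))
      rw [swapV_shiftV, swapV_revV] at e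
      exact h3.trans e
    · have h3 := congrArg swapV h2.rec_eq
      rw [swapV_sub, swapV_actL, swapV_actL, swapV_shiftV, swapV_revV, swapV_swapV,
        swapV_swapV] at h3
      exact h3
    · have := h2.gram_old; rwa [gram_swapV] at this
    · have := h2.gram_new; rwa [gram_swapV] at this
  obtain ⟨hoT, hrT⟩ := hoT'
  have eG : (lev (n + 1) (m + 1)).G = gram c (Ph lev (n + 1) m) (Ph lev (n + 1) (m + 1)) := by
    rw [h.gram_eq_cholesky hc hpd ho, hlev, ← hK]; rfl
  have hGTs := hs.gram_eq_cholesky hc.swap hpd'.swap (F' := swapV (PT lev (n + 1) (m + 1))) hoT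
  rw [Ph_swapFam, gram_swapV, gramK_swap hc, Matrix.conjTranspose_conjTranspose] at hGTs
  have eGT : (lev (n + 1) (m + 1)).GT = gram c (PT lev n (m + 1)) (PT lev (n + 1) (m + 1)) := by
    rw [hGTs, hlev, ← hK]; rfl
  have eG1 : (lev (n + 1) (m + 1)).G1 =
      gram c (shiftV (0, 1) (Ph lev (n + 1) m)) (Ph lev (n + 1) (m + 1)) := by
    rw [(h.gram_eq_matG1 hc hpd hpd' ho).1, gram_eq_matET hc h, ← eET, ← eG, ← hK, ← hK1, hlev]; rfl
  have eG1T : (lev (n + 1) (m + 1)).G1T =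
      gram c (shiftV (1, 0) (PT lev n (m + 1))) (PT lev (n + 1) (m + 1)) := by
    have h1 := (hs.gram_eq_matG1 hc.swap hpd'.swap hpd.swap (F' := swapV (PT lev (n + 1) (m + 1)))
      hoT).1
    rw [gram_eq_matET hc.swap hs] at h1
    have e1 := gram_swapV c (shiftV (1, 0) (PT lev n (m + 1))) (PT lev (n + 1) (m + 1))
    rw [swapV_shiftV] at e1
    rw [Ph_swapFam, gram_swapV, ← eGT, gramK_swap hc, gramK1_swap,
      Matrix.conjTranspose_conjTranspose, Matrix.transpose_transpose] at h1
    have e2 : ((swapFam lev (m + 1) n).swap) = lev n (m + 1) := Level.swap_swap _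
    have e3 : ((swapFam lev m (n + 1)).swap) = lev (n + 1) m := Level.swap_swap _
    rw [e2, e3, ← eE] at h1
    refine Eq.trans ?_ (h1.symm.trans e1)
    rw [← hK, ← hK1, hlev]; rfl
  have eJ : (lev (n + 1) (m + 1)).J = gram c (Ph lev (n + 1) (m + 1)) (PT lev (n + 1) (m + 1)) := by
    rw [h.gram_eq_matJ hc hpd hpd' hpdN ho hoT, ← eG, ← eGT, ← hK, hlev]; rfl
  have eJ1 : (lev (n + 1) (m + 1)).J1 =
      gram c (revV ((n : ℤ) + 1, (m : ℤ) + 1) (Ph lev (n + 1) (m + 1)))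
        (PT lev (n + 1) (m + 1)) := by
    rw [h.gram_eq_matJ1 hc hr hoT, ← eJ, ← eGT, hlev]; rfl
  exact
    { orth := by simpa using ho
      orthT := by simpa using hoT
      K := by rw [hlev]; exact hK
      K1 := by
        have : (lev (n + 1) (m + 1)).K1 = gramK1 lev c n m := by rw [hlev]; exact hK1
        rw [this, gramK1]; simp [PhD, PTD]
      G := eG
      G1 := eG1
      GT := eGT
      G1T := eG1T
      J := eJ
      J1 := by simpa using eJ1
      E := fun k hk => by
        obtain rfl : n = k := by omega
        simpa using hr.hE
      A := fun k hk => by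
        obtain rfl : n = k := by omega
        exact ⟨hr.utp, by simpa using hr.rec_eq⟩
      ET := fun k hk => by
        obtain rfl : m = k := by omega
        simpa using hrT.hE
      AT := fun k hk => by
        obtain rfl : m = k := by omega
        exact ⟨hrT.utp, by simpa using hrT.rec_eq⟩ }

end inner

/-! ### Levels `(n+1, 0)` -/

section edge
variable {lev : ∀ n m : ℕ, Level n m} {c : ℤ × ℤ → ℂ} {n : ℕ}

lemma matrix_one_ext {M N : Matrix (Fin 1) (Fin 1) ℂ} (h : M 0 0 = N 0 0) : M = N := by
  ext i j; rw [Subsingleton.elim i 0, Subsingleton.elim j 0, h]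

lemma one_sub_mul_conjTranspose (E : Matrix (Fin 1) (Fin 1) ℂ) :
    (1 - E * Eᴴ) 0 0 = ((1 - ‖E 0 0‖ ^ 2 : ℝ) : ℂ) := by
  simp [Matrix.sub_apply, Matrix.mul_apply, Complex.mul_conj']

lemma edge_cholesky {E : Matrix (Fin 1) (Fin 1) ℂ} (h : ‖E 0 0‖ < 1) :
    UTP (Matrix.of fun _ _ => ((Real.sqrt (1 - ‖E 0 0‖ ^ 2) : ℝ) : ℂ) :
      Matrix (Fin 1) (Fin 1) ℂ) ∧
    1 - E * Eᴴ = (Matrix.of fun _ _ => ((Real.sqrt (1 - ‖E 0 0‖ ^ 2) : ℝ) : ℂ) :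
      Matrix (Fin 1) (Fin 1) ℂ) *
        (Matrix.of fun _ _ => ((Real.sqrt (1 - ‖E 0 0‖ ^ 2) : ℝ) : ℂ))ᴴ := by
  have h0 : 0 < 1 - ‖E 0 0‖ ^ 2 := by nlinarith [norm_nonneg (E 0 0)]
  refine ⟨⟨fun i j hij => absurd hij (by omega), fun i => isPos_ofReal (Real.sqrt_pos.2 h0)⟩, ?_⟩
  apply matrix_one_ext
  rw [one_sub_mul_conjTranspose]
  simp only [Matrix.mul_apply, Matrix.of_apply, Matrix.conjTranspose_apply, Finset.univ_unique,
    Finset.sum_singleton]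
  rw [(isPos_ofReal (Real.sqrt_pos.2 h0)).star_eq, ← Complex.ofReal_mul, Real.mul_self_sqrt h0.le]

lemma norm_lt_one_of_cholesky {A E : Matrix (Fin 1) (Fin 1) ℂ} (hA : UTP A)
    (h : 1 - E * Eᴴ = A * Aᴴ) : ‖E 0 0‖ < 1 := by
  have h1 := congrFun (congrFun h 0) 0
  rw [one_sub_mul_conjTranspose] at h1
  simp only [Matrix.mul_apply, Matrix.conjTranspose_apply, Finset.univ_unique,
    Finset.sum_singleton] at h1
  have h2 := (hA.2 0)
  have h3 := (h2.mul h2).1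
  have h4 : A 0 0 * star (A 0 0) = A 0 0 * A 0 0 := by rw [h2.star_eq]
  have h5 := congrArg Complex.re (h1.trans h4)
  rw [Complex.ofReal_re] at h5
  rw [← h5] at h3
  nlinarith [norm_nonneg (E 0 0)]

/-- The reflection coefficient `⟨z φ_{n,0}, reverse φ_{n,0}⟩`. -/
def gramEdge (lev : ∀ n m : ℕ, Level n m) (c : ℤ × ℤ → ℂ) (n : ℕ) : Matrix (Fin 1) (Fin 1) ℂ :=
  gram c (shiftV (1, 0) (Ph lev n 0)) (revV (n, 0) (Ph lev n 0))

lemma Good.orth_edge (h : Good lev c n 0) : IsOrth c n 0 (Ph lev n 0) := by simpa using h.orth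

lemma Good.orthT_edge (h : Good lev c n 0) : IsOrthT c n 0 (PT lev n 0) := by simpa using h.orthT

/-- The residual of zΦ_{n,0} has squared norm 1 - |Ê|², and it is the only new direction. -/
lemma pd_edge_iff (hc : Herm c) (h : Good lev c n 0) (hpd : PD c n 0) :
    PD c ((n : ℤ) + 1) 0 ↔ ‖gramEdge lev c n 0 0‖ < 1 := by
  constructor
  · intro h1
    obtain ⟨A, hA, hAE⟩ := h.orth_edge.exists_next hc (E := gramEdge lev c n) rfl h1
    exact norm_lt_one_of_cholesky hA hAE
  · intro h1
    obtain ⟨hA, hAE⟩ := edge_cholesky h1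
    exact (h.orth_edge.next hc rfl hA hAE).pd hc (by simpa using hpd)

lemma eq_zero_of_mem_box_neg {f : Laurent} {n : ℤ} (hf : f ∈ box 0 (n, 0 - 1)) : f = 0 :=
  box_eq_bot_of_lt (Or.inr (by simp)) hf

/-- The vector `Φ̃_{n,0}` in terms of `Φ_{n,0}` and `Φ̃_{n-1,0}`. -/
lemma Good.PT_edge (hc : Herm c) (h : Good lev c n 0)
    (hD : IsOrthT c ((n : ℤ) - 1) 0 (PTD lev n 0)) :
    PT lev n 0 = (lev n 0).Jᴴ ⊳ Ph lev n 0 + (lev n 0).GTᴴ ⊳ PTD lev n 0 := by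
  have hJ : (lev n 0).Jᴴ = gram c (PT lev n 0) (Ph lev n 0) := by
    rw [h.J, gram_conjTranspose hc]
  have hG : (lev n 0).GTᴴ = gram c (PT lev n 0) (PTD lev n 0) := by
    rw [h.GT, gram_conjTranspose hc]
  have h1 := h.orth_edge.decompV hc h.orthT_edge.mem
  rw [← hJ] at h1
  have h2 := hD.decompV hc h1
  rw [gram_sub_left, gram_actL_left, gram_eq_zero h.orth_edge.perp hD.mem, ← hG, Matrix.mul_zero,
    sub_zero] at h2
  have h3 : PT lev n 0 - (lev n 0).Jᴴ ⊳ Ph lev n 0 - (lev n 0).GTᴴ ⊳ PTD lev n 0 = 0 := by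
    funext a; exact eq_zero_of_mem_box_neg (h2 a)
  rw [← sub_eq_zero, ← h3]; abel

/-- At m = 0 the vector Φ̃_{n+1,0} is the new polynomial followed by Φ̃_{n,0}, an orthonormal basis
of all polynomials in z of degree at most n+1. As zΦ̃_{n,0} lies in their span, Γ̃¹ satisfies MM† =
1, and this fixes its corner entry. -/
lemma good_edge (hc : Herm c) (h : Good lev c n 0)
    (hD : IsOrthT c ((n : ℤ) - 1) 0 (PTD lev n 0)) (u : ℂ)
    (hlev : lev (n + 1) 0 = edgeStep u (lev n 0)) (hu : gramEdge lev c n 0 0 = u)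
    (hu1 : ‖u‖ < 1) : Good lev c (n + 1) 0 := by
  set E := gramEdge lev c n with hE
  have hE' : E = gram c (shiftV (1, 0) (Ph lev n 0)) (revV (n, 0) (Ph lev n 0)) := rfl
  obtain ⟨hA, hAE⟩ := edge_cholesky (E := E) (by rw [hu]; exact hu1)
  set A : Matrix (Fin 1) (Fin 1) ℂ :=
    Matrix.of fun _ _ => ((Real.sqrt (1 - ‖E 0 0‖ ^ 2) : ℝ) : ℂ) with hAdef
  have eE : (lev (n + 1) 0).E = E := by
    apply matrix_one_ext; rw [hlev, hu]; rfl
  have eA : (lev (n + 1) 0).A = A := by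
    apply matrix_one_ext; rw [hlev, hAdef, hu]; rfl
  have eJ : (lev (n + 1) 0).J = corner 0 (n + 1) := by rw [hlev]; rfl
  have eGT : (lev (n + 1) 0).GT = U (n + 1) := by rw [hlev]; rfl
  have ePh : Ph lev (n + 1) 0 = A⁻¹ ⊳ zResid n 0 E (Ph lev n 0) := by
    funext a
    have h1 := emb_nextPhi (c := c) A E (lev n 0) h.orth a
    have h2 : (lev (n + 1) 0).Phi a = nextPhi (lev (n + 1) 0).A (lev (n + 1) 0).E (lev n 0) a := by
      rw [hlev]; rfl
    rw [Ph, h2, eA, eE, h1]; simp; rfl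
  have ePT : PT lev (n + 1) 0 = Fin.cons (Ph lev (n + 1) 0 0) (PT lev n 0) := by
    funext a
    have h2 : (lev (n + 1) 0).PhiT a = act (corner 0 (n + 1))ᴴ (lev (n + 1) 0).Phi a +
        act (U (n + 1))ᴴ (lev n 0).PhiT a := by rw [hlev]; rfl
    rw [PT, h2, map_add, act, act, map_sum, map_sum]
    simp only [emb_C_mul]
    refine Fin.cases ?_ (fun a => ?_) a
    · rw [Finset.sum_eq_zero (s := (Finset.univ : Finset (Fin (n + 1))))]
      · simp [corner, Ph]
      · intro b _; simp [U, (Fin.succ_ne_zero b).symm]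
    · rw [Finset.sum_eq_zero (s := (Finset.univ : Finset (Fin 1))), zero_add,
        Finset.sum_eq_single a]
      · simp [U, PT]
      · intro b _ hb; simp [U, hb.symm]
      · simp
      · intro b _; simp [corner, (Fin.succ_ne_zero a).symm]
  have ho := h.orth_edge.next hc hE' hA hAE
  have hr := h.orth_edge.recur hc hE' hA hAE
  rw [← ePh] at ho hr
  have hp : Perp c (Ph lev (n + 1) 0) (box 0 (n, 0)) := by simpa using ho.perp
  have hT0 : PT lev (n + 1) 0 0 = Ph lev (n + 1) 0 0 := by rw [ePT]; rfl
  have hTs : ∀ a : Fin (n + 1), PT lev (n + 1) 0 a.succ = PT lev n 0 a := by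
    intro a; rw [ePT]; rfl
  have hpT : ∀ a, ip c (Ph lev (n + 1) 0 0) (PT lev n 0 a) = 0 := fun a =>
    hp 0 _ (h.orthT_edge.mem a)
  have gTT : ∀ a b, ip c (PT lev n 0 a) (PT lev n 0 b) = if a = b then 1 else 0 := fun a b => by
    have := congrFun (congrFun h.orthT_edge.gram a) b
    rwa [Matrix.one_apply] at this
  have gPP : ip c (Ph lev (n + 1) 0 0) (Ph lev (n + 1) 0 0) = 1 := by
    have := congrFun (congrFun ho.gram 0) 0
    rwa [Matrix.one_apply_eq] at this
  have hoT : IsOrthT c ((n : ℤ) + 1) 0 (PT lev (n + 1) 0) := by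
    have hu0 := ho.utp.2 0
    have huT := IsOrth.utp h.orthT_edge
    simp only [coefZ, Matrix.of_apply, UTP, swapV, swapL_apply, Prod.swap_prod_mk] at huT hu0
    refine ⟨by push_cast; ring, ?_, ⟨?_, ?_⟩, ?_, ?_⟩
    · intro a
      rw [swapV, swapL_mem_box]
      refine Fin.cases ?_ (fun a => ?_) a
      · rw [hT0]; exact ho.mem 0
      · rw [hTs]
        exact box_mono (by simp) (by simp) (by simp) (by simp) (h.orthT_edge.mem a)
    · intro i j
      simp only [coefZ, Matrix.of_apply, swapV, swapL_apply, Prod.swap_prod_mk]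
      refine Fin.cases ?_ (fun i => ?_) i
      · intro h; exact absurd h (Fin.not_lt_zero j)
      · rw [hTs]
        refine Fin.cases ?_ (fun j => ?_) j
        · intro _
          exact mem_box.1 (h.orthT_edge.mem i) _ (by simp)
        · intro hij
          have := huT.1 i j (by simpa using hij)
          rw [← this]
          congr 2; simp
    · intro i
      simp only [coefZ, Matrix.of_apply, swapV, swapL_apply, Prod.swap_prod_mk]
      refine Fin.cases ?_ (fun i => ?_) i
      · rw [hT0]; simpa using hu0
      · rw [hTs]
        have := huT.2 i
        convert this using 3; simp
    · rw [gram_swapV]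
      ext a b
      rw [gram, Matrix.of_apply]
      refine Fin.cases ?_ (fun a => ?_) a <;> refine Fin.cases ?_ (fun b => ?_) b
      · rw [hT0, gPP]; simp
      · rw [hT0, hTs, hpT]; simp [(Fin.succ_ne_zero b).symm]
      · rw [hT0, hTs, ip_eq_zero_comm hc (hpT a)]; simp
      · rw [hTs, hTs, gTT]; simp [Matrix.one_apply]
    · intro a g hg
      rw [box_eq_bot_of_lt (Or.inl (by simp)) hg]; simp
  have gGT : gram c (PT lev n 0) (PT lev (n + 1) 0) = U (n + 1) := by
    ext a b
    rw [gram, Matrix.of_apply]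
    refine Fin.cases ?_ (fun b => ?_) b
    · rw [hT0, ip_eq_zero_comm hc (hpT a)]; simp [U, (Fin.succ_ne_zero a).symm]
    · rw [hTs, gTT]; simp [U, eq_comm]
  have gJ : gram c (Ph lev (n + 1) 0) (PT lev (n + 1) 0) = corner 0 (n + 1) := by
    ext a b
    have ha : a = 0 := Fin.ext (by omega)
    rw [ha, gram, Matrix.of_apply]
    refine Fin.cases ?_ (fun b => ?_) b
    · rw [hT0, gPP]; simp [corner]
    · rw [hTs, hpT]; simp [corner, (Fin.succ_ne_zero b).symm]
  have gX : gram c (shiftV (1, 0) (PT lev n 0)) (PT lev n 0) = edgeRows E (lev n 0) := by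
    have e1 : gram c (shiftV (1, 0) (Ph lev n 0)) (PT lev n 0) = E * (lev n 0).J1 := by
      rw [hr.shift_eq, gram_add_left, gram_actL_left, gram_actL_left,
        gram_eq_zero hp h.orthT_edge.mem, h.J1]
      simp
    have e2 : shiftV (1, 0) (PT lev n 0) = (lev n 0).Jᴴ ⊳ shiftV (1, 0) (Ph lev n 0) +
        (lev n 0).GTᴴ ⊳ shiftV (1, 0) (PTD lev n 0) := by
      conv_lhs => rw [h.PT_edge hc hD]
      rw [shiftV_add, shiftV_actL, shiftV_actL]
    rw [e2, gram_add_left, gram_actL_left, gram_actL_left, e1, ← h.G1T, edgeRows,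
      Matrix.mul_assoc]
  have gG1T : gram c (shiftV (1, 0) (PT lev n 0)) (PT lev (n + 1) 0) =
      edgeRows E (lev n 0) * U (n + 1) + Matrix.single 0 0
        ((Real.sqrt (1 - ((edgeRows E (lev n 0) * (edgeRows E (lev n 0))ᴴ) 0 0).re) : ℝ) : ℂ) := by
    have hF : IsOrth (swapM c) 0 (((n : ℤ) + 1) - 1) (swapV (PT lev n 0)) := by
      simpa [IsOrthT] using h.orthT_edge
    have e := gram_swapV c (shiftV (1, 0) (PT lev n 0)) (PT lev (n + 1) 0)
    rw [swapV_shiftV] at e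
    set M := gram c (shiftV (1, 0) (PT lev n 0)) (PT lev (n + 1) 0) with hM
    have hne : ∀ a : Fin n, M a.succ 0 = 0 := by
      intro a
      cases n with
      | zero => exact a.elim0
      | succ n =>
        rw [← e]; exact gram_shift_consecutive_ne hc.swap hF hoT a
    have hpos : IsPos (M 0 0) := by
      rw [← e]; exact gram_shift_consecutive_pos hc.swap hF hoT
    have hMs : ∀ a b, M a b.succ = edgeRows E (lev n 0) a b := by
      intro a b
      rw [← gX, hM, gram, Matrix.of_apply, hTs]; rfl
    have hdec : shiftV (1, 0) (PT lev n 0) = M ⊳ PT lev (n + 1) 0 := by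
      rw [← sub_eq_zero]
      funext a
      refine eq_zero_of_mem_box_neg (n := (n : ℤ) + 1) ?_
      refine hoT.decompV hc (G := shiftV (1, 0) (PT lev n 0)) (fun a => ?_) a
      exact box_mono (by simp) (by simp) (by simp) (by simp)
        (shift_mem_box (1, 0) (h.orthT_edge.mem a))
    have hMM : M * Mᴴ = 1 := by
      have := h.orthT_edge.gram
      rw [← gram_shiftV c (1, 0), hdec, gram_actL_left, gram_actL_right, hoT.gram,
        Matrix.one_mul] at this
      exact this
    have h00 : M 0 0 * star (M 0 0) =
        1 - (edgeRows E (lev n 0) * (edgeRows E (lev n 0))ᴴ) 0 0 := by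
      have := congrFun (congrFun hMM 0) 0
      rw [Matrix.mul_apply, Fin.sum_univ_succ, Matrix.one_apply_eq] at this
      rw [← this, Matrix.mul_apply]
      simp only [Matrix.conjTranspose_apply, hMs]
      ring
    have hre : M 0 0 * star (M 0 0) =
        ((1 - ((edgeRows E (lev n 0) * (edgeRows E (lev n 0))ᴴ) 0 0).re : ℝ) : ℂ) := by
      have e : M 0 0 * star (M 0 0) = ((M 0 0 * star (M 0 0)).re : ℂ) := by
        rw [hpos.star_eq]; exact (hpos.mul hpos).eq_ofReal
      rw [e, h00]; simp
    ext a b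
    rw [Matrix.add_apply]
    refine Fin.cases ?_ (fun b => ?_) b
    · rw [mul_U_apply_zero, zero_add]
      revert a
      refine Fin.cases ?_ fun a => ?_
      · rw [Matrix.single_apply, if_pos ⟨rfl, rfl⟩]
        exact isPos_eq_sqrt hpos hre
      · rw [Matrix.single_apply, if_neg (by simp [(Fin.succ_ne_zero a).symm]), hne]
    · rw [mul_U_apply_succ, hMs, Matrix.single_apply, if_neg (by simp [(Fin.succ_ne_zero b).symm]),
        add_zero]
  have gJ1 : gram c (revV ((n : ℤ) + 1, 0) (Ph lev (n + 1) 0)) (PT lev (n + 1) 0) =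
      nextJ1 A E (corner 0 (n + 1)) (U (n + 1)) (lev n 0) := by
    have h1 := hr.rev_new hc
    have e : (((n : ℤ), (0 : ℤ)) + (1, 0) : ℤ × ℤ) = ((n : ℤ) + 1, 0) := by simp
    rw [e] at h1
    have h2 : revV ((n : ℤ), 0) (Ph lev n 0) = (lev n 0).J1 ⊳ PT lev n 0 := by
      rw [← sub_eq_zero]
      funext a
      refine eq_zero_of_mem_box_neg (n := (n : ℤ)) ?_
      have := h.orthT_edge.decompV hc h.orth_edge.rev_mem a
      have e1 : (lev n 0).J1 = gram c (revV ((n : ℤ), 0) (Ph lev n 0)) (PT lev n 0) := by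
        rw [h.J1]; simp
      rwa [← e1] at this
    rw [h1, gram_sub_left, gram_actL_left, gram_actL_left, gJ, h2, gram_actL_left, gGT, nextJ1,
      ← Matrix.mul_assoc]
    abel
  exact
    { orth := by simpa using ho
      orthT := by simpa using hoT
      K := by ext a; exact a.elim0
      K1 := by ext a; exact a.elim0
      G := by ext a; exact a.elim0
      G1 := by ext a; exact a.elim0
      GT := by rw [eGT]; exact gGT.symm
      G1T := by
        refine Eq.trans ?_ gG1T.symm
        have : (lev (n + 1) 0).G1T = edgeRows (lev (n + 1) 0).E (lev n 0) * U (n + 1) +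
          Matrix.single 0 0 ((Real.sqrt (1 - ((edgeRows (lev (n + 1) 0).E (lev n 0) *
            (edgeRows (lev (n + 1) 0).E (lev n 0))ᴴ) 0 0).re) : ℝ) : ℂ) := by rw [hlev]; rfl
        rw [this, eE]
      J := by rw [eJ]; exact gJ.symm
      J1 := by
        have : (lev (n + 1) 0).J1 = nextJ1 (lev (n + 1) 0).A (lev (n + 1) 0).E
          (lev (n + 1) 0).J (lev (n + 1) 0).GT (lev n 0) := by rw [hlev]; rfl
        rw [this, eA, eE, eJ, eGT, ← gJ1]; simp
      E := fun k hk => by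
        obtain rfl : n = k := by omega
        rw [eE, hE']; simp
      A := fun k hk => by
        obtain rfl : n = k := by omega
        rw [eA, eE]
        exact ⟨hA, by simpa using hr.rec_eq⟩
      ET := fun k hk => absurd hk (by omega)
      AT := fun k hk => absurd hk (by omega) }

/-! ### Level `(0, 0)` -/

lemma pd_zero_iff : PD c 0 0 ↔ 0 < (c 0).re := by
  constructor
  · intro h
    have := h (Finsupp.single 0 1) (single_mem_box (by simp)) (by simp)
    simpa using this
  · intro h f hf hne
    have hf' : f = Finsupp.single 0 (f 0) := by
      ext x
      by_cases hx : x = 0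
      · rw [hx]; simp
      · rw [Finsupp.single_apply, if_neg (Ne.symm hx)]
        refine mem_box.1 hf x fun h => hx ?_
        ext <;> simp at h ⊢ <;> omega
    have h0 : f 0 ≠ 0 := fun h0 => hne (by rw [hf', h0, Finsupp.single_zero])
    rw [hf', ip_single, sub_self, Complex.star_def, Complex.mul_conj, Complex.re_ofReal_mul]
    exact mul_pos (Complex.normSq_pos.2 h0) h

lemma good_zero (hc : Herm c) (h : 0 < (c 0).re) (hlev : lev 0 0 = baseLevel (c 0)) :
    Good lev c 0 0 := by
  have him : (c 0).im = 0 := by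
    have := congrArg Complex.im (hc 0); simp at this; linarith
  set r : ℂ := ((1 / Real.sqrt (c 0).re : ℝ) : ℂ) with hr
  have hrpos : IsPos r := isPos_ofReal (one_div_pos.2 (Real.sqrt_pos.2 h))
  have ePh : Ph lev 0 0 = fun _ => Finsupp.single 0 r := by
    funext a; rw [Ph, hlev]
    change emb (MvPolynomial.C r) = _
    rw [← MvPolynomial.monomial_zero', emb_monomial]; rfl
  have ePT : PT lev 0 0 = fun _ => Finsupp.single 0 r := by
    funext a; rw [PT, hlev]
    change emb (MvPolynomial.C r) = _
    rw [← MvPolynomial.monomial_zero', emb_monomial]; rfl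
  have hn : r * star r * c 0 = 1 := by
    rw [hrpos.star_eq, show c 0 = ((c 0).re : ℂ) from Complex.ext (by simp) (by simp [him]), hr,
      ← Complex.ofReal_mul, ← Complex.ofReal_mul]
    rw [div_mul_div_comm, Real.mul_self_sqrt h.le]
    rw [one_mul, one_div, inv_mul_cancel₀ h.ne', Complex.ofReal_one]
  have hg : ∀ c', c' 0 = c 0 → gram c' (fun _ : Fin 1 => (Finsupp.single 0 r : Laurent))
      (fun _ : Fin 1 => (Finsupp.single 0 r : Laurent)) = 1 := by
    intro c' h
    apply matrix_one_ext
    rw [gram, Matrix.of_apply, ip_single, sub_self, h, hn]; simp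
  have ho : ∀ c', c' 0 = c 0 → IsOrth c' 0 0 fun _ : Fin 1 => (Finsupp.single 0 r : Laurent) := by
    intro c' h
    refine ⟨by simp, fun _ => single_mem_box (by simp), ⟨fun i j hij => absurd hij (by omega),
      fun i => ?_⟩, hg c' h, fun a g hg => ?_⟩
    · rw [Subsingleton.elim i 0]
      simp only [coefZ, Matrix.of_apply, Fin.val_zero, Nat.cast_zero, sub_zero]
      rw [← Prod.zero_eq_mk, Finsupp.single_eq_same]; exact hrpos
    · rw [box_eq_bot_of_lt (Or.inl (by simp)) hg]; simp
  exact
    { orth := by rw [ePh]; exact ho c rfl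
      orthT := by
        rw [ePT, IsOrthT]
        have : swapV (fun _ : Fin 1 => (Finsupp.single 0 r : Laurent)) =
            fun _ => Finsupp.single 0 r := by funext a; simp [swapV]
        rw [this]; exact ho _ rfl
      K := by ext a; exact a.elim0
      K1 := by ext a; exact a.elim0
      G := by ext a; exact a.elim0
      G1 := by ext a; exact a.elim0
      GT := by ext a; exact a.elim0
      G1T := by ext a; exact a.elim0
      J := by rw [ePh, ePT, hg c rfl, hlev]; rfl
      J1 := by
        have : revV (((0 : ℕ) : ℤ), ((0 : ℕ) : ℤ)) (fun _ : Fin 1 => (Finsupp.single 0 r : Laurent))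
            = fun _ => Finsupp.single 0 r := by
          funext a
          simp only [revV, rev_single, hrpos.star_eq, Nat.cast_zero, sub_zero]; rfl
        rw [ePh, ePT, this, hg c rfl, hlev]; rfl
      E := fun k hk => absurd hk (by omega)
      A := fun k hk => absurd hk (by omega)
      ET := fun k hk => absurd hk (by omega)
      AT := fun k hk => absurd hk (by omega) }

end edge

/-! ### Moments and parameters -/

lemma ip_congr {c c' : ℤ × ℤ → ℂ} {f g : Laurent}
    (h : ∀ x y, f x ≠ 0 → g y ≠ 0 → c (x - y) = c' (x - y)) : ip c f g = ip c' f g := by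
  unfold ip
  refine Finsupp.sum_congr fun x hx => Finsupp.sum_congr fun y hy => ?_
  rw [h x y (Finsupp.mem_support_iff.1 hx) (Finsupp.mem_support_iff.1 hy)]

lemma ip_congr_box {c c' : ℤ × ℤ → ℂ} {n m : ℤ}
    (h : ∀ x : ℤ × ℤ, |x.1| ≤ n → |x.2| ≤ m → c x = c' x) {f g : Laurent} {lo lo' hi hi' : ℤ × ℤ}
    (hf : f ∈ box lo hi) (hg : g ∈ box lo' hi') (h1 : hi.1 - lo'.1 ≤ n) (h2 : hi'.1 - lo.1 ≤ n)
    (h3 : hi.2 - lo'.2 ≤ m) (h4 : hi'.2 - lo.2 ≤ m) : ip c f g = ip c' f g := by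
  refine ip_congr fun x y hx hy => h _ ?_ ?_
  all_goals
    have hx' := not_imp_comm.1 (mem_box.1 hf x) hx
    have hy' := not_imp_comm.1 (mem_box.1 hg y) hy
    rw [abs_le]
    simp only [Prod.fst_sub, Prod.snd_sub]
    omega

lemma ip_sub_moment (c c' : ℤ × ℤ → ℂ) (f g : Laurent) :
    ip (c - c') f g = ip c f g - ip c' f g := by
  unfold ip Finsupp.sum
  rw [← Finset.sum_sub_distrib]
  refine Finset.sum_congr rfl fun x _ => ?_
  rw [← Finset.sum_sub_distrib]
  exact Finset.sum_congr rfl fun y _ => by simp only [Pi.sub_apply]; ring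

lemma ip_eq_single {c : ℤ × ℤ → ℂ} {f g : Laurent} (X Y : ℤ × ℤ)
    (h : ∀ x y, f x ≠ 0 → g y ≠ 0 → (x, y) ≠ (X, Y) → c (x - y) = 0) :
    ip c f g = f X * star (g Y) * c (X - Y) := by
  unfold ip Finsupp.sum
  rw [Finset.sum_eq_single X]
  · simp only
    rw [Finset.sum_eq_single Y]
    · intro y hy hne
      by_cases hX : f X = 0
      · simp [hX]
      · rw [h X y hX (Finsupp.mem_support_iff.1 hy) (by simp [hne]), mul_zero]
    · intro hY; rw [Finsupp.notMem_support_iff.1 hY]; simp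
  · intro x hx hne
    refine Finset.sum_eq_zero fun y hy => ?_
    simp only
    rw [h x y (Finsupp.mem_support_iff.1 hx) (Finsupp.mem_support_iff.1 hy) (by simp [hne]),
      mul_zero]
  · intro hX; rw [Finsupp.notMem_support_iff.1 hX]; simp

section params
variable (lev : ∀ n m : ℕ, Level n m)

/-- The combination of `Φ̃_{n,m+1}` with coefficients `0, …, 0, 1` at `z^n w^(m+1), …, w^(m+1)`. -/
def relVec (n m : ℕ) : Laurent := ((lev n (m + 1)).leadT⁻¹ ⊳ PT lev n (m + 1)) (Fin.last n)

/-- The vectors whose product is the first parameter at a level. -/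
def posVecs : ℕ → ℕ → Laurent × Laurent
  | 0, 0 => (Finsupp.single 0 1, Finsupp.single 0 1)
  | n + 1, 0 => (shift (1, 0) (Ph lev n 0 0), rev (n, 0) (Ph lev n 0 0))
  | 0, m + 1 => (shift (0, 1) (PT lev 0 m 0), rev (0, m) (PT lev 0 m 0))
  | n + 1, m + 1 => (shift (0, 1) (Ph lev (n + 1) m 0), rev (n, (m : ℤ) + 1) (PT lev n (m + 1) 0))

/-- The vectors whose product is the second parameter at a level. -/
def negVecs : ℕ → ℕ → Laurent × Laurent
  | n + 1, m + 1 =>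
    if n = 0 ∧ m = 0 then (Ph lev (n + 1) m 0, PT lev n (m + 1) 0)
    else (Finsupp.single ((n : ℤ) + 1, 0) 1, relVec lev n m)
  | _, _ => 0

/-- The first parameter at a level. -/
def posParam (u : ℤ → ℤ → ℂ) : ℕ → ℕ → ℂ
  | n + 1, m + 1 => star (u (n + 1) (m + 1))
  | n, m => u n m

/-- The second parameter at a level. -/
def negParam (u : ℤ → ℤ → ℂ) : ℕ → ℕ → ℂ
  | n + 1, m + 1 => if n = 0 ∧ m = 0 then star (u 1 (-1)) else u (-(n + 1)) (m + 1)
  | _, _ => 0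

/-- The form with moments `c` has the parameters `u` at a level. -/
def ParamEq (c : ℤ × ℤ → ℂ) (u : ℤ → ℤ → ℂ) (n m : ℕ) : Prop :=
  ip c (posVecs lev n m).1 (posVecs lev n m).2 = posParam u n m ∧
  ip c (negVecs lev n m).1 (negVecs lev n m).2 = negParam u n m

variable {lev} {c : ℤ × ℤ → ℂ} {n m : ℕ}

lemma relK_last (hc : Herm c) (h : LowerGood lev c (n + 1) (m + 1)) :
    relK lev c n m (Fin.last m) (Fin.last n) =
      ip c (Finsupp.single ((n : ℤ) + 1, 0) 1) (relVec lev n m) := by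
  rw [relK_eq hc h, ← Matrix.conjTranspose_nonsing_inv, ← gram_actL_right, gram, Matrix.of_apply,
    relVec]
  simp

lemma LowerGood.relVec_mem (h : LowerGood lev c (n + 1) (m + 1)) :
    relVec lev n m ∈ box 0 (n, (m : ℤ) + 1) := actL_mem h.orthT_left.mem _

lemma LowerGood.relVec_apply (h : LowerGood lev c (n + 1) (m + 1)) :
    relVec lev n m (0, (m : ℤ) + 1) = 1 := by
  have h1 := congrFun (congrFun h.utp_leadT.inv_mul (Fin.last n)) (Fin.last n)
  rw [Matrix.one_apply_eq] at h1
  rw [relVec, actL_apply, ← h1, Matrix.mul_apply]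
  refine Finset.sum_congr rfl fun b _ => ?_
  rw [leadT_eq]
  simp [coefZ, swapV]

/-- The product of `f` and `g` involves one moment of degree `k`, and otherwise only moments of
smaller degree. -/
structure LeadAt (f g : Laurent) (X Y : ℤ × ℤ) (k : ℤ) : Prop where
  left : f X ≠ 0
  right : g Y ≠ 0
  lt : ∀ x y, f x ≠ 0 → g y ≠ 0 → (x, y) ≠ (X, Y) → |(x - y).1| + |(x - y).2| < k

lemma leadAt_of_box {f g : Laurent} {lo hi lo' hi' X Y : ℤ × ℤ} {k : ℤ} (hf : f ∈ box lo hi)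
    (hg : g ∈ box lo' hi') (hX : f X ≠ 0) (hY : g Y ≠ 0)
    (h : ∀ x y : ℤ × ℤ, lo.1 ≤ x.1 ∧ x.1 ≤ hi.1 ∧ lo.2 ≤ x.2 ∧ x.2 ≤ hi.2 →
      lo'.1 ≤ y.1 ∧ y.1 ≤ hi'.1 ∧ lo'.2 ≤ y.2 ∧ y.2 ≤ hi'.2 →
      ¬(x.1 = X.1 ∧ x.2 = X.2 ∧ y.1 = Y.1 ∧ y.2 = Y.2) →
      |x.1 - y.1| + |x.2 - y.2| < k) : LeadAt f g X Y k :=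
  ⟨hX, hY, fun x y hx hy hne => h x y (not_imp_comm.1 (mem_box.1 hf x) hx)
    (not_imp_comm.1 (mem_box.1 hg y) hy) fun h => hne (by
      obtain ⟨h1, h2, h3, h4⟩ := h
      rw [Prod.mk.injEq]; exact ⟨Prod.ext h1 h2, Prod.ext h3 h4⟩)⟩

lemma Good.Ph_top (h : Good lev c n m) : Ph lev n m 0 (n, m) ≠ 0 := by
  have := (h.orth.utp.2 0).ne_zero
  simpa [coefZ] using this

lemma Good.PT_top (h : Good lev c n m) : PT lev n m 0 (n, m) ≠ 0 := by
  have := ((IsOrth.utp h.orthT).2 0).ne_zero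
  simpa [coefZ, swapV] using this

/-- Among all pairs of exponents only z^N w^M against 1 reaches total degree N + M, so this
parameter determines the moment at (N, M) from smaller ones. -/
lemma posVecs_mem {N M : ℕ} (h : LowerGood lev c N M) :
    (posVecs lev N M).1 ∈ box 0 (N, M) ∧ (posVecs lev N M).2 ∈ box 0 (N, M) ∧
      LeadAt (posVecs lev N M).1 (posVecs lev N M).2 (N, M) 0 (N + M) := by
  match N, M with
  | 0, 0 =>
    have h0 : (Finsupp.single 0 1 : Laurent) ∈ box 0 0 := single_mem_box (by simp)
    refine ⟨h0, h0, leadAt_of_box h0 h0 (by simp [posVecs, ← Prod.zero_eq_mk])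
      (by simp [posVecs]) ?_⟩
    intro x y hx hy hne; simp at hx hy hne; omega
  | n + 1, 0 =>
    have hg := (h n 0 (by omega) le_rfl (by simp))
    have h1 : shift (1, 0) (Ph lev n 0 0) ∈ box (1, 0) ((n : ℤ) + 1, 0) := by
      simpa using shift_mem_box (1, 0) (hg.orth.mem 0)
    have h2 : rev (n, 0) (Ph lev n 0 0) ∈ box 0 (n, 0) := by
      simpa using rev_mem_box ((n : ℤ), (0 : ℤ)) (hg.orth.mem 0)
    have ht := hg.Ph_top
    refine ⟨box_mono (by simp) (by simp) (by simp) (by simp) h1,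
      box_mono (by simp) (by simp) (by simp) (by simp) h2,
      leadAt_of_box h1 h2 (by simpa [posVecs] using ht) (by simpa [posVecs] using ht) ?_⟩
    intro x y hx hy hne; simp at hx hy hne ⊢
    rcases abs_cases (x.1 - y.1) with h | h <;> rcases abs_cases (x.2 - y.2) with h' | h' <;> omega
  | 0, m + 1 =>
    have hg := (h 0 m le_rfl (by omega) (by simp))
    have h1 : shift (0, 1) (PT lev 0 m 0) ∈ box (0, 1) (0, (m : ℤ) + 1) := by
      simpa using shift_mem_box (0, 1) (hg.orthT.mem 0)
    have h2 : rev (0, m) (PT lev 0 m 0) ∈ box 0 (0, m) := by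
      simpa using rev_mem_box ((0 : ℤ), (m : ℤ)) (hg.orthT.mem 0)
    have ht := hg.PT_top
    refine ⟨box_mono (by simp) (by simp) (by simp) (by simp) h1,
      box_mono (by simp) (by simp) (by simp) (by simp) h2,
      leadAt_of_box h1 h2 (by simpa [posVecs] using ht) (by simpa [posVecs] using ht) ?_⟩
    intro x y hx hy hne; simp at hx hy hne ⊢
    rcases abs_cases (x.1 - y.1) with h | h <;> rcases abs_cases (x.2 - y.2) with h' | h' <;> omega
  | n + 1, m + 1 =>
    have h1 : shift (0, 1) (Ph lev (n + 1) m 0) ∈ box (0, 1) ((n : ℤ) + 1, (m : ℤ) + 1) := by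
      simpa using shift_mem_box (0, 1) (h.orth_down.mem 0)
    have h2 : rev (n, (m : ℤ) + 1) (PT lev n (m + 1) 0) ∈ box 0 (n, (m : ℤ) + 1) := by
      simpa using rev_mem_box (n, (m : ℤ) + 1) (h.orthT_left.mem 0)
    have ht := h.down.Ph_top
    have ht' := h.left.PT_top
    refine ⟨box_mono (by simp) (by simp) (by simp) (by simp) h1,
      box_mono (by simp) (by simp) (by simp) (by simp) h2,
      leadAt_of_box h1 h2 (by simpa [posVecs] using ht) (by simpa [posVecs] using ht') ?_⟩
    intro x y hx hy hne; simp at hx hy hne ⊢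
    rcases abs_cases (x.1 - y.1) with h | h <;> rcases abs_cases (x.2 - y.2) with h' | h' <;> omega

/-- Here the extreme pair is z^{n+1} against w^{m+1}, so this parameter determines the moment at
(n+1, -(m+1)). -/
lemma negVecs_mem (h : LowerGood lev c (n + 1) (m + 1)) :
    (negVecs lev (n + 1) (m + 1)).1 ∈ box 0 ((n : ℤ) + 1, (m : ℤ) + 1) ∧
    (negVecs lev (n + 1) (m + 1)).2 ∈ box 0 ((n : ℤ) + 1, (m : ℤ) + 1) ∧
      LeadAt (negVecs lev (n + 1) (m + 1)).1 (negVecs lev (n + 1) (m + 1)).2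
        ((n : ℤ) + 1, 0) (0, (m : ℤ) + 1) (((n : ℤ) + 1) + ((m : ℤ) + 1)) := by
  rw [negVecs]
  split_ifs with h0
  · obtain ⟨rfl, rfl⟩ := h0
    have h1 : Ph lev (0 + 1) 0 0 ∈ box 0 (1, 0) := by simpa using h.orth_down.mem 0
    have h2 : PT lev 0 (0 + 1) 0 ∈ box 0 (0, 1) := by simpa using h.orthT_left.mem 0
    have ht := h.down.Ph_top
    have ht' := h.left.PT_top
    refine ⟨box_mono (by simp) (by simp) (by simp) (by simp) h1,
      box_mono (by simp) (by simp) (by simp) (by simp) h2,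
      leadAt_of_box h1 h2 (by simpa using ht) (by simpa using ht') ?_⟩
    intro x y hx hy hne; simp at hx hy hne ⊢
    rcases abs_cases (x.1 - y.1) with h | h <;> rcases abs_cases (x.2 - y.2) with h' | h' <;> omega
  · have h1 : (Finsupp.single ((n : ℤ) + 1, 0) 1 : Laurent) ∈
        box ((n : ℤ) + 1, 0) ((n : ℤ) + 1, 0) := single_mem_box (by simp)
    refine ⟨single_mem_box (by simp; omega),
      box_mono (by simp) (by simp) (by simp) (by simp) h.relVec_mem,
      leadAt_of_box h1 h.relVec_mem (by simp) (by simp [h.relVec_apply]) ?_⟩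
    intro x y hx hy hne; simp at hx hy hne ⊢
    rcases abs_cases (x.1 - y.1) with h | h <;> rcases abs_cases (x.2 - y.2) with h' | h' <;> omega

end params

/-! ### One step of the construction -/

section step
variable {u : ℤ → ℤ → ℂ} {c : ℤ × ℤ → ℂ}

lemma level_zero_zero : level u 0 0 = baseLevel (u 0 0) := by rw [level]

lemma level_succ_zero (n : ℕ) : level u (n + 1) 0 = edgeStep (u (n + 1) 0) (level u n 0) := by
  rw [level]

lemma level_zero_succ (m : ℕ) :
    level u 0 (m + 1) = (edgeStep (u 0 (m + 1)) (level u 0 m).swap).swap := by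
  rw [level]

lemma level_succ_succ (n m : ℕ) :
    level u (n + 1) (m + 1) = innerStep u (level u n (m + 1)) (level u (n + 1) m) := by
  rw [level]

lemma ParamEq.matK_eq (hc : Herm c) {n m : ℕ} (h : LowerGood (level u) c (n + 1) (m + 1))
    (hp : ParamEq (level u) c u (n + 1) (m + 1)) :
    matK u (level u n (m + 1)) (level u (n + 1) m) = gramK (level u) c n m := by
  have h2 := hp.2
  rw [negVecs, negParam] at h2
  by_cases h0 : n = 0 ∧ m = 0
  · rw [if_pos h0, if_pos h0] at h2
    obtain ⟨rfl, rfl⟩ := h0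
    apply matrix_one_ext
    rw [matK, if_pos ⟨rfl, rfl⟩, Matrix.of_apply, ← h2]
    rfl
  · rw [if_neg h0, if_neg h0] at h2
    exact Bicircle.matK_eq hc h u h0 (by rw [relK_last hc h, h2])

/-- The positivity condition at a level is the positive definiteness of the form, and then the
level consists of the orthonormal polynomials of the form. -/
theorem step (hc : Herm c) {N M : ℕ}
    (hlow : ∀ i j : ℕ, i ≤ N → j ≤ M → (i, j) ≠ (N, M) → Good (level u) c i j ∧ PD c i j)
    (hp : ParamEq (level u) c u N M) :
    (Positivity u N M ↔ PD c N M) ∧ (PD c N M → Good (level u) c N M) := by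
  have hlg : LowerGood (level u) c N M := fun i j hi hj hij => (hlow i j hi hj hij).1
  match N, M with
  | 0, 0 =>
    have h1 := hp.1
    simp only [posVecs, ip_single, posParam] at h1
    have h2 : c 0 = u 0 0 := by simpa using h1
    refine ⟨?_, fun h => ?_⟩
    · rw [Positivity, ← h2]; exact pd_zero_iff.symm
    · exact good_zero hc (pd_zero_iff.1 h) (by rw [h2, level_zero_zero])
  | n + 1, 0 =>
    obtain ⟨hg, hpd⟩ := hlow n 0 (by omega) le_rfl (by simp)
    have h1 : gramEdge (level u) c n 0 0 = u (n + 1) 0 := by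
      have := hp.1
      simp only [posVecs, posParam] at this
      rw [← Nat.cast_succ, ← Nat.cast_zero (R := ℤ), ← this]; rfl
    have hE : (level u (n + 1) 0).E 0 0 = u (n + 1) 0 := by rw [level_succ_zero]; rfl
    have hiff := pd_edge_iff hc hg hpd
    rw [h1] at hiff
    have hiff' : PD c (n + 1 : ℕ) (0 : ℕ) ↔ ‖u (n + 1) 0‖ < 1 := by simpa using hiff
    refine ⟨?_, fun h => ?_⟩
    · rw [Positivity, hE]; exact hiff'.symm
    · refine good_edge hc hg ?_ _ (level_succ_zero n) h1 (hiff'.1 h)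
      exact isOrthT_PTD fun k hk => hlg k 0 (by omega) le_rfl (by simp; omega)
  | 0, m + 1 =>
    obtain ⟨hg, hpd⟩ := hlow 0 m le_rfl (by omega) (by simp)
    have hgs := hg.swap hc
    have h1 : gramEdge (swapFam (level u)) (swapM c) m 0 0 = u 0 (m + 1) := by
      have := hp.1
      simp only [posVecs, posParam] at this
      rw [gramEdge, Ph_swapFam]
      have e := gram_swapV c (shiftV (0, 1) (PT (level u) 0 m)) (revV (0, (m : ℤ)) (PT (level u) 0 m))
      rw [swapV_shiftV, swapV_revV] at e
      refine (congrFun (congrFun e 0) 0).trans ?_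
      rw [← Nat.cast_succ, ← Nat.cast_zero (R := ℤ), ← this]; rfl
    have hlev : swapFam (level u) (m + 1) 0 = edgeStep (u 0 (m + 1)) (swapFam (level u) m 0) := by
      rw [swapFam, level_zero_succ, Level.swap_swap]; rfl
    have hE : (level u 0 (m + 1)).ET 0 0 = u 0 (m + 1) := by rw [level_zero_succ]; rfl
    have hiff := pd_edge_iff hc.swap hgs hpd.swap
    rw [h1] at hiff
    have hiff' : PD c (0 : ℕ) (m + 1 : ℕ) ↔ ‖u 0 (m + 1)‖ < 1 := by
      rw [← hiff]
      constructor
      · intro h; simpa using h.swap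
      · intro h; have := h.swap; rw [swapM_swapM] at this; simpa using this
    refine ⟨?_, fun h => ?_⟩
    · rw [Positivity, hE]; exact hiff'.symm
    · have hgN := good_edge hc.swap hgs (isOrthT_PTD fun k hk =>
        (hlg 0 k le_rfl (by omega) (by simp; omega)).swap hc) _ hlev h1 (hiff'.1 h)
      have := hgN.swap hc.swap
      rwa [swapFam_swapFam, swapM_swapM] at this
  | n + 1, m + 1 =>
    have hK := hp.matK_eq hc hlg
    have hK1 : matK1 u (level u n (m + 1)) (level u (n + 1) m) = gramK1 (level u) c n m :=
      matK1_eq hc hlg u hp.1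
    have hpd : PD c n ((m : ℤ) + 1) := by
      simpa using (hlow n (m + 1) (by omega) le_rfl (by simp)).2
    have hpd' : PD c ((n : ℤ) + 1) m := by
      simpa using (hlow (n + 1) m le_rfl (by omega) (by simp)).2
    have hgood : PD c ((n : ℤ) + 1) ((m : ℤ) + 1) → Good (level u) c (n + 1) (m + 1) := fun h =>
      good_inner hc hlg hpd hpd' h u (level_succ_succ n m) hK hK1
    have eK : (level u (n + 1) (m + 1)).K = gramK (level u) c n m := by
      rw [level_succ_succ, ← hK]; rfl
    have eK1 : (level u (n + 1) (m + 1)).K1 = gramK1 (level u) c n m := by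
      rw [level_succ_succ, ← hK1]; rfl
    have eG : (level u (n + 1) (m + 1)).G =
        upperCholesky (1 - gramK (level u) c n m * (gramK (level u) c n m)ᴴ) * U (m + 1) := by
      rw [level_succ_succ, ← hK]; rfl
    -- Forwards, ‖K‖ < 1 provides the Cholesky factor needed by `LowerGood.pd`. Backwards, the new
    -- orthonormal vector yields both the factor and the bound on H³.
    have key : Positivity u (n + 1) (m + 1) ↔ PD c ((n : ℤ) + 1) ((m : ℤ) + 1) := by
      rw [Positivity, opNorm_lt_one_iff, eK, eK1, eG]
      constructor
      · rintro ⟨h1, h2⟩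
        obtain ⟨hB, hBK⟩ := isUpperCholesky_upperCholesky (exists_utp h1)
        exact hlg.pd hc hpd hpd' hB hBK h2
      · intro h
        have hg := hgood h
        have ho : IsOrth c ((n : ℤ) + 1) ((m : ℤ) + 1) (Ph (level u) (n + 1) (m + 1)) := by
          simpa using hg.orth
        obtain ⟨B, hB, hBK, hBG⟩ := hlg.exists_cholesky hc hpd ho
        refine ⟨by rw [hBK]; exact hB.posDef, ?_⟩
        rw [← hlg.gram_eq_cholesky hc hpd ho]
        exact (hlg.gram_eq_matG1 hc hpd hpd' ho).2
    exact ⟨by simpa using key, fun h => hgood (by simpa using h)⟩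

end step

/-! ### The moments determined by the parameters -/

section moments
variable (u : ℤ → ℤ → ℂ)

/-- The value of a new moment. -/
def newMoment (c : ℤ × ℤ → ℂ) (x : ℤ × ℤ) : ℂ :=
  let N := x.1.natAbs
  let M := x.2.natAbs
  let P := posVecs (level u) N M
  let Q := negVecs (level u) N M
  -- In the recursion c vanishes from total degree N + M on, so `ip c P.1 P.2` lacks exactly the
  -- leading term; the quotient solves the linear equation for the new moment.
  let v := (posParam u N M - ip c P.1 P.2) / (P.1 (N, M) * star (P.2 0))
  let w := (negParam u N M - ip c Q.1 Q.2) / (Q.1 (N, 0) * star (Q.2 (0, M)))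
  if 0 ≤ x.1 ∧ 0 ≤ x.2 then v
  else if x.1 ≤ 0 ∧ x.2 ≤ 0 then star v
  else if 0 ≤ x.1 then w else star w

/-- The moments of total degree less than `k`. -/
def momentStage : ℕ → ℤ × ℤ → ℂ
  | 0 => 0
  | k + 1 => fun x =>
    if x.1.natAbs + x.2.natAbs = k then newMoment u (momentStage k) x else momentStage k x

/-- The moments determined by the parameters. -/
def moment (x : ℤ × ℤ) : ℂ := newMoment u (momentStage u (x.1.natAbs + x.2.natAbs)) x

lemma momentStage_of_le {k : ℕ} {x : ℤ × ℤ} (h : k ≤ x.1.natAbs + x.2.natAbs) :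
    momentStage u k x = 0 := by
  induction k with
  | zero => rfl
  | succ k ih =>
    simp only [momentStage]
    rw [if_neg (by omega), ih (by omega)]

lemma momentStage_of_lt {k : ℕ} {x : ℤ × ℤ} (h : x.1.natAbs + x.2.natAbs < k) :
    momentStage u k x = moment u x := by
  induction k with
  | zero => omega
  | succ k ih =>
    simp only [momentStage]
    by_cases hk : x.1.natAbs + x.2.natAbs = k
    · rw [if_pos hk, moment, hk]
    · rw [if_neg hk, ih (by omega)]

variable {u}

lemma herm_moment (hu : ∀ i j : ℤ, u (-i) (-j) = star (u i j)) : Herm (moment u) := by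
  intro x
  have e1 : (-x).1.natAbs = x.1.natAbs := by simp
  have e2 : (-x).2.natAbs = x.2.natAbs := by simp
  by_cases hx : x = 0
  · subst hx
    have h0 : star (u 0 0) = u 0 0 := by rw [← hu]; simp
    simp [moment, newMoment, posVecs, posParam, momentStage, ← Prod.zero_eq_mk]
    simpa using h0.symm
  · have hx' : x.1 ≠ 0 ∨ x.2 ≠ 0 := by
      by_contra! h; exact hx (Prod.ext h.1 h.2)
    simp only [moment, newMoment, e1, e2]
    simp only [Prod.fst_neg, Prod.snd_neg]
    by_cases h1 : 0 ≤ x.1 ∧ 0 ≤ x.2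
    · rw [if_neg (by omega), if_pos (by omega), if_pos h1]
    · rw [if_neg h1]
      by_cases h2 : x.1 ≤ 0 ∧ x.2 ≤ 0
      · rw [if_pos (by omega), if_pos h2, star_star]
      · rw [if_neg (by omega), if_neg (by omega), if_neg h2]
        by_cases h3 : 0 ≤ x.1
        · rw [if_pos h3, if_neg (by omega)]
        · rw [if_neg h3, if_pos (by omega), star_star]

/-- The moments and their stage k agree below total degree k, and only one pair of exponents reaches
that degree. -/
lemma ip_moment_of_leadAt {f g : Laurent} {X Y : ℤ × ℤ} {k : ℕ} (h : LeadAt f g X Y k)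
    (hk : (X - Y).1.natAbs + (X - Y).2.natAbs = k) :
    ip (moment u) f g = ip (momentStage u k) f g + f X * star (g Y) * moment u (X - Y) := by
  have h1 : ip (moment u - momentStage u k) f g =
      f X * star (g Y) * (moment u - momentStage u k) (X - Y) :=
    ip_eq_single X Y fun x y hx hy hne => by
      have := h.lt x y hx hy hne
      rw [Int.abs_eq_natAbs, Int.abs_eq_natAbs] at this
      rw [Pi.sub_apply, momentStage_of_lt u (by omega), sub_self]
  rw [ip_sub_moment, Pi.sub_apply, momentStage_of_le u hk.ge, sub_zero] at h1
  rw [← h1]; ring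

/-- The form c serves only to guarantee the degrees and nonzero leading coefficients of vectors that
depend on u alone; the equation for the moments then holds by their definition. -/
lemma paramEq_moment {N M : ℕ} {c : ℤ × ℤ → ℂ} (h : LowerGood (level u) c N M) :
    ParamEq (level u) (moment u) u N M := by
  refine ⟨?_, ?_⟩
  · obtain ⟨-, -, hl⟩ := posVecs_mem h
    rw [ip_moment_of_leadAt (k := N + M) (by simpa using hl) (by simp), sub_zero, moment,
      newMoment]
    simp only [Int.natAbs_natCast, Nat.cast_nonneg, and_self, if_true]
    rw [mul_div_cancel₀ _ (mul_ne_zero hl.left (star_ne_zero.2 hl.right))]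
    ring
  · match N, M with
    | 0, M => simp [negVecs, negParam]
    | n + 1, 0 => simp [negVecs, negParam]
    | n + 1, m + 1 =>
      obtain ⟨-, -, hl⟩ := negVecs_mem h
      rw [ip_moment_of_leadAt (k := (n + 1) + (m + 1)) (by simpa using hl) (by simp; omega), moment,
        newMoment]
      have e1 : ((((n : ℤ) + 1, (0 : ℤ)) - ((0 : ℤ), (m : ℤ) + 1)) : ℤ × ℤ).1.natAbs = n + 1 := by
        simp; omega
      have e2 : ((((n : ℤ) + 1, (0 : ℤ)) - ((0 : ℤ), (m : ℤ) + 1)) : ℤ × ℤ).2.natAbs = m + 1 := by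
        simp; omega
      simp only [e1, e2]
      rw [if_neg (by simp; omega), if_neg (by simp), if_pos (by simp; omega)]
      push_cast
      rw [mul_div_cancel₀ _ (mul_ne_zero hl.left (star_ne_zero.2 hl.right))]
      ring

end moments

/-! ### Strips on which the recurrence coefficients vanish -/

lemma posVecs_swapFam (lev : ∀ n m : ℕ, Level n m) (c : ℤ × ℤ → ℂ) (n m : ℕ) :
    ip (swapM c) (posVecs (swapFam lev) m n).1 (posVecs (swapFam lev) m n).2 =
      ip c (posVecs lev n m).1 (posVecs lev n m).2 := by
  match n, m with
  | 0, 0 => simp [posVecs, swapM]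
  | n + 1, 0 =>
    simp only [posVecs, PT_swapFam, swapV]
    rw [← ip_swapL c, swapL_shift, swapL_rev]; rfl
  | 0, m + 1 =>
    simp only [posVecs, Ph_swapFam, swapV]
    rw [← ip_swapL c, swapL_shift, swapL_rev]; rfl
  | n + 1, m + 1 =>
    exact congrFun (congrFun (gramK1_swap (lev := lev) (c := c) (n := n) (m := m)) 0) 0

/-- The recurrence coefficients vanish on the strip of the levels `(n, j)`, `j ≥ m`. -/
structure Strip (lev : ∀ n m : ℕ, Level n m) (c : ℤ × ℤ → ℂ) (n m : ℕ) : Prop where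
  good : ∀ k ≤ n, ∀ j, Good lev c k j
  pd : ∀ j : ℕ, PD c n j
  K : ∀ j, m ≤ j → (lev n j).K = 0
  ET : ∀ k, k + 1 = n → ∀ j, m ≤ j → (lev k (j + 1)).ET = 0
  par : ∀ j, m ≤ j → ip c (posVecs lev n (j + 1)).1 (posVecs lev n (j + 1)).2 = 0

lemma IsTop.perp_shift {c : ℤ × ℤ → ℂ} {n m : ℤ} {f : Laurent} (h : IsTop c n m f) (v : ℤ × ℤ)
    {x : ℤ × ℤ} (hx : v.1 ≤ x.1 ∧ x.1 ≤ n + v.1 ∧ v.2 ≤ x.2 ∧ x.2 ≤ m + v.2)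
    (hne : ¬(x.1 = n + v.1 ∧ x.2 = m + v.2)) (a : ℂ) :
    ip c (shift v f) (Finsupp.single x a) = 0 := by
  have e : Finsupp.single x a = shift v (Finsupp.single (x - v) a) := by simp
  rw [e, ip_shift]
  refine h.perp _ (single_mem_box (by simp; omega)) ?_
  rw [Finsupp.single_apply, if_neg]
  intro h'
  exact hne (by have h1 := congrArg Prod.fst h'; have h2 := congrArg Prod.snd h'; simp at h1 h2; omega)

lemma IsTop.perp_rev {c : ℤ × ℤ → ℂ} (hc : Herm c) {n m : ℤ} {f : Laurent} (h : IsTop c n m f)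
    {x : ℤ × ℤ} (hx : 0 ≤ x.1 ∧ x.1 ≤ n ∧ 0 ≤ x.2 ∧ x.2 ≤ m) (hne : ¬(x.1 = 0 ∧ x.2 = 0)) (a : ℂ) :
    ip c (rev (n, m) f) (Finsupp.single x a) = 0 := by
  have e : Finsupp.single x a = rev (n, m) (Finsupp.single ((n, m) - x) (star a)) := by simp
  rw [e, ip_rev]
  refine ip_eq_zero_comm hc (h.perp _ (single_mem_box (by simp; omega)) ?_)
  rw [Finsupp.single_apply, if_neg]
  intro h'
  exact hne (by have h1 := congrArg Prod.fst h'; have h2 := congrArg Prod.snd h'; simp at h1 h2; omega)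

/-- The submodule orthogonal to `f`. -/
def perpTo (c : ℤ × ℤ → ℂ) (f : Laurent) : Submodule ℂ Laurent where
  carrier := {g | ip c f g = 0}
  add_mem' := fun {a b} ha hb => by
    simp only [Set.mem_ofPred_eq] at *; rw [ip_add_right, ha, hb, add_zero]
  zero_mem' := by simp
  smul_mem' := fun r g hg => by simp only [Set.mem_ofPred_eq] at *; rw [ip_smul_right, hg, mul_zero]

@[simp] lemma mem_perpTo {c : ℤ × ℤ → ℂ} {f g : Laurent} : g ∈ perpTo c f ↔ ip c f g = 0 := Iff.rfl

/-- A Laurent polynomial minus its part at one exponent. -/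
lemma eq_single_add (g : Laurent) (x : ℤ × ℤ) : g = Finsupp.single x (g x) + g.erase x := by
  rw [Finsupp.single_add_erase]

lemma box_induction_ne {lo hi X : ℤ × ℤ} {f : Laurent} (hf : f ∈ box lo hi) (h0 : f X = 0)
    (S : Submodule ℂ Laurent)
    (h : ∀ x : ℤ × ℤ, lo.1 ≤ x.1 → x.1 ≤ hi.1 → lo.2 ≤ x.2 → x.2 ≤ hi.2 →
      ¬(x.1 = X.1 ∧ x.2 = X.2) → Finsupp.single x 1 ∈ S) : f ∈ S := by
  rw [← Finsupp.sum_single f]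
  refine Submodule.sum_mem _ fun x hx => ?_
  by_cases hb : lo.1 ≤ x.1 ∧ x.1 ≤ hi.1 ∧ lo.2 ≤ x.2 ∧ x.2 ≤ hi.2
  · by_cases hX : x.1 = X.1 ∧ x.2 = X.2
    · rw [show x = X from Prod.ext hX.1 hX.2]; simp [h0]
    · have := S.smul_mem (f x) (h x hb.1 hb.2.1 hb.2.2.1 hb.2.2.2 hX)
      simpa using this
  · simp [mem_box.1 hf x hb]

lemma isTop_of_single {c : ℤ × ℤ → ℂ} {n m : ℤ} {f : Laurent} (hf : f ∈ box 0 (n, m))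
    (hpos : IsPos (f (n, m))) (hn : ip c f f = 1)
    (h : ∀ x : ℤ × ℤ, 0 ≤ x.1 → x.1 ≤ n → 0 ≤ x.2 → x.2 ≤ m → ¬(x.1 = n ∧ x.2 = m) →
      ip c f (Finsupp.single x 1) = 0) : IsTop c n m f :=
  ⟨hf, hpos, hn, fun _ hg h0 => mem_perpTo.1 (box_induction_ne hg h0 (perpTo c f)
    fun x h1 h2 h3 h4 h5 => h x h1 h2 h3 h4 h5)⟩

namespace Strip
variable {lev : ∀ n m : ℕ, Level n m} {c : ℤ × ℤ → ℂ} {n m : ℕ}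

lemma isTop (h : Strip lev c n m) (hc : Herm c) (j : ℕ) : IsTop c n j (Ph lev n j 0) :=
  (h.good n le_rfl j).orth.isTop hc

/-- With zero reflection matrix, AA† = 1 forces A = 1, and the recurrence reduces to multiplication
by w. -/
lemma shift_PT (h : Strip lev c n m) (hc : Herm c) {k : ℕ} (hk : k + 1 = n) {j : ℕ}
    (hj : m ≤ j) : shiftV (0, 1) (PT lev k j) = PT lev k (j + 1) := by
  have hg := h.good k (by omega) (j + 1)
  obtain ⟨hA, h1⟩ := hg.AT j rfl
  have hr : Recur c (0, 1) (k, j) (lev k (j + 1)).AT (lev k (j + 1)).ET (PT lev k j)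
      (PT lev k (j + 1)) :=
    ⟨hA, hg.ET j rfl, h1, (h.good k (by omega) j).orthT.gram, hg.orthT.gram⟩
  have h2 := hr.mul_conjTranspose hc
  rw [h.ET k hk j hj, Matrix.zero_mul, sub_zero] at h2
  have h3 : (lev k (j + 1)).AT = 1 := by
    have h4 := upperCholesky_eq hA h2.symm
    rw [← h4]
    refine upperCholesky_eq ⟨fun i j hij => Matrix.one_apply_ne hij.ne', fun i => ?_⟩ (by simp)
    rw [Matrix.one_apply_eq]; exact ⟨by simp, by simp⟩
  rw [h3, h.ET k hk j hj, one_actL] at h1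
  rw [h1]; ext a x; simp [actL]

/-- K = 0 says that Φ̃_{n-1,j+1} is orthogonal to Φ_{n,j}, the part by which the box (n, j) exceeds
(n-1, j). -/
lemma PT_perp (h : Strip lev c n m) (hc : Herm c) {k : ℕ} (hk : k + 1 = n) {j : ℕ}
    (hj : m ≤ j + 1) : Perp c (PT lev k (j + 1)) (box 0 (n, j)) := by
  subst hk
  have hg := h.good (k + 1) le_rfl (j + 1)
  have hK : gram c (Ph lev (k + 1) j) (PT lev k (j + 1)) = 0 := by
    rw [← h.K _ hj]; exact hg.K.symm
  refine (h.good (k + 1) le_rfl j).orth.perp_of_gram hc ?_ ?_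
  · have := (h.good k (by omega) (j + 1)).orthT.perp
    simpa using this
  · rw [← gram_conjTranspose hc, hK, Matrix.conjTranspose_zero]

/-- Raising the w-degree from b ≥ m to b+1 only adds the span of Φ̃_{n-1,b+1}, which is orthogonal
to f by `PT_perp`. -/
lemma perp_strip (h : Strip lev c n m) (hc : Herm c) {k : ℕ} (hk : k + 1 = n) {f : Laurent}
    (hf : f ∈ box 0 (n, m)) (hp : ∀ g ∈ box 0 (k, m), ip c f g = 0) (b : ℕ) :
    ∀ g ∈ box 0 (k, b), ip c f g = 0 := by
  by_cases hb : b ≤ m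
  · exact fun g hg => hp g (box_mono (by simp) (by simp) (by simp) (by simpa using hb) hg)
  · induction b with
    | zero => omega
    | succ b ih =>
      have ih' : ∀ g ∈ box 0 ((k : ℤ), (b : ℤ)), ip c f g = 0 := by
        by_cases hb' : b ≤ m
        · exact fun g hg => hp g (box_mono (by simp) (by simp) (by simp) (by simpa using hb') hg)
        · exact ih hb'
      intro g hg
      have h1 := (h.good k (by omega) (b + 1)).orthT.decomp hc hg
      have h2 := ih' _ (box_mono (by simp) (by simp) (by simp) (by simp) h1)
      have h3 : ∀ a, ip c f (PT lev k (b + 1) a) = 0 := fun a =>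
        ip_eq_zero_comm hc (h.PT_perp hc hk (by omega) a f
          (box_mono (by simp) (by simp) (by simp) (by simp; omega) hf))
      simpa [ip_sub_right, ip_sum_right, ip_smul_right, h3] using h2

/-- After reversal the product becomes that of w·z^{n-a}w^j with the reverse of Φ. Expand z^{n-a}w^j
along Φ̃_{n-1,j}. Times w, the expansion becomes Φ̃_{n-1,j+1}, orthogonal to the box (n, j), while
the remainder has w-degrees 1 to j, to which the reverse is orthogonal. -/
lemma shift_Ph_perp (h : Strip lev c n m) (hc : Herm c) {k : ℕ} (hk : k + 1 = n) {j : ℕ}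
    (hj : m ≤ j) {a : ℤ} (ha : 1 ≤ a) (ha' : a ≤ n) :
    ip c (shift (0, 1) (Ph lev n j 0)) (Finsupp.single (a, 0) 1) = 0 := by
  have hT := h.isTop hc j
  have e1 : rev ((n : ℤ), (j : ℤ) + 1) (shift (0, 1) (Ph lev n j 0)) = rev (n, j) (Ph lev n j 0) := by
    rw [rev_shift]; congr 1; ext <;> simp
  rw [← ip_rev c ((n : ℤ), (j : ℤ) + 1), e1, rev_single]
  set x : Laurent := Finsupp.single ((n : ℤ) - a, (j : ℤ)) 1 with hx
  have e2 : (Finsupp.single (((n : ℤ), (j : ℤ) + 1) - (a, 0)) (star 1) : Laurent) =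
      shift (0, 1) x := by simp [hx]
  rw [e2]
  have hxm : x ∈ box 0 ((k : ℤ), (j : ℤ)) := single_mem_box (by simp; omega)
  have h1 := (h.good k (by omega) j).orthT.decomp hc hxm
  set y : Fin (k + 1) → ℂ := fun b => ip c x (PT lev k j b) with hy
  have h2 : shift (0, 1) x = shift (0, 1) (x - ∑ b, y b • PT lev k j b) +
      ∑ b, y b • PT lev k (j + 1) b := by
    rw [← h.shift_PT hc hk hj]
    simp [shiftV]
  rw [h2, ip_add_left, ip_sum_left]
  have h3 : ∀ b, ip c (y b • PT lev k (j + 1) b) (rev (n, j) (Ph lev n j 0)) = 0 := fun b => by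
    rw [ip_smul_left, h.PT_perp hc hk (by omega) b, mul_zero]
    have := rev_mem_box ((n : ℤ), (j : ℤ)) hT.mem
    simpa using this
  rw [Finset.sum_eq_zero fun b _ => h3 b, add_zero]
  have h4 := shift_mem_box (0, 1) h1
  refine ip_eq_zero_comm hc (mem_perpTo.1 (box_induction h4 (perpTo c _) fun z z1 z2 z3 z4 => ?_))
  simp at z1 z2 z3 z4
  exact hT.perp_rev hc (by omega) (by omega) 1

/-- wΦ is orthogonal to monomials of positive w-degree below the top by shifting, and to z^a with a
≥ 1 by `shift_Ph_perp`. The vanishing parameter adds orthogonality to 1, because its second vector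
has nonzero constant term and no top term. So wΦ is the top polynomial of the next level. -/
lemma shift_Ph (h : Strip lev c n m) (hc : Herm c) {j : ℕ} (hj : m ≤ j) :
    shift (0, 1) (Ph lev n j 0) = Ph lev n (j + 1) 0 := by
  have hT := h.isTop hc j
  have hpd := h.pd (j + 1)
  have hb : ∀ x : ℤ × ℤ, 0 ≤ x.1 → x.1 ≤ n → 0 ≤ x.2 → x.2 ≤ (j : ℤ) + 1 →
      ¬(x.1 = n ∧ x.2 = (j : ℤ) + 1) → ¬(x.1 = 0 ∧ x.2 = 0) →
      ip c (shift (0, 1) (Ph lev n j 0)) (Finsupp.single x 1) = 0 := by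
    intro x h1 h2 h3 h4 h5 h6
    by_cases hx : x.2 = 0
    · obtain ⟨a, b⟩ := x
      simp only at *
      subst hx
      exact h.shift_Ph_perp hc (k := n - 1) (by omega) hj (by omega) h2
    · exact hT.perp_shift (0, 1) (by simp; omega) (by simp; omega) 1
  have hpar := h.par j hj
  set g : Laurent := (posVecs lev n (j + 1)).2 with hg
  have key : (posVecs lev n (j + 1)).1 = shift (0, 1) (Ph lev n j 0) ∧ g ∈ box 0 (n, (j : ℤ) + 1) ∧
      g (n, (j : ℤ) + 1) = 0 ∧ g (0, 0) ≠ 0 := by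
    match n, h with
    | 0, h =>
      have hg0 := h.good 0 le_rfl j
      have e : PT lev 0 j 0 = Ph lev 0 j 0 := (hg0.Ph_zero hc (h.pd j)).symm
      simp only [posVecs, hg, e]
      have hm := rev_mem_box (((0 : ℕ) : ℤ), (j : ℤ)) hT.mem
      refine ⟨trivial, box_mono (by simp) (by simp) (by simp) (by simp) hm, ?_, ?_⟩
      · exact mem_box.1 hm _ (by simp)
      · simpa using hg0.Ph_top
    | k + 1, h =>
      simp only [posVecs, hg]
      have hgk := h.good k (by omega) (j + 1)
      have hm := rev_mem_box ((k : ℤ), (j : ℤ) + 1) (hgk.orthT.mem 0)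
      refine ⟨trivial, box_mono (by simp) (by simp) (by simp) (by simp) hm, ?_, ?_⟩
      · exact mem_box.1 hm _ (by simp)
      · simpa using hgk.PT_top
  obtain ⟨k1, k2, k3, k4⟩ := key
  rw [k1] at hpar
  have h0 : ip c (shift (0, 1) (Ph lev n j 0)) (Finsupp.single (0, 0) 1) = 0 := by
    have h1 : g.erase (0, 0) ∈ perpTo c (shift (0, 1) (Ph lev n j 0)) := by
      have hm : g.erase (0, 0) ∈ box 0 ((n : ℤ), (j : ℤ) + 1) := mem_box.2 fun x hx => by
        rw [Finsupp.erase_apply]; split_ifs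
        · rfl
        · exact mem_box.1 k2 x hx
      rw [← Finsupp.sum_single (g.erase (0, 0))]
      refine Submodule.sum_mem _ fun x hx => ?_
      have hx0 := Finsupp.mem_support_iff.1 hx
      have hxb := not_imp_comm.1 (mem_box.1 hm x) hx0
      rw [Finsupp.erase_apply] at hx0
      have hne : x ≠ (0, 0) := fun h => hx0 (if_pos h)
      rw [if_neg hne] at hx0
      have := (perpTo c (shift (0, 1) (Ph lev n j 0))).smul_mem (g.erase (0, 0) x)
        (x := Finsupp.single x 1) (hb x (by simpa using hxb.1) (by simpa using hxb.2.1)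
          (by simpa using hxb.2.2.1) (by simpa using hxb.2.2.2)
          (fun h => hx0 (by rw [show x = ((n : ℤ), (j : ℤ) + 1) from Prod.ext h.1 h.2]; exact k3))
          (fun h => hne (Prod.ext h.1 h.2)))
      simpa using this
    rw [eq_single_add g (0, 0), ip_add_right, mem_perpTo.1 h1, add_zero] at hpar
    have e : (Finsupp.single (0, 0) (g (0, 0)) : Laurent) = g (0, 0) • Finsupp.single (0, 0) 1 := by
      simp
    rw [e, ip_smul_right] at hpar
    exact (mul_eq_zero.1 hpar).resolve_left (star_ne_zero.2 k4)
  have htop : IsTop c n ((j : ℤ) + 1) (shift (0, 1) (Ph lev n j 0)) := by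
    refine isTop_of_single ?_ ?_ ?_ ?_
    · exact box_mono (by simp) (by simp) (by simp) (by simp) (shift_mem_box (0, 1) hT.mem)
    · simpa using hT.pos
    · rw [ip_shift, hT.norm]
    · intro x h1 h2 h3 h4 h5
      by_cases h6 : x.1 = 0 ∧ x.2 = 0
      · rw [show x = (0, 0) from Prod.ext h6.1 h6.2]; exact h0
      · exact hb x h1 h2 h3 h4 h5 h6
  have := h.isTop hc (j + 1)
  exact htop.eq (by simpa using hpd) (by simpa using this)

lemma shift_Ph_add (h : Strip lev c n m) (hc : Herm c) (j : ℕ) :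
    shift (0, j) (Ph lev n m 0) = Ph lev n (m + j) 0 := by
  induction j with
  | zero => simp [← Prod.zero_eq_mk]
  | succ j ih =>
    rw [← add_assoc, ← h.shift_Ph hc (by omega), ← ih, shift_shift]
    congr 2; ext <;> simp; ring

/-- The orthogonality relations of the polynomial `p` on a strip. -/
theorem orthogonal (h : Strip lev c n m) (hc : Herm c) {a b : ℤ} (ha : 0 ≤ a) (ha' : a ≤ n)
    (hab : ¬(a = n ∧ m ≤ b)) : ip c (Ph lev n m 0) (Finsupp.single (a, b) 1) = 0 := by
  by_cases hb : b ≤ m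
  · have e : ((0, ((-b).toNat : ℤ)) : ℤ × ℤ).2 = (-b).toNat := rfl
    rw [← ip_shift c (0, ((-b).toNat : ℤ)), h.shift_Ph_add hc, shift_single]
    refine (h.isTop hc _).perp _ (single_mem_box (by simp; omega)) ?_
    rw [Finsupp.single_apply, if_neg]
    intro h'
    have h1 := congrArg Prod.fst h'; have h2 := congrArg Prod.snd h'; simp at h1 h2; omega
  · refine h.perp_strip hc (k := n - 1) (by omega) (h.isTop hc m).mem ?_ b.toNat _
      (single_mem_box (by simp; omega))
    intro g hg
    refine (h.isTop hc m).perp g (box_mono (by simp) (by simp) (by simp) (by simp) hg)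
      (mem_box.1 hg _ (by simp; omega))

end Strip

/-! ### The levels on the two strips -/

section params
variable {u : ℤ → ℤ → ℂ} {n m : ℕ}

/-- `Reached` at levels (n, j) and (i, m) arbitrarily far out contains the positivity of every level
on the strips; the maxima keep the target different from (N, M). -/
lemma positivity_strip
    (ha : ∀ j : ℕ, m ≤ j → Reached u n j ∧ (level u n j).K = 0 ∧
      (∀ k : ℕ, k + 1 = n → (level u k (j + 1)).ET = 0) ∧ u n (j + 1) = 0)
    (hb : ∀ i : ℕ, n < i → Reached u i m ∧ (level u i m).K = 0 ∧
      (∀ k : ℕ, k + 1 = m → (level u i k).E = 0) ∧ u i m = 0)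
    (N M : ℕ) (h : N ≤ n ∨ M ≤ m) : Positivity u N M := by
  rcases h with h | h
  · exact (ha (max m (M + 1)) (le_max_left _ _)).1 N M h
      ((Nat.le_succ M).trans (le_max_right _ _)) (by simp; omega)
  · exact (hb (max (n + 1) (N + 1)) (by omega)).1 N M (by omega) h (by simp; omega)

/-- The levels on the two strips belong to a positive form. -/
lemma good_strip {c : ℤ × ℤ → ℂ} (hc : Herm c)
    (hparam : ∀ N M : ℕ, (N ≤ n ∨ M ≤ m) → LowerGood (level u) c N M →
      ParamEq (level u) c u N M)
    (hpos : ∀ N M : ℕ, (N ≤ n ∨ M ≤ m) → Positivity u N M) :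
    ∀ k N M : ℕ, N + M = k → (N ≤ n ∨ M ≤ m) → Good (level u) c N M ∧ PD c N M := by
  intro k
  induction k using Nat.strong_induction_on with
  | _ k ih =>
    intro N M hk h
    have hlow : ∀ i j : ℕ, i ≤ N → j ≤ M → (i, j) ≠ (N, M) → Good (level u) c i j ∧ PD c i j := by
      intro i j hi hj hij
      have : i + j < k := by
        by_contra hlt
        exact hij (by rw [Prod.mk.injEq]; omega)
      exact ih _ this i j rfl (by omega)
    obtain ⟨h1, h2⟩ := step hc hlow
      (hparam N M h fun i j hi hj hij => (hlow i j hi hj hij).1)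
    have hpd := h1.1 (hpos N M h)
    exact ⟨h2 hpd, hpd⟩

lemma strip_of_params {c : ℤ × ℤ → ℂ}
    (ha : ∀ j : ℕ, m ≤ j → Reached u n j ∧ (level u n j).K = 0 ∧
      (∀ k : ℕ, k + 1 = n → (level u k (j + 1)).ET = 0) ∧ u n (j + 1) = 0)
    (hparam : ∀ N M : ℕ, (N ≤ n ∨ M ≤ m) → ParamEq (level u) c u N M)
    (hgood : ∀ N M : ℕ, (N ≤ n ∨ M ≤ m) → Good (level u) c N M ∧ PD c N M) :
    Strip (level u) c n m where
  good := fun k hk j => (hgood k j (Or.inl hk)).1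
  pd := fun j => (hgood n j (Or.inl le_rfl)).2
  K := fun j hj => (ha j hj).2.1
  ET := fun k hk j hj => (ha j hj).2.2.1 k hk
  par := fun j hj => by
    rw [(hparam n (j + 1) (Or.inl le_rfl)).1]
    have := (ha j hj).2.2.2
    cases n with
    | zero => simpa [posParam] using this
    | succ n => simpa [posParam] using this

lemma strip_swap_of_params {c : ℤ × ℤ → ℂ} (hc : Herm c)
    (ha : ∀ j : ℕ, m ≤ j → Reached u n j ∧ (level u n j).K = 0 ∧
      (∀ k : ℕ, k + 1 = n → (level u k (j + 1)).ET = 0) ∧ u n (j + 1) = 0)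
    (hb : ∀ i : ℕ, n < i → Reached u i m ∧ (level u i m).K = 0 ∧
      (∀ k : ℕ, k + 1 = m → (level u i k).E = 0) ∧ u i m = 0)
    (hparam : ∀ N M : ℕ, (N ≤ n ∨ M ≤ m) → ParamEq (level u) c u N M)
    (hgood : ∀ N M : ℕ, (N ≤ n ∨ M ≤ m) → Good (level u) c N M ∧ PD c N M) :
    Strip (swapFam (level u)) (swapM c) m n where
  good := fun k hk j => (hgood j k (Or.inr hk)).1.swap hc
  pd := fun j => (hgood j m (Or.inr le_rfl)).2.swap
  K := fun i hi => by
    change ((level u i m).K)ᴴ = 0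
    rcases hi.eq_or_lt with rfl | hi
    · rw [(ha m le_rfl).2.1, Matrix.conjTranspose_zero]
    · rw [(hb i hi).2.1, Matrix.conjTranspose_zero]
  ET := fun k hk i hi => (hb (i + 1) (by omega)).2.2.1 k hk
  par := fun i hi => by
    rw [posVecs_swapFam, (hparam (i + 1) m (Or.inr le_rfl)).1]
    have := (hb (i + 1) (by omega)).2.2.2
    cases m with
    | zero => simpa [posParam] using this
    | succ m => simpa [posParam] using this

end params

/-! ### Evaluation of Laurent polynomials -/

/-- The value of a Laurent polynomial at a point. -/
def evL (z w : ℂ) : Laurent →ₗ[ℂ] ℂ :=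
  Finsupp.lsum ℂ fun x => LinearMap.toSpanSingleton ℂ ℂ (z ^ x.1 * w ^ x.2)

lemma evL_apply (z w : ℂ) (f : Laurent) :
    evL z w f = f.sum fun x a => a * (z ^ x.1 * w ^ x.2) := by
  rw [evL, Finsupp.lsum_apply]; rfl

@[simp] lemma evL_single (z w : ℂ) (x : ℤ × ℤ) (a : ℂ) :
    evL z w (Finsupp.single x a) = a * (z ^ x.1 * w ^ x.2) := by
  rw [evL_apply, Finsupp.sum_single_index (by simp)]

lemma evL_emb (z w : ℂ) (p : Poly) : evL z w (emb p) = MvPolynomial.eval ![z, w] p := by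
  induction p using MvPolynomial.induction_on' with
  | monomial d a => simp [MvPolynomial.eval_monomial, Finsupp.prod_fintype]
  | add p q hp hq => rw [map_add, map_add, map_add, hp, hq]

lemma evL_swapL (z w : ℂ) (f : Laurent) : evL z w (swapL f) = evL w z f := by
  induction f using Finsupp.induction_linear with
  | zero => simp
  | add f g hf hg => simp [hf, hg]
  | single x a => simp [mul_comm]

lemma evL_shift_z (z w : ℂ) {f : Laurent} {b : ℤ × ℤ} (hf : f ∈ box 0 b) :
    evL z w (shift (1, 0) f) = z * evL z w f := by
  have : f ∈ LinearMap.ker ((evL z w).comp (shift (1, 0)).toLinearMap - z • evL z w) :=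
    box_induction hf _ fun x h1 _ _ _ => by
      have h1' : 0 ≤ x.1 := h1
      have e : z ^ (x.1 + 1) = z ^ x.1 * z := by
        lift x.1 to ℕ using h1' with k
        exact_mod_cast pow_succ z k
      simp [e]; ring
  simpa [sub_eq_zero] using this

lemma evL_shift_w (z w : ℂ) {f : Laurent} {b : ℤ × ℤ} (hf : f ∈ box 0 b) :
    evL z w (shift (0, 1) f) = w * evL z w f := by
  have : f ∈ LinearMap.ker ((evL z w).comp (shift (0, 1)).toLinearMap - w • evL z w) :=
    box_induction hf _ fun x _ _ h1 _ => by
      have h1' : 0 ≤ x.2 := h1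
      have e : w ^ (x.2 + 1) = w ^ x.2 * w := by
        lift x.2 to ℕ using h1' with k
        exact_mod_cast pow_succ w k
      simp [e]; ring
  simpa [sub_eq_zero] using this

lemma continuousAt_evL {z w : ℂ} (hz : z ≠ 0) (hw : w ≠ 0) (f : Laurent) :
    ContinuousAt (fun x : ℂ × ℂ => evL x.1 x.2 f) (z, w) := by
  simp only [evL_apply, Finsupp.sum]
  refine tendsto_finsetSum _ fun x _ => ?_
  refine Filter.Tendsto.mul tendsto_const_nhds (Filter.Tendsto.mul ?_ ?_)
  · exact (continuousAt_zpow₀ z x.1 (Or.inl hz)).comp (x := (z, w)) (f := Prod.fst) continuousAt_fst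
  · exact (continuousAt_zpow₀ w x.2 (Or.inl hw)).comp (x := (z, w)) (f := Prod.snd) continuousAt_snd

/-- A Laurent polynomial cannot be a multiple of a proper shift of itself. -/
lemma eq_zero_of_eq_smul_shift {f : Laurent} {s : ℂ} {v : ℤ × ℤ} (hv : v ≠ 0)
    (h : f = s • shift v f) : f = 0 := by
  have h1 : ∀ (k : ℕ) (x : ℤ × ℤ), f x = s ^ k * f (x - k • v) := by
    intro k
    induction k with
    | zero => simp
    | succ k ih =>
      intro x
      have h2 : f (x - k • v) = s * f (x - (k + 1) • v) := by
        conv_lhs => rw [h]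
        rw [Finsupp.smul_apply, shift_apply, smul_eq_mul, add_smul, one_smul, sub_sub]
      rw [ih, h2]; ring
  ext x
  have hinj : Function.Injective fun k : ℕ => x - k • v := by
    intro a b hab
    simp only [sub_right_inj] at hab
    by_contra hne
    apply hv
    have e1 := congrArg Prod.fst hab
    have e2 := congrArg Prod.snd hab
    rw [Prod.smul_fst, Prod.smul_fst, nsmul_eq_mul, nsmul_eq_mul] at e1
    rw [Prod.smul_snd, Prod.smul_snd, nsmul_eq_mul, nsmul_eq_mul] at e2
    have hab' : (a : ℤ) ≠ b := by exact_mod_cast hne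
    have e3 : ((a : ℤ) - b) * v.1 = 0 := by linarith
    have e4 : ((a : ℤ) - b) * v.2 = 0 := by linarith
    exact Prod.ext ((mul_eq_zero.1 e3).resolve_left (sub_ne_zero.2 hab'))
      ((mul_eq_zero.1 e4).resolve_left (sub_ne_zero.2 hab'))
  -- The support is finite, so some x - kv lies outside it.
  obtain ⟨k, hk⟩ := (f.support.finite_toSet.preimage hinj.injOn).exists_notMem
  rw [h1 k x]
  simp only [Set.mem_preimage, Finset.mem_coe, Finsupp.notMem_support_iff] at hk
  rw [hk, mul_zero]; rfl

/-! ### Kernels of functionals -/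

section kernel
variable {c : ℤ × ℤ → ℂ} {k : ℕ}

/-- The functional `e` is represented by `κ` on `S`. -/
def Represents (c : ℤ × ℤ → ℂ) (e : Laurent →ₗ[ℂ] ℂ) (S : Submodule ℂ Laurent) (κ : Laurent) :
    Prop :=
  ∀ g ∈ S, ip c g κ = e g

/-- A kernel grows by the orthonormal directions added to the space, each weighted by the conjugate
of its value under the functional. -/
lemma Represents.add {e : Laurent →ₗ[ℂ] ℂ} {S T : Submodule ℂ Laurent} {κ : Laurent}
    {F : Fin k → Laurent} (h : Represents c e S κ) (hκ : κ ∈ S) (hFS : Perp c F S)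
    (hT : ∀ g ∈ T, g - ∑ b, ip c g (F b) • F b ∈ S) :
    Represents c e T (κ + ∑ b, star (e (F b)) • F b) := by
  intro g hg
  have h1 := h _ (hT g hg)
  have h2 : ∀ b, ip c (F b) κ = 0 := fun b => hFS b κ hκ
  simp only [ip_sub_left, ip_sum_left, ip_smul_left, h2, mul_zero, Finset.sum_const_zero, sub_zero,
    map_sub, map_sum, map_smul, smul_eq_mul] at h1
  rw [ip_add_right, h1, ip_sum_right]
  simp only [ip_smul_right, star_star]
  rw [sub_add_eq_add_sub, sub_eq_iff_eq_add]
  congr 1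
  exact Finset.sum_congr rfl fun b _ => mul_comm _ _

/-- The kernel is accumulated over the orthonormal vectors of levels (0, M), …, (N-1, M). -/
lemma exists_represents (hc : Herm c) (e : Laurent →ₗ[ℂ] ℂ) (M : ℤ) (N : ℕ)
    (h : ∀ i < N, ∃ (k : ℕ) (F : Fin k → Laurent), IsOrth c i M F) :
    ∃ κ ∈ box 0 ((N : ℤ) - 1, M), Represents c e (box 0 ((N : ℤ) - 1, M)) κ := by
  induction N with
  | zero =>
    refine ⟨0, Submodule.zero_mem _, fun g hg => ?_⟩
    rw [box_eq_bot_of_lt (by simp) hg]; simp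
  | succ N ih =>
    obtain ⟨κ, hκ, hr⟩ := ih fun i hi => h i (by omega)
    obtain ⟨k, F, hF⟩ := h N (by omega)
    have e1 : ((N + 1 : ℕ) : ℤ) - 1 = N := by push_cast; ring
    rw [e1]
    refine ⟨_, ?_, hr.add hκ hF.perp fun g hg => hF.decomp hc hg⟩
    refine Submodule.add_mem _ (box_mono (by simp) (by simp) (by simp) (by simp) hκ)
      (Submodule.sum_mem _ fun b _ => Submodule.smul_mem _ _ (hF.mem b))

end kernel

/-! ### Splitting of boxes -/

lemma box_split_top {n m : ℤ} {f : Laurent} (hf : f ∈ box 0 (n, m)) (h0 : f (n, m) = 0) :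
    ∃ a ∈ box 0 (n - 1, m), ∃ b ∈ box 0 (n, m - 1), f = a + b := by
  have : f ∈ box 0 (n - 1, m) ⊔ box 0 (n, m - 1) := by
    refine box_induction_ne hf h0 _ fun x h1 h2 h3 h4 h5 => ?_
    simp only [Prod.fst_zero, Prod.snd_zero] at *
    by_cases hx : x.1 = n
    · exact Submodule.mem_sup_right (single_mem_box (by simp; omega))
    · exact Submodule.mem_sup_left (single_mem_box (by simp; omega))
  obtain ⟨a, ha, b, hb, e⟩ := Submodule.mem_sup.1 this
  exact ⟨a, ha, b, hb, e.symm⟩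

lemma box_split_bottom {n m : ℤ} {f : Laurent} (hf : f ∈ box 0 (n, m)) (h0 : f (0, 0) = 0) :
    ∃ a ∈ box 0 (n - 1, m), ∃ b ∈ box 0 (n, m - 1), f = shift (1, 0) a + shift (0, 1) b := by
  have : f ∈ (box 0 (n - 1, m)).map (shift (1, 0)).toLinearMap ⊔
      (box 0 (n, m - 1)).map (shift (0, 1)).toLinearMap := by
    refine box_induction_ne hf h0 _ fun x h1 h2 h3 h4 h5 => ?_
    simp only [Prod.fst_zero, Prod.snd_zero] at *
    by_cases hx : x.1 = 0
    · exact Submodule.mem_sup_right ⟨Finsupp.single (x - (0, 1)) 1,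
        single_mem_box (by simp; omega), by simp⟩
    · exact Submodule.mem_sup_left ⟨Finsupp.single (x - (1, 0)) 1,
        single_mem_box (by simp; omega), by simp⟩
  obtain ⟨a, ⟨a', ha', rfl⟩, b, ⟨b', hb', rfl⟩, e⟩ := Submodule.mem_sup.1 this
  exact ⟨a', ha', b', hb', e.symm⟩

/-! ### Stability -/

section stability
variable {c : ℤ × ℤ → ℂ} {n m : ℤ} {k l : ℕ} {F : Fin k → Laurent} {P : Fin l → Laurent}
  {p : Laurent}

/-- The reverse of h at (n, m-1) is orthogonal to the box (n-1, m-1), hence lies in the span of F,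
and is therefore orthogonal even to the box (n-1, m). Reversing this at (n, m) multiplies h by w and
a by z. -/
lemma IsOrth.perp_shift_of_gram (hc : Herm c) (hpd : PD c n m) (hF : IsOrth c n (m - 1) F)
    (hFA : Perp c F (box 0 (n - 1, m))) {h : Laurent} (hh : h ∈ box 0 (n, m - 1))
    (hp : ∀ g ∈ box 0 (n - 1, m - 1), ip c (shift (1, 0) g) h = 0) :
    ∀ a ∈ box 0 (n - 1, m), ip c (shift (1, 0) a) (shift (0, 1) h) = 0 := by
  intro a ha
  set h' := rev (n, m - 1) h with hh'
  have hm : h' ∈ box 0 (n, m - 1) := by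
    have := rev_mem_box (n, m - 1) hh
    simpa using this
  have h1 : h' - ∑ b, ip c h' (F b) • F b ∈ box 0 (n - 1, m - 1) := hF.decomp hc hm
  have h2 : ∀ g ∈ box 0 (n - 1, m - 1), ip c h' g = 0 := by
    intro g hg
    have := hp (rev (n - 1, m - 1) g) (by
      have := rev_mem_box (n - 1, m - 1) hg; simpa using this)
    rw [shift_rev, ← ip_rev c (n, m - 1), rev_rev] at this
    simpa [hh'] using this
  have h4 : ∀ g ∈ box 0 (n - 1, m), ip c (∑ b, ip c h' (F b) • F b) g = 0 := by
    intro g hg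
    rw [ip_sum_left]
    exact Finset.sum_eq_zero fun b _ => by rw [ip_smul_left, hFA b g hg, mul_zero]
  have h5 : h' - ∑ b, ip c h' (F b) • F b = 0 := by
    refine (hpd.mono (n' := n - 1) (m' := m - 1) (by omega) (by omega)).eq_zero h1 ?_
    rw [ip_sub_left, h2 _ h1, h4 _ (box_mono (by simp) (by simp) (by simp) (by simp) h1), sub_zero]
  have h6 := h4 (rev (n - 1, m) a) (by
    have := rev_mem_box (n - 1, m) ha; simpa using this)
  rw [← sub_eq_zero.1 h5, hh', ← ip_rev c (n, m), rev_rev, rev_rev] at h6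
  simpa using h6

lemma IsOrthT.perp_shift_of_gram (hc : Herm c) (hpd : PD c n m) (hP : IsOrthT c (n - 1) m P)
    (hPB : Perp c P (box 0 (n, m - 1))) {h : Laurent} (hh : h ∈ box 0 (n - 1, m))
    (hp : ∀ g ∈ box 0 (n - 1, m - 1), ip c (shift (0, 1) g) h = 0) :
    ∀ a ∈ box 0 (n, m - 1), ip c (shift (0, 1) a) (shift (1, 0) h) = 0 := by
  intro a ha
  have := IsOrth.perp_shift_of_gram hc.swap hpd.swap hP hPB.swapV (h := swapL h)
    (swapL_mem_box.2 hh) (fun g hg => ?_) (swapL a) (swapL_mem_box.2 ha)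
  · rw [← ip_swapL c, swapL_shift, swapL_shift]; exact this
  · have := hp (swapL g) (swapL_mem_box.2 hg)
    rw [← ip_swapL c, swapL_shift, swapL_swapL] at this
    exact this

set_option maxHeartbeats 1000000 in
/-- Stability of the reverse of the top polynomial when the two families of orthonormal
polynomials below it are orthogonal to each other. -/
theorem evL_rev_ne_zero (hc : Herm c) (hpd : PD c n m) (hn : 0 ≤ n) (hm : 0 ≤ m)
    (hF : IsOrth c n (m - 1) F) (hP : IsOrthT c (n - 1) m P) (hFP : gram c F P = 0)
    (hp : IsTop c n m p)
    (hκ : ∀ e : Laurent →ₗ[ℂ] ℂ, ∃ κ ∈ box 0 (n - 1, m - 1), Represents c e (box 0 (n - 1, m - 1)) κ)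
    {z w : ℂ} (hz : ‖z‖ ≤ 1) (hw : ‖w‖ ≤ 1) : evL z w (rev (n, m) p) ≠ 0 := by
  intro hq
  have hPF : gram c P F = 0 := by
    rw [← gram_conjTranspose hc, hFP, Matrix.conjTranspose_zero]
  -- Thus F and P are orthogonal complements of the box (n-1, m-1) inside (n, m-1) and (n-1, m), and
  -- each is orthogonal to the whole of the other box.
  have hFA : Perp c F (box 0 (n - 1, m)) := hP.perp_of_gram hc hF.perp hFP
  have hPB : Perp c P (box 0 (n, m - 1)) := hF.perp_of_gram hc hP.perp hPF
  obtain ⟨κ, hκm, hκ⟩ := hκ (evL z w)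
  set α := ∑ b, star (evL z w (P b)) • P b with hα
  set β := ∑ b, star (evL z w (F b)) • F b with hβ
  have hαm : α ∈ box 0 (n - 1, m) := Submodule.sum_mem _ fun b _ => Submodule.smul_mem _ _ (hP.mem b)
  have hβm : β ∈ box 0 (n, m - 1) := Submodule.sum_mem _ fun b _ => Submodule.smul_mem _ _ (hF.mem b)
  have toA : ∀ {f}, f ∈ box 0 (n - 1, m - 1) → f ∈ box 0 (n - 1, m) := fun hf =>
    box_mono (by simp) (by simp) (by simp) (by simp) hf
  have toB : ∀ {f}, f ∈ box 0 (n - 1, m - 1) → f ∈ box 0 (n, m - 1) := fun hf =>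
    box_mono (by simp) (by simp) (by simp) (by simp) hf
  have AV : ∀ {f}, f ∈ box 0 (n - 1, m) → f ∈ box 0 (n, m) := fun hf =>
    box_mono (by simp) (by simp) (by simp) (by simp) hf
  have BV : ∀ {f}, f ∈ box 0 (n, m - 1) → f ∈ box 0 (n, m) := fun hf =>
    box_mono (by simp) (by simp) (by simp) (by simp) hf
  have zV : ∀ {f}, f ∈ box 0 (n - 1, m) → shift (1, 0) f ∈ box 0 (n, m) := fun hf =>
    box_mono (by simp) (by simp) (by simp) (by simp) (shift_mem_box (1, 0) hf)
  have wV : ∀ {f}, f ∈ box 0 (n, m - 1) → shift (0, 1) f ∈ box 0 (n, m) := fun hf =>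
    box_mono (by simp) (by simp) (by simp) (by simp) (shift_mem_box (0, 1) hf)
  have hA : Represents c (evL z w) (box 0 (n - 1, m)) (κ + α) :=
    hκ.add hκm hP.perp fun g hg => hP.decomp hc hg
  have hB : Represents c (evL z w) (box 0 (n, m - 1)) (κ + β) :=
    hκ.add hκm hF.perp fun g hg => hF.decomp hc hg
  have hβA : ∀ g ∈ box 0 (n - 1, m), ip c g β = 0 := fun g hg => by
    rw [hβ, ip_sum_right]
    exact Finset.sum_eq_zero fun b _ => by
      rw [ip_smul_right, ip_eq_zero_comm hc (hFA b g hg), mul_zero]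
  have hαB : ∀ g ∈ box 0 (n, m - 1), ip c g α = 0 := fun g hg => by
    rw [hα, ip_sum_right]
    exact Finset.sum_eq_zero fun b _ => by
      rw [ip_smul_right, ip_eq_zero_comm hc (hPB b g hg), mul_zero]
  have hpA : ∀ g ∈ box 0 (n - 1, m), ip c p g = 0 := fun g hg =>
    hp.perp g (AV hg) (mem_box.1 hg _ (by simp))
  have hpB : ∀ g ∈ box 0 (n, m - 1), ip c p g = 0 := fun g hg =>
    hp.perp g (BV hg) (mem_box.1 hg _ (by simp))
  set p0 := evL z w p with hp0
  -- `k1` is the kernel of evaluation on the box (n, m) by orthonormal expansion. `k2` is an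
  -- inclusion-exclusion of shifted kernels; it is a second kernel of evaluation only because (z, w)
  -- is a zero of the reverse of p.
  set k1 := κ + α + β + star p0 • p with hk1
  set k2 := (star z) • shift (1, 0) (κ + α) + (star w) • shift (0, 1) (κ + β) -
    (star z * star w) • shift (1, 1) κ with hk2
  have hk1m : k1 ∈ box 0 (n, m) := Submodule.add_mem _ (Submodule.add_mem _ (Submodule.add_mem _
    (AV (toA hκm)) (AV hαm)) (BV hβm)) (Submodule.smul_mem _ _ hp.mem)
  have h11 : shift (1, 1) κ = shift (1, 0) (shift (0, 1) κ) := by rw [shift_shift]; rfl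
  have h11' : shift (1, 1) κ = shift (0, 1) (shift (1, 0) κ) := by rw [shift_shift]; rfl
  have wκ : shift (0, 1) κ ∈ box 0 (n - 1, m) :=
    box_mono (by simp) (by simp) (by simp) (by simp) (shift_mem_box (0, 1) hκm)
  have zκ : shift (1, 0) κ ∈ box 0 (n, m - 1) :=
    box_mono (by simp) (by simp) (by simp) (by simp) (shift_mem_box (1, 0) hκm)
  have hAm := Submodule.add_mem _ (toA hκm) hαm
  have hBm := Submodule.add_mem _ (toB hκm) hβm
  have hk2m : k2 ∈ box 0 (n, m) := Submodule.sub_mem _ (Submodule.add_mem _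
    (Submodule.smul_mem _ _ (zV hAm)) (Submodule.smul_mem _ _ (wV hBm)))
    (Submodule.smul_mem _ _ (by rw [h11]; exact zV wκ))
  have r1 : Represents c (evL z w) (box 0 (n, m)) k1 := by
    have rA : ∀ g ∈ box 0 (n - 1, m), ip c g k1 = evL z w g := fun g hg => by
      rw [hk1, ip_add_right, ip_add_right, hA g hg, hβA g hg, ip_smul_right,
        ip_eq_zero_comm hc (hpA g hg)]; simp
    have rB : ∀ g ∈ box 0 (n, m - 1), ip c g k1 = evL z w g := fun g hg => by
      rw [hk1, add_right_comm κ, ip_add_right, ip_add_right, hB g hg, hαB g hg, ip_smul_right,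
        ip_eq_zero_comm hc (hpB g hg)]; simp
    have rp : ip c p k1 = p0 := by
      rw [hk1, ip_add_right, ip_add_right, hpA _ hAm, hpB _ hβm, ip_smul_right, hp.norm]; simp
    intro g hg
    have ht := hp.pos.ne_zero
    obtain ⟨a, ha, b, hb, e⟩ := box_split_top (f := g - (g (n, m) / p (n, m)) • p)
      (Submodule.sub_mem _ hg (Submodule.smul_mem _ _ hp.mem)) (by simp [ht])
    rw [sub_eq_iff_eq_add] at e
    rw [e]
    simp only [ip_add_left, ip_smul_left, map_add, map_smul, rA a ha, rB b hb, rp, smul_eq_mul, hp0]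
  have r2 : Represents c (evL z w) (box 0 (n, m)) k2 := by
    have rA : ∀ a ∈ box 0 (n - 1, m), ip c (shift (1, 0) a) k2 = z * evL z w a := fun a ha => by
      have h1 := hF.perp_shift_of_gram hc hpd hFA (h := (κ + β) - star z • shift (1, 0) κ)
        (Submodule.sub_mem _ hBm (Submodule.smul_mem _ _ zκ)) (fun g hg => by
          rw [ip_sub_right, hB, ip_smul_right, ip_shift, hκ g hg, evL_shift_z z w hg, star_star,
            sub_self]
          exact box_mono (by simp) (by simp) (by simp) (by simp) (shift_mem_box (1, 0) hg)) a ha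
      have e : k2 = star z • shift (1, 0) (κ + α) +
          star w • shift (0, 1) ((κ + β) - star z • shift (1, 0) κ) := by
        rw [hk2, h11', map_sub, smul_sub, map_smul, smul_smul, mul_comm (star w)]; abel
      rw [e, ip_add_right, ip_smul_right, ip_shift, hA a ha, ip_smul_right, h1]; simp
    have rB : ∀ b ∈ box 0 (n, m - 1), ip c (shift (0, 1) b) k2 = w * evL z w b := fun b hb => by
      have h1 := hP.perp_shift_of_gram hc hpd hPB (h := (κ + α) - star w • shift (0, 1) κ)
        (Submodule.sub_mem _ hAm (Submodule.smul_mem _ _ wκ)) (fun g hg => by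
          rw [ip_sub_right, hA, ip_smul_right, ip_shift, hκ g hg, evL_shift_w z w hg, star_star,
            sub_self]
          exact box_mono (by simp) (by simp) (by simp) (by simp) (shift_mem_box (0, 1) hg)) b hb
      have e : k2 = star w • shift (0, 1) (κ + β) +
          star z • shift (1, 0) ((κ + α) - star w • shift (0, 1) κ) := by
        rw [hk2, h11, map_sub, smul_sub, map_smul, smul_smul]; abel
      rw [e, ip_add_right, ip_smul_right, ip_shift, hB b hb, ip_smul_right, h1]; simp
    -- `k2` has no constant term, and the reverse of p is orthogonal to all such polynomials of the
    -- box.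
    have rq : ip c (rev (n, m) p) k2 = 0 := by
      rw [← ip_rev c (n, m), rev_rev, sub_self, shift_zero]
      refine ip_eq_zero_comm hc (hp.perp _ ?_ ?_)
      · have := rev_mem_box (n, m) hk2m; simpa using this
      · have e0 : ∀ {f : Laurent} {b : ℤ × ℤ}, f ∈ box 0 b → f (-1, 0) = 0 ∧ f (0, -1) = 0 ∧
            f (-1, -1) = 0 := fun hf => ⟨mem_box.1 hf _ (by simp), mem_box.1 hf _ (by simp),
              mem_box.1 hf _ (by simp)⟩
        have e1 := (e0 hAm).1
        have e2 := (e0 hBm).2.1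
        have e3 := (e0 hκm).2.2
        have e4 : k2 (0, 0) = star z * (κ + α) (-1, 0) + star w * (κ + β) (0, -1) -
            star z * star w * κ (-1, -1) := rfl
        rw [rev_apply, sub_self]
        change star (k2 (0, 0)) = 0
        rw [e4, e1, e2, e3]; simp
    intro g hg
    have hqm : rev (n, m) p ∈ box 0 (n, m) := by
      have := rev_mem_box (n, m) hp.mem; simpa using this
    have ht : rev (n, m) p (0, 0) ≠ 0 := by simpa using hp.pos.ne_zero
    obtain ⟨a, ha, b, hb, e⟩ := box_split_bottom
      (f := g - (g (0, 0) / rev (n, m) p (0, 0)) • rev (n, m) p)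
      (Submodule.sub_mem _ hg (Submodule.smul_mem _ _ hqm)) (by
        rw [Finsupp.sub_apply, Finsupp.smul_apply, smul_eq_mul, div_mul_cancel₀ _ ht, sub_self])
    rw [sub_eq_iff_eq_add] at e
    rw [e]
    simp only [ip_add_left, ip_smul_left, map_add, map_smul, rA a ha, rB b hb, rq, hq,
      evL_shift_z z w ha, evL_shift_w z w hb, smul_zero, mul_zero]
  have h12 : k1 = k2 := by
    have hd := Submodule.sub_mem _ hk1m hk2m
    exact sub_eq_zero.1 (hpd.eq_zero hd (by rw [ip_sub_right, r1 _ hd, r2 _ hd, sub_self]))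
  -- the value of both sides at the zero
  set T := (ip c κ κ).re with hT
  set A := ∑ b, Complex.normSq (evL z w (P b)) with hAdef
  set B := ∑ b, Complex.normSq (evL z w (F b)) with hBdef
  have eκ : evL z w κ = (T : ℂ) := by rw [← hκ κ hκm, ip_self_eq_re hc]
  have eα : evL z w α = (A : ℂ) := by
    rw [hα, map_sum, hAdef, Complex.ofReal_sum]
    exact Finset.sum_congr rfl fun b _ => by
      rw [map_smul, smul_eq_mul, Complex.normSq_eq_conj_mul_self]; rfl
  have eβ : evL z w β = (B : ℂ) := by
    rw [hβ, map_sum, hBdef, Complex.ofReal_sum]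
    exact Finset.sum_congr rfl fun b _ => by
      rw [map_smul, smul_eq_mul, Complex.normSq_eq_conj_mul_self]; rfl
  have hT0 : 0 ≤ T := by
    by_cases h : κ = 0
    · simp [hT, h]
    · exact (hpd κ (AV (toA hκm)) h).le
  have hA0 : 0 ≤ A := Finset.sum_nonneg fun b _ => Complex.normSq_nonneg _
  have hB0 : 0 ≤ B := Finset.sum_nonneg fun b _ => Complex.normSq_nonneg _
  have hκ0 : T = 0 → κ = 0 := fun h =>
    hpd.eq_zero (AV (toA hκm)) (by rw [ip_self_eq_re hc, ← hT, h]; simp)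
  have hα0 : A = 0 → α = 0 := fun h => by
    have h1 := (Finset.sum_eq_zero_iff_of_nonneg fun b _ => Complex.normSq_nonneg _).1 h
    exact Finset.sum_eq_zero fun b hb => by rw [Complex.normSq_eq_zero.1 (h1 b hb)]; simp
  have hβ0 : B = 0 → β = 0 := fun h => by
    have h1 := (Finset.sum_eq_zero_iff_of_nonneg fun b _ => Complex.normSq_nonneg _).1 h
    exact Finset.sum_eq_zero fun b hb => by rw [Complex.normSq_eq_zero.1 (h1 b hb)]; simp
  have ev2 : ∀ z' w' : ℂ, evL z' w' k2 = star z * z' * (evL z' w' κ + evL z' w' α) +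
      star w * w' * (evL z' w' κ + evL z' w' β) - star z * star w * z' * w' * evL z' w' κ := by
    intro z' w'
    simp only [hk2, map_sub, map_add, map_smul, h11, evL_shift_z z' w' wκ, evL_shift_w z' w' hκm,
      evL_shift_z z' w' (toA hκm), evL_shift_z z' w' hαm, evL_shift_w z' w' hβm, smul_eq_mul]
    ring
  have nz : star z * z = (Complex.normSq z : ℂ) := by rw [Complex.normSq_eq_conj_mul_self]; rfl
  have nw : star w * w = (Complex.normSq w : ℂ) := by rw [Complex.normSq_eq_conj_mul_self]; rfl
  set x := Complex.normSq z with hx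
  set y := Complex.normSq w with hy
  have hx1 : x ≤ 1 := by rw [hx, Complex.normSq_eq_norm_sq]; nlinarith only [norm_nonneg z, hz]
  have hy1 : y ≤ 1 := by rw [hy, Complex.normSq_eq_norm_sq]; nlinarith only [norm_nonneg w, hw]
  -- Evaluation of k1 = k2 at (z, w) itself: T, A, B are the values there of κ, α, β, all
  -- nonnegative, so every term must vanish.
  have main : (1 - x) * (1 - y) * T + (1 - x) * A + (1 - y) * B + Complex.normSq p0 = 0 := by
    have h1 := congrArg (evL z w) h12
    have h2 : star p0 * p0 = (Complex.normSq p0 : ℂ) := by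
      rw [Complex.normSq_eq_conj_mul_self]; rfl
    rw [ev2, hk1, map_add, map_add, map_add, map_smul, ← hp0, smul_eq_mul, eκ, eα, eβ, h2, nz, nw,
      show star z * star w * z * w = (star z * z) * (star w * w) by ring, nz, nw] at h1
    have h3 : ((((1 - x) * (1 - y) * T + (1 - x) * A + (1 - y) * B + Complex.normSq p0 : ℝ)) : ℂ) =
        0 := by push_cast; linear_combination h1
    exact_mod_cast h3
  have m1 : 0 ≤ (1 - x) * (1 - y) * T :=
    mul_nonneg (mul_nonneg (by linarith) (by linarith)) hT0
  have m2 : 0 ≤ (1 - x) * A := mul_nonneg (by linarith) hA0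
  have m3 : 0 ≤ (1 - y) * B := mul_nonneg (by linarith) hB0
  have m4 := Complex.normSq_nonneg p0
  have hp00 : p0 = 0 := Complex.normSq_eq_zero.1 (by linarith)
  have a1 : (1 - x) * (1 - y) * T = 0 := by linarith
  have a2 : (1 - x) * A = 0 := by linarith
  have a3 : (1 - y) * B = 0 := by linarith
  have id1 : κ + α + β = star z • shift (1, 0) (κ + α) + star w • shift (0, 1) (κ + β) -
      (star z * star w) • shift (1, 1) κ := by
    rw [← hk2, ← h12, hk1, hp00]; simp
  -- it remains to see that both sides vanish
  suffices hfin : T = 0 ∧ A = 0 ∧ B = 0 by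
    -- Otherwise the zero polynomial would represent evaluation, which takes the value 1 at the
    -- constant 1.
    have h1 := r1 (Finsupp.single (0, 0) 1) (single_mem_box (by simp; omega))
    rw [hk1, hκ0 hfin.1, hα0 hfin.2.1, hβ0 hfin.2.2, hp00] at h1
    simp at h1
  rcases hx1.lt_or_eq with hx1 | hx1
  · have hA' : A = 0 := (mul_eq_zero.1 a2).resolve_left (by linarith)
    rcases hy1.lt_or_eq with hy1 | hy1
    · exact ⟨(mul_eq_zero.1 a1).resolve_left (mul_ne_zero (by linarith) (by linarith)), hA',
        (mul_eq_zero.1 a3).resolve_left (by linarith)⟩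
    -- For |w| = 1 the identity says that this polynomial is a multiple of its own shift by w, hence
    -- 0. Comparing norms in κ + β = z̄·zκ then gives T + B = |z|² T with |z| < 1.
    · have h0 : (κ + β) - star z • shift (1, 0) κ = 0 := by
        refine eq_zero_of_eq_smul_shift (s := star w) (v := (0, 1)) (by simp) ?_
        rw [hα0 hA', add_zero, h11'] at id1
        nth_rewrite 1 [id1]
        rw [map_sub, smul_sub, map_smul, smul_smul, mul_comm (star w)]; abel
      have h1 := hB _ hBm
      rw [sub_eq_zero.1 h0, ip_smul_left, ip_smul_right, ip_shift, hκ κ hκm, ← sub_eq_zero.1 h0,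
        map_add, eκ, eβ, ← mul_assoc, star_star, nz] at h1
      have h2 : x * T = T + B := by exact_mod_cast h1
      have h3 : 0 ≤ (1 - x) * T := mul_nonneg (by linarith only [hx1]) hT0
      have h4 : (1 - x) * T = 0 := by linarith only [h2, h3, hB0]
      exact ⟨(mul_eq_zero.1 h4).resolve_left (by linarith only [hx1]), hA', by linarith only [h2, h4]⟩
  · rcases hy1.lt_or_eq with hy1 | hy1
    · have hB' : B = 0 := (mul_eq_zero.1 a3).resolve_left (by linarith)
      have h0 : (κ + α) - star w • shift (0, 1) κ = 0 := by
        refine eq_zero_of_eq_smul_shift (s := star z) (v := (1, 0)) (by simp) ?_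
        rw [hβ0 hB', add_zero, add_zero, h11] at id1
        nth_rewrite 1 [id1]
        rw [map_sub, smul_sub, map_smul, smul_smul]; abel
      have h1 := hA _ hAm
      rw [sub_eq_zero.1 h0, ip_smul_left, ip_smul_right, ip_shift, hκ κ hκm, ← sub_eq_zero.1 h0,
        map_add, eκ, eα, ← mul_assoc, star_star, nw] at h1
      have h2 : y * T = T + A := by exact_mod_cast h1
      have h3 : 0 ≤ (1 - y) * T := mul_nonneg (by linarith only [hy1]) hT0
      have h4 : (1 - y) * T = 0 := by linarith only [h2, h3, hA0]
      exact ⟨(mul_eq_zero.1 h4).resolve_left (by linarith only [hy1]), by linarith only [h2, h4], hB'⟩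
    · have hz0 : z ≠ 0 := fun h => by simp [hx, h] at hx1
      have hw0 : w ≠ 0 := fun h => by simp [hy, h] at hy1
      rw [hx1] at nz
      rw [hy1] at nw
      have hval : ∀ z' w' : ℂ, evL z' w' κ + evL z' w' α + evL z' w' β =
          star z * z' * (evL z' w' κ + evL z' w' α) + star w * w' * (evL z' w' κ + evL z' w' β) -
            star z * star w * z' * w' * evL z' w' κ := by
        intro z' w'
        rw [← ev2, ← h12, hk1, hp00]; simp
      -- On the bicircle `main` carries no information. Instead, the identity at a variable first
      -- coordinate z' gives (1 - z̄z')α(z', w) = 0, and α(z, w) = 0 follows by continuity.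
      have hA' : A = 0 := by
        have h1 : ∀ z', z' ≠ z → evL z' w α = 0 := by
          intro z' hz'
          have h2 := hval z' w
          have h3 : (1 - star z * z') * evL z' w α = 0 := by
            push_cast at nw
            linear_combination h2 + (evL z' w κ + evL z' w β - star z * z' * evL z' w κ) * nw
          refine (mul_eq_zero.1 h3).resolve_left fun h4 => hz' ?_
          have h5 : star z ≠ 0 := star_ne_zero.2 hz0
          apply mul_left_cancel₀ h5
          push_cast at nz
          linear_combination -h4 - nz
        have h2 : Filter.Tendsto (fun z' => evL z' w α) (nhdsWithin z {z}ᶜ) (nhds (evL z w α)) :=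
          ((continuousAt_evL hz0 hw0 α).comp (f := fun z' => (z', w)) (x := z)
            (by fun_prop)).tendsto.mono_left nhdsWithin_le_nhds
        have h3 : evL z w α = 0 := tendsto_nhds_unique h2 (Filter.Tendsto.congr'
          (by filter_upwards [self_mem_nhdsWithin] with z' hz' using (h1 z' hz').symm)
          tendsto_const_nhds)
        rw [eα] at h3
        exact_mod_cast h3
      have hB' : B = 0 := by
        have h1 : ∀ w', w' ≠ w → evL z w' β = 0 := by
          intro w' hw'
          have h2 := hval z w'
          have h3 : (1 - star w * w') * evL z w' β = 0 := by
            push_cast at nz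
            linear_combination h2 + (evL z w' κ + evL z w' α - star w * w' * evL z w' κ) * nz
          refine (mul_eq_zero.1 h3).resolve_left fun h4 => hw' ?_
          have h5 : star w ≠ 0 := star_ne_zero.2 hw0
          apply mul_left_cancel₀ h5
          push_cast at nw
          linear_combination -h4 - nw
        have h2 : Filter.Tendsto (fun w' => evL z w' β) (nhdsWithin w {w}ᶜ) (nhds (evL z w β)) :=
          ((continuousAt_evL hz0 hw0 β).comp (f := fun w' => (z, w')) (x := w)
            (by fun_prop)).tendsto.mono_left nhdsWithin_le_nhds
        have h3 : evL z w β = 0 := tendsto_nhds_unique h2 (Filter.Tendsto.congr'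
          (by filter_upwards [self_mem_nhdsWithin] with w' hw' using (h1 w' hw').symm)
          tendsto_const_nhds)
        rw [eβ] at h3
        exact_mod_cast h3
      -- What remains of the identity factors: applying 1 - z̄·(shift by z) and then 1 - w̄·(shift
      -- by w) to κ gives 0, and each factor is injective.
      have h0 : κ - star z • shift (1, 0) κ = 0 := by
        refine eq_zero_of_eq_smul_shift (s := star w) (v := (0, 1)) (by simp) ?_
        rw [hα0 hA', hβ0 hB', add_zero, add_zero, h11'] at id1
        nth_rewrite 1 [id1]
        rw [map_sub, smul_sub, map_smul, smul_smul, mul_comm (star w)]; abel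
      have hk : κ = 0 := eq_zero_of_eq_smul_shift (s := star z) (v := (1, 0)) (by simp)
        (sub_eq_zero.1 h0)
      exact ⟨by simp [hT, hk], hA', hB'⟩

end stability

/-! ### Polynomials in an operator -/

section operators
open Polynomial

/-- A polynomial in an operator is injective on an invariant subspace which contains no
eigenvectors for its roots. -/
lemma eq_zero_of_aeval_eq_zero {E : Type*} [AddCommGroup E] [Module ℂ E] (T : Module.End ℂ E)
    (W : Submodule ℂ E) (hW : ∀ x ∈ W, T x ∈ W) (r : ℂ[X]) (hr : r ≠ 0)
    (h : ∀ a, r.IsRoot a → ∀ x ∈ W, T x = a • x → x = 0) :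
    ∀ x ∈ W, aeval T r x = 0 → x = 0 := by
  induction hd : r.natDegree generalizing r with
  | zero =>
    intro x _ h0
    rw [eq_C_of_natDegree_eq_zero hd, aeval_C, Module.algebraMap_end_apply] at h0
    refine (smul_eq_zero.1 h0).resolve_left fun h1 => hr ?_
    rw [eq_C_of_natDegree_eq_zero hd, h1, C_0]
  | succ d ih =>
    obtain ⟨a, ha⟩ := IsAlgClosed.exists_root r
      (fun h0 => by rw [natDegree_eq_zero_iff_degree_le_zero.2 h0.le] at hd; omega)
    obtain ⟨g, rfl⟩ := dvd_iff_isRoot.2 ha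
    have hg : g ≠ 0 := right_ne_zero_of_mul hr
    have hgd : g.natDegree = d := by
      rw [natDegree_mul (X_sub_C_ne_zero a) hg, natDegree_X_sub_C] at hd; omega
    intro x hx h0
    rw [mul_comm, map_mul, Module.End.mul_apply] at h0
    have h1 := ih g hg (fun b hb => h b (by rw [IsRoot.def, eval_mul, hb.eq_zero, mul_zero])) hgd _
      (by
        rw [map_sub, aeval_X, aeval_C, LinearMap.sub_apply, Module.algebraMap_end_apply]
        exact W.sub_mem (hW x hx) (W.smul_mem _ hx)) h0
    rw [map_sub, aeval_X, aeval_C, LinearMap.sub_apply, Module.algebraMap_end_apply,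
      sub_eq_zero] at h1
    exact h a ha x hx h1

/-- Two relations and their multiples determine a functional up to the resultant. -/
lemma resultant_smul_eq_zero {R M : Type*} [CommRing R] [AddCommGroup M] [Module R M] {f g : R[X]}
    {n : ℕ} (hf : f.natDegree ≤ n) (hg : g.natDegree ≤ n) (L : R[X] →ₗ[R] M)
    (h1 : ∀ k < n, L (f * X ^ k) = 0) (h2 : ∀ k < n, L (g * X ^ k) = 0) {j : ℕ} (hj : j < n + n) :
    resultant f g n n • L (X ^ j) = 0 := by
  have key : ∀ e : R[X], (∀ k < n, L (e * X ^ k) = 0) → ∀ a ∈ degreeLT R n, L (e * a) = 0 := by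
    intro e he a ha
    by_cases ha0 : a = 0
    · simp [ha0]
    rw [a.as_sum_range_C_mul_X_pow' ((natDegree_lt_iff_degree_lt ha0).2 (mem_degreeLT.1 ha)),
      Finset.mul_sum, map_sum]
    refine Finset.sum_eq_zero fun k hk => ?_
    rw [← smul_eq_C_mul, mul_smul_comm, map_smul, he k (Finset.mem_range.1 hk), smul_zero]
  have hX : (X ^ j : R[X]) ∈ degreeLT R (n + n) := by
    rw [mem_degreeLT]; exact (degree_X_pow_le j).trans_lt (by exact_mod_cast hj)
  -- The adjugate of the Sylvester matrix writes the resultant times X^j as f·a + g·b with a, b of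
  -- degree below n.
  have h3 := congrArg Subtype.val
    (LinearMap.congr_fun (sylveserMap_comp_adjSylvester f g hf hg) ⟨X ^ j, hX⟩)
  set ab := adjSylvester (m := n) (n := n) f g ⟨X ^ j, hX⟩ with hab
  have h4 : f * ab.2.1 + g * ab.1.1 = resultant f g n n • X ^ j := h3
  rw [← map_smul, ← h4, map_add, key f h1 _ ab.2.2, key g h2 _ ab.1.2, add_zero]

end operators

/-! ### Bounded sequences -/

section sequences
open Polynomial

/-- The shift of sequences. -/
def shiftSeq : Module.End ℂ (ℤ → ℂ) := LinearMap.funLeft ℂ ℂ fun b => b + 1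

@[simp] lemma shiftSeq_apply (d : ℤ → ℂ) (b : ℤ) : shiftSeq d b = d (b + 1) := rfl

lemma shiftSeq_pow_apply (k : ℕ) (d : ℤ → ℂ) (b : ℤ) : (shiftSeq ^ k) d b = d (b + k) := by
  induction k generalizing b with
  | zero => simp
  | succ k ih =>
    rw [pow_succ', Module.End.mul_apply, shiftSeq_apply, ih]; congr 1; push_cast; ring

/-- The bounded sequences. -/
def boundedSeq : Submodule ℂ (ℤ → ℂ) where
  carrier := {d | ∃ C, ∀ b, ‖d b‖ ≤ C}
  add_mem' := by
    rintro d e ⟨C, hC⟩ ⟨C', hC'⟩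
    exact ⟨C + C', fun b => (norm_add_le _ _).trans (add_le_add (hC b) (hC' b))⟩
  zero_mem' := ⟨0, fun b => by simp⟩
  smul_mem' := by
    rintro r d ⟨C, hC⟩
    exact ⟨‖r‖ * C, fun b => by
      rw [Pi.smul_apply, norm_smul]; exact mul_le_mul_of_nonneg_left (hC b) (norm_nonneg r)⟩

/-- The recurrence sequences growing geometrically are unbounded. -/
lemma eq_zero_of_geometric {a : ℂ} (ha : 1 < ‖a‖) {d : ℕ → ℂ} {C : ℝ} (hC : ∀ k, ‖d k‖ ≤ C)
    (h : ∀ k, d (k + 1) = a * d k) : d 0 = 0 := by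
  by_contra hne
  have h1 : ∀ k, d k = a ^ k * d 0 := fun k => by
    induction k with
    | zero => simp
    | succ k ih => rw [h, ih]; ring
  obtain ⟨k, hk⟩ := pow_unbounded_of_one_lt (C / ‖d 0‖) ha
  have h2 := hC k
  rw [h1, norm_mul, norm_pow] at h2
  rw [div_lt_iff₀ (norm_pos_iff.2 hne)] at hk
  linarith

/-- An eigensequence grows geometrically, forwards if |a| > 1 and backwards if 0 < |a| < 1. -/
lemma bounded_eq_zero {a : ℂ} (ha : ‖a‖ ≠ 1) {d : ℤ → ℂ} (hd : d ∈ boundedSeq)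
    (h : shiftSeq d = a • d) : d = 0 := by
  obtain ⟨C, hC⟩ := hd
  have h' : ∀ b, d (b + 1) = a * d b := fun b => congrFun h b
  funext b
  rcases lt_or_gt_of_ne ha with h1 | h1
  · by_cases ha0 : a = 0
    · have := h' (b - 1); rw [sub_add_cancel, ha0, zero_mul] at this; exact this
    · have := eq_zero_of_geometric (a := a⁻¹) (d := fun k : ℕ => d (b - k)) (C := C)
        (by rw [norm_inv]; exact (one_lt_inv₀ (norm_pos_iff.2 ha0)).2 h1) (fun k => hC _)
        (fun k => by
          have := h' (b - (k + 1 : ℕ))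
          rw [show b - ((k + 1 : ℕ) : ℤ) + 1 = b - k by push_cast; ring] at this
          rw [this, inv_mul_cancel_left₀ ha0])
      simpa using this
  · have := eq_zero_of_geometric (d := fun k : ℕ => d (b + k)) (C := C) h1 (fun k => hC _)
      (fun k => by
        have := h' (b + k)
        rw [← this]; congr 1; push_cast; ring)
    simpa using this

lemma bounded_eq_zero_of_aeval (r : ℂ[X]) (h : ∀ a, ‖a‖ = 1 → r.eval a ≠ 0) {d : ℤ → ℂ}
    (hd : d ∈ boundedSeq) (h0 : aeval shiftSeq r d = 0) : d = 0 := by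
  refine eq_zero_of_aeval_eq_zero shiftSeq boundedSeq ?_ r ?_ ?_ d hd h0
  · rintro x ⟨C, hC⟩; exact ⟨C, fun b => hC _⟩
  · rintro rfl; exact h 1 (by simp) (by simp)
  · intro a ha x hx hT
    exact bounded_eq_zero (fun h1 => h a h1 ha) hx hT

end sequences

/-! ### Laurent polynomials as polynomials in two variables -/

section toPoly
open Polynomial

/-- The polynomial in `z` whose coefficients are polynomials in `w`. -/
def toPoly : Laurent →ₗ[ℂ] ℂ[X][X] :=
  Finsupp.lsum ℂ fun x => LinearMap.toSpanSingleton ℂ _ (monomial x.1.toNat (monomial x.2.toNat 1))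

@[simp] lemma toPoly_single (x : ℤ × ℤ) (a : ℂ) :
    toPoly (Finsupp.single x a) = monomial x.1.toNat (monomial x.2.toNat a) := by
  simp [toPoly, smul_monomial]

lemma natDegree_toPoly {n m : ℕ} {f : Laurent} (hf : f ∈ box 0 ((n : ℤ), (m : ℤ))) :
    (toPoly f).natDegree ≤ n := by
  have : f ∈ ((degreeLE ℂ[X] n).restrictScalars ℂ).comap toPoly :=
    box_induction hf _ fun x h1 h2 h3 h4 => by
      simp only [Prod.fst_zero] at h1 h2
      rw [Submodule.mem_comap, toPoly_single]
      exact mem_degreeLE.2 ((degree_monomial_le _ _).trans (by exact_mod_cast (by omega)))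
  exact natDegree_le_iff_degree_le.2 (mem_degreeLE.1 this)

/-- Induction over a box of exponents, for an additive condition. -/
lemma box_induction_add {lo hi : ℤ × ℤ} {f : Laurent} (hf : f ∈ box lo hi) (S : Laurent → Prop)
    (h0 : S 0) (hadd : ∀ f g, S f → S g → S (f + g))
    (h : ∀ (x : ℤ × ℤ) (a : ℂ), lo.1 ≤ x.1 → x.1 ≤ hi.1 → lo.2 ≤ x.2 → x.2 ≤ hi.2 →
      S (Finsupp.single x a)) : S f := by
  rw [← Finsupp.sum_single f]
  refine Finset.sum_induction _ S hadd h0 fun x hx => ?_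
  have := not_imp_comm.1 (mem_box.1 hf x) (Finsupp.mem_support_iff.1 hx)
  exact h x _ this.1 this.2.1 this.2.2.1 this.2.2.2

lemma eval_toPoly {n m : ℤ} {f : Laurent} (hf : f ∈ box 0 (n, m)) (z w : ℂ) :
    ((toPoly f).map (evalRingHom w)).eval z = evL z w f := by
  refine box_induction_add hf (fun f => ((toPoly f).map (evalRingHom w)).eval z = evL z w f)
    (by simp) (fun f g hf hg => ?_) fun x a h1 h2 h3 h4 => ?_
  · rw [map_add, Polynomial.map_add, eval_add, hf, hg, map_add]
  · obtain ⟨i, hi⟩ := Int.eq_ofNat_of_zero_le h1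
    obtain ⟨j, hj⟩ := Int.eq_ofNat_of_zero_le h3
    simp [hi, hj]; ring

/-- On |w| = 1 the leading coefficient in z is, up to conjugation and a unimodular factor, the
reverse at z = 0; stability makes it nonzero there. -/
lemma star_eval_coeff_toPoly {n m : ℕ} {f : Laurent} (hf : f ∈ box 0 ((n : ℤ), (m : ℤ))) {w : ℂ}
    (hw : ‖w‖ = 1) :
    w ^ m * star (((toPoly f).coeff n).eval w) = evL 0 w (rev (n, m) f) := by
  have hw0 : w ≠ 0 := fun h => by simp [h] at hw
  have hs : star w = w⁻¹ := (Complex.inv_eq_conj hw).symm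
  refine box_induction_add hf
    (fun f => w ^ m * star (((toPoly f).coeff n).eval w) = evL 0 w (rev (n, m) f))
    (by simp) (fun f g hf hg => ?_) fun x a h1 h2 h3 h4 => ?_
  · rw [map_add, coeff_add, eval_add, star_add, mul_add, hf, hg, rev_add, map_add]
  · obtain ⟨i, hi⟩ := Int.eq_ofNat_of_zero_le h1
    obtain ⟨j, hj⟩ := Int.eq_ofNat_of_zero_le h3
    rw [toPoly_single, rev_single, evL_single, coeff_monomial]
    simp only [hi, hj, Int.toNat_natCast, Prod.fst_sub, Prod.snd_sub]
    by_cases hin : i = n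
    · rw [if_pos hin, hin, eval_monomial, star_mul, star_pow, hs, sub_self, zpow_zero, one_mul,
        zpow_sub₀ hw0, zpow_natCast, zpow_natCast, inv_pow]
      field_simp
    · rw [if_neg hin, zero_zpow _ (by omega)]; simp

lemma evL_rev {z w : ℂ} (hz : z ≠ 0) (hw : w ≠ 0) (v : ℤ × ℤ) (f : Laurent) :
    evL z w (rev v f) = z ^ v.1 * w ^ v.2 * star (evL (star z)⁻¹ (star w)⁻¹ f) := by
  induction f using Finsupp.induction_linear with
  | zero => simp
  | add f g hf hg => rw [rev_add, map_add, hf, hg, map_add, star_add, mul_add]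
  | single x a =>
    rw [rev_single, evL_single, evL_single, star_mul, star_mul, Prod.fst_sub, Prod.snd_sub,
      zpow_sub₀ hz, zpow_sub₀ hw, star_zpow₀, star_zpow₀, star_inv₀, star_inv₀, star_star, star_star]
    simp only [inv_zpow]
    field_simp

end toPoly

/-! ### The moments on a strip are determined by the orthogonality relations -/

section unique
open Polynomial
variable {c c₀ : ℤ × ℤ → ℂ} {n m : ℕ} {p : Laurent}

/-- The functional on polynomials defined by moments in a strip. -/
def seqFun (D : ℤ × ℤ → ℂ) (n : ℕ) : ℂ[X][X] →ₗ[ℂ[X]] Module.AEval' shiftSeq :=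
  Polynomial.lsum fun s => LinearMap.toSpanSingleton ℂ[X] _
    (Module.AEval'.of shiftSeq fun b => D ((s : ℤ) - n, b))

lemma seqFun_monomial (D : ℤ × ℤ → ℂ) (n s : ℕ) (r : ℂ[X]) :
    seqFun D n (monomial s r) =
      Module.AEval'.of shiftSeq (aeval shiftSeq r fun b => D ((s : ℤ) - n, b)) := by
  rw [seqFun, Polynomial.lsum_apply, sum_monomial_index _ _ (by simp)]
  rfl

/-- Multiplication by w acts as the shift of sequences, so the relations of f with z^{N-k}w^{-b} for
all b become one relation over ℂ[w]. -/
lemma seqFun_toPoly_mul (D : ℤ × ℤ → ℂ) (N : ℕ) (k : ℕ) {n m : ℤ} {f : Laurent}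
    (hf : f ∈ box 0 (n, m)) :
    seqFun D N (toPoly f * X ^ k) = Module.AEval'.of shiftSeq
      fun b => ip D f (Finsupp.single ((N : ℤ) - k, -b) 1) := by
  refine box_induction_add hf (fun f => seqFun D N (toPoly f * X ^ k) = Module.AEval'.of shiftSeq
      fun b => ip D f (Finsupp.single ((N : ℤ) - k, -b) 1)) ?_ (fun f g hf hg => ?_)
      fun x a h1 h2 h3 h4 => ?_
  · simp; rfl
  · rw [map_add, add_mul, map_add, hf, hg, ← map_add]
    congr 1; funext b; simp [ip_add_left]
  · rw [toPoly_single, monomial_mul_X_pow, seqFun_monomial]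
    congr 1; funext b
    rw [← C_mul_X_pow_eq_monomial, map_mul, aeval_C, map_pow, aeval_X, Module.End.mul_apply,
      Module.algebraMap_end_apply, Pi.smul_apply, shiftSeq_pow_apply, ip_single, smul_eq_mul,
      star_one, mul_one]
    congr 2
    obtain ⟨i, hi⟩ := Int.eq_ofNat_of_zero_le h1
    obtain ⟨j, hj⟩ := Int.eq_ofNat_of_zero_le h3
    ext
    · simp [hi]; ring
    · simp [hj]; ring

/-- Nonnegativity of the form at z^{v+x} - t z^v with t = c(x)/|c(x)|, where v makes both exponents
nonnegative. This is the source of boundedness along the strips. -/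
lemma norm_moment_le {N M : ℤ} (hc : Herm c) (hpd : PD c N M) {x : ℤ × ℤ} (h1 : |x.1| ≤ N)
    (h2 : |x.2| ≤ M) : ‖c x‖ ≤ (c 0).re := by
  set v : ℤ × ℤ := (max (-x.1) 0, max (-x.2) 0) with hv
  obtain ⟨h1, h1'⟩ := abs_le.1 h1
  obtain ⟨h2, h2'⟩ := abs_le.1 h2
  have key : ∀ t : ℂ, 0 ≤ (ip c (Finsupp.single (v + x) 1 - Finsupp.single v t)
      (Finsupp.single (v + x) 1 - Finsupp.single v t)).re := by
    intro t
    by_cases h0 : (Finsupp.single (v + x) 1 - Finsupp.single v t : Laurent) = 0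
    · rw [h0]; simp
    · refine (hpd _ (Submodule.sub_mem _ (single_mem_box ?_) (single_mem_box ?_)) h0).le
      · simp [hv]; omega
      · simp [hv]; omega
  by_cases hx : c x = 0
  · have h3 := key 0
    simp at h3
    simpa [hx] using h3
  · have hne : (‖c x‖ : ℂ) ≠ 0 := by simpa using hx
    have h3 := key (c x / ‖c x‖)
    have h4 : c x * star (c x) = (‖c x‖ : ℂ) ^ 2 := Complex.mul_conj' (c x)
    have h5 : ip c (Finsupp.single (v + x) 1 - Finsupp.single v (c x / ‖c x‖))
        (Finsupp.single (v + x) 1 - Finsupp.single v (c x / ‖c x‖)) = 2 * c 0 - 2 * ‖c x‖ := by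
      have e : v - (v + x) = -x := by abel
      simp only [ip_sub_left, ip_sub_right, ip_single, sub_self, add_sub_cancel_left, e, hc x,
        star_div₀, star_one, mul_one, one_mul]
      rw [show star (‖c x‖ : ℂ) = ‖c x‖ from Complex.conj_ofReal _]
      field_simp
      linear_combination (c 0 - 2 * ‖c x‖) * h4
    rw [h5] at h3
    simp at h3
    linarith

/-- The relations satisfied by `p` on a strip. -/
def StripOrth (c : ℤ × ℤ → ℂ) (n m : ℤ) (p : Laurent) : Prop :=
  ∀ a b : ℤ, 0 ≤ a → a ≤ n → ¬(a = n ∧ m ≤ b) → ip c p (Finsupp.single (a, b) 1) = 0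

/-- w^{-k}p contains no monomial z^n w^b with b ≥ m, so p is orthogonal to it; shift invariance and
Hermitian symmetry give the claim. -/
lemma StripOrth.shift_eq (hc : Herm c) (h : StripOrth c n m p) (hp : p ∈ box 0 ((n : ℤ), (m : ℤ)))
    {k : ℤ} (hk : 1 ≤ k) : ip c p (shift (0, k) p) = 0 := by
  rw [← ip_shift c (0, -k), shift_shift]
  have h1 : ip c p (shift (0, -k) p) = 0 := by
    refine mem_perpTo.1 (box_induction (shift_mem_box (0, -k) hp) _ fun x h1 h2 h3 h4 => ?_)
    simp at h1 h2 h3 h4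
    exact h x.1 x.2 h1 h2 (by omega)
  have h2 := ip_eq_zero_comm hc h1
  simpa [← Prod.zero_eq_mk] using h2

/-- Moments on a strip are determined by the relations satisfied by `p`. -/
theorem StripOrth.unique (hc : Herm c) (hc₀ : Herm c₀) (hp : p ∈ box 0 ((n : ℤ), (m : ℤ)))
    (hp0 : p (n, m) ≠ 0) (hpd : ∀ j : ℕ, PD c n j) (hpd₀ : ∀ j : ℕ, PD c₀ n j)
    (h : StripOrth c n m p) (h₀ : StripOrth c₀ n m p) (hn : ip c p p = 1) (hn₀ : ip c₀ p p = 1)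
    (hst : ∀ z w : ℂ, ‖z‖ ≤ 1 → ‖w‖ ≤ 1 → evL z w (rev (n, m) p) ≠ 0) {x : ℤ × ℤ}
    (hx : |x.1| ≤ n) : c x = c₀ x := by
  set D := c - c₀ with hD
  have hDh : Herm D := fun x => by simp [hD, hc x, hc₀ x]
  have hbd : ∀ k : ℤ, |k| ≤ n → (fun b => D (k, b)) ∈ boundedSeq := fun k hk =>
    ⟨(c 0).re + (c₀ 0).re, fun b => (norm_sub_le _ _).trans (add_le_add
      (norm_moment_le hc (hpd b.natAbs) hk (by simp)) (norm_moment_le hc₀ (hpd₀ b.natAbs) hk (by simp)))⟩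
  -- all relations hold for the difference
  have rel : ∀ a b : ℤ, 0 ≤ a → a ≤ n → ip D p (Finsupp.single (a, b) 1) = 0 := by
    have h1 : ∀ a b : ℤ, 0 ≤ a → a ≤ n → ¬(a = n ∧ m ≤ b) →
        ip D p (Finsupp.single (a, b) 1) = 0 := fun a b ha ha' hab => by
      rw [hD, ip_sub_moment, h a b ha ha' hab, h₀ a b ha ha' hab, sub_zero]
    -- The relations missing at z^n w^{m+k} come from the product of p with w^k p, which is 1 for k
    -- = 0 and 0 otherwise for both forms; all its other terms are already known by induction.
    have h2 : ∀ k : ℕ, ip D p (Finsupp.single ((n : ℤ), (m : ℤ) + k) 1) = 0 := by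
      intro k
      induction k using Nat.strong_induction_on with
      | _ k ih =>
        have h3 : ip D p (shift (0, k) p) = 0 := by
          rw [hD, ip_sub_moment]
          rcases Nat.eq_zero_or_pos k with rfl | hk
          · simp [← Prod.zero_eq_mk, hn, hn₀]
          · rw [h.shift_eq hc hp (by omega), h₀.shift_eq hc₀ hp (by omega), sub_zero]
        set g := shift (0, (k : ℤ)) p with hg
        have hgt : g (n, (m : ℤ) + k) = p (n, m) := by simp [hg]
        have hgm : g - Finsupp.single ((n : ℤ), (m : ℤ) + k) (p (n, m)) ∈ perpTo D p := by
          have hgb : g ∈ box (0, (k : ℤ)) ((n : ℤ), (m : ℤ) + k) := by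
            simpa using shift_mem_box (0, (k : ℤ)) hp
          refine box_induction_ne (X := ((n : ℤ), (m : ℤ) + k))
            (Submodule.sub_mem _ hgb (single_mem_box (by simp))) (by simp [hgt]) _
            fun y y1 y2 y3 y4 y5 => ?_
          simp only at y1 y2 y3 y4 y5
          by_cases hy : y.1 = n ∧ (m : ℤ) ≤ y.2
          · have := ih (y.2 - m).toNat (by omega)
            rw [show (m : ℤ) + (y.2 - m).toNat = y.2 by omega, ← hy.1] at this
            exact this
          · exact h1 y.1 y.2 y1 y2 hy
        rw [mem_perpTo, ip_sub_right, h3, zero_sub, neg_eq_zero] at hgm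
        have e : (Finsupp.single ((n : ℤ), (m : ℤ) + k) (p (n, m)) : Laurent) =
            p (n, m) • Finsupp.single ((n : ℤ), (m : ℤ) + k) 1 := by simp
        rw [e, ip_smul_right] at hgm
        exact (mul_eq_zero.1 hgm).resolve_left (star_ne_zero.2 hp0)
    intro a b ha ha'
    by_cases hab : a = n ∧ (m : ℤ) ≤ b
    · have := h2 (b - m).toNat
      rwa [show (m : ℤ) + (b - m).toNat = b by omega, ← hab.1] at this
    · exact h1 a b ha ha' hab
  have rel' : ∀ a b : ℤ, 0 ≤ a → a ≤ n → ip D (rev (n, m) p) (Finsupp.single (a, b) 1) = 0 := by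
    intro a b ha ha'
    rw [← ip_rev D (n, m), rev_rev, sub_self, shift_zero, rev_single, star_one]
    exact ip_eq_zero_comm hDh (rel _ _ (by simpa using ha') (by simpa using ha))
  have hqm : rev (n, m) p ∈ box 0 ((n : ℤ), (m : ℤ)) := by
    have := rev_mem_box ((n : ℤ), (m : ℤ)) hp; simpa using this
  have hP := natDegree_toPoly hp
  have hQ := natDegree_toPoly hqm
  set r := resultant (toPoly p) (toPoly (rev (n, m) p)) n n with hr
  have hlead : ∀ w : ℂ, ‖w‖ = 1 → ((toPoly p).coeff n).eval w ≠ 0 := by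
    intro w hw h0
    refine hst 0 w (by simp) hw.le ?_
    rw [← star_eval_coeff_toPoly hp hw, h0]; simp
  have hr1 : ∀ w : ℂ, ‖w‖ = 1 → r.eval w ≠ 0 := by
    intro w hw
    have hw0 : w ≠ 0 := fun h => by simp [h] at hw
    rw [← coe_evalRingHom, hr, ← resultant_map_map]
    set P := (toPoly p).map (evalRingHom w) with hPdef
    set Q := (toPoly (rev (n, m) p)).map (evalRingHom w) with hQdef
    have hPn : P.natDegree = n := by
      refine le_antisymm (natDegree_map_le.trans hP) (le_natDegree_of_ne_zero ?_)
      rw [hPdef, coeff_map]; exact hlead w hw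
    have hQn : Q.natDegree ≤ n := natDegree_map_le.trans hQ
    obtain ⟨d, hd⟩ := Nat.exists_eq_add_of_le hQn
    -- The resultant has formal degrees n, n, but the second polynomial may drop in degree; each
    -- lost degree costs a factor equal to the nonzero leading coefficient of the first.
    have e : resultant P Q n n = P.coeff n ^ d * resultant P Q := by
      conv_lhs => rw [show resultant P Q n n = resultant P Q n (Q.natDegree + d) by rw [← hd]]
      rw [resultant_add_right_deg _ _ _ _ _ le_rfl, hPn]
    rw [e]
    refine mul_ne_zero (pow_ne_zero _ ?_) (resultant_ne_zero _ _ ?_)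
    · rw [hPdef, coeff_map]; exact hlead w hw
    · refine (isCoprime_iff_aeval_ne_zero_of_isAlgClosed (k := ℂ) (K := ℂ) P Q).2 fun z => ?_
      by_contra! hz
      rw [hPdef, hQdef] at hz
      replace hz : evL z w p = 0 ∧ evL z w (rev (n, m) p) = 0 :=
        ⟨(eval_toPoly hp z w).symm.trans hz.1, (eval_toPoly hqm z w).symm.trans hz.2⟩
      -- By stability a common zero has |z| > 1, and its reflection (1/z̄, 1/w̄) is then a zero of
      -- the reverse of p in the closed bidisk.
      have h1 : 1 < ‖z‖ := by
        by_contra! h1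
        exact hst z w h1 hw.le hz.2
      have hz0 : z ≠ 0 := fun h => by simp [h] at h1; linarith
      have h2 := hst (star z)⁻¹ (star w)⁻¹ (by
        rw [norm_inv, norm_star]; exact inv_le_one_of_one_le₀ h1.le) (by simp [hw])
      rw [evL_rev (inv_ne_zero (star_ne_zero.2 hz0)) (inv_ne_zero (star_ne_zero.2 hw0))] at h2
      simp [hz.1] at h2
  have hlow : ∀ j : ℕ, j < n + n → ∀ b, D ((j : ℤ) - n, b) = 0 := by
    intro j hj
    have h1 := resultant_smul_eq_zero hP hQ (seqFun D n)
      (fun k hk => by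
        rw [seqFun_toPoly_mul D n k hp]
        rw [show (fun b => ip D p (Finsupp.single ((n : ℤ) - k, -b) 1)) = 0 from
          funext fun b => rel _ _ (by omega) (by omega), map_zero])
      (fun k hk => by
        rw [seqFun_toPoly_mul D n k hqm]
        rw [show (fun b => ip D (rev (n, m) p) (Finsupp.single ((n : ℤ) - k, -b) 1)) = 0 from
          funext fun b => rel' _ _ (by omega) (by omega), map_zero]) hj
    rw [← monomial_one_right_eq_X_pow, seqFun_monomial, map_one, Module.End.one_apply, ← hr] at h1
    have h2 : aeval shiftSeq r (fun b => D ((j : ℤ) - n, b)) = 0 :=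
      (Module.AEval'.of shiftSeq).injective (by rw [map_zero]; exact h1)
    exact fun b => congrFun (bounded_eq_zero_of_aeval r hr1
      (hbd _ (by rw [abs_le]; omega)) h2) b
  have hlow' : ∀ a b : ℤ, -n ≤ a → a < n → D (a, b) = 0 := fun a b h1 h2 => by
    have := hlow (a + n).toNat (by omega) b
    rwa [show (((a + n).toNat : ℤ)) - n = a by omega] at this
  -- The resultant reaches only the 2n columns -n, …, n-1. In the relation of p with the column 0
  -- these drop out, and the leading coefficient of p in z alone annihilates the column n.
  have htop : (fun b => D ((n : ℤ), b)) = 0 := by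
    refine bounded_eq_zero_of_aeval ((toPoly p).coeff n) hlead (hbd _ (by simp)) ?_
    have h1 := seqFun_toPoly_mul D n n hp
    rw [show (fun b => ip D p (Finsupp.single ((n : ℤ) - n, -b) 1)) = 0 from
          funext fun b => rel _ _ (by omega) (by omega), map_zero,
      (toPoly p).as_sum_range' (n + 1) (by omega), Finset.sum_mul, map_sum,
      Finset.sum_eq_single_of_mem n (by simp)] at h1
    · rw [monomial_mul_X_pow, seqFun_monomial] at h1
      have h2 := (Module.AEval'.of shiftSeq).injective (h1.trans (map_zero _).symm)
      simpa using h2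
    · intro s hs hsn
      have hs' := Finset.mem_range.1 hs
      rw [monomial_mul_X_pow, seqFun_monomial,
        show (fun b => D (((s + n : ℕ) : ℤ) - n, b)) = 0 from
          funext fun b => hlow' _ b (by omega) (by omega), map_zero, map_zero]
  have hle : D x = 0 := by
    obtain ⟨h1, h2⟩ := abs_le.1 hx
    rcases h2.lt_or_eq with h2 | h2
    · exact hlow' x.1 x.2 h1 h2
    · have := congrFun htop x.2
      rw [← h2] at this; exact this
  exact sub_eq_zero.1 hle

end unique

/-! ### Forms of Bernstein–Szegő type -/

/-- The orthogonality relations of the form given by the density `1/|p|²`. -/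
structure BernsteinSzego (c : ℤ × ℤ → ℂ) (n m : ℕ) (p : Laurent) : Prop where
  herm : Herm c
  pd : ∀ N M : ℕ, PD c N M
  mem : p ∈ box 0 ((n : ℤ), (m : ℤ))
  pos : IsPos (p (n, m))
  norm : ip c p p = 1
  perp : ∀ a b : ℤ, ¬(n ≤ a ∧ m ≤ b) → ip c p (Finsupp.single (a, b) 1) = 0
  stable : ∀ z w : ℂ, ‖z‖ ≤ 1 → ‖w‖ ≤ 1 → evL z w (rev (n, m) p) ≠ 0

/-! ### Sequences on the half-line -/

section halfline
open Polynomial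

/-- The shift of sequences on the half-line. -/
def shiftNat : Module.End ℂ (ℕ → ℂ) := LinearMap.funLeft ℂ ℂ fun b => b + 1

@[simp] lemma shiftNat_apply (d : ℕ → ℂ) (b : ℕ) : shiftNat d b = d (b + 1) := rfl

lemma shiftNat_pow_apply (k : ℕ) (d : ℕ → ℂ) (b : ℕ) : (shiftNat ^ k) d b = d (b + k) := by
  induction k generalizing b with
  | zero => simp
  | succ k ih =>
    rw [pow_succ', Module.End.mul_apply, shiftNat_apply, ih]; congr 1; ring

/-- The bounded sequences on the half-line. -/
def boundedNat : Submodule ℂ (ℕ → ℂ) where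
  carrier := {d | ∃ C, ∀ b, ‖d b‖ ≤ C}
  add_mem' := by
    rintro d e ⟨C, hC⟩ ⟨C', hC'⟩
    exact ⟨C + C', fun b => (norm_add_le _ _).trans (add_le_add (hC b) (hC' b))⟩
  zero_mem' := ⟨0, fun b => by simp⟩
  smul_mem' := by
    rintro r d ⟨C, hC⟩
    exact ⟨‖r‖ * C, fun b => by
      rw [Pi.smul_apply, norm_smul]; exact mul_le_mul_of_nonneg_left (hC b) (norm_nonneg r)⟩

/-- On a half-line only forward growth is available, so zeros must be excluded from the whole closed
disk. -/
lemma boundedNat_eq_zero_of_aeval (r : ℂ[X]) (h : ∀ a, ‖a‖ ≤ 1 → r.eval a ≠ 0) {d : ℕ → ℂ}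
    (hd : d ∈ boundedNat) (h0 : aeval shiftNat r d = 0) : d = 0 := by
  refine eq_zero_of_aeval_eq_zero shiftNat boundedNat ?_ r ?_ ?_ d hd h0
  · rintro x ⟨C, hC⟩; exact ⟨C, fun b => hC _⟩
  · rintro rfl; exact h 0 (by simp) (by simp)
  · rintro a ha x ⟨C, hC⟩ hT
    funext b
    have := eq_zero_of_geometric (a := a) (d := fun k => x (b + k)) (C := C)
      (by by_contra! h1; exact h a h1 ha) (fun k => hC _) (fun k => congrFun hT (b + k))
    simpa using this

/-- The columns to the right of a vanish by `h`, so only the z^0 part of g contributes, with w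
acting as the shift. -/
lemma aeval_coeff_zero_toPoly {c : ℤ × ℤ → ℂ} {n m a : ℤ} {f g : Laurent} (hg : g ∈ box 0 (n, m))
    (h : ∀ s b : ℤ, a < s → s ≤ a + n → 0 ≤ b → ip c (Finsupp.single (s, b) 1) f = 0) (b : ℕ) :
    aeval shiftNat ((toPoly g).coeff 0) (fun b : ℕ => ip c (Finsupp.single (a, (b : ℤ)) 1) f) b =
      ip c (shift (a, (b : ℤ)) g) f := by
  refine box_induction_add hg (fun g => aeval shiftNat ((toPoly g).coeff 0)
    (fun b : ℕ => ip c (Finsupp.single (a, (b : ℤ)) 1) f) b = ip c (shift (a, (b : ℤ)) g) f) (by simp)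
    (fun g g' hg hg' => ?_) fun x r h1 h2 h3 h4 => ?_
  · rw [map_add, coeff_add, map_add, LinearMap.add_apply, Pi.add_apply, hg, hg', map_add,
      ip_add_left]
  · obtain ⟨i, hi⟩ := Int.eq_ofNat_of_zero_le h1
    obtain ⟨j, hj⟩ := Int.eq_ofNat_of_zero_le h3
    have e : ∀ y, (Finsupp.single y r : Laurent) = r • Finsupp.single y 1 := fun y => by simp
    rw [toPoly_single, coeff_monomial, shift_single, e, ip_smul_left]
    simp only [hi, hj, Int.toNat_natCast]
    by_cases hi0 : i = 0
    · rw [if_pos hi0, ← C_mul_X_pow_eq_monomial, map_mul, aeval_C, map_pow, aeval_X,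
        Module.End.mul_apply, Module.algebraMap_end_apply, Pi.smul_apply, shiftNat_pow_apply,
        smul_eq_mul]
      congr 3
      ext
      · simp [hi, hi0]
      · simp [hj]; ring
    · simp only [Prod.fst_zero, Prod.snd_zero] at h1 h2 h3 h4
      rw [if_neg hi0, map_zero, LinearMap.zero_apply, Pi.zero_apply,
        show x + (a, (b : ℤ)) = (x.1 + a, x.2 + b) from rfl, h _ _ (by omega) (by omega) (by omega),
        mul_zero]

end halfline

namespace BernsteinSzego
variable {c : ℤ × ℤ → ℂ} {n m : ℕ} {p : Laurent}

lemma stripOrth (h : BernsteinSzego c n m p) : StripOrth c n m p := fun a b _ ha hab =>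
  h.perp a b (by omega)

lemma perp_shift (h : BernsteinSzego c n m p) {a b x y : ℤ} (hx : ¬(n + a ≤ x ∧ m + b ≤ y)) :
    ip c (shift (a, b) p) (Finsupp.single (x, y) 1) = 0 := by
  have e : (Finsupp.single (x, y) 1 : Laurent) = shift (a, b) (Finsupp.single (x - a, y - b) 1) := by
    simp
  rw [e, ip_shift]
  exact h.perp _ _ (by omega)

lemma isTop_shift (h : BernsteinSzego c n m p) {a b : ℤ} (ha : 0 ≤ a) (hb : 0 ≤ b) :
    IsTop c (n + a) (m + b) (shift (a, b) p) := by
  refine isTop_of_single ?_ ?_ ?_ ?_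
  · exact box_mono (by simpa using ha) (by simpa using hb) (by simp) (by simp)
      (shift_mem_box (a, b) h.mem)
  · simpa using h.pos
  · rw [ip_shift, h.norm]
  · intro x h1 h2 h3 h4 h5
    exact h.perp_shift (by omega)

lemma perp_rev (h : BernsteinSzego c n m p) {a b x y : ℤ} (hx : ¬(x ≤ a ∧ y ≤ b)) :
    ip c (shift (a, b) (rev (n, m) p)) (Finsupp.single (x, y) 1) = 0 := by
  have := h.perp_shift (a := 0) (b := 0) (x := n + a - x) (y := m + b - y) (by omega)
  rw [shift_rev, ← ip_rev c ((n : ℤ) + a, (m : ℤ) + b), rev_rev, rev_single, star_one]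
  refine ip_eq_zero_comm h.herm ?_
  have e : (((n : ℤ) + a, (m : ℤ) + b) - ((a, b) + ((n : ℤ), (m : ℤ))) : ℤ × ℤ) = (0, 0) := by
    ext <;> simp <;> ring
  rw [e]
  exact this

lemma isTop_eq (h : BernsteinSzego c n m p) {N M : ℕ} (hN : n ≤ N) (hM : m ≤ M) {f : Laurent}
    (hf : IsTop c N M f) : f = shift ((N : ℤ) - n, (M : ℤ) - m) p := by
  have := h.isTop_shift (a := (N : ℤ) - n) (b := (M : ℤ) - m) (by omega) (by omega)
  rw [add_sub_cancel, add_sub_cancel] at this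
  exact hf.eq (h.pd N M) this

/-- Orthogonality to the left of a strip. -/
lemma perp_left (h : BernsteinSzego c n m p) {f : Laurent} (hf : f ∈ box 0 ((n : ℤ), (m : ℤ)))
    (h0 : ∀ a b : ℤ, 0 ≤ a → a < n → 0 ≤ b → ip c (Finsupp.single (a, b) 1) f = 0) (a b : ℤ)
    (ha : a < n) (hb : 0 ≤ b) : ip c (Finsupp.single (a, b) 1) f = 0 := by
  by_cases ha0 : 0 ≤ a
  · exact h0 a b ha0 ha hb
  · obtain ⟨k, rfl⟩ : ∃ k : ℕ, a = -(k : ℤ) - 1 := ⟨(-a - 1).toNat, by omega⟩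
    clear ha0 ha
    induction k using Nat.strong_induction_on generalizing b with
    | _ k ih =>
      have hqm : rev (n, m) p ∈ box 0 ((n : ℤ), (m : ℤ)) := by
        have := rev_mem_box ((n : ℤ), (m : ℤ)) h.mem; simpa using this
      have hbig : ∀ s b : ℤ, -(k : ℤ) - 1 < s → s ≤ -(k : ℤ) - 1 + n → 0 ≤ b →
          ip c (Finsupp.single (s, b) 1) f = 0 := by
        intro s b h1 h2 hb
        by_cases hs : 0 ≤ s
        · exact h0 s b hs (by omega) hb
        · have := ih (-s - 1).toNat (by omega) b hb
          rwa [show -(((-s - 1).toNat : ℕ) : ℤ) - 1 = s by omega] at this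
      -- f is orthogonal to the shifts of the reverse of p that end in this column. As the columns
      -- to its right vanish, the z^0 coefficient of the reverse annihilates the column; that
      -- polynomial in w has no zero in the closed disk, and moments are bounded.
      have hz : (fun b : ℕ => ip c (Finsupp.single (-(k : ℤ) - 1, (b : ℤ)) 1) f) = 0 := by
        refine boundedNat_eq_zero_of_aeval ((toPoly (rev (n, m) p)).coeff 0) (fun w hw => ?_) ?_ ?_
        · have h1 := eval_toPoly hqm 0 w
          rw [← Polynomial.coeff_zero_eq_eval_zero, Polynomial.coeff_map] at h1
          exact fun h2 => h.stable 0 w (by simp) hw (h1.symm.trans h2)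
        · refine ⟨∑ x ∈ f.support, ‖f x‖ * (c 0).re, fun b => ?_⟩
          have e : ip c (Finsupp.single (-(k : ℤ) - 1, (b : ℤ)) 1) f =
              ∑ x ∈ f.support, star (f x) * c ((-(k : ℤ) - 1, (b : ℤ)) - x) := by
            rw [ip, Finsupp.sum_single_index (by simp), Finsupp.sum]; simp
          simp only [e]
          refine (norm_sum_le _ _).trans (Finset.sum_le_sum fun x _ => ?_)
          rw [norm_mul, norm_star]
          refine mul_le_mul_of_nonneg_left ?_ (norm_nonneg _)
          exact norm_moment_le h.herm (h.pd _ _) (Int.abs_eq_natAbs _).le (Int.abs_eq_natAbs _).le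
        · funext b
          rw [aeval_coeff_zero_toPoly hqm hbig b]
          refine ip_eq_zero_comm h.herm ?_
          refine ip_eq_zero_comm h.herm (mem_perpTo.1 (box_induction hf _ fun x h1 h2 h3 h4 => ?_))
          simp only [Prod.fst_zero] at h1
          exact h.perp_rev (by omega)
      have := congrFun hz b.toNat
      rwa [Int.toNat_of_nonneg hb] at this

end BernsteinSzego

/-! ### All levels -/

section allLevels
variable {u : ℤ → ℤ → ℂ} {c : ℤ × ℤ → ℂ} {n m : ℕ} {p : Laurent}

/-- The last row of the inverse leading matrix applied to F has z^n as its only term of z-degree n.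
-/
lemma IsOrth.exists_monic {n m : ℤ} (hn : 0 ≤ n) {k : ℕ} {F : Fin (k + 1) → Laurent}
    (hF : IsOrth c n m F) :
    ∃ f ∈ box 0 (n, m), Finsupp.single (n, 0) 1 - f ∈ box 0 (n - 1, m) ∧
      ∀ g ∈ box 0 (n - 1, m), ip c f g = 0 := by
  have hk : (k : ℤ) = m := by have := hF.card; push_cast at this; omega
  have hm : ((coefZ n m F)⁻¹ ⊳ F) (Fin.last k) ∈ box 0 (n, m) := actL_mem hF.mem _
  refine ⟨((coefZ n m F)⁻¹ ⊳ F) (Fin.last k), hm, ?_, hF.perp.actL _ _⟩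
  refine mem_box_of_coef (k := k + 1)
    (Submodule.sub_mem _ (single_mem_box (by simp; omega)) hm) hF.card fun b => ?_
  have h1 := congrFun (congrFun hF.utp.inv_mul (Fin.last k)) b
  rw [← coefZ_actL] at h1
  rw [Finsupp.sub_apply, sub_eq_zero]
  refine Eq.trans ?_ h1.symm
  rw [Finsupp.single_apply, Matrix.one_apply]
  refine if_congr ?_ rfl rfl
  rw [Prod.mk.injEq, Fin.ext_iff, Fin.val_last]
  omega

/-- The parameters vanish away from the strips. -/
lemma BernsteinSzego.paramEq (h : BernsteinSzego c n m p)
    (hu : ∀ i j : ℤ, u (-i) (-j) = star (u i j))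
    (hs : Strip (level u) c n m) (hc : ∀ i j : ℕ, n < i → m < j → u i j = 0 ∧ u (-i) j = 0)
    {N M : ℕ} (hN : n < N) (hM : m < M) (hl : LowerGood (level u) c N M) :
    ParamEq (level u) c u N M := by
  obtain ⟨k, rfl⟩ : ∃ k, N = k + 1 := ⟨N - 1, by omega⟩
  obtain ⟨l, rfl⟩ : ∃ l, M = l + 1 := ⟨M - 1, by omega⟩
  obtain ⟨hu1, hu2⟩ := hc _ _ hN hM
  push_cast at hu1 hu2
  -- Beyond the strips, top polynomials are monomial multiples of p.
  have eP : Ph (level u) (k + 1) l 0 = shift ((k : ℤ) + 1 - n, (l : ℤ) - m) p := by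
    have := h.isTop_eq (by omega) (by omega) (hl.down.orth.isTop h.herm)
    simpa using this
  have eT : PT (level u) k (l + 1) 0 = shift ((k : ℤ) - n, (l : ℤ) + 1 - m) p := by
    have := h.isTop_eq (by omega) (by omega) (hl.left.orthT.isTop h.herm)
    simpa using this
  refine ⟨?_, ?_⟩
  · rw [posVecs, posParam, hu1, star_zero]
    simp only [eP, eT, shift_shift, rev_shift]
    have e1 : ((0, 1) + ((k : ℤ) + 1 - n, (l : ℤ) - m) : ℤ × ℤ) =
        ((k : ℤ) + 1 - n, (l : ℤ) + 1 - m) := by ext <;> simp; ring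
    have e2 : (((k : ℤ), (l : ℤ) + 1) - ((k : ℤ) - n, (l : ℤ) + 1 - m) : ℤ × ℤ) =
        ((n : ℤ), (m : ℤ)) := by ext <;> simp
    rw [e1, e2]
    have hqm : rev (n, m) p ∈ box 0 ((n : ℤ), (m : ℤ)) := by
      have := rev_mem_box ((n : ℤ), (m : ℤ)) h.mem; simpa using this
    refine mem_perpTo.1 (box_induction hqm _ fun x h1 h2 h3 h4 => ?_)
    simp only [Prod.fst_zero] at h1 h2
    exact h.perp_shift (by omega)
  · rw [negVecs, negParam]
    split_ifs with h0
    · have e : u 1 (-1) = 0 := by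
        have := hu (-1) 1
        rw [neg_neg] at this
        rw [this, ← star_zero]
        congr 1
        simpa [h0.1, h0.2] using hu2
      rw [e, star_zero]
      simp only [eP, eT]
      have hm := shift_mem_box ((k : ℤ) - n, (l : ℤ) + 1 - m) h.mem
      refine mem_perpTo.1 (box_induction hm _ fun x h1 h2 h3 h4 => ?_)
      simp at h1 h2
      exact h.perp_shift (by omega)
    · have e : u (-(k + 1)) (l + 1) = 0 := by rw [← hu2]
      rw [e]
      simp only
      -- With f = z^n + (lower in z), the monomial z^{k+1} is z^{k+1-n}f plus a polynomial of degree
      -- (k, m). The shifted f is orthogonal to w-degrees ≥ 0 and z-degrees at most k by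
      -- `perp_left`; the rest is orthogonal to `relVec` because m ≤ l.
      obtain ⟨f, hf, hf1, hf2⟩ := (hs.good n le_rfl m).orth.exists_monic (by simp)
      have hleft := h.perp_left hf (fun a b ha ha' hb => by
        have := hs.perp_strip h.herm (k := n - 1) (by omega) hf
          (fun g hg => hf2 g (box_mono (by simp) (by simp) (by simp; omega) (by simp) hg)) b.toNat
          (Finsupp.single (a, b) 1) (single_mem_box (by simp; omega))
        exact ip_eq_zero_comm h.herm this)
      have hr := hl.relVec_mem
      have h1 : ip c (shift ((k : ℤ) + 1 - n, 0) f) (relVec (level u) k l) = 0 := by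
        refine mem_perpTo.1 (box_induction hr _ fun x h1 h2 h3 h4 => ?_)
        simp only [Prod.fst_zero, Prod.snd_zero] at h1 h2 h3
        have e : (Finsupp.single x 1 : Laurent) = shift ((k : ℤ) + 1 - n, 0)
          (Finsupp.single (x.1 - ((k : ℤ) + 1 - n), x.2) 1) := by simp
        rw [mem_perpTo, e, ip_shift]
        exact ip_eq_zero_comm h.herm (hleft _ _ (by omega) h3)
      have h2 : ip c (Finsupp.single ((k : ℤ) + 1, 0) 1 - shift ((k : ℤ) + 1 - n, 0) f)
          (relVec (level u) k l) = 0 := by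
        have h3 := shift_mem_box ((k : ℤ) + 1 - n, 0) hf1
        rw [map_sub, shift_single] at h3
        have h4 := hl.left.orthT.perp.actL ((level u k (l + 1)).leadT⁻¹) (Fin.last k)
        refine ip_eq_zero_comm h.herm (h4 _ ?_)
        have h5 := box_mono (lo' := 0) (hi' := ((k : ℤ), ((l + 1 : ℕ) : ℤ) - 1)) (by simp; omega) (by simp) (by simp) (by simp; omega) h3
        simpa using h5
      rw [ip_sub_left, h1, sub_zero] at h2
      exact h2

/-- All levels belong to the form, and the positivity condition holds everywhere. -/
theorem BernsteinSzego.good_all (h : BernsteinSzego c n m p)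
    (hu : ∀ i j : ℤ, u (-i) (-j) = star (u i j))
    (hs : Strip (level u) c n m) (hc : ∀ i j : ℕ, n < i → m < j → u i j = 0 ∧ u (-i) j = 0)
    (hparam : ∀ N M : ℕ, (N ≤ n ∨ M ≤ m) → ParamEq (level u) c u N M) :
    ∀ k N M : ℕ, N + M = k → Good (level u) c N M ∧ Positivity u N M := by
  intro k
  induction k using Nat.strong_induction_on with
  | _ k ih =>
    intro N M hk
    have hlow : ∀ i j : ℕ, i ≤ N → j ≤ M → (i, j) ≠ (N, M) → Good (level u) c i j ∧ PD c i j := by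
      intro i j hi hj hij
      have : i + j < k := by
        by_contra hlt
        exact hij (by rw [Prod.mk.injEq]; omega)
      exact ⟨(ih _ this i j rfl).1, h.pd i j⟩
    have hp : ParamEq (level u) c u N M := by
      by_cases hNM : N ≤ n ∨ M ≤ m
      · exact hparam N M hNM
      · exact h.paramEq hu hs hc (by omega) (by omega) fun i j hi hj hij => (hlow i j hi hj hij).1
    obtain ⟨h1, h2⟩ := step h.herm hlow hp
    exact ⟨h2 (h.pd N M), h1.2 (h.pd N M)⟩

end allLevels

/-! ### Means over the bicircle -/

section torusMean

/-- The mean of a function of two angles. -/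
def torusMean (F : ℝ → ℝ → ℂ) : ℂ :=
  (1 / (2 * (Real.pi : ℂ))) ^ 2 *
    ∫ θ in (-Real.pi)..Real.pi, ∫ φ in (-Real.pi)..Real.pi, F θ φ

lemma torusMean_add {F G : ℝ → ℝ → ℂ} (hF : Continuous F.uncurry) (hG : Continuous G.uncurry) :
    torusMean (fun θ φ => F θ φ + G θ φ) = torusMean F + torusMean G := by
  unfold torusMean
  rw [← mul_add, ← intervalIntegral.integral_add]
  · congr 2
    funext θ
    exact intervalIntegral.integral_add
      ((hF.comp (Continuous.prodMk_right θ)).intervalIntegrable _ _)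
      ((hG.comp (Continuous.prodMk_right θ)).intervalIntegrable _ _)
  · exact (intervalIntegral.continuous_parametric_intervalIntegral_of_continuous' hF
      _ _).intervalIntegrable _ _
  · exact (intervalIntegral.continuous_parametric_intervalIntegral_of_continuous' hG
      _ _).intervalIntegrable _ _

lemma torusMean_const_mul (r : ℂ) (F : ℝ → ℝ → ℂ) :
    torusMean (fun θ φ => r * F θ φ) = r * torusMean F := by
  simp only [torusMean, intervalIntegral.integral_const_mul]
  ring

lemma torusMean_star (F : ℝ → ℝ → ℂ) :
    torusMean (fun θ φ => star (F θ φ)) = star (torusMean F) := by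
  have h : ∀ f : ℝ → ℂ, ∫ x in (-Real.pi)..Real.pi, star (f x) =
      star (∫ x in (-Real.pi)..Real.pi, f x) := fun f => intervalIntegral.intervalIntegral_conj
  unfold torusMean
  simp only [h]
  rw [star_mul', star_pow]
  congr 2
  rw [star_div₀, star_one, star_mul']
  simp

lemma torusMean_ofReal (F : ℝ → ℝ → ℝ) :
    torusMean (fun θ φ => (F θ φ : ℂ)) = (((1 / (2 * Real.pi)) ^ 2 *
      ∫ θ in (-Real.pi)..Real.pi, ∫ φ in (-Real.pi)..Real.pi, F θ φ : ℝ) : ℂ) := by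
  unfold torusMean
  simp only [intervalIntegral.integral_ofReal]
  push_cast
  rfl

lemma torusMean_nonneg {F : ℝ → ℝ → ℝ}
    (h : ∀ θ ∈ Set.Icc (-Real.pi) Real.pi, ∀ φ ∈ Set.Icc (-Real.pi) Real.pi, 0 ≤ F θ φ) :
    0 ≤ (torusMean fun θ φ => (F θ φ : ℂ)).re ∧ (torusMean fun θ φ => (F θ φ : ℂ)).im = 0 := by
  rw [torusMean_ofReal]
  refine ⟨?_, Complex.ofReal_im _⟩
  rw [Complex.ofReal_re]
  have hpi : -Real.pi ≤ Real.pi := by linarith [Real.pi_pos]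
  exact mul_nonneg (by positivity) (intervalIntegral.integral_nonneg hpi fun θ hθ =>
    intervalIntegral.integral_nonneg hpi fun φ hφ => h θ hθ φ hφ)

lemma torusMean_one : torusMean (fun _ _ => 1) = 1 := by
  have hpi : (Real.pi : ℂ) ≠ 0 := by exact_mod_cast Real.pi_ne_zero
  simp [torusMean]
  field_simp
  ring

lemma torusMean_swap {F : ℝ → ℝ → ℂ} (hF : Continuous F.uncurry) :
    torusMean F = torusMean fun θ φ => F φ θ := by
  unfold torusMean
  congr 1
  refine MeasureTheory.intervalIntegral_intervalIntegral_swap ?_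
  refine MeasureTheory.IntegrableOn.mono_set (t := Set.uIcc (-Real.pi) Real.pi ×ˢ
    Set.uIcc (-Real.pi) Real.pi) (hF.continuousOn.integrableOn_compact
      (isCompact_uIcc.prod isCompact_uIcc)) ?_
  exact Set.prod_mono Set.uIoc_subset_uIcc Set.uIoc_subset_uIcc

lemma integral_circle {g : ℂ → ℂ} (hg : DifferentiableOn ℂ g (Metric.closedBall 0 1)) (h0 : g 0 = 0) :
    ∫ φ in (-Real.pi)..Real.pi, g (Circle.exp φ) = 0 := by
  have h1 : DiffContOnCl ℂ g (Metric.ball 0 |1|) := by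
    refine DifferentiableOn.diffContOnCl ?_
    rwa [abs_one, closure_ball _ one_ne_zero]
  have h2 := h1.circleAverage
  rw [h0, Real.circleAverage_def] at h2
  have h3 : ∫ θ in (0 : ℝ)..2 * Real.pi, g (circleMap 0 1 θ) = 0 :=
    (smul_eq_zero.1 h2).resolve_left (by positivity)
  have hper : Function.Periodic (fun φ => g (circleMap 0 1 φ)) (2 * Real.pi) := fun x => by
    simp [periodic_circleMap 0 1 x]
  have h4 := hper.intervalIntegral_add_eq (-Real.pi) 0
  rw [zero_add, show -Real.pi + 2 * Real.pi = Real.pi by ring, h3] at h4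
  rw [← h4]
  congr 1
  funext φ
  simp [circleMap]

end torusMean

/-! ### Laurent polynomials as functions of two angles -/

/-- The values of a Laurent polynomial on the bicircle. -/
def evT (f : Laurent) (θ φ : ℝ) : ℂ := evL (Circle.exp θ) (Circle.exp φ) f

lemma continuous_evT (f : Laurent) : Continuous (evT f).uncurry := by
  rw [continuous_iff_continuousAt]
  rintro ⟨θ, φ⟩
  exact (continuousAt_evL (Circle.coe_ne_zero _) (Circle.coe_ne_zero _) f).comp
    (f := fun x : ℝ × ℝ => ((Circle.exp x.1 : ℂ), (Circle.exp x.2 : ℂ))) (x := (θ, φ))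
    (by fun_prop)

@[simp] lemma evT_zero (θ φ : ℝ) : evT 0 θ φ = 0 := by simp [evT]

lemma evT_add (f g : Laurent) (θ φ : ℝ) : evT (f + g) θ φ = evT f θ φ + evT g θ φ := by simp [evT]

lemma evT_single (x : ℤ × ℤ) (a : ℂ) (θ φ : ℝ) :
    evT (Finsupp.single x a) θ φ = a * evT (Finsupp.single x 1) θ φ := by simp [evT]

lemma star_circle (θ : ℝ) : star (Circle.exp θ : ℂ) = (Circle.exp θ : ℂ)⁻¹ := by
  rw [← Circle.coe_inv, Circle.coe_inv_eq_conj]; rfl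

lemma evT_single_mul_star (x y : ℤ × ℤ) (θ φ : ℝ) :
    evT (Finsupp.single x 1) θ φ * star (evT (Finsupp.single y 1) θ φ) =
      evT (Finsupp.single (x - y) 1) θ φ := by
  have hz : (Circle.exp θ : ℂ) ≠ 0 := Circle.coe_ne_zero _
  have hw : (Circle.exp φ : ℂ) ≠ 0 := Circle.coe_ne_zero _
  simp only [evT, evL_single, one_mul, star_mul', star_zpow₀, star_circle, Prod.fst_sub,
    Prod.snd_sub, zpow_sub₀ hz, zpow_sub₀ hw, inv_zpow]
  field_simp

lemma evT_rev (v : ℤ × ℤ) (f : Laurent) (θ φ : ℝ) :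
    evT (rev v f) θ φ = evT (Finsupp.single v 1) θ φ * star (evT f θ φ) := by
  rw [evT, evL_rev (Circle.coe_ne_zero _) (Circle.coe_ne_zero _), star_circle, star_circle, inv_inv,
    inv_inv]
  simp [evT]

/-! ### Moments of a weight -/

/-- The moments of a weight. -/
def weightMoment (K : ℝ → ℝ → ℝ) (x : ℤ × ℤ) : ℂ :=
  torusMean fun θ φ => evT (Finsupp.single x 1) θ φ * K θ φ

section weight
variable {K : ℝ → ℝ → ℝ}

lemma continuous_evT_mul (hK : Continuous K.uncurry) (f g : Laurent) :
    Continuous (fun θ φ => evT f θ φ * star (evT g θ φ) * K θ φ : ℝ → ℝ → ℂ).uncurry :=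
  ((continuous_evT f).mul (continuous_evT g).star).mul (Complex.continuous_ofReal.comp hK)

lemma ip_weightMoment (hK : Continuous K.uncurry) (f g : Laurent) :
    ip (weightMoment K) f g = torusMean fun θ φ => evT f θ φ * star (evT g θ φ) * K θ φ := by
  have h0 : torusMean (fun _ _ => 0) = 0 := by simp [torusMean]
  induction f using Finsupp.induction_linear with
  | zero => simp [h0]
  | add f f' hf hf' =>
    rw [ip_add_left, hf, hf', ← torusMean_add (continuous_evT_mul hK _ _) (continuous_evT_mul hK _ _)]
    congr 1; funext θ φ; rw [evT_add]; ring
  | single x a =>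
    induction g using Finsupp.induction_linear with
    | zero => simp [h0]
    | add g g' hg hg' =>
      rw [ip_add_right, hg, hg', ← torusMean_add (continuous_evT_mul hK _ _)
        (continuous_evT_mul hK _ _)]
      congr 1; funext θ φ; rw [evT_add, star_add]; ring
    | single y b =>
      rw [ip_single, weightMoment, ← torusMean_const_mul]
      congr 1; funext θ φ
      rw [evT_single x a, evT_single y b, star_mul', ← evT_single_mul_star]; ring

lemma herm_weightMoment : Herm (weightMoment K) := by
  intro x
  rw [weightMoment, weightMoment, ← torusMean_star]
  congr 1; funext θ φ
  have := evT_single_mul_star 0 x θ φ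
  rw [zero_sub] at this
  rw [← this, star_mul', Complex.star_def, Complex.conj_ofReal]
  simp [evT]

/-- The mean value property. -/
lemma torusMean_div_eq_zero {q : Laurent} {n m : ℤ} (hq : q ∈ box 0 (n, m))
    (hst : ∀ z w : ℂ, ‖z‖ ≤ 1 → ‖w‖ ≤ 1 → evL z w q ≠ 0) {s t : ℤ} (h : 0 < s ∨ 0 < t) :
    torusMean (fun θ φ => evT (Finsupp.single (s, t) 1) θ φ / evT q θ φ) = 0 := by
  have hdw : ∀ z, Differentiable ℂ fun w => evL z w q := fun z => by
    refine box_induction_add hq (fun q => Differentiable ℂ fun w => evL z w q) (by simp)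
      (fun f g hf hg => by simp only [map_add]; exact hf.add hg) fun x a h1 h2 h3 h4 => ?_
    obtain ⟨j, hj⟩ := Int.eq_ofNat_of_zero_le h3
    simp only [evL_single, hj, zpow_natCast]
    fun_prop
  have hdz : ∀ w, Differentiable ℂ fun z => evL z w q := fun w => by
    refine box_induction_add hq (fun q => Differentiable ℂ fun z => evL z w q) (by simp)
      (fun f g hf hg => by simp only [map_add]; exact hf.add hg) fun x a h1 h2 h3 h4 => ?_
    obtain ⟨j, hj⟩ := Int.eq_ofNat_of_zero_le h1
    simp only [evL_single, hj, zpow_natCast]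
    fun_prop
  have hball : ∀ {z : ℂ}, z ∈ Metric.closedBall (0 : ℂ) 1 → ‖z‖ ≤ 1 := fun hz => by simpa using hz
  rcases h with h | h
  · obtain ⟨k, rfl⟩ := Int.eq_ofNat_of_zero_le h.le
    have hcont : Continuous (fun θ φ => evT (Finsupp.single ((k : ℤ), t) 1) θ φ / evT q θ φ :
        ℝ → ℝ → ℂ).uncurry :=
      (continuous_evT _).div (continuous_evT q) fun x => hst _ _ (by simp) (by simp)
    rw [torusMean_swap hcont]
    unfold torusMean
    simp only [evT, evL_single, zpow_natCast]
    rw [intervalIntegral.integral_congr (g := fun _ => 0), intervalIntegral.integral_zero, mul_zero]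
    intro φ _
    refine integral_circle (g := fun z => 1 * (z ^ k * (Circle.exp φ : ℂ) ^ t) /
      evL z (Circle.exp φ) q) ?_ ?_
    · refine DifferentiableOn.div (by fun_prop) (hdz _).differentiableOn fun z hz =>
        hst z _ (hball hz) (by simp)
    · simp [show k ≠ 0 by omega]
  · obtain ⟨k, rfl⟩ := Int.eq_ofNat_of_zero_le h.le
    unfold torusMean
    simp only [evT, evL_single, zpow_natCast]
    rw [intervalIntegral.integral_congr (g := fun _ => 0), intervalIntegral.integral_zero, mul_zero]
    intro θ _
    refine integral_circle (g := fun w => 1 * ((Circle.exp θ : ℂ) ^ s * w ^ k) /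
      evL (Circle.exp θ) w q) ?_ ?_
    · refine DifferentiableOn.div (by fun_prop) (hdw _).differentiableOn fun w hw =>
        hst _ w (by simp) (hball hw)
    · simp [show k ≠ 0 by omega]

lemma weightMoment_one (x : ℤ × ℤ) : weightMoment (fun _ _ => 1) x = if x = 0 then 1 else 0 := by
  have key : ∀ x : ℤ × ℤ, 0 < x.1 ∨ 0 < x.2 → weightMoment (fun _ _ => 1) x = 0 := fun x hx => by
    have := torusMean_div_eq_zero (q := Finsupp.single 0 1) (n := 0) (m := 0)
      (single_mem_box (by simp)) (fun z w _ _ => by simp) hx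
    rw [weightMoment, ← this]
    congr 1; funext θ φ
    simp [evT]
  split_ifs with h
  · rw [h, weightMoment]
    refine Eq.trans ?_ torusMean_one
    congr 1; funext θ φ
    simp [evT]
  · by_cases hx : 0 < x.1 ∨ 0 < x.2
    · exact key x hx
    · have h1 : x.1 ≠ 0 ∨ x.2 ≠ 0 := by
        by_contra! h'; exact h (Prod.ext h'.1 h'.2)
      have h2 := herm_weightMoment (K := fun _ _ => 1) x
      rw [key (-x) (by simp only [Prod.fst_neg, Prod.snd_neg]; omega)] at h2
      exact (star_eq_zero.1 h2.symm)

/-- Split off the minimum κ > 0 of the weight on the period square. The rest gives a nonnegative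
form, and the constant weight 1 gives the sum of |f_x|². -/
lemma pd_weightMoment (hK : Continuous K.uncurry) (hpos : ∀ θ φ, 0 < K θ φ) {f : Laurent}
    (hf : f ≠ 0) : 0 < (ip (weightMoment K) f f).re := by
  obtain ⟨x₀, hx₀, hmin⟩ := (isCompact_Icc.prod isCompact_Icc :
      IsCompact (Set.Icc (-Real.pi) Real.pi ×ˢ Set.Icc (-Real.pi) Real.pi)).exists_isMinOn
    ⟨(0, 0), by constructor <;> constructor <;> simp [Real.pi_pos.le]⟩ hK.continuousOn
  set κ : ℝ := K.uncurry x₀ with hκ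
  have hκ0 : 0 < κ := hpos _ _
  have hK' : Continuous (fun θ φ => K θ φ - κ : ℝ → ℝ → ℝ).uncurry := hK.sub continuous_const
  have hsq : ∀ θ φ (r : ℝ), evT f θ φ * star (evT f θ φ) * r = ((‖evT f θ φ‖ ^ 2 * r : ℝ) : ℂ) :=
    fun θ φ r => by rw [Complex.star_def, Complex.mul_conj, Complex.normSq_eq_norm_sq]; push_cast; rfl
  have h0 : Continuous (fun θ φ => (κ : ℂ) * (evT f θ φ * star (evT f θ φ) * ((1 : ℝ) : ℂ)) :
      ℝ → ℝ → ℂ).uncurry :=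
    continuous_const.mul (continuous_evT_mul (K := fun _ _ => 1) continuous_const f f)
  have h1 : ip (weightMoment K) f f = ip (weightMoment fun θ φ => K θ φ - κ) f f +
      κ * ip (weightMoment fun _ _ => 1) f f := by
    rw [ip_weightMoment hK, ip_weightMoment hK', ip_weightMoment continuous_const,
      ← torusMean_const_mul, ← torusMean_add (continuous_evT_mul hK' f f) h0]
    congr 1; funext θ φ; push_cast; ring
  have h2 : 0 ≤ (ip (weightMoment fun θ φ => K θ φ - κ) f f).re := by
    rw [ip_weightMoment hK']
    simp only [hsq]
    refine (torusMean_nonneg fun θ hθ φ hφ => mul_nonneg (by positivity) ?_).1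
    exact sub_nonneg.2 (hmin (Set.mk_mem_prod hθ hφ))
  have h3 : 0 < (ip (weightMoment fun _ _ => 1) f f).re := by
    have : ip (weightMoment fun _ _ => 1) f f = ((∑ x ∈ f.support, ‖f x‖ ^ 2 : ℝ) : ℂ) := by
      rw [ip, Finsupp.sum, Complex.ofReal_sum]
      refine Finset.sum_congr rfl fun x hx => ?_
      rw [Finsupp.sum, Finset.sum_eq_single x]
      · simp [weightMoment_one, Complex.mul_conj, Complex.normSq_eq_norm_sq]
      · intro y _ hy
        rw [weightMoment_one, if_neg (sub_ne_zero.2 (Ne.symm hy)), mul_zero]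
      · exact fun h => absurd hx h
    rw [this, Complex.ofReal_re]
    exact Finset.sum_pos (fun x hx => by have := Finsupp.mem_support_iff.1 hx; positivity)
      (Finsupp.support_nonempty_iff.2 hf)
  rw [h1, Complex.add_re, Complex.re_ofReal_mul]
  have := mul_pos hκ0 h3
  linarith

/-- The weight `1/|p|²`. -/
def bsWeight (p : Laurent) (θ φ : ℝ) : ℝ := (‖evT p θ φ‖ ^ 2)⁻¹

lemma evT_ne_zero {p : Laurent} {v : ℤ × ℤ}
    (hst : ∀ z w : ℂ, ‖z‖ ≤ 1 → ‖w‖ ≤ 1 → evL z w (rev v p) ≠ 0) (θ φ : ℝ) : evT p θ φ ≠ 0 :=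
  fun h => hst (Circle.exp θ) (Circle.exp φ) (by simp) (by simp) (by
    have := evT_rev v p θ φ
    rwa [h, star_zero, mul_zero] at this)

lemma continuous_bsWeight {p : Laurent} {v : ℤ × ℤ}
    (hst : ∀ z w : ℂ, ‖z‖ ≤ 1 → ‖w‖ ≤ 1 → evL z w (rev v p) ≠ 0) :
    Continuous (bsWeight p).uncurry :=
  ((continuous_evT p).norm.pow 2).inv₀ fun x =>
    pow_ne_zero 2 (norm_ne_zero_iff.2 (evT_ne_zero hst x.1 x.2))

/-- On the bicircle p times the conjugate of z^a w^b, divided by |p|², equals z^{n-a}w^{m-b} over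
the reverse of p. The reverse has no zeros in the closed bidisk, so the mean is 0 as soon as one
exponent is positive. -/
lemma bernsteinSzego_weightMoment {p : Laurent} {n m : ℕ} (hp : p ∈ box 0 (n, m))
    (hpos : IsPos (p (n, m)))
    (hst : ∀ z w : ℂ, ‖z‖ ≤ 1 → ‖w‖ ≤ 1 → evL z w (rev (n, m) p) ≠ 0) :
    BernsteinSzego (weightMoment (bsWeight p)) n m p := by
  have hp0 := fun θ φ => evT_ne_zero hst θ φ
  have hK := continuous_bsWeight hst
  have hsq : ∀ θ φ, (bsWeight p θ φ : ℂ) = (evT p θ φ * star (evT p θ φ))⁻¹ :=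
    fun θ φ => by
      rw [bsWeight, Complex.star_def, Complex.mul_conj, Complex.normSq_eq_norm_sq]; push_cast; rfl
  refine ⟨herm_weightMoment, fun N M f _ hf => pd_weightMoment hK (fun θ φ => ?_) hf, hp, hpos, ?_,
    fun a b hab => ?_, hst⟩
  · have := hp0 θ φ; rw [bsWeight]; positivity
  · rw [ip_weightMoment hK]
    refine Eq.trans ?_ torusMean_one
    congr 1; funext θ φ
    rw [hsq, mul_inv_cancel₀ (mul_ne_zero (hp0 θ φ) (star_ne_zero.2 (hp0 θ φ)))]
  · rw [ip_weightMoment hK]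
    refine Eq.trans ?_ (torusMean_div_eq_zero (q := rev (n, m) p) (n := n) (m := m) (s := n - a)
      (t := m - b) ?_ hst (by omega))
    · congr 1; funext θ φ
      have h1 := hp0 θ φ
      have h2 := star_ne_zero.2 h1
      have h3 := evT_rev (n, m) p θ φ
      have h4 : evT (Finsupp.single ((n : ℤ), (m : ℤ)) 1) θ φ ≠ 0 := by simp [evT]
      have h5 := evT_single_mul_star (n, m) (a, b) θ φ
      rw [Prod.mk_sub_mk] at h5
      rw [hsq, h3, ← h5]
      field_simp
    · simpa using rev_mem_box (v := ((n : ℤ), (m : ℤ))) hp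

end weight

/-! ### The weight belonging to the parameters -/

section
variable {lev : ∀ n m : ℕ, Level n m} {c : ℤ × ℤ → ℂ} {n m : ℕ}

/-- K_{n,m} = 0 is precisely the orthogonality of Φ_{n,m-1} and Φ̃_{n-1,m} required by the stability
theorem. -/
lemma Strip.stable (h : Strip lev c n m) (hc : Herm c) {z w : ℂ} (hz : ‖z‖ ≤ 1) (hw : ‖w‖ ≤ 1) :
    evL z w (rev (n, m) (Ph lev n m 0)) ≠ 0 := by
  have hg := h.good n le_rfl m
  refine evL_rev_ne_zero hc (h.pd m) (by omega) (by omega)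
    (isOrth_PhD fun k _ => h.good n le_rfl k) (isOrthT_PTD fun k hk => h.good k (by omega) m)
    (hg.K ▸ h.K m le_rfl) (hg.orth.isTop hc) (fun e => ?_) hz hw
  refine exists_represents hc e _ n fun i hi => ⟨_, PhD lev i m, ?_⟩
  exact isOrth_PhD fun k _ => h.good i hi.le k

lemma Strip.stripOrth (h : Strip lev c n m) (hc : Herm c) : StripOrth c n m (Ph lev n m 0) :=
  fun _ _ ha ha' hab => h.orthogonal hc ha ha' hab

lemma ParamEq.congr {c' : ℤ × ℤ → ℂ} {u : ℤ → ℤ → ℂ} {N M : ℕ} (h : ParamEq lev c u N M)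
    (hl : LowerGood lev c N M) (hcc : ∀ x : ℤ × ℤ, |x.1| ≤ N → |x.2| ≤ M → c x = c' x) :
    ParamEq lev c' u N M := by
  obtain ⟨h1, h2, -⟩ := posVecs_mem hl
  refine ⟨?_, ?_⟩
  · rw [← h.1]
    exact (ip_congr_box hcc h1 h2 (by simp) (by simp) (by simp) (by simp)).symm
  · rw [← h.2]
    match N, M, hl, hcc with
    | 0, 0, _, _ => simp [negVecs]
    | N + 1, 0, _, _ => simp [negVecs]
    | 0, M + 1, _, _ => simp [negVecs]
    | N + 1, M + 1, hl, hcc =>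
      obtain ⟨h1, h2, -⟩ := negVecs_mem hl
      exact (ip_congr_box hcc h1 h2 (by simp) (by simp) (by simp) (by simp)).symm

end

/-- The form built from u is known to be positive only on the strips. There it yields p and
coincides with the weight 1/|p|², by uniqueness in both variables. The weight thus inherits the
parameters on the strips and has zero parameters elsewhere, so all levels belong to it. -/
theorem good_weightMoment {u : ℤ → ℤ → ℂ} (hu : ∀ i j : ℤ, u (-i) (-j) = star (u i j)) {n m : ℕ}
    (ha : ∀ j : ℕ, m ≤ j → Reached u n j ∧ (level u n j).K = 0 ∧
      (∀ k : ℕ, k + 1 = n → (level u k (j + 1)).ET = 0) ∧ u n (j + 1) = 0)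
    (hb : ∀ i : ℕ, n < i → Reached u i m ∧ (level u i m).K = 0 ∧
      (∀ k : ℕ, k + 1 = m → (level u i k).E = 0) ∧ u i m = 0)
    (hc : ∀ i j : ℕ, n < i → m < j → u i j = 0 ∧ u (-i) j = 0) :
    BernsteinSzego (weightMoment (bsWeight (Ph (level u) n m 0))) n m (Ph (level u) n m 0) ∧
      ∀ N M : ℕ, Good (level u) (weightMoment (bsWeight (Ph (level u) n m 0))) N M ∧
        Positivity u N M := by
  set p := Ph (level u) n m 0 with hp
  set c := moment u
  set c₀ := weightMoment (bsWeight p)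
  have hcH : Herm c := herm_moment hu
  have hpos := positivity_strip ha hb
  have hgood' := good_strip (n := n) (m := m) hcH (fun N M _ hl => paramEq_moment hl) hpos
  have hgood : ∀ N M : ℕ, (N ≤ n ∨ M ≤ m) → Good (level u) c N M ∧ PD c N M :=
    fun N M h => hgood' _ N M rfl h
  have hlow : ∀ N M : ℕ, (N ≤ n ∨ M ≤ m) → LowerGood (level u) c N M :=
    fun N M h i j hi hj _ => (hgood i j (by omega)).1
  have hparam : ∀ N M : ℕ, (N ≤ n ∨ M ≤ m) → ParamEq (level u) c u N M :=
    fun N M h => paramEq_moment (hlow N M h)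
  have hs := strip_of_params ha hparam hgood
  have hs' := strip_swap_of_params hcH ha hb hparam hgood
  have hnm := hgood n m (Or.inl le_rfl)
  have htop : IsTop c n m p := hnm.1.orth.isTop hcH
  have hst : ∀ z w : ℂ, ‖z‖ ≤ 1 → ‖w‖ ≤ 1 → evL z w (rev (n, m) p) ≠ 0 :=
    fun z w hz hw => hs.stable hcH hz hw
  have hbs : BernsteinSzego c₀ n m p := bernsteinSzego_weightMoment htop.mem htop.pos hst
  have hcc : ∀ x : ℤ × ℤ, |x.1| ≤ n → c x = c₀ x := fun x hx =>
    StripOrth.unique hcH hbs.herm htop.mem htop.pos.ne_zero hs.pd (fun j => hbs.pd n j)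
      (hs.stripOrth hcH) hbs.stripOrth htop.norm hbs.norm hst hx
  have hpT : Ph (swapFam (level u)) m n 0 = swapL p := by
    rw [Ph_swapFam, hp, hnm.1.Ph_zero hcH hnm.2]; rfl
  have hrev : rev ((m : ℤ), (n : ℤ)) (swapL p) = swapL (rev (n, m) p) := by
    rw [swapL_rev]; rfl
  have hcc' : ∀ x : ℤ × ℤ, |x.2| ≤ m → c x = c₀ x := fun x hx => by
    have h0 : StripOrth (swapM c₀) m n (swapL p) := fun a b _ _ hab => by
      have := hbs.perp b a (by omega)
      rw [← ip_swapL, swapL_single] at this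
      exact this
    have hpd₀ : ∀ j : ℕ, PD (swapM c₀) m j := fun j => (hbs.pd j m).swap
    have := StripOrth.unique (x := (x.2, x.1)) hcH.swap hbs.herm.swap htop.swap.mem
      htop.swap.pos.ne_zero hs'.pd hpd₀ (hpT ▸ hs'.stripOrth hcH.swap) h0
      (by rw [ip_swapL]; exact htop.norm) (by rw [ip_swapL]; exact hbs.norm)
      (fun z w hz hw => by rw [hrev, evL_swapL]; exact hst w z hw hz) hx
    simpa [swapM] using this
  have hparam₀ : ∀ N M : ℕ, (N ≤ n ∨ M ≤ m) → ParamEq (level u) c₀ u N M := fun N M h =>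
    (hparam N M h).congr (hlow N M h) fun x h1 h2 => by
      rcases h with h | h
      · exact hcc x (by omega)
      · exact hcc' x (by omega)
  have hgood₀' := good_strip (n := n) (m := m) hbs.herm (fun N M h _ => hparam₀ N M h) hpos
  have hs₀ := strip_of_params ha hparam₀ fun N M h => hgood₀' _ N M rfl h
  exact ⟨hbs, fun N M => hbs.good_all hu hs₀ hc hparam₀ _ N M rfl⟩

/-! ### Polynomials on the bicircle -/

lemma onTorus_apply (P : Poly) (x : Circle × Circle) : onTorus P x = evL x.1 x.2 (emb P) := by
  rw [evL_emb]
  induction P using MvPolynomial.induction_on with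
  | C a => simp [onTorus]
  | add P Q hP hQ => rw [map_add, ContinuousMap.add_apply, hP, hQ, map_add]
  | mul_X P i hP =>
    rw [map_mul, ContinuousMap.mul_apply, hP, map_mul]
    fin_cases i <;> simp [onTorus]

lemma emb_mem_box_iff {P : Poly} {n m : ℕ} :
    emb P ∈ box 0 ((n : ℤ), (m : ℤ)) ↔ P.degreeOf 0 ≤ n ∧ P.degreeOf 1 ≤ m := by
  rw [mem_box, MvPolynomial.degreeOf_le_iff, MvPolynomial.degreeOf_le_iff]
  constructor
  · intro h
    have key : ∀ d ∈ P.support, d 0 ≤ n ∧ d 1 ≤ m := fun d hd => by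
      by_contra hd'
      refine MvPolynomial.mem_support_iff.1 hd ?_
      have h1 := h ((d 0 : ℤ), (d 1 : ℤ)) (by simpa using fun h1 => by omega)
      rwa [emb_apply_nat, coef, show Finsupp.single 0 (d 0) + Finsupp.single 1 (d 1) = d from
        exponent_ext (by simp) (by simp)] at h1
    exact ⟨fun d hd => (key d hd).1, fun d hd => (key d hd).2⟩
  · rintro ⟨h1, h2⟩ ⟨a, b⟩ hx
    by_cases hneg : a < 0 ∨ b < 0
    · exact emb_apply_of_neg P hneg
    obtain ⟨i, rfl⟩ := Int.eq_ofNat_of_zero_le (show 0 ≤ a by omega)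
    obtain ⟨j, rfl⟩ := Int.eq_ofNat_of_zero_le (show 0 ≤ b by omega)
    rw [emb_apply_nat, coef]
    by_contra h
    have h3 := h1 _ (MvPolynomial.mem_support_iff.2 h)
    have h4 := h2 _ (MvPolynomial.mem_support_iff.2 h)
    simp at h3 h4
    exact hx (by simp; omega)

/-! ### The orthonormal vectors of all levels as a basis of the polynomials -/

section levels
variable {lev : ∀ n m : ℕ, Level n m} {c : ℤ × ℤ → ℂ}

lemma ip_Ph (hc : Herm c) {M : ℕ} (h : ∀ N, Good lev c N M) (i j : ℕ) (a b : Fin (M + 1)) :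
    ip c (Ph lev i M a) (Ph lev j M b) = if i = j ∧ a = b then 1 else 0 := by
  have key : ∀ {i j : ℕ} (a b : Fin (M + 1)), i < j → ip c (Ph lev j M b) (Ph lev i M a) = 0 :=
    fun {i j} a b hij => (h j).orth.perp b _
      (box_mono (by simp) (by simp) (by simp; omega) (by simp) ((h i).orth.mem a))
  rcases lt_trichotomy i j with hij | rfl | hij
  · rw [if_neg fun h => hij.ne h.1]
    exact ip_eq_zero_comm hc (key a b hij)
  · have := congrFun (congrFun (h i).orth.gram a) b
    simpa [gram, Matrix.one_apply] using this
  · rw [if_neg fun h => hij.ne' h.1, key b a hij]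

lemma ip_PT (hc : Herm c) {N : ℕ} (h : ∀ M, Good lev c N M) (i j : ℕ) (a b : Fin (N + 1)) :
    ip c (PT lev N i a) (PT lev N j b) = if i = j ∧ a = b then 1 else 0 := by
  have := ip_Ph hc.swap (fun M => (h M).swap hc) i j a b
  rwa [Ph_swapFam, Ph_swapFam, swapV, swapV, ip_swapL] at this

lemma mem_span_Phi (hc : Herm c) {M : ℕ} (h : ∀ N, Good lev c N M) (N : ℕ) {P : Poly}
    (hP : emb P ∈ box 0 ((N : ℤ) - 1, (M : ℤ))) :
    P ∈ Submodule.span ℂ (Set.range fun x : ℕ × Fin (M + 1) => (lev x.1 M).Phi x.2) := by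
  induction N generalizing P with
  | zero =>
    have : emb P = 0 := box_eq_bot_of_lt (by simp) hP
    rw [(map_eq_zero_iff emb emb_injective).1 this]
    exact Submodule.zero_mem _
  | succ N ih =>
    have h1 := (h N).orth.decomp hc (f := emb P) (by simpa using hP)
    have h2 := @ih (P - ∑ b, ip c (emb P) (Ph lev N M b) • (lev N M).Phi b)
      (by simpa [Ph] using h1)
    rw [← sub_add_cancel P (∑ b, ip c (emb P) (Ph lev N M b) • (lev N M).Phi b)]
    exact Submodule.add_mem _ h2 (Submodule.sum_mem _ fun b _ => Submodule.smul_mem _ _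
      (Submodule.subset_span ⟨(N, b), rfl⟩))

end levels

/-! ### Positive functionals -/

/-- For real g with |g| ≤ ‖f‖ both ‖f‖·1 ± g are nonnegative; real and imaginary parts together
account for the factor 2. -/
lemma norm_apply_le_of_nonneg {X : Type*} [TopologicalSpace X] [CompactSpace X]
    {ℒ : C(X, ℂ) →ₗ[ℂ] ℂ}
    (h : ∀ f : C(X, ℂ), (∀ x, 0 ≤ (f x).re ∧ (f x).im = 0) → 0 ≤ (ℒ f).re ∧ (ℒ f).im = 0)
    (f : C(X, ℂ)) : ‖ℒ f‖ ≤ 2 * (ℒ 1).re * ‖f‖ := by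
  have h1 := h 1 fun x => by simp
  have key : ∀ g : C(X, ℂ), (∀ x, (g x).im = 0) → (∀ x, |(g x).re| ≤ ‖f‖) →
      ‖ℒ g‖ ≤ (ℒ 1).re * ‖f‖ := fun g hg hb => by
    have h2 := h ((‖f‖ : ℂ) • (1 : C(X, ℂ)) - g) fun x => by
      have := abs_le.1 (hb x)
      simp [hg x]; linarith
    have h3 := h ((‖f‖ : ℂ) • (1 : C(X, ℂ)) + g) fun x => by
      have := abs_le.1 (hb x)
      simp [hg x]; linarith
    simp only [map_sub, map_add, map_smul, smul_eq_mul, Complex.sub_re, Complex.add_re,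
      Complex.sub_im, Complex.add_im, Complex.re_ofReal_mul, Complex.im_ofReal_mul, h1.2] at h2 h3
    have h4 : ℒ g = ((ℒ g).re : ℂ) := Complex.ext (by simp) (by simp; linarith)
    rw [h4, Complex.norm_real, Real.norm_eq_abs, abs_le]
    constructor <;> linarith
  set a : C(X, ℂ) := ⟨fun x => ((f x).re : ℂ), by fun_prop⟩
  set b : C(X, ℂ) := ⟨fun x => ((f x).im : ℂ), by fun_prop⟩
  have hf : f = a + Complex.I • b := by
    ext x
    simp only [a, b, ContinuousMap.add_apply, ContinuousMap.smul_apply, ContinuousMap.coe_mk,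
      smul_eq_mul]
    rw [mul_comm, Complex.re_add_im]
  have ha := key a (fun x => by simp [a]) fun x => by
    simpa [a] using (Complex.abs_re_le_norm (f x)).trans (f.norm_coe_le_norm x)
  have hb := key b (fun x => by simp [b]) fun x => by
    simpa [b] using (Complex.abs_im_le_norm (f x)).trans (f.norm_coe_le_norm x)
  calc ‖ℒ f‖ = ‖ℒ a + Complex.I * ℒ b‖ := by
        conv_lhs => rw [hf]
        rw [map_add, map_smul, smul_eq_mul]
    _ ≤ ‖ℒ a‖ + ‖ℒ b‖ := (norm_add_le _ _).trans (by simp)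
    _ ≤ _ := by linarith

/-- Positive functionals are determined by the products of a polynomial and a conjugate of a
polynomial. -/
lemma eq_of_nonneg {ℒ ℒ' : C(Circle × Circle, ℂ) →ₗ[ℂ] ℂ}
    (h : ∀ f : C(Circle × Circle, ℂ), (∀ x, 0 ≤ (f x).re ∧ (f x).im = 0) →
      0 ≤ (ℒ f).re ∧ (ℒ f).im = 0)
    (h' : ∀ f : C(Circle × Circle, ℂ), (∀ x, 0 ≤ (f x).re ∧ (f x).im = 0) →
      0 ≤ (ℒ' f).re ∧ (ℒ' f).im = 0)
    (heq : ∀ P Q : Poly, ℒ (onTorus P * star (onTorus Q)) = ℒ' (onTorus P * star (onTorus Q))) :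
    ℒ = ℒ' := by
  -- The span of these products is closed under multiplication and conjugation and contains the
  -- coordinates, so it contains the star algebra they generate, which is dense by
  -- Stone-Weierstrass.
  set T : Set C(Circle × Circle, ℂ) := Set.range fun x : Poly × Poly => onTorus x.1 * star (onTorus x.2)
  set V := Submodule.span ℂ T
  have hT : ∀ P Q : Poly, onTorus P * star (onTorus Q) ∈ V := fun P Q =>
    Submodule.subset_span ⟨(P, Q), rfl⟩
  have hmul : V * V ≤ V := by
    rw [Submodule.span_mul_span, Submodule.span_le]
    rintro _ ⟨_, ⟨⟨P, Q⟩, rfl⟩, _, ⟨⟨P', Q'⟩, rfl⟩, rfl⟩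
    have := hT (P * P') (Q * Q')
    rw [map_mul, map_mul, star_mul'] at this
    rw [mul_mul_mul_comm] at this
    exact this
  have hstar : ∀ f ∈ V, star f ∈ V := fun f hf => by
    refine Submodule.span_induction (p := fun f _ => star f ∈ V) ?_ (by simp) (fun f g _ _ hf hg => ?_)
      (fun r f _ hf => ?_) hf
    · rintro _ ⟨⟨P, Q⟩, rfl⟩
      simpa [mul_comm] using hT Q P
    · rw [star_add]; exact Submodule.add_mem _ hf hg
    · rw [star_smul]; exact Submodule.smul_mem _ _ hf
  set S := StarAlgebra.adjoin ℂ (Set.range fun i : Fin 2 => onTorus (MvPolynomial.X i))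
  have hS : ∀ f ∈ S, f ∈ V := fun f hf => by
    refine StarAlgebra.adjoin_induction (p := fun f _ => f ∈ V) ?_ (fun r => ?_)
      (fun f g _ _ hf hg => Submodule.add_mem _ hf hg)
      (fun f g _ _ hf hg => hmul (Submodule.mul_mem_mul hf hg)) (fun f _ hf => hstar f hf) hf
    · rintro _ ⟨i, rfl⟩
      simpa using hT (MvPolynomial.X i) 1
    · have := Submodule.smul_mem _ r (hT 1 1)
      simpa [Algebra.algebraMap_eq_smul_one] using this
  have hdense : S.topologicalClosure = ⊤ := by
    refine ContinuousMap.starSubalgebra_topologicalClosure_eq_top_of_separatesPoints S ?_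
    intro x y hxy
    have hX : ∀ i : Fin 2, onTorus (MvPolynomial.X i) ∈ S := fun i =>
      StarAlgebra.subset_adjoin _ _ ⟨i, rfl⟩
    by_cases h1 : x.1 = y.1
    · have h2 : x.2 ≠ y.2 := fun h2 => hxy (Prod.ext h1 h2)
      exact ⟨_, ⟨_, hX 1, rfl⟩, by simpa [onTorus] using fun h => h2 (Circle.ext h)⟩
    · exact ⟨_, ⟨_, hX 0, rfl⟩, by simpa [onTorus] using fun h => h1 (Circle.ext h)⟩
  have hc : Continuous ℒ := (ℒ.mkContinuous _ (norm_apply_le_of_nonneg h)).continuous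
  have hc' : Continuous ℒ' := (ℒ'.mkContinuous _ (norm_apply_le_of_nonneg h')).continuous
  have hV : ∀ f ∈ V, ℒ f = ℒ' f := fun f hf =>
    LinearMap.eqOn_span (by rintro _ ⟨⟨P, Q⟩, rfl⟩; exact heq P Q) hf
  ext f
  have hf : f ∈ closure (S : Set C(Circle × Circle, ℂ)) := by
    rw [← StarSubalgebra.topologicalClosure_coe, hdense]; trivial
  exact closure_minimal (fun g hg => hV g (hS g hg)) (isClosed_eq hc hc') hf

/-- For M bounding the w-degrees of P and Q, both lie in the span of the vectors Φ_{i,M}, on which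
orthonormality prescribes the functional. -/
lemma IsFunctionalOf.apply_mul_star {u : ℤ → ℤ → ℂ} {c : ℤ × ℤ → ℂ} (hc : Herm c)
    (hg : ∀ N M, Good (level u) c N M) {ℒ : C(Circle × Circle, ℂ) →ₗ[ℂ] ℂ}
    (hℒ : IsFunctionalOf u ℒ) (P Q : Poly) :
    ℒ (onTorus P * star (onTorus Q)) = ip c (emb P) (emb Q) := by
  set N := max (P.degreeOf 0) (Q.degreeOf 0)
  set M := max (P.degreeOf 1) (Q.degreeOf 1)
  have hspan : ∀ {P : Poly}, P.degreeOf 0 ≤ N → P.degreeOf 1 ≤ M →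
      P ∈ Submodule.span ℂ (Set.range fun x : ℕ × Fin (M + 1) => (level u x.1 M).Phi x.2) :=
    fun h1 h2 => mem_span_Phi hc (fun N => hg N M) (N + 1)
      (by simpa using emb_mem_box_iff.2 ⟨h1, h2⟩)
  refine Submodule.span_induction (p := fun P _ =>
    ℒ (onTorus P * star (onTorus Q)) = ip c (emb P) (emb Q)) ?_ (by simp) (fun P P' _ _ hP hP' => ?_)
    (fun r P _ hP => ?_) (hspan (P := P) (le_max_left _ _) (le_max_left _ _))
  · rintro _ ⟨⟨i, a⟩, rfl⟩
    refine Submodule.span_induction (p := fun Q _ =>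
      ℒ (onTorus ((level u i M).Phi a) * star (onTorus Q)) = ip c (emb ((level u i M).Phi a)) (emb Q))
      ?_ (by simp) (fun P P' _ _ hP hP' => ?_) (fun r P _ hP => ?_)
      (hspan (P := Q) (le_max_right _ _) (le_max_right _ _))
    · rintro _ ⟨⟨j, b⟩, rfl⟩
      exact (hℒ.2.1 M i j a b).trans (ip_Ph hc (fun N => hg N M) i j a b).symm
    · simp only [map_add, star_add, mul_add, ip_add_right, hP, hP']
    · simp only [map_smul, star_smul, mul_smul_comm, ip_smul_right, hP, smul_eq_mul]
  · simp only [map_add, add_mul, ip_add_left, hP, hP']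
  · simp only [map_smul, smul_mul_assoc, ip_smul_left, hP, smul_eq_mul]

/-- The functional belonging to a weight. -/
def weightFunctional {K : ℝ → ℝ → ℝ} (hK : Continuous K.uncurry) : C(Circle × Circle, ℂ) →ₗ[ℂ] ℂ where
  toFun f := torusMean fun θ φ => f (Circle.exp θ, Circle.exp φ) * K θ φ
  map_add' f g := by
    have key : ∀ f : C(Circle × Circle, ℂ), Continuous
        (fun θ φ => f (Circle.exp θ, Circle.exp φ) * K θ φ : ℝ → ℝ → ℂ).uncurry := fun f =>
      (f.continuous.comp (by fun_prop : Continuous fun x : ℝ × ℝ =>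
        (Circle.exp x.1, Circle.exp x.2))).mul (Complex.continuous_ofReal.comp hK)
    rw [← torusMean_add (key f) (key g)]
    simp [add_mul]
  map_smul' r f := by
    rw [RingHom.id_apply, smul_eq_mul, ← torusMean_const_mul]
    simp [mul_assoc]

section weightFunctional
variable {K : ℝ → ℝ → ℝ} (hK : Continuous K.uncurry)

lemma weightFunctional_mul_star (P Q : Poly) :
    weightFunctional hK (onTorus P * star (onTorus Q)) = ip (weightMoment K) (emb P) (emb Q) := by
  rw [ip_weightMoment hK]
  simp only [weightFunctional, LinearMap.coe_mk, AddHom.coe_mk, ContinuousMap.mul_apply,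
    ContinuousMap.star_apply, onTorus_apply, evT]

lemma isFunctionalOf_weightFunctional (hK0 : ∀ θ φ, 0 ≤ K θ φ) {u : ℤ → ℤ → ℂ}
    (hg : ∀ N M, Good (level u) (weightMoment K) N M) :
    IsFunctionalOf u (weightFunctional hK) := by
  refine ⟨fun f hf => ?_, fun M i j a b => ?_, fun N i j a b => ?_⟩
  · have e : weightFunctional hK f = torusMean fun θ φ =>
        (((f (Circle.exp θ, Circle.exp φ)).re * K θ φ : ℝ) : ℂ) := by
      change torusMean _ = torusMean _
      congr 1; funext θ φ
      have : f (Circle.exp θ, Circle.exp φ) = ((f (Circle.exp θ, Circle.exp φ)).re : ℂ) :=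
        Complex.ext (by simp) (by simp [(hf _).2])
      rw [Complex.ofReal_mul, ← this]
    rw [e]
    exact torusMean_nonneg fun θ _ φ _ => mul_nonneg (hf _).1 (hK0 θ φ)
  · rw [weightFunctional_mul_star]
    exact ip_Ph herm_weightMoment (fun N => hg N M) i j a b
  · rw [weightFunctional_mul_star]
    exact ip_PT herm_weightMoment (fun M => hg N M) i j a b

end weightFunctional

end Bicircle

end

theorem mainTheorem5 (u : ℤ → ℤ → ℂ) (hu : ∀ i j : ℤ, u (-i) (-j) = star (u i j)) (n m : ℕ)
    (hpos : ∀ i j : ℕ, i ≤ n → j ≤ m → Bicircle.Positivity u i j)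
    (ha : ∀ j : ℕ, m ≤ j → Bicircle.Reached u n j ∧ (Bicircle.level u n j).K = 0 ∧
      (∀ k : ℕ, k + 1 = n → (Bicircle.level u k (j + 1)).ET = 0) ∧ u n (j + 1) = 0)
    (hb : ∀ i : ℕ, n < i → Bicircle.Reached u i m ∧ (Bicircle.level u i m).K = 0 ∧
      (∀ k : ℕ, k + 1 = m → (Bicircle.level u i k).E = 0) ∧ u i m = 0)
    (hc : ∀ i j : ℕ, n < i → m < j → u i j = 0 ∧ u (-i) j = 0) :
    (∀ i j : ℕ, Bicircle.Positivity u i j) ∧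
    ∃ p : Bicircle.Poly, Bicircle.HasDegree p n m ∧ Bicircle.Stable (Bicircle.reverse n m p) ∧
      ∃ ℒ : C(Circle × Circle, ℂ) →ₗ[ℂ] ℂ, Bicircle.IsFunctionalOf u ℒ ∧
        (∀ ℒ' : C(Circle × Circle, ℂ) →ₗ[ℂ] ℂ, Bicircle.IsFunctionalOf u ℒ' → ℒ' = ℒ) ∧
        ∀ f : C(Circle × Circle, ℂ),
          ℒ f = (1 / (2 * (Real.pi : ℂ))) ^ 2 *
            ∫ θ in (-Real.pi)..Real.pi, ∫ φ in (-Real.pi)..Real.pi,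
              f (Circle.exp θ, Circle.exp φ) /
                ((‖MvPolynomial.eval ![(Circle.exp θ : ℂ), (Circle.exp φ : ℂ)] p‖ ^ 2 : ℝ) : ℂ) := by
  obtain ⟨hbs, hgood⟩ := Bicircle.good_weightMoment hu ha hb hc
  have hmem := hbs.mem
  have hev : ∀ θ φ : ℝ, Bicircle.evT (Bicircle.Ph (Bicircle.level u) n m 0) θ φ =
      MvPolynomial.eval ![(Circle.exp θ : ℂ), (Circle.exp φ : ℂ)] ((Bicircle.level u n m).Phi 0) :=
    fun θ φ => Bicircle.evL_emb _ _ _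
  have hK := Bicircle.continuous_bsWeight hbs.stable
  have hℒ := Bicircle.isFunctionalOf_weightFunctional hK
    (fun θ φ => by rw [Bicircle.bsWeight]; positivity) fun N M => (hgood N M).1
  refine ⟨fun i j => (hgood i j).2, (Bicircle.level u n m).Phi 0, ?_, fun z w hz hw => ?_,
    Bicircle.weightFunctional hK, hℒ, fun ℒ' hℒ' => ?_, fun f => ?_⟩
  · obtain ⟨h1, h2⟩ := Bicircle.emb_mem_box_iff.1 hmem
    refine ⟨h1, h2, ?_⟩
    rw [← Bicircle.emb_apply_nat]
    exact hbs.pos.ne_zero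
  · rw [← Bicircle.evL_emb, Bicircle.emb_reverse n m hmem]
    exact hbs.stable z w hz hw
  · refine Bicircle.eq_of_nonneg hℒ'.1 hℒ.1 fun P Q => ?_
    rw [hℒ'.apply_mul_star hbs.herm fun N M => (hgood N M).1,
      hℒ.apply_mul_star hbs.herm fun N M => (hgood N M).1]
  · simp only [← hev, div_eq_mul_inv]
    simp only [← Complex.ofReal_inv]
    rfl
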